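/- Let $k$ be an algebraically closed field (of arbitrary characteristic) and let $\mathbb P^2$, $\mathbb P^9$ be projective spaces over $k$, where the homogeneous coordinates $a_m$ of $\mathbb P^9$ are indexed by the ten monomials $m$ of degree three in the coordinates $x_0,x_1,x_2$ of $\mathbb P^2$. For a $k$-scheme $S$ put $\mathbb P^2_S=\mathbb P^2\times_k S$. A flat family of closed subschemes of $\mathbb P^2$ over $S$ is a closed subscheme $D\subseteq\mathbb P^2_S$ that is flat and locally of finite presentation over $S$ (the second condition is automatic if $S$ is locally Noetherian); it is a flat family of cubics if its fibre over every field-valued point $\operatorname{Spec}K\to S$ is the curve $V_+(F)\subseteq\mathbb P^2_K$ of a nonzero cubic form $F$ over $K$. For a morphism $\varphi\colon X\to S$, flat, locally of finite presentation and of relative pure dimension $d$, the critical locus $C(\varphi)\subseteq X$ is the closed subscheme with ideal sheaf the $d$-th Fitting ideal $\operatorname{Fitt}^d(\Omega^1_{X/S})$, and a section of $\varphi$ is singular if it factors through $C(\varphi)$. Let $SC$ be the functor on $k$-schemes that sends $S$ to the set of pairs $(D,\sigma)$ of a flat family $D\subseteq\mathbb P^2_S$ of cubics over $S$ and a singular section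 $\sigma\colon S\to D$. Let $Z=\{\sum_m a_m x^m=0\}\subseteq\mathbb P^2\times\mathbb P^9$, and let $\varphi\colon Z\to\mathbb P^9$ be the projection. Then: (1) $\varphi$ is the universal family over $\operatorname{Hilb}^{3t}_{\mathbb P^2}=\mathbb P^9$: the functor that sends a $k$-scheme $S$ to the set of flat families $D\subseteq\mathbb P^2_S$ all of whose fibres over field-valued points have Hilbert polynomial $3t$ is represented by $\mathbb P^9$, with universal object $Z$. (2) The critical locus $C(\varphi)$ (for $d=1$) represents the functor $SC$ (in particular, the pairs $(D,\sigma)$ are stable under pullback); the universal pair is the pullback of $Z$ along $C(\varphi)\to\mathbb P^9$ together with the section given by $C(\varphi)\to\mathbb P^2$. (3) The scheme $C(\varphi)$ is smooth of relative dimension $8$ over $k$, projective over $k$, and its dimension is $8$. -/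

import Mathlib

open CategoryTheory CategoryTheory.Limits Opposite AlgebraicGeometry

universe u

attribute [-instance] CategoryTheory.catToReflQuiver

namespace SingularCubics

noncomputable section

attribute [local instance] MvPolynomial.gradedAlgebra

/-! ### Fitting ideals and the critical locus -/

/-- The `d`-th Fitting ideal of a (finitely generated) `R`-module `M`: the ideal generated by all
`m × m` minors of matrices of relations between `m + d` generators of `M`. -/
def fittingIdeal (R : Type u) [CommRing R] (M : Type u) [AddCommGroup M] [Module R M] (d : ℕ) :
    Ideal R :=
  Ideal.span {x : R | ∃ (m : ℕ) (g : Fin (m + d) → M),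
    Submodule.span R (Set.range g) = ⊤ ∧
    ∃ r : Fin m → Fin (m + d) → R, (∀ i, ∑ j, r i j • g j = 0) ∧
    ∃ c : Fin m → Fin (m + d), x = Matrix.det (Matrix.of fun i j => r i (c j))}

/-- The ideal of `Γ(X, U)` given by the `d`-th Fitting ideal of `Ω_{Γ(X, U)/Γ(S, V)}`, for opens
`U ⊆ X` and `V ⊆ S` with `φ(U) ⊆ V`. -/
def differentialsFitting {X S : Scheme.{u}} (φ : X ⟶ S) (d : ℕ) (U : X.Opens) (V : S.Opens)
    (e : U ≤ φ ⁻¹ᵁ V) : Ideal Γ(X, U) :=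
  letI : Algebra Γ(S, V) Γ(X, U) := (φ.appLE V U e).hom.toAlgebra
  fittingIdeal Γ(X, U) (Ω[Γ(X, U)⁄Γ(S, V)]) d

/-- The ideal sheaf `Fitt^d(Ω¹_{X/S})` of the critical locus of a morphism `φ : X ⟶ S` locally of
finite type (of relative pure dimension `d`). Its sections over an affine open `W` are the
functions whose restriction to every affine open `U ⊆ W` that maps into an affine open `V ⊆ S`
lies in the `d`-th Fitting ideal of `Ω_{Γ(X, U)/Γ(S, V)}`. -/
def criticalIdeal {X S : Scheme.{u}} (φ : X ⟶ S) (d : ℕ) : X.IdealSheafData :=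
  Scheme.IdealSheafData.ofIdeals fun W =>
    ⨅ (U : X.affineOpens) (V : S.affineOpens) (hUW : U.1 ≤ W.1) (e : U.1 ≤ φ ⁻¹ᵁ V.1),
      (differentialsFitting φ d U.1 V.1 e).comap (X.presheaf.map (homOfLE hUW).op).hom

/-- The critical locus `C(φ)`, a closed subscheme of `X`. -/
abbrev criticalLocus {X S : Scheme.{u}} (φ : X ⟶ S) (d : ℕ) : Scheme.{u} :=
  (criticalIdeal φ d).subscheme

/-! ### Projective spaces -/

/-- Projective space `Proj k[xᵢ : i ∈ ι]` over `k`, with its structure morphism. -/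
def projectiveSpace (k : Type u) [CommRing k] (ι : Type) : Over (Spec (CommRingCat.of k)) :=
  Over.mk (Y := Proj (MvPolynomial.homogeneousSubmodule ι k))
    (Proj.toSpecZero (MvPolynomial.homogeneousSubmodule ι k) ≫
      Spec.map (CommRingCat.ofHom
        (algebraMap k (MvPolynomial.homogeneousSubmodule ι k 0))))

/-- The standard chart `xᵢ ≠ 0`. -/
def chart (k : Type u) [CommRing k] {ι : Type} (i : ι) : (projectiveSpace k ι).left.Opens :=
  Proj.basicOpen (MvPolynomial.homogeneousSubmodule ι k) (MvPolynomial.X i)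

/-- The function `xⱼ / xᵢ` on the chart `xᵢ ≠ 0`. -/
def ratio (k : Type u) [CommRing k] {ι : Type} (i j : ι) :
    Γ((projectiveSpace k ι).left, chart k i) :=
  (Proj.awayToSection (MvPolynomial.homogeneousSubmodule ι k) (MvPolynomial.X i)).hom
    (HomogeneousLocalization.Away.mk (MvPolynomial.homogeneousSubmodule ι k)
      (MvPolynomial.isHomogeneous_X k i) 1 (MvPolynomial.X j)
      (by simpa using MvPolynomial.isHomogeneous_X k j))

/-- A `k`-scheme is projective if it admits a closed immersion over `k` into some `ℙⁿ`. -/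
def IsProjective {k : Type u} [CommRing k] (X : Over (Spec (CommRingCat.of k))) : Prop :=
  ∃ (n : ℕ) (i : X ⟶ projectiveSpace k (Fin (n + 1))), IsClosedImmersion i.left

/-- The ideal sheaf generated on each of the opens `U i` by the single function `f i`: its
sections over an affine open `W` are the functions that are multiples of `f i` on every affine
open contained in `W` and in `U i`. (It is used for opens that cover `X` and functions that differ
by units on the overlaps.) -/
def ofLocalEquations {X : Scheme.{u}} {ι : Type} (U : ι → X.Opens) (f : ∀ i, Γ(X, U i)) :
    X.IdealSheafData :=
  Scheme.IdealSheafData.ofIdeals fun W =>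
    ⨅ (i : ι) (V : X.affineOpens) (hVW : V.1 ≤ W.1) (hVU : V.1 ≤ U i),
      (Ideal.span {(X.presheaf.map (homOfLE hVU).op).hom (f i)}).comap
        (X.presheaf.map (homOfLE hVW).op).hom

variable {k : Type u} [Field k]

/-! ### The projective plane over a base -/

/-- `ℙ²_S = ℙ² × S` for a `k`-scheme `S`. -/
abbrev plane (S : Over (Spec (CommRingCat.of k))) : Scheme.{u} :=
  pullback (projectiveSpace k (Fin 3)).hom S.hom

/-- The projection `ℙ²_S ⟶ ℙ²`. -/
abbrev toPlane (S : Over (Spec (CommRingCat.of k))) :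
    plane S ⟶ (projectiveSpace k (Fin 3)).left :=
  pullback.fst (projectiveSpace k (Fin 3)).hom S.hom

/-- The projection `ℙ²_S ⟶ S`. -/
abbrev toBase (S : Over (Spec (CommRingCat.of k))) : plane S ⟶ S.left :=
  pullback.snd (projectiveSpace k (Fin 3)).hom S.hom

/-- The base change morphism `ℙ²_T ⟶ ℙ²_S` of a morphism `T ⟶ S`. -/
def planeMap {S T : Over (Spec (CommRingCat.of k))} (g : T ⟶ S) : plane T ⟶ plane S :=
  pullback.lift (toPlane T) (toBase T ≫ g.left) (by simp [pullback.condition])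

@[simp] lemma planeMap_toPlane {S T : Over (Spec (CommRingCat.of k))} (g : T ⟶ S) :
    planeMap g ≫ toPlane S = toPlane T :=
  pullback.lift_fst _ _ _

@[simp] lemma planeMap_toBase {S T : Over (Spec (CommRingCat.of k))} (g : T ⟶ S) :
    planeMap g ≫ toBase S = toBase T ≫ g.left :=
  pullback.lift_snd _ _ _

@[simp] lemma planeMap_id (S : Over (Spec (CommRingCat.of k))) : planeMap (𝟙 S) = 𝟙 _ := by
  apply pullback.hom_ext <;> simp [planeMap]

@[simp] lemma planeMap_comp {S T R : Over (Spec (CommRingCat.of k))} (h : R ⟶ T) (g : T ⟶ S) :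
    planeMap (h ≫ g) = planeMap h ≫ planeMap g := by
  apply pullback.hom_ext
  · rw [Category.assoc, planeMap_toPlane, planeMap_toPlane, planeMap_toPlane]
  · rw [Category.assoc, planeMap_toBase, planeMap_toBase, ← Category.assoc, planeMap_toBase,
      Over.comp_left, Category.assoc]

/-- The chart `xᵢ ≠ 0` of `ℙ²_S`. -/
def planeChart (S : Over (Spec (CommRingCat.of k))) (i : Fin 3) : (plane S).Opens :=
  toPlane S ⁻¹ᵁ chart k i

/-- The function `xⱼ / xᵢ` on the chart `xᵢ ≠ 0` of `ℙ²_S`. -/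
def planeRatio (S : Over (Spec (CommRingCat.of k))) (i j : Fin 3) : Γ(plane S, planeChart S i) :=
  ((toPlane S).app (chart k i)).hom (ratio k i j)

/-! ### Subschemes of the plane over a field -/

/-- The spectrum of a field `K`, as a `k`-scheme through a morphism to a `k`-scheme `S`. -/
abbrev fieldPoint {S : Over (Spec (CommRingCat.of k))} (K : Type u) [Field K]
    (t : Spec (CommRingCat.of K) ⟶ S.left) : Over (Spec (CommRingCat.of k)) :=
  Over.mk (t ≫ S.hom)

section

variable (K : Type u) [Field K] (p : Spec (CommRingCat.of K) ⟶ Spec (CommRingCat.of k))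

/-- Dehomogenisation: the ring homomorphism that sends a polynomial `F` over `K` to
`F(x₀/xᵢ, x₁/xᵢ, x₂/xᵢ)`, a function on the chart `xᵢ ≠ 0` of `ℙ²_K`. For a form `F` of degree `n`
this is `F / xᵢⁿ`. -/
def dehomogenize (i : Fin 3) :
    MvPolynomial (Fin 3) K →+* Γ(plane (Over.mk p), planeChart (Over.mk p) i) :=
  MvPolynomial.eval₂Hom
    (((toBase (Over.mk p)).appLE ⊤ (planeChart (Over.mk p) i) le_top).hom.comp
      (Scheme.ΓSpecIso (CommRingCat.of K)).inv.hom)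
    (planeRatio (Over.mk p) i)

/-- The closed subscheme `V₊(F)` of `ℙ²_K`, for a form `F`. -/
def curveOfForm (F : MvPolynomial (Fin 3) K) : (plane (Over.mk p)).IdealSheafData :=
  ofLocalEquations (planeChart (Over.mk p)) fun i => dehomogenize K p i F

/-- A closed subscheme of `ℙ²_K` is a cubic if it is `V₊(F)` for a nonzero cubic form `F`. -/
def IsCubic (D : (plane (Over.mk p)).IdealSheafData) : Prop :=
  ∃ F : MvPolynomial (Fin 3) K, F.IsHomogeneous 3 ∧ F ≠ 0 ∧ D = curveOfForm K p F

/-- The space of forms of degree `n` that vanish on the closed subscheme `D` of `ℙ²_K`, that is,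
the degree `n` part of the saturated homogeneous ideal of `D`. -/
def vanishingForms (D : (plane (Over.mk p)).IdealSheafData) (n : ℕ) :
    Submodule K (MvPolynomial.homogeneousSubmodule (Fin 3) K n) where
  carrier := {F | ∀ (i : Fin 3) (V : (plane (Over.mk p)).affineOpens)
    (h : V.1 ≤ planeChart (Over.mk p) i),
    ((plane (Over.mk p)).presheaf.map (homOfLE h).op).hom (dehomogenize K p i F.1) ∈ D.ideal V}
  add_mem' hF hG i V h := by
    simpa only [Submodule.coe_add, map_add] using add_mem (hF i V h) (hG i V h)
  zero_mem' i V h := by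
    simp only [ZeroMemClass.coe_zero, map_zero, zero_mem]
  smul_mem' c F hF i V h := by
    simpa only [Submodule.coe_smul, MvPolynomial.smul_eq_C_mul, map_mul] using
      Ideal.mul_mem_left _ _ (hF i V h)

/-- The closed subscheme `D` of `ℙ²_K` has Hilbert polynomial `P`: for all large `n`, the degree
`n` part of its homogeneous coordinate ring has dimension `P(n)`. -/
def HasHilbertPolynomial (P : Polynomial ℚ) (D : (plane (Over.mk p)).IdealSheafData) : Prop :=
  ∀ᶠ n : ℕ in Filter.atTop,
    (Module.finrank K
      (MvPolynomial.homogeneousSubmodule (Fin 3) K n ⧸ vanishingForms K p D n) : ℚ) =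
      P.eval (n : ℚ)

end

/-! ### Flat families of plane curves, the Hilbert functor and the functor of singular cubics -/

/-- The closed subscheme `D ⊆ ℙ²_S` is flat and locally of finite presentation over `S`. -/
def IsFlatFamily {S : Over (Spec (CommRingCat.of k))} (D : (plane S).IdealSheafData) : Prop :=
  Flat (D.subschemeι ≫ toBase S) ∧ LocallyOfFinitePresentation (D.subschemeι ≫ toBase S)

/-- The fibre of `D ⊆ ℙ²_S` over a field-valued point of `S`. -/
def fibre {S : Over (Spec (CommRingCat.of k))} (D : (plane S).IdealSheafData)
    (K : Type u) [Field K] (t : Spec (CommRingCat.of K) ⟶ S.left) :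
    (plane (fieldPoint K t)).IdealSheafData :=
  D.comap (planeMap (Over.homMk t : fieldPoint K t ⟶ S))

variable (k) in
/-- The functor that sends `S` to the set of closed subschemes of `ℙ²_S`, with pullback. -/
def closedSubschemes : (Over (Spec (CommRingCat.of k)))ᵒᵖ ⥤ Type u where
  obj S := (plane S.unop).IdealSheafData
  map g := ↾fun D => D.comap (planeMap g.unop)
  map_id S := by
    ext D : 3
    exact (congrArg D.comap (planeMap_id S.unop)).trans (Scheme.IdealSheafData.comap_id D)
  map_comp g h := by
    ext D : 3
    exact (congrArg D.comap (planeMap_comp h.unop g.unop)).trans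
      (Scheme.IdealSheafData.comap_comp D _ _)

/-- The `S`-points of the Hilbert scheme of closed subschemes of `ℙ²` with Hilbert
polynomial `3t`. -/
def hilbertPoints (S : Over (Spec (CommRingCat.of k))) : Set ((closedSubschemes k).obj (op S)) :=
  {D : (plane S).IdealSheafData | IsFlatFamily D ∧
    ∀ (K : Type u) [Field K] (t : Spec (CommRingCat.of K) ⟶ S.left),
      HasHilbertPolynomial K (t ≫ S.hom) (3 * Polynomial.X) (fibre D K t)}

/-- A flat family of plane cubics over `S`. -/
def IsCubicFamily {S : Over (Spec (CommRingCat.of k))} (D : (plane S).IdealSheafData) : Prop :=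
  IsFlatFamily D ∧ ∀ (K : Type u) [Field K] (t : Spec (CommRingCat.of K) ⟶ S.left),
    IsCubic K (t ≫ S.hom) (fibre D K t)

/-- The sections of `ℙ²_S ⟶ S`. -/
abbrev PlaneSection (S : Over (Spec (CommRingCat.of k))) : Type u :=
  {σ : S.left ⟶ plane S // σ ≫ toBase S = 𝟙 S.left}

/-- The pullback of a section of `ℙ²_S ⟶ S` along `T ⟶ S`. -/
def PlaneSection.pull {S T : Over (Spec (CommRingCat.of k))} (g : T ⟶ S) (σ : PlaneSection S) :
    PlaneSection T :=
  ⟨pullback.lift (g.left ≫ σ.1 ≫ toPlane S) (𝟙 T.left) (by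
    have h : σ.1 ≫ toBase S ≫ S.hom = S.hom := by rw [← Category.assoc, σ.2, Category.id_comp]
    rw [Category.assoc, Category.assoc, pullback.condition, h, Over.w, Category.id_comp]),
    pullback.lift_snd _ _ _⟩

lemma PlaneSection.pull_toPlane {S T : Over (Spec (CommRingCat.of k))} (g : T ⟶ S)
    (σ : PlaneSection S) : (σ.pull g).1 ≫ toPlane T = g.left ≫ σ.1 ≫ toPlane S :=
  pullback.lift_fst _ _ _

lemma PlaneSection.ext {S : Over (Spec (CommRingCat.of k))} {σ τ : PlaneSection S}
    (h : σ.1 ≫ toPlane S = τ.1 ≫ toPlane S) : σ = τ :=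
  Subtype.ext (pullback.hom_ext h (σ.2.trans τ.2.symm))

lemma PlaneSection.pull_id {S : Over (Spec (CommRingCat.of k))} (σ : PlaneSection S) :
    σ.pull (𝟙 S) = σ :=
  PlaneSection.ext (by rw [PlaneSection.pull_toPlane, Over.id_left, Category.id_comp])

lemma PlaneSection.pull_comp {S T R : Over (Spec (CommRingCat.of k))} (h : R ⟶ T) (g : T ⟶ S)
    (σ : PlaneSection S) : σ.pull (h ≫ g) = (σ.pull g).pull h :=
  PlaneSection.ext (by
    rw [PlaneSection.pull_toPlane, PlaneSection.pull_toPlane, PlaneSection.pull_toPlane,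
      Over.comp_left, Category.assoc])

variable (k) in
/-- The functor that sends `S` to the set of pairs of a closed subscheme of `ℙ²_S` and a section
of `ℙ²_S ⟶ S`, with pullback. -/
def pairs : (Over (Spec (CommRingCat.of k)))ᵒᵖ ⥤ Type u where
  obj S := (plane S.unop).IdealSheafData × PlaneSection S.unop
  map g := ↾fun x => (x.1.comap (planeMap g.unop), x.2.pull g.unop)
  map_id S := by
    ext x : 3
    exact Prod.ext
      ((congrArg x.1.comap (planeMap_id S.unop)).trans (Scheme.IdealSheafData.comap_id x.1))
      (PlaneSection.pull_id x.2)
  map_comp g h := by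
    ext x : 3
    exact Prod.ext
      ((congrArg x.1.comap (planeMap_comp h.unop g.unop)).trans
        (Scheme.IdealSheafData.comap_comp x.1 _ _))
      (PlaneSection.pull_comp h.unop g.unop x.2)

/-- A section `τ` of `φ : X ⟶ S`, of relative dimension `d`, is singular if it factors through the
critical locus of `φ`. -/
def IsSingularSection {X S : Scheme.{u}} (φ : X ⟶ S) (d : ℕ) (τ : S ⟶ X) : Prop :=
  τ ≫ φ = 𝟙 S ∧ ∃ h : S ⟶ criticalLocus φ d, h ≫ (criticalIdeal φ d).subschemeι = τ

/-- The `S`-points of `SC`: the pairs of a flat family `D ⊆ ℙ²_S` of cubics over `S` and a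
singular section of `D ⟶ S`. -/
def SC (S : Over (Spec (CommRingCat.of k))) : Set ((pairs k).obj (op S)) :=
  {x : (plane S).IdealSheafData × PlaneSection S | IsCubicFamily x.1 ∧
    ∃ τ : S.left ⟶ x.1.subscheme, τ ≫ x.1.subschemeι = x.2.1 ∧
      IsSingularSection (x.1.subschemeι ≫ toBase S) 1 τ}

/-- The subsets `P S ⊆ F(S)` form a subfunctor of `F`, and this subfunctor is represented by `X`
with universal element `x`. -/
def IsRepresentedBy {C : Type*} [Category.{u} C] {F : Cᵒᵖ ⥤ Type u}
    (P : ∀ S : C, Set (F.obj (op S))) (X : C) (x : F.obj (op X)) : Prop :=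
  ∃ (G : Subfunctor F) (_ : ∀ S : C, G.obj (op S) = P S) (r : G.toFunctor.RepresentableBy X),
    (r.homEquiv (𝟙 X)).1 = x

/-! ### The universal family of plane cubics and its critical locus -/

/-- The monomials of degree three in three variables. -/
abbrev CubicMonomial : Type := Sym (Fin 3) 3

lemma card_cubicMonomial : Fintype.card CubicMonomial = 10 := by
  simp [Sym.card_sym_eq_choose, Nat.choose]

variable (k) in
/-- `ℙ⁹`, with homogeneous coordinates `a_m` indexed by the ten cubic monomials `m`. -/
def spaceOfCubics : Over (Spec (CommRingCat.of k)) := projectiveSpace k CubicMonomial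

variable (k) in
/-- The open subset `xᵢ ≠ 0`, `a_m ≠ 0` of `ℙ² × ℙ⁹`. -/
def bichart (c : Fin 3 × CubicMonomial) : (plane (spaceOfCubics k)).Opens :=
  planeChart (spaceOfCubics k) c.1 ⊓ toBase (spaceOfCubics k) ⁻¹ᵁ chart k c.2

variable (k) in
/-- The function `(∑ₘ' a_m' xᵐ') / (a_m xᵢ³)` on the open subset `xᵢ ≠ 0`, `a_m ≠ 0`. -/
def universalEquation (c : Fin 3 × CubicMonomial) :
    Γ(plane (spaceOfCubics k), bichart k c) :=
  ∑ m : CubicMonomial,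
    ((plane (spaceOfCubics k)).presheaf.map (homOfLE inf_le_right).op).hom
        (((toBase (spaceOfCubics k)).app (chart k c.2)).hom (ratio k c.2 m)) *
      ((m : Multiset (Fin 3)).map fun j =>
        ((plane (spaceOfCubics k)).presheaf.map (homOfLE inf_le_left).op).hom
          (planeRatio (spaceOfCubics k) c.1 j)).prod

variable (k) in
/-- The universal cubic `Z = {∑ₘ a_m xᵐ = 0} ⊆ ℙ² × ℙ⁹`. -/
def universalCubic : (plane (spaceOfCubics k)).IdealSheafData :=
  ofLocalEquations (bichart k) (universalEquation k)

variable (k) in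
/-- The projection `φ : Z ⟶ ℙ⁹`. -/
abbrev universalFamily : (universalCubic k).subscheme ⟶ (spaceOfCubics k).left :=
  (universalCubic k).subschemeι ≫ toBase (spaceOfCubics k)

variable (k) in
/-- The inclusion `C(φ) ⟶ ℙ² × ℙ⁹`. -/
abbrev criticalInclusion : criticalLocus (universalFamily k) 1 ⟶ plane (spaceOfCubics k) :=
  (criticalIdeal (universalFamily k) 1).subschemeι ≫ (universalCubic k).subschemeι

variable (k) in
/-- The critical locus `C(φ)` of the universal family of plane cubics, as a `k`-scheme. -/
def universalCriticalLocus : Over (Spec (CommRingCat.of k)) :=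
  Over.mk (criticalInclusion k ≫ toBase (spaceOfCubics k) ≫ (spaceOfCubics k).hom)

variable (k) in
/-- The morphism `C(φ) ⟶ ℙ⁹`. -/
def criticalToSpace : universalCriticalLocus k ⟶ spaceOfCubics k :=
  Over.homMk (criticalInclusion k ≫ toBase (spaceOfCubics k)) (Category.assoc _ _ _)

variable (k) in
/-- The section of `ℙ² × C(φ) ⟶ C(φ)` given by the morphism `C(φ) ⟶ ℙ²`. -/
def tautologicalSection : PlaneSection (universalCriticalLocus k) :=
  ⟨pullback.lift (criticalInclusion k ≫ toPlane (spaceOfCubics k)) (𝟙 _)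
    ((Category.assoc _ _ _).trans
      ((congrArg (criticalInclusion k ≫ ·) pullback.condition).trans
        (Category.id_comp (universalCriticalLocus k).hom).symm)), pullback.lift_snd _ _ _⟩

variable (k) in
/-- The tautological pair over `C(φ)`: the pullback of the universal cubic along `C(φ) ⟶ ℙ⁹`, with
the section given by `C(φ) ⟶ ℙ²`. -/
def tautologicalPair : (pairs k).obj (op (universalCriticalLocus k)) :=
  ((universalCubic k).comap (planeMap (criticalToSpace k)), tautologicalSection k)

end

end SingularCubics

/-! ### Ideal sheaves: pullback, factorisation, local equations. -/

namespace SingularCubics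

noncomputable section

attribute [local instance] MvPolynomial.gradedAlgebra

/-! ### Ideal sheaves -/

section IdealSheaves

open Scheme

/-! Everything rests on one local description, valid over any infinite field: `D ⊆ ℙ²_S` is a flat
family of cubics if and only if, locally on `S`, it is the zero locus of a cubic form over the base
with a coefficient equal to `1` (`isCubicFamily_iff`). Such a form is determined by `D` up to a
scalar (`IsZeroLocusOn.exists_eq_C_mul`), so the coefficients of the local forms glue to a morphism
to `ℙ⁹` that pulls `Z` back to `D` (`exists_comap_eq`), and this morphism is unique
(`hom_ext_of_comap_eq`).

A form with a unit coefficient is a nonzerodivisor modulo every ideal of the base, and this makes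
its zero locus flat (`flat_comp_of_ker_eq_span_singleton`). Conversely, over a local ring of `S` a
linear change of coordinates makes the cubic of the closed fibre monic in `x₀`; this is where an
infinite residue field is needed. Nakayama's lemma shows that, in large degrees, every form is
congruent, modulo the forms vanishing on `D`, to one of `x₀`-degree at most two. Flatness shows that
no nonzero form of this kind vanishes on `D`. Reducing `x₁ⁿ x₀³` and `x₂ⁿ x₀³` and comparing the
results produces a cubic form that generates the ideal (`exists_cubicForm_of_coeff_eq_one`). Finite
presentation extends it to a neighbourhood (`IsCubicFamily.isLocallyCubicForm`).

For (1) it remains to see that a subscheme of `ℙ²_K` with Hilbert polynomial `3t` is a cubic. A form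
`d` of least degree whose multiples exceed the ideal by a bounded dimension divides every form in
the ideal (`dvd_of_forall_finrank_sup_le`); counting dimensions shows that `d` is a cubic and
generates.

For (2), on the chart `xᵢ ≠ 0` the differentials of `D` over `S` are generated by two elements with
the single relation `dF = 0`, so by Euler's formula the first Fitting ideal is the ideal of the
partial derivatives of `F` (`criticalIdeal_eq`). This ideal commutes with base change. Hence a pair
`(D, σ)` in `SC` is the same as a morphism to `ℙ² × ℙ⁹` along which the universal cubic form and its
partial derivatives vanish, that is, a morphism to `C(φ)` (`mem_SC_iff`).

For (3), at a point with `xᵢ = 1` these equations are linear in the coefficients and can be solved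
uniquely for those of the three monomials `xᵢ² xₗ`. The remaining coefficients, one of them
normalised to `1`, and the two affine coordinates of the point are free, so `C(φ)` is covered by
affine spaces of dimension `6 + 2` (`exists_criticalChart_equiv`). The Segre map gives projectivity.
-/

lemma ideal_comap_top_of_isAffine {X Y : Scheme.{u}} [IsAffine X] [IsAffine Y]
    (I : Y.IdealSheafData) (f : X ⟶ Y) :
    (I.comap f).ideal ⟨⊤, isAffineOpen_top X⟩ =
      (I.ideal ⟨⊤, isAffineOpen_top Y⟩).map f.appTop.hom := by
  have key (J : X.IdealSheafData) : (J.map f).ideal ⟨⊤, isAffineOpen_top Y⟩ =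
      (J.ideal ⟨⊤, isAffineOpen_top X⟩).comap f.appTop.hom :=
    IdealSheafData.ideal_map_of_isAffineHom J f ⟨⊤, isAffineOpen_top Y⟩
  apply le_antisymm
  -- Pullback of ideal sheaves is left adjoint to pushforward, so it is enough to test against the
  -- ideal sheaf attached to the extended ideal.
  · have : I.comap f ≤ IdealSheafData.ofIdealTop
        ((I.ideal ⟨⊤, isAffineOpen_top Y⟩).map f.appTop.hom) := by
      rw [← IdealSheafData.le_map_iff_comap_le]
      apply IdealSheafData.le_of_isAffine
      rw [key, ← Ideal.map_le_iff_le_comap]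
      exact (IdealSheafData.equivOfIsAffine.right_inv
        ((I.ideal ⟨⊤, isAffineOpen_top Y⟩).map f.appTop.hom)).ge
    refine (this ⟨⊤, isAffineOpen_top X⟩).trans ?_
    exact (IdealSheafData.equivOfIsAffine.right_inv
        ((I.ideal ⟨⊤, isAffineOpen_top Y⟩).map f.appTop.hom)).le
  · rw [Ideal.map_le_iff_le_comap, ← key]
    exact I.le_map_comap f _

lemma ideal_comap_of_isOpenImmersion_of_le {X Y : Scheme.{u}} (I : Y.IdealSheafData)
    (f : X ⟶ Y) [IsOpenImmersion f] (U : X.affineOpens) (V : Y.affineOpens)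
    (e : U.1 ≤ f ⁻¹ᵁ V.1) :
    (I.comap f).ideal U = (I.ideal V).map (f.appLE V U e).hom := by
  have h : f ''ᵁ U.1 ≤ V.1 := by
    rintro _ ⟨x, hx, rfl⟩; exact e hx
  rw [IdealSheafData.ideal_comap_of_isOpenImmersion,
    ← I.map_ideal (U := ⟨f ''ᵁ U.1, U.2.image_of_isOpenImmersion f⟩) (V := V) h]
  have : f.appLE V U e = Y.presheaf.map (homOfLE h).op ≫ (f.appIso U.1).hom := by
    rw [Scheme.Hom.appIso_hom', Scheme.Hom.map_appLE]
  rw [this, CommRingCat.hom_comp, ← Ideal.map_map]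
  ext x
  have h1 : ((f.appIso U.1).hom.hom : Γ(Y, f ''ᵁ U.1) → Γ(X, U.1)) ((f.appIso U.1).inv.hom x) = x := by
    rw [← CommRingCat.comp_apply, Iso.inv_hom_id]; rfl
  refine ⟨fun hx => ?_, fun hx => ?_⟩
  · rw [← h1]
    exact Ideal.mem_map_of_mem _ hx
  · have hs : Function.Surjective (f.appIso U.1).hom.hom :=
      (f.appIso U.1).commRingCatIsoToRingEquiv.surjective
    rw [Ideal.mem_map_iff_of_surjective _ hs] at hx
    obtain ⟨y, hy, rfl⟩ := hx
    rw [Ideal.mem_comap]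
    have h2 : (f.appIso U.1).inv.hom ((f.appIso U.1).hom.hom y) = y := by
      rw [← CommRingCat.comp_apply, Iso.hom_inv_id]; rfl
    exact h2.symm ▸ hy

/-- Pulling back to the affine schemes `U` and `V` only restricts the ideals, so the formula follows
from `ideal_comap_top_of_isAffine` for the morphism `U ⟶ V` induced by `f`. -/
lemma ideal_comap {X Y : Scheme.{u}} (I : Y.IdealSheafData) (f : X ⟶ Y)
    (U : X.affineOpens) (V : Y.affineOpens) (e : U.1 ≤ f ⁻¹ᵁ V.1) :
    (I.comap f).ideal U = (I.ideal V).map (f.appLE V U e).hom := by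
  have : IsAffine U.1 := U.2
  have : IsAffine V.1 := V.2
  have h1 := ideal_comap_of_isOpenImmersion_of_le (I.comap f) U.1.ι
    ⟨⊤, isAffineOpen_top _⟩ U (by simp)
  have h2 := ideal_comap_of_isOpenImmersion_of_le I V.1.ι
    ⟨⊤, isAffineOpen_top _⟩ V (by simp)
  have h3 := ideal_comap_top_of_isAffine (I.comap V.1.ι) (f.resLE V.1 U.1 e)
  rw [← IdealSheafData.comap_comp, Scheme.Hom.resLE_comp_ι, IdealSheafData.comap_comp, h1, h2,
    Ideal.map_map] at h3
  have p : ⊤ ≤ U.1.ι ⁻¹ᵁ U.1 := by simp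
  have hb : IsIso (U.1.ι.appLE U.1 ⊤ p) := by
    have : U.1.ι.appLE U.1 ⊤ p = U.1.topIso.inv := by
      simp only [Scheme.Opens.ι_appLE, Scheme.Opens.topIso]
      rfl
    rw [this]; infer_instance
  have hinj : Function.Injective (Ideal.map (U.1.ι.appLE U.1 ⊤ p).hom) := by
    intro I J hIJ
    have h := congrArg (Ideal.map (inv (U.1.ι.appLE U.1 ⊤ p)).hom) hIJ
    rw [Ideal.map_map, Ideal.map_map, ← CommRingCat.hom_comp, IsIso.hom_inv_id,
      CommRingCat.hom_id] at h
    simpa only [Ideal.map_id] using h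
  apply hinj
  rw [h3, Ideal.map_map]
  congr 1
  rw [← CommRingCat.hom_comp, ← CommRingCat.hom_comp, Scheme.Hom.appLE_comp_appLE,
    Scheme.Hom.appTop, Scheme.Hom.app_eq_appLE]
  refine congrArg _ (Eq.symm <| Eq.trans ?_ (Scheme.Hom.appLE_comp_appLE (f.resLE V.1 U.1 e) V.1.ι V.1 ⊤ ⊤
    (by simp) le_top).symm)
  simp only [Scheme.Hom.resLE_comp_ι]

/-- This turns each factorisation condition (singular sections, points of the critical locus) into
the vanishing of a pulled back ideal, which behaves well under composition. -/
lemma exists_lift_iff {X T : Scheme.{u}} (I : X.IdealSheafData) (f : T ⟶ X) :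
    (∃ g : T ⟶ I.subscheme, g ≫ I.subschemeι = f) ↔ I.comap f = ⊥ := by
  constructor
  · rintro ⟨g, rfl⟩
    rw [IdealSheafData.comap_comp]
    have : I.comap I.subschemeι = ⊥ := by
      rw [eq_bot_iff, ← IdealSheafData.le_map_iff_comap_le]
      simp
    rw [this, IdealSheafData.comap_bot]
  · intro h
    have : I ≤ f.ker := by
      rw [← IdealSheafData.map_bot, IdealSheafData.le_map_iff_comap_le, h]
    exact ⟨IsClosedImmersion.lift I.subschemeι f (by simpa using this),
      IsClosedImmersion.lift_fac _ _ _⟩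

/-- `ofLocalEquations` is by construction only the largest ideal sheaf inside a family of ideals,
which bounds it from above. The lower bound needs an actual ideal sheaf with the expected sections.
-/
lemma ideal_ofLocalEquations {X : Scheme.{u}} [X.IsSeparated] {ι : Type} [Finite ι]
    (U : ι → X.Opens) (hU : ∀ i, IsAffineOpen (U i)) (f : ∀ i, Γ(X, U i))
    (h : ∀ i j, X.presheaf.map (homOfLE (inf_le_left : U i ⊓ U j ≤ U i)).op (f i) ∈
      Ideal.span {X.presheaf.map (homOfLE (inf_le_right : U i ⊓ U j ≤ U j)).op (f j)})
    (i : ι) (W : X.affineOpens) (hW : W.1 ≤ U i) :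
    (ofLocalEquations U f).ideal W = Ideal.span {X.presheaf.map (homOfLE hW).op (f i)} := by
  have (j : ι) : IsAffine (U j) := hU j
  -- The intersection of the pushforwards of the ideals `(f j)` from the opens `U j`. Separatedness
  -- makes the inclusions `U j ⟶ X` affine, so these pushforwards can be computed; on `W ≤ U i` the
  -- hypothesis `h` says that the indices `j ≠ i` impose no further condition.
  let J : X.IdealSheafData := ⨅ j, IdealSheafData.map
    (IdealSheafData.ofIdealTop (Ideal.span {(U j).topIso.inv.hom (f j)})) (U j).ι
  have hJ (i : ι) (W : X.affineOpens) (hW : W.1 ≤ U i) :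
      J.ideal W = Ideal.span {X.presheaf.map (homOfLE hW).op (f i)} := by
    have hle (j : ι) : (U j).ι ⁻¹ᵁ W.1 ≤ (U j).ι ⁻¹ᵁ (U j) := by simp
    have e (j : ι) : (U j).ι.appLE (U j) ((U j).ι ⁻¹ᵁ W.1) (hle _) =
        (U j).topIso.inv ≫ (U j).toScheme.presheaf.map (homOfLE le_top).op := by
      rw [Scheme.Opens.ι_appLE, Scheme.Opens.topIso]
      exact X.presheaf.map_comp _ _
    have hcomp (j : ι) (s : Γ(X, W.1)) : s ∈ (IdealSheafData.map (IdealSheafData.ofIdealTop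
        (Ideal.span {(U j).topIso.inv.hom (f j)})) (U j).ι).ideal W ↔
        (U j).ι.app W.1 s ∈ Ideal.span {(U j).ι.appLE (U j) ((U j).ι ⁻¹ᵁ W.1)
          (hle _) (f j)} := by
      have : IsAffineHom (U j).ι := IsAffineHom.of_comp (U j).ι (terminal.from X)
      have haff : IsAffineOpen ((U j).ι ⁻¹ᵁ W.1) := W.2.preimage (U j).ι
      rw [IdealSheafData.ideal_map _ _ _ haff, Ideal.mem_comap]
      refine iff_of_eq (congrArg (fun I => (U j).ι.app W.1 s ∈ I) ?_)
      refine (Ideal.map_span _ _).trans ?_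
      rw [Set.image_singleton, ← CommRingCat.comp_apply]
      congr 3
      exact congrArg _ (e j).symm
    rw [IdealSheafData.ideal_iInf]
    apply le_antisymm
    · intro s hs
      simp only [iInf_apply, Submodule.mem_iInf] at hs
      have hs := (hcomp i s).mp (hs i)
      have : IsIso ((U i).ι.app W.1) := Scheme.Hom.isIso_app _ _ (by simpa using hW)
      have e : (U i).ι.appLE (U i) ((U i).ι ⁻¹ᵁ W.1) (hle _) =
          X.presheaf.map (homOfLE hW).op ≫ (U i).ι.app W.1 := by
        rw [Scheme.Hom.app_eq_appLE, Scheme.Hom.map_appLE]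
      rw [e, CommRingCat.comp_apply, Ideal.mem_span_singleton] at hs
      obtain ⟨c, hc⟩ := hs
      rw [Ideal.mem_span_singleton]
      refine ⟨inv ((U i).ι.app W.1) c, ?_⟩
      have := congrArg (inv ((U i).ι.app W.1)) hc
      rw [map_mul, ← CommRingCat.comp_apply, ← CommRingCat.comp_apply, IsIso.hom_inv_id] at this
      simpa using this
    · rw [Ideal.span_singleton_le_iff_mem, iInf_apply, Submodule.mem_iInf]
      intro j
      rw [hcomp]
      have e : (U j).ι ⁻¹ᵁ W.1 ≤ (U j).ι ⁻¹ᵁ (U i ⊓ U j) := fun x hx => ⟨hW hx, x.2⟩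
      have := Ideal.mem_map_of_mem ((U j).ι.appLE (U i ⊓ U j) ((U j).ι ⁻¹ᵁ W.1) e).hom (h i j)
      rw [Ideal.map_span, Set.image_singleton, ← CommRingCat.comp_apply, ← CommRingCat.comp_apply,
        Scheme.Hom.map_appLE, Scheme.Hom.map_appLE] at this
      rwa [← CommRingCat.comp_apply, Scheme.Hom.app_eq_appLE, Scheme.Hom.map_appLE]
  apply le_antisymm
  · intro s hs
    have := IdealSheafData.ideal_ofIdeals_le _ W hs
    simp only [Submodule.mem_iInf] at this
    have := this i W le_rfl hW
    simpa using this
  · rw [← hJ i W hW]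
    refine (?_ : J ≤ ofLocalEquations U f) W
    rw [ofLocalEquations, IdealSheafData.le_ofIdeals_iff]
    intro W s hs
    simp only [Submodule.mem_iInf]
    intro i V hVW hVU
    rw [Ideal.mem_comap]
    have := J.ideal_le_comap_ideal (U := V) (V := W) hVW hs
    rwa [hJ i V hVU] at this

end IdealSheaves

end

end SingularCubics
-- Coordinates: functions on charts and morphisms to projective space.
namespace SingularCubics

noncomputable section

attribute [local instance] MvPolynomial.gradedAlgebra

/-! ### Charts of projective space -/

section Charts

lemma le_preimage_top {X Y : Scheme.{u}} (f : X ⟶ Y) (U : X.Opens) : U ≤ f ⁻¹ᵁ ⊤ := le_top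

/-- The structure homomorphism `k → Γ(X, U)` of a `k`-scheme. -/
def scalars {k : Type u} [CommRing k] (X : Over (Spec (CommRingCat.of k))) (U : X.left.Opens) :
    k →+* Γ(X.left, U) :=
  ((Scheme.ΓSpecIso (CommRingCat.of k)).inv ≫ X.hom.appLE ⊤ U (le_preimage_top _ _)).hom

lemma appLE_scalars {k : Type u} [CommRing k] {X Y : Over (Spec (CommRingCat.of k))} (g : X ⟶ Y)
    (U : X.left.Opens) (V : Y.left.Opens) (e : U ≤ g.left ⁻¹ᵁ V) :
    (g.left.appLE V U e).hom.comp (scalars Y V) = scalars X U := by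
  rw [scalars, scalars, ← CommRingCat.hom_comp, Category.assoc, Scheme.Hom.appLE_comp_appLE]
  simp only [Over.w]

lemma ΓSpecIso_inv_comp_appLE_of_ι_comp_eq {X : Scheme.{u}} {R : CommRingCat.{u}} (f : X ⟶ Spec R)
    (U : X.Opens) (ψ : R ⟶ Γ(X, U)) (h : U.ι ≫ f = U.toSpecΓ ≫ Spec.map ψ) :
    (Scheme.ΓSpecIso R).inv ≫ f.appLE ⊤ U (le_preimage_top _ _) = ψ := by
  have h2 := congrArg Scheme.Hom.appTop h
  rw [Scheme.Hom.comp_appTop, Scheme.Hom.comp_appTop, Scheme.Opens.toSpecΓ_appTop] at h2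
  have h3 := Scheme.ΓSpecIso_naturality ψ
  have h4 : f.appLE ⊤ U (le_preimage_top _ _) = f.appTop ≫ U.ι.appTop ≫ U.topIso.hom := by
    rw [Scheme.Hom.appTop, Scheme.Hom.app_eq_appLE, Scheme.Opens.ι_appTop]
    erw [← X.presheaf.map_comp]
    exact (Scheme.Hom.appLE_map _ _ _).symm
  rw [h4, reassoc_of% h2, reassoc_of% h3, Iso.inv_hom_id_assoc, Iso.inv_hom_id,
    Category.comp_id]

variable {k : Type u} [Field k] {ι : Type}

lemma X_mem_homogeneousSubmodule (i : ι) :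
    (MvPolynomial.X i : MvPolynomial ι k) ∈ MvPolynomial.homogeneousSubmodule ι k 1 :=
  MvPolynomial.isHomogeneous_X k i

lemma isAffineOpen_chart (i : ι) : IsAffineOpen (chart k i) :=
  Proj.isAffineOpen_basicOpen _ _ (MvPolynomial.isHomogeneous_X k i) one_pos

lemma iSup_chart : ⨆ i : ι, chart k i = ⊤ := by
  refine Proj.iSup_basicOpen_eq_top' _ _ (fun i => ⟨1, MvPolynomial.isHomogeneous_X k i⟩) ?_
  rw [eq_top_iff]
  rintro F -
  induction F using MvPolynomial.induction_on with
  | C c => exact Subalgebra.algebraMap_mem (Algebra.adjoin (MvPolynomial.homogeneousSubmodule ι k 0)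
      (Set.range (MvPolynomial.X (R := k)))) ⟨MvPolynomial.C c, MvPolynomial.isHomogeneous_C ι c⟩
  | add p q hp hq => exact add_mem hp hq
  | mul_X p i hp => exact mul_mem hp (Algebra.subset_adjoin ⟨i, rfl⟩)

/-- The isomorphism between functions on the chart `xᵢ ≠ 0` and homogeneous fractions. -/
def chartIso (i : ι) : CommRingCat.of (HomogeneousLocalization.Away
    (MvPolynomial.homogeneousSubmodule ι k) (MvPolynomial.X i)) ≅
    Γ((projectiveSpace k ι).left, chart k i) :=
  Proj.basicOpenIsoAway (MvPolynomial.homogeneousSubmodule ι k) (MvPolynomial.X i)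
      (X_mem_homogeneousSubmodule i) one_pos

lemma chartIso_hom (i : ι) : (chartIso (k := k) i).hom =
    Proj.awayToSection (MvPolynomial.homogeneousSubmodule ι k) (MvPolynomial.X i) :=
  Proj.basicOpenIsoAway_hom _ _ (X_mem_homogeneousSubmodule i) one_pos

/-- Functions on the chart `xᵢ ≠ 0` as elements of `k[x][1 / xᵢ]`. -/
def chartVal (i : ι) : Γ((projectiveSpace k ι).left, chart k i) →+*
    Localization.Away (MvPolynomial.X i : MvPolynomial ι k) :=
  (algebraMap (HomogeneousLocalization.Away (MvPolynomial.homogeneousSubmodule ι k)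
    (MvPolynomial.X i)) _).comp (chartIso i).inv.hom

lemma chartVal_chartIso (i : ι) (a) : chartVal (k := k) i ((chartIso i).hom a) = a.val := by
  rw [chartVal, RingHom.comp_apply, ← CommRingCat.comp_apply, Iso.hom_inv_id,
    HomogeneousLocalization.algebraMap_apply]
  rfl

lemma chartVal_injective (i : ι) : Function.Injective (chartVal (k := k) i) :=
  (HomogeneousLocalization.val_injective _).comp
    (chartIso i).symm.commRingCatIsoToRingEquiv.injective

lemma chartVal_ratio (i j : ι) : chartVal (k := k) i (ratio k i j) =
    IsLocalization.mk' _ (MvPolynomial.X j : MvPolynomial ι k)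
      (⟨MvPolynomial.X i, Submonoid.mem_powers _⟩ : Submonoid.powers _) := by
  have := chartVal_chartIso i (HomogeneousLocalization.Away.mk
    (MvPolynomial.homogeneousSubmodule ι k) (X_mem_homogeneousSubmodule i) 1 (MvPolynomial.X j)
      (by simpa using MvPolynomial.isHomogeneous_X k j))
  rw [HomogeneousLocalization.Away.val_mk, Localization.mk_eq_mk', chartIso_hom] at this
  refine Eq.trans this ?_
  simp only [pow_one]

lemma ratio_self (i : ι) : ratio k i i = 1 := by
  apply chartVal_injective
  rw [chartVal_ratio, map_one]
  exact IsLocalization.mk'_self _ _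

lemma chartIso_fromZero (i : ι) :
    CommRingCat.ofHom (algebraMap k (MvPolynomial.homogeneousSubmodule ι k 0)) ≫
      CommRingCat.ofHom (HomogeneousLocalization.fromZeroRingHom
        (MvPolynomial.homogeneousSubmodule ι k) (Submonoid.powers (MvPolynomial.X i))) ≫
      (chartIso i).hom = CommRingCat.ofHom (scalars (projectiveSpace k ι) (chart k i)) := by
  refine (ΓSpecIso_inv_comp_appLE_of_ι_comp_eq (projectiveSpace k ι).hom _ _ ?_).symm
  have h := Proj.awayι_toSpecZero (MvPolynomial.homogeneousSubmodule ι k) (MvPolynomial.X i)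
        (X_mem_homogeneousSubmodule i) one_pos
  rw [← Proj.basicOpenIsoSpec_inv_ι, Category.assoc, Iso.inv_comp_eq,
    Proj.basicOpenIsoSpec_hom] at h
  rw [Spec.map_comp, Spec.map_comp, chartIso_hom]
  exact congrArg (· ≫ Spec.map (CommRingCat.ofHom
    (algebraMap k (MvPolynomial.homogeneousSubmodule ι k 0)))) h

lemma chartVal_scalars (i : ι) (c : k) :
    chartVal i (scalars (projectiveSpace k ι) (chart k i) c) =
      algebraMap (MvPolynomial ι k) _ (MvPolynomial.C c) := by
  have := congr($(chartIso_fromZero (k := k) i) c)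
  refine (congrArg _ this.symm).trans ?_
  exact chartVal_chartIso i _

/-- The homomorphism `F ↦ F(x / xᵢ)` from polynomials to functions on the chart `xᵢ ≠ 0`. -/
def chartPoly (i : ι) : MvPolynomial ι k →+* Γ((projectiveSpace k ι).left, chart k i) :=
  MvPolynomial.eval₂Hom (scalars _ _) (ratio k i)

lemma _root_.MvPolynomial.IsHomogeneous.eval₂_mul_left {σ R B : Type*} [CommSemiring R]
    [CommSemiring B] {F : MvPolynomial σ R} {n : ℕ} (hF : F.IsHomogeneous n) (φ : R →+* B) (u : B)
    (g : σ → B) : F.eval₂ φ (fun j => u * g j) = u ^ n * F.eval₂ φ g := by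
  rw [MvPolynomial.eval₂_eq, MvPolynomial.eval₂_eq, Finset.mul_sum]
  refine Finset.sum_congr rfl fun d hd => ?_
  simp only [mul_pow, Finset.prod_mul_distrib, Finset.prod_pow_eq_pow_sum]
  rw [← hF.degree_eq_sum_deg_support hd]
  ring

lemma chartVal_chartPoly (i : ι) (F : MvPolynomial ι k) (n : ℕ) (hF : F.IsHomogeneous n) :
    chartVal i (chartPoly i F) = Localization.mk F (⟨MvPolynomial.X i ^ n, n, rfl⟩ :
      Submonoid.powers (MvPolynomial.X i : MvPolynomial ι k)) := by
  have h : (chartVal i).comp (chartPoly i) =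
      MvPolynomial.eval₂Hom ((algebraMap (MvPolynomial ι k)
        (Localization.Away (MvPolynomial.X i : MvPolynomial ι k))).comp MvPolynomial.C)
        (fun j => IsLocalization.mk' (Localization.Away (MvPolynomial.X i : MvPolynomial ι k))
          1 (⟨MvPolynomial.X i, Submonoid.mem_powers _⟩ :
            Submonoid.powers (MvPolynomial.X i : MvPolynomial ι k)) *
          algebraMap (MvPolynomial ι k) _ (MvPolynomial.X j)) := by
    refine MvPolynomial.ringHom_ext (fun c => ?_) (fun j => ?_)
    · simp [chartPoly, chartVal_scalars]
    · simp only [chartPoly, RingHom.comp_apply, MvPolynomial.eval₂Hom_X', chartVal_ratio]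
      rw [mul_comm, ← IsLocalization.mk'_eq_mul_mk'_one]
  have h2 := congr($h F)
  rw [RingHom.comp_apply] at h2
  rw [h2, MvPolynomial.coe_eval₂Hom, hF.eval₂_mul_left, ← MvPolynomial.coe_eval₂Hom]
  have h3 : MvPolynomial.eval₂Hom ((algebraMap (MvPolynomial ι k)
      (Localization.Away (MvPolynomial.X i : MvPolynomial ι k))).comp MvPolynomial.C)
      (fun j => algebraMap (MvPolynomial ι k) _ (MvPolynomial.X j)) =
      algebraMap (MvPolynomial ι k) _ :=
    MvPolynomial.ringHom_ext (fun c => by simp) (fun j => by simp)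
  rw [h3, Localization.mk_eq_mk', ← IsLocalization.mk'_pow, mul_comm, one_pow,
    ← IsLocalization.mk'_eq_mul_mk'_one]
  rfl

/-- A homogeneous fraction `F / xᵢⁿ` of degree zero is `F` evaluated at the ratios `xⱼ / xᵢ`. -/
lemma chartPoly_surjective (i : ι) : Function.Surjective (chartPoly (k := k) i) := by
  intro s
  obtain ⟨a, rfl⟩ := (chartIso i).commRingCatIsoToRingEquiv.surjective s
  obtain ⟨n, F, hF, rfl⟩ := HomogeneousLocalization.Away.mk_surjective _
    (X_mem_homogeneousSubmodule i) a
  refine ⟨F, chartVal_injective i ?_⟩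
  rw [chartVal_chartPoly i F n (by simpa using hF)]
  exact ((chartVal_chartIso i _).trans (HomogeneousLocalization.Away.val_mk _ _ _ _ _)).symm

lemma chart_ringHom_ext {B : Type*} [CommRing B] (i : ι)
    {f g : Γ((projectiveSpace k ι).left, chart k i) →+* B}
    (h₁ : f.comp (scalars _ _) = g.comp (scalars _ _)) (h₂ : ∀ j, f (ratio k i j) = g (ratio k i j)) :
    f = g := by
  have : f.comp (chartPoly i) = g.comp (chartPoly i) :=
    MvPolynomial.ringHom_ext (fun c => by simpa [chartPoly] using congr($h₁ c))
      (fun j => by simpa [chartPoly] using h₂ j)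
  exact (RingHom.cancel_right (chartPoly_surjective i)).mp this

/-- The homomorphism from functions on the chart `xᵢ ≠ 0` that sends `xⱼ / xᵢ` to `a j`. -/
def chartLift {B : Type*} [CommRing B] (φ : k →+* B) (i : ι) (a : ι → B) (ha : a i = 1) :
    Γ((projectiveSpace k ι).left, chart k i) →+* B :=
  (IsLocalization.Away.lift (S := Localization.Away (MvPolynomial.X i : MvPolynomial ι k))
    (MvPolynomial.X i : MvPolynomial ι k) (g := MvPolynomial.eval₂Hom φ a) (by simp [ha])).comp
    (chartVal i)

lemma chartLift_ratio {B : Type*} [CommRing B] (φ : k →+* B) (i : ι) (a : ι → B) (ha : a i = 1)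
    (j : ι) : chartLift φ i a ha (ratio k i j) = a j := by
  rw [chartLift, RingHom.comp_apply, chartVal_ratio, IsLocalization.Away.lift,
    IsLocalization.lift_mk'_spec]
  simp [ha]

lemma chartLift_scalars {B : Type*} [CommRing B] (φ : k →+* B) (i : ι) (a : ι → B) (ha : a i = 1) :
    (chartLift φ i a ha).comp (scalars _ _) = φ := by
  ext c
  rw [RingHom.comp_apply, chartLift, RingHom.comp_apply, chartVal_scalars,
    IsLocalization.Away.lift_eq]
  simp

/-- The homogeneous fraction `xⱼ / xᵢ`. -/
def fraction (k : Type u) [Field k] (i j : ι) :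
    HomogeneousLocalization.Away (MvPolynomial.homogeneousSubmodule ι k) (MvPolynomial.X i) :=
  HomogeneousLocalization.Away.mk _ (X_mem_homogeneousSubmodule i) 1 (MvPolynomial.X j)
    (by simpa using MvPolynomial.isHomogeneous_X k j)

lemma val_awayMap_fraction {i j l : ι} {x : MvPolynomial ι k}
    (hx : x = MvPolynomial.X i * MvPolynomial.X j) :
    (HomogeneousLocalization.awayMap (MvPolynomial.homogeneousSubmodule ι k)
      (X_mem_homogeneousSubmodule j) hx (fraction k i l)).val =
      Localization.mk (MvPolynomial.X l * MvPolynomial.X j) ⟨x, Submonoid.mem_powers _⟩ := by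
  rw [fraction, HomogeneousLocalization.awayMap_mk, HomogeneousLocalization.Away.val_mk]
  simp only [pow_one]

lemma awayMap_fraction_mul (i j l : ι) {x : MvPolynomial ι k}
    (hi : x = MvPolynomial.X i * MvPolynomial.X j) (hj : x = MvPolynomial.X j * MvPolynomial.X i) :
    HomogeneousLocalization.awayMap (MvPolynomial.homogeneousSubmodule ι k)
      (X_mem_homogeneousSubmodule i) hj (fraction k j i) *
    HomogeneousLocalization.awayMap (MvPolynomial.homogeneousSubmodule ι k)
      (X_mem_homogeneousSubmodule j) hi (fraction k i l) =
    HomogeneousLocalization.awayMap (MvPolynomial.homogeneousSubmodule ι k)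
      (X_mem_homogeneousSubmodule i) hj (fraction k j l) := by
  apply HomogeneousLocalization.val_injective
  rw [HomogeneousLocalization.val_mul, val_awayMap_fraction, val_awayMap_fraction,
    val_awayMap_fraction, Localization.mk_mul, Localization.mk_eq_mk_iff, Localization.r_iff_exists]
  refine ⟨1, ?_⟩
  simp only [OneMemClass.coe_one, one_mul, Submonoid.coe_mul, hi]
  ring

/-- Both sides come from homogeneous fractions on the basic open subset of `xᵢ xⱼ`, where the
identity is one of fractions. It is the source of all changes of chart below. -/
lemma ratio_mul_ratio {i j : ι} (l : ι) {U : (projectiveSpace k ι).left.Opens}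
    (hi : U ≤ chart k i) (hj : U ≤ chart k j) :
    (projectiveSpace k ι).left.presheaf.map (homOfLE hj).op (ratio k j i) *
      (projectiveSpace k ι).left.presheaf.map (homOfLE hi).op (ratio k i l) =
      (projectiveSpace k ι).left.presheaf.map (homOfLE hj).op (ratio k j l) := by
  have hx : (MvPolynomial.X i * MvPolynomial.X j : MvPolynomial ι k) =
    MvPolynomial.X j * MvPolynomial.X i := mul_comm _ _
  let W : (projectiveSpace k ι).left.Opens := Proj.basicOpen
    (MvPolynomial.homogeneousSubmodule ι k) (MvPolynomial.X i * MvPolynomial.X j)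
  have hW : U ≤ W := (le_inf hi hj).trans (Proj.basicOpen_mul _ _ _).ge
  have hWi : W ≤ chart k i := Proj.basicOpen_mono _ _ _ ⟨_, rfl⟩
  have hWj : W ≤ chart k j := Proj.basicOpen_mono _ _ _ ⟨_, hx⟩
  let θ : HomogeneousLocalization.Away (MvPolynomial.homogeneousSubmodule ι k)
      (MvPolynomial.X i * MvPolynomial.X j) →+* Γ((projectiveSpace k ι).left, W) :=
    (Proj.awayToSection (MvPolynomial.homogeneousSubmodule ι k)
      (MvPolynomial.X i * MvPolynomial.X j)).hom
  have ri (l : ι) : θ (HomogeneousLocalization.awayMap (MvPolynomial.homogeneousSubmodule ι k)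
      (X_mem_homogeneousSubmodule j) rfl (fraction k i l)) =
      (projectiveSpace k ι).left.presheaf.map (homOfLE hWi).op (ratio k i l) :=
    congr($(Proj.awayMap_awayToSection (MvPolynomial.homogeneousSubmodule ι k)
      (X_mem_homogeneousSubmodule j)
      (rfl : (MvPolynomial.X i * MvPolynomial.X j : MvPolynomial ι k) = _)) (fraction k i l))
  have rj (l : ι) : θ (HomogeneousLocalization.awayMap (MvPolynomial.homogeneousSubmodule ι k)
      (X_mem_homogeneousSubmodule i) hx (fraction k j l)) =
      (projectiveSpace k ι).left.presheaf.map (homOfLE hWj).op (ratio k j l) :=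
    congr($(Proj.awayMap_awayToSection (MvPolynomial.homogeneousSubmodule ι k)
      (X_mem_homogeneousSubmodule i) hx) (fraction k j l))
  have key : (projectiveSpace k ι).left.presheaf.map (homOfLE hWj).op (ratio k j i) *
      (projectiveSpace k ι).left.presheaf.map (homOfLE hWi).op (ratio k i l) =
      (projectiveSpace k ι).left.presheaf.map (homOfLE hWj).op (ratio k j l) := by
    rw [← ri, ← rj, ← rj, ← map_mul, awayMap_fraction_mul]
  have res {V : (projectiveSpace k ι).left.Opens} (h : W ≤ V) (h' : U ≤ V)
      (s : Γ((projectiveSpace k ι).left, V)) :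
      (projectiveSpace k ι).left.presheaf.map (homOfLE hW).op
        ((projectiveSpace k ι).left.presheaf.map (homOfLE h).op s) =
      (projectiveSpace k ι).left.presheaf.map (homOfLE h').op s := by
    rw [← CommRingCat.comp_apply, ← Functor.map_comp]; rfl
  rw [← res hWj hj, ← res hWi hi, ← res hWj hj, ← map_mul, key]

/-- On the overlap `xⱼ / xᵢ` has the inverse `xᵢ / xⱼ`. For the converse, the chart is identified
with a spectrum, in which `xⱼ ≠ 0` is the basic open subset of the fraction `xⱼ / xᵢ`. -/
lemma chart_inf_chart (i j : ι) :
    chart k i ⊓ chart k j = (projectiveSpace k ι).left.basicOpen (ratio k i j) := by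
  apply le_antisymm
  · have h := ratio_mul_ratio (k := k) (i := j) (j := i) i (U := chart k i ⊓ chart k j)
      inf_le_right inf_le_left
    rw [ratio_self, map_one] at h
    have := Scheme.basicOpen_of_isUnit _ (IsUnit.of_mul_eq_one _ h)
    rw [Scheme.basicOpen_res] at this
    exact this.ge.trans inf_le_right
  · refine le_inf (Scheme.basicOpen_le _ _) ?_
    intro x hx
    have hxi : x ∈ chart k i := Scheme.basicOpen_le _ _ hx
    have h1 := Proj.awayι_preimage_basicOpen (MvPolynomial.homogeneousSubmodule ι k)
      (X_mem_homogeneousSubmodule (k := k) i) one_pos (X_mem_homogeneousSubmodule j) one_pos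
    have h2 : HomogeneousLocalization.Away.isLocalizationElem (X_mem_homogeneousSubmodule (k := k) i)
      (X_mem_homogeneousSubmodule j) = fraction k i j := by
      apply HomogeneousLocalization.val_injective
      simp [fraction, HomogeneousLocalization.Away.isLocalizationElem]
    rw [h2] at h1
    have h3 : (⟨x, hxi⟩ : chart k i) ∈ (chart k i).toSpecΓ ⁻¹ᵁ
        PrimeSpectrum.basicOpen (ratio k i j) := by
      rw [Scheme.Opens.toSpecΓ_preimage_basicOpen]; exact hx
    have h4 : Proj.basicOpenToSpec (MvPolynomial.homogeneousSubmodule ι k) (MvPolynomial.X i)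
        ⟨x, hxi⟩ ∈ PrimeSpectrum.basicOpen (fraction k i j) := h3
    rw [← h1] at h4
    have h5 : Proj.basicOpenToSpec (MvPolynomial.homogeneousSubmodule ι k) (MvPolynomial.X i) ≫
        Proj.awayι (MvPolynomial.homogeneousSubmodule ι k) (MvPolynomial.X i)
        (X_mem_homogeneousSubmodule i) one_pos = (Proj.basicOpen _ _).ι := by
      rw [← Proj.basicOpenIsoSpec_inv_ι, ← Category.assoc, ← Proj.basicOpenIsoSpec_hom _ _
        (X_mem_homogeneousSubmodule i) one_pos, Iso.hom_inv_id, Category.id_comp]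
    have h6 := congr($h5 ⟨x, hxi⟩)
    have h7 : x = Proj.awayι (MvPolynomial.homogeneousSubmodule ι k) (MvPolynomial.X i)
        (X_mem_homogeneousSubmodule i) one_pos (Proj.basicOpenToSpec
        (MvPolynomial.homogeneousSubmodule ι k) (MvPolynomial.X i) ⟨x, hxi⟩) := h6.symm
    rw [h7]
    exact h4

lemma ι_comp_hom (X : Over (Spec (CommRingCat.of k))) (U : X.left.Opens) :
    U.ι ≫ X.hom = U.toSpecΓ ≫ Spec.map (CommRingCat.ofHom (scalars X U)) := by
  have h : CommRingCat.ofHom (scalars X U) =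
      (Scheme.ΓSpecIso (CommRingCat.of k)).inv ≫ X.hom.appLE ⊤ U (le_preimage_top _ _) := rfl
  rw [h, Spec.map_comp, Scheme.Opens.toSpecΓ_SpecMap_appLE_assoc, Scheme.Opens.toSpecΓ_top,
    Category.assoc, Scheme.Hom.resLE_comp_ι_assoc, ← SpecMap_ΓSpecIso_hom, ← Spec.map_comp, Iso.inv_hom_id, Spec.map_id, Category.comp_id]

lemma ι_comp_left_eq_of_ratio {X : Over (Spec (CommRingCat.of k))}
    {g g' : X ⟶ projectiveSpace k ι} (i : ι) {U : X.left.Opens}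
    (e : U ≤ g.left ⁻¹ᵁ chart k i) (e' : U ≤ g'.left ⁻¹ᵁ chart k i)
    (h : ∀ j, g.left.appLE (chart k i) U e (ratio k i j) =
      g'.left.appLE (chart k i) U e' (ratio k i j)) :
    U.ι ≫ g.left = U.ι ≫ g'.left := by
  have : g.left.appLE (chart k i) U e = g'.left.appLE (chart k i) U e' := by
    ext1
    exact chart_ringHom_ext i ((appLE_scalars g _ _ _).trans (appLE_scalars g' _ _ _).symm) h
  rw [← Scheme.Hom.resLE_comp_ι g.left e, ← Scheme.Hom.resLE_comp_ι g'.left e',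
    ← (isAffineOpen_chart i).toSpecΓ_fromSpec, ← Scheme.Opens.toSpecΓ_SpecMap_appLE_assoc,
    ← Scheme.Opens.toSpecΓ_SpecMap_appLE_assoc, this]

lemma exists_hom_of_ratio (X : Over (Spec (CommRingCat.of k))) (i : ι) (a : ι → Γ(X.left, ⊤))
    (ha : a i = 1) : ∃ (g : X ⟶ projectiveSpace k ι) (e : ⊤ ≤ g.left ⁻¹ᵁ chart k i),
      ∀ j, g.left.appLE (chart k i) ⊤ e (ratio k i j) = a j := by
  let ψ := CommRingCat.ofHom (chartLift (scalars X ⊤) i a ha)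
  let f := X.left.toSpecΓ ≫ Spec.map ψ ≫ (isAffineOpen_chart i).fromSpec
  have hf : f ≫ (projectiveSpace k ι).hom = X.hom := by
    have h1 : (isAffineOpen_chart (k := k) i).fromSpec ≫ (projectiveSpace k ι).hom =
        Spec.map (CommRingCat.ofHom (scalars (projectiveSpace k ι) (chart k i))) := by
      rw [← IsAffineOpen.isoSpec_inv_ι, Category.assoc, ι_comp_hom,
        IsAffineOpen.isoSpec_inv_toSpecΓ_assoc]
    have h2 : CommRingCat.ofHom (scalars (projectiveSpace k ι) (chart k i)) ≫ ψ =
        CommRingCat.ofHom (scalars X ⊤) := by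
      ext1
      exact chartLift_scalars _ _ _ ha
    rw [Category.assoc, Category.assoc, h1, ← Spec.map_comp, h2]
    have := ι_comp_hom X ⊤
    rw [Scheme.Opens.toSpecΓ_top, Category.assoc] at this
    have hi : IsIso (⊤ : X.left.Opens).ι := inferInstanceAs (IsIso X.left.topIso.hom)
    exact ((cancel_epi _).mp this).symm
  have e : ⊤ ≤ f ⁻¹ᵁ chart k i := by
    intro x _
    exact (isAffineOpen_chart i).range_fromSpec.le ⟨_, rfl⟩
  refine ⟨Over.homMk f hf, e, fun j => ?_⟩
  have : f.appLE (chart k i) ⊤ e = ψ := by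
    have h1 : (isAffineOpen_chart (k := k) i).fromSpec.appLE (chart k i) ⊤ (by simp) =
        (Scheme.ΓSpecIso _).inv := by
      rw [Scheme.Hom.appLE, IsAffineOpen.fromSpec_app_self, Category.assoc, ← Functor.map_comp]
      exact (congrArg (_ ≫ ·) ((Spec Γ((projectiveSpace k ι).left, chart k i)).presheaf.map_id
        (op ⊤))).trans (Category.comp_id _)
    have h2 := Scheme.Hom.appLE_comp_appLE (X.left.toSpecΓ ≫ Spec.map ψ)
      (isAffineOpen_chart (k := k) i).fromSpec (chart k i) ⊤ ⊤ (by simp) (le_preimage_top _ _)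
    rw [h1] at h2
    have h3 : (X.left.toSpecΓ ≫ Spec.map ψ).appLE ⊤ ⊤ (le_preimage_top _ _) =
        (X.left.toSpecΓ ≫ Spec.map ψ).appTop := Scheme.Hom.appLE_eq_app _
    rw [h3, Scheme.Hom.comp_appTop, Scheme.toSpecΓ_appTop, ← Scheme.ΓSpecIso_inv_naturality_assoc,
      Iso.inv_hom_id, Category.comp_id] at h2
    simp only [f, ← Category.assoc]
    exact h2.symm
  exact (congrArg (fun φ => φ.hom (ratio k i j)) this).trans (chartLift_ratio _ _ _ ha _)

end Charts

end

end SingularCubics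
namespace SingularCubics

noncomputable section

attribute [local instance] MvPolynomial.gradedAlgebra

/-! ### Charts of the projective plane over a base -/

section PlaneCharts

variable {k : Type u} [Field k]

/-- The part of the chart `xᵢ ≠ 0` of `ℙ²_S` over an open subset `V` of `S`. -/
def chartOver (S : Over (Spec (CommRingCat.of k))) (i : Fin 3) (V : S.left.Opens) :
    (plane S).Opens :=
  planeChart S i ⊓ toBase S ⁻¹ᵁ V

variable {S T : Over (Spec (CommRingCat.of k))}

lemma chartOver_le_chart (i : Fin 3) (V : S.left.Opens) : chartOver S i V ≤ planeChart S i :=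
  inf_le_left

lemma chartOver_le_base (i : Fin 3) (V : S.left.Opens) : chartOver S i V ≤ toBase S ⁻¹ᵁ V :=
  inf_le_right

lemma le_toPlane {U : (plane S).Opens} {i : Fin 3} (hi : U ≤ planeChart S i) :
    U ≤ toPlane S ⁻¹ᵁ chart k i := hi

lemma le_toPlane_inf {U : (plane S).Opens} {i j : Fin 3} (hi : U ≤ planeChart S i)
    (hj : U ≤ planeChart S j) : U ≤ toPlane S ⁻¹ᵁ (chart k i ⊓ chart k j) :=
  le_inf hi hj

/-- The function `xⱼ / xᵢ` on an open subset of the chart `xᵢ ≠ 0` of `ℙ²_S`. -/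
def ratioOn {U : (plane S).Opens} {i : Fin 3} (hi : U ≤ planeChart S i) (j : Fin 3) :
    Γ(plane S, U) :=
  (plane S).presheaf.map (homOfLE hi).op (planeRatio S i j)

lemma ratioOn_eq {U : (plane S).Opens} {i : Fin 3} (hi : U ≤ planeChart S i) (j : Fin 3) :
    ratioOn hi j = (toPlane S).appLE (chart k i) U (le_toPlane hi) (ratio k i j) := by
  have := congr($(Scheme.Hom.app_eq_appLE (f := toPlane S) (U := chart k i)) (ratio k i j))
  refine (congrArg ((plane S).presheaf.map (homOfLE hi).op) this).trans ?_
  exact congr($(Scheme.Hom.appLE_map (f := toPlane S) (U := chart k i) _ (homOfLE hi).op)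
    (ratio k i j))

lemma map_ratioOn {U U' : (plane S).Opens} {i : Fin 3} (hi : U ≤ planeChart S i) (h : U' ≤ U)
    (j : Fin 3) :
    (plane S).presheaf.map (homOfLE h).op (ratioOn hi j) = ratioOn (h.trans hi) j := by
  rw [ratioOn_eq, ratioOn_eq, ← CommRingCat.comp_apply, Scheme.Hom.appLE_map]

lemma ratioOn_self {U : (plane S).Opens} {i : Fin 3} (hi : U ≤ planeChart S i) :
    ratioOn hi i = 1 := by
  rw [ratioOn_eq, ratio_self, map_one]

lemma ratioOn_mul_ratioOn {U : (plane S).Opens} {i j : Fin 3} (hi : U ≤ planeChart S i)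
    (hj : U ≤ planeChart S j) (l : Fin 3) : ratioOn hj i * ratioOn hi l = ratioOn hj l := by
  have := congrArg ((toPlane S).appLE (chart k i ⊓ chart k j) U (le_toPlane_inf hi hj))
    (ratio_mul_ratio (k := k) l (inf_le_left : chart k i ⊓ chart k j ≤ _) inf_le_right)
  rw [map_mul, ← CommRingCat.comp_apply, ← CommRingCat.comp_apply, ← CommRingCat.comp_apply,
    Scheme.Hom.map_appLE, Scheme.Hom.map_appLE] at this
  rwa [ratioOn_eq, ratioOn_eq, ratioOn_eq]

lemma appLE_ratioOn (g : T ⟶ S) {U : (plane S).Opens} {U' : (plane T).Opens}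
    (e : U' ≤ planeMap g ⁻¹ᵁ U) {i : Fin 3} (hi : U ≤ planeChart S i) (hi' : U' ≤ planeChart T i)
    (j : Fin 3) : (planeMap g).appLE U U' e (ratioOn hi j) = ratioOn hi' j := by
  rw [ratioOn_eq, ratioOn_eq, ← CommRingCat.comp_apply, Scheme.Hom.appLE_comp_appLE]
  simp only [planeMap_toPlane]

lemma planeMap_preimage_planeChart (g : T ⟶ S) (i : Fin 3) :
    planeMap g ⁻¹ᵁ planeChart S i = planeChart T i := by
  rw [planeChart, planeChart, ← Scheme.Hom.comp_preimage, planeMap_toPlane]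

lemma chartOver_le_preimage (g : T ⟶ S) (i : Fin 3) {V : S.left.Opens} {W : T.left.Opens}
    (e : W ≤ g.left ⁻¹ᵁ V) : chartOver T i W ≤ planeMap g ⁻¹ᵁ chartOver S i V := by
  rw [chartOver, chartOver, Scheme.Hom.preimage_inf, planeMap_preimage_planeChart,
    ← Scheme.Hom.comp_preimage, planeMap_toBase, Scheme.Hom.comp_preimage]
  exact inf_le_inf_left _ fun _ hx => e hx

/-- Dehomogenisation: the ring homomorphism that sends a polynomial `F` over `Γ(S, V)` to the
function `F(x₀/xᵢ, x₁/xᵢ, x₂/xᵢ)` on an open subset of the chart `xᵢ ≠ 0` of `ℙ²_S` over `V`. -/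
def dehom {U : (plane S).Opens} {V : S.left.Opens} {i : Fin 3} (hi : U ≤ planeChart S i)
    (hV : U ≤ toBase S ⁻¹ᵁ V) : MvPolynomial (Fin 3) Γ(S.left, V) →+* Γ(plane S, U) :=
  MvPolynomial.eval₂Hom ((toBase S).appLE V U hV).hom (ratioOn hi)

@[simp] lemma dehom_X {U : (plane S).Opens} {V : S.left.Opens} {i : Fin 3}
    (hi : U ≤ planeChart S i) (hV : U ≤ toBase S ⁻¹ᵁ V) (j : Fin 3) :
    dehom hi hV (MvPolynomial.X j) = ratioOn hi j := by
  simp [dehom]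

@[simp] lemma dehom_C {U : (plane S).Opens} {V : S.left.Opens} {i : Fin 3}
    (hi : U ≤ planeChart S i) (hV : U ≤ toBase S ⁻¹ᵁ V) (c : Γ(S.left, V)) :
    dehom hi hV (MvPolynomial.C c) = (toBase S).appLE V U hV c := by
  simp [dehom]

lemma map_dehom {U U' : (plane S).Opens} {V : S.left.Opens} {i : Fin 3} (hi : U ≤ planeChart S i)
    (hV : U ≤ toBase S ⁻¹ᵁ V) (h : U' ≤ U) (F : MvPolynomial (Fin 3) Γ(S.left, V)) :
    (plane S).presheaf.map (homOfLE h).op (dehom hi hV F) =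
      dehom (h.trans hi) (h.trans hV) F := by
  have : ((plane S).presheaf.map (homOfLE h).op).hom.comp (dehom hi hV) =
      dehom (h.trans hi) (h.trans hV) := by
    refine MvPolynomial.ringHom_ext (fun c => ?_) (fun j => ?_)
    · rw [RingHom.comp_apply, dehom_C, dehom_C, ← CommRingCat.comp_apply, Scheme.Hom.appLE_map]
    · rw [RingHom.comp_apply, dehom_X, dehom_X]
      exact map_ratioOn _ _ _
  exact congr($this F)

lemma appLE_dehom (g : T ⟶ S) {U : (plane S).Opens} {U' : (plane T).Opens} {V : S.left.Opens}
    {W : T.left.Opens} (e : U' ≤ planeMap g ⁻¹ᵁ U) (e' : W ≤ g.left ⁻¹ᵁ V) {i : Fin 3}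
    (hi : U ≤ planeChart S i) (hi' : U' ≤ planeChart T i) (hV : U ≤ toBase S ⁻¹ᵁ V)
    (hW : U' ≤ toBase T ⁻¹ᵁ W) (F : MvPolynomial (Fin 3) Γ(S.left, V)) :
    (planeMap g).appLE U U' e (dehom hi hV F) =
      dehom hi' hW (F.map (g.left.appLE V W e').hom) := by
  have : ((planeMap g).appLE U U' e).hom.comp (dehom hi hV) =
      (dehom hi' hW).comp (MvPolynomial.map (g.left.appLE V W e').hom) := by
    refine MvPolynomial.ringHom_ext (fun c => ?_) (fun j => ?_)
    · rw [RingHom.comp_apply, RingHom.comp_apply, MvPolynomial.map_C, dehom_C, dehom_C,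
        ← CommRingCat.comp_apply, ← CommRingCat.comp_apply, Scheme.Hom.appLE_comp_appLE,
        Scheme.Hom.appLE_comp_appLE]
      simp only [planeMap_toBase]
    · rw [RingHom.comp_apply, RingHom.comp_apply, MvPolynomial.map_X, dehom_X, dehom_X]
      exact appLE_ratioOn g e hi hi' j
  exact congr($this F)

lemma dehom_map {U : (plane S).Opens} {V W : S.left.Opens} {i : Fin 3} (hi : U ≤ planeChart S i)
    (hV : U ≤ toBase S ⁻¹ᵁ V) (hW : U ≤ toBase S ⁻¹ᵁ W) (h : W ≤ V)
    (F : MvPolynomial (Fin 3) Γ(S.left, V)) :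
    dehom hi hW (F.map (S.left.presheaf.map (homOfLE h).op).hom) = dehom hi hV F := by
  have : (dehom hi hW).comp (MvPolynomial.map (S.left.presheaf.map (homOfLE h).op).hom) =
      dehom hi hV := by
    refine MvPolynomial.ringHom_ext (fun c => ?_) (fun j => ?_)
    · rw [RingHom.comp_apply, MvPolynomial.map_C, dehom_C, dehom_C,
        ← CommRingCat.comp_apply, Scheme.Hom.map_appLE]
    · rw [RingHom.comp_apply, MvPolynomial.map_X, dehom_X, dehom_X]
  exact congr($this F)

lemma dehom_change {U : (plane S).Opens} {V : S.left.Opens} {i j : Fin 3}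
    (hi : U ≤ planeChart S i) (hj : U ≤ planeChart S j) (hV : U ≤ toBase S ⁻¹ᵁ V) {n : ℕ}
    {F : MvPolynomial (Fin 3) Γ(S.left, V)} (hF : F.IsHomogeneous n) :
    dehom hj hV F = ratioOn hj i ^ n * dehom hi hV F := by
  rw [dehom, dehom, MvPolynomial.coe_eval₂Hom, MvPolynomial.coe_eval₂Hom,
    ← hF.eval₂_mul_left]
  congr 1
  ext l
  exact (ratioOn_mul_ratioOn hi hj l).symm

/-- The chart over `V` is a fibre product of affine schemes, so its ring is a tensor product. The
mapping property of `R[x₀, x₁, x₂] / (xᵢ - 1)` for this ring, with `R = Γ(S, V)`, follows. -/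
lemma isPushout_chartOver (i : Fin 3) {V : S.left.Opens} (hV : IsAffineOpen V) :
    IsPushout ((projectiveSpace k (Fin 3)).hom.appLE ⊤ (chart k i) (le_preimage_top _ _))
      (S.hom.appLE ⊤ V (le_preimage_top _ _))
      ((toPlane S).appLE (chart k i) (chartOver S i V) (le_toPlane (chartOver_le_chart i V)))
      ((toBase S).appLE V (chartOver S i V) (chartOver_le_base i V)) :=
  (isIso_pushoutSection_iff (IsPullback.of_hasPullback _ _) _ _ rfl).mp
    (isIso_pushoutSection_of_isAffineOpen _ _ _ rfl (isAffineOpen_top _) hV (isAffineOpen_chart i))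

lemma isAffineOpen_chartOver (i : Fin 3) {V : S.left.Opens} (hV : IsAffineOpen V) :
    IsAffineOpen (chartOver S i V) := by
  have hT : IsAffine ((⊤ : (Spec (CommRingCat.of k)).Opens) : Scheme.{u}) := isAffineOpen_top _
  have hV' : IsAffine (V : Scheme.{u}) := hV
  have hC : IsAffine (chart k i : Scheme.{u}) := isAffineOpen_chart i
  exact .of_isIso (Scheme.Hom.isPullback_resLE (IsPullback.of_hasPullback _ _)
    (le_preimage_top S.hom V) (le_preimage_top (projectiveSpace k (Fin 3)).hom (chart k i))
    (UY := chartOver S i V) rfl).isoPullback.hom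

lemma exists_chartOver_desc (i : Fin 3) {V : S.left.Opens} (hV : IsAffineOpen V)
    {B : Type u} [CommRing B] (φ : Γ(S.left, V) →+* B) (a : Fin 3 → B) (ha : a i = 1) :
    ∃ ψ : Γ(plane S, chartOver S i V) →+* B,
      ψ.comp (dehom (chartOver_le_chart i V) (chartOver_le_base i V)) =
        MvPolynomial.eval₂Hom φ a := by
  have hc : (projectiveSpace k (Fin 3)).hom.appLE ⊤ (chart k i) (le_preimage_top _ _) ≫
      CommRingCat.ofHom (R := Γ((projectiveSpace k (Fin 3)).left, chart k i))
        (chartLift (φ.comp (scalars S V)) i a ha) =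
      S.hom.appLE ⊤ V (le_preimage_top _ _) ≫ CommRingCat.ofHom φ := by
    rw [← cancel_epi (Scheme.ΓSpecIso (CommRingCat.of k)).inv]
    ext1
    exact chartLift_scalars _ _ _ ha
  refine ⟨((isPushout_chartOver i hV).desc _ _ hc).hom,
    MvPolynomial.ringHom_ext (fun c => ?_) (fun j => ?_)⟩
  · rw [RingHom.comp_apply, dehom_C, MvPolynomial.eval₂Hom_C]
    exact congr($((isPushout_chartOver i hV).inr_desc _ _ hc) c)
  · rw [RingHom.comp_apply, dehom_X, MvPolynomial.eval₂Hom_X', ratioOn_eq]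
    exact (congr($((isPushout_chartOver i hV).inl_desc _ _ hc) (ratio k i j))).trans
      (chartLift_ratio _ _ _ ha _)

lemma chartOver_ringHom_ext (i : Fin 3) {V : S.left.Opens} (hV : IsAffineOpen V)
    {B : Type u} [CommRing B] {f g : Γ(plane S, chartOver S i V) →+* B}
    (h : f.comp (dehom (chartOver_le_chart i V) (chartOver_le_base i V)) =
      g.comp (dehom (chartOver_le_chart i V) (chartOver_le_base i V))) : f = g := by
  have : CommRingCat.ofHom f = CommRingCat.ofHom g := by
    apply (isPushout_chartOver i hV).hom_ext
    · ext1
      refine chart_ringHom_ext i ?_ (fun j => ?_)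
      · have hw := congrArg CommRingCat.Hom.hom (isPushout_chartOver i hV).w
        have hw' : ((toPlane S).appLE (chart k i) (chartOver S i V)
            (le_toPlane (chartOver_le_chart i V))).hom.comp (scalars _ _) =
            ((toBase S).appLE V (chartOver S i V) (chartOver_le_base i V)).hom.comp
              (scalars S V) :=
          congrArg (fun φ => RingHom.comp φ (Scheme.ΓSpecIso (CommRingCat.of k)).inv.hom) hw
        ext c
        have h1 := congr($h (MvPolynomial.C (scalars S V c)))
        rw [RingHom.comp_apply, RingHom.comp_apply, dehom_C] at h1
        have h2 := congr($hw' c)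
        exact (congrArg f h2).trans (h1.trans (congrArg g h2).symm)
      · have h1 := congr($h (MvPolynomial.X j))
        rw [RingHom.comp_apply, RingHom.comp_apply, dehom_X, ratioOn_eq] at h1
        exact h1
    · ext c
      have := congr($h (MvPolynomial.C c))
      rw [RingHom.comp_apply, RingHom.comp_apply, dehom_C] at this
      exact this
  exact congrArg CommRingCat.Hom.hom this

/-- By the mapping property of the chart ring there is a homomorphism from it to the image of
dehomogenisation; followed by the inclusion it is the identity, so the image is everything. -/
lemma dehom_surjective (i : Fin 3) {V : S.left.Opens} (hV : IsAffineOpen V) :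
    Function.Surjective (dehom (chartOver_le_chart i V) (chartOver_le_base i V)) := by
  let D := dehom (chartOver_le_chart i V) (chartOver_le_base i V)
  obtain ⟨ψ, hψ⟩ := exists_chartOver_desc i hV
    (D.rangeRestrict.comp MvPolynomial.C) (fun j => D.rangeRestrict (MvPolynomial.X j)) (by
      apply Subtype.ext
      simp [D, ratioOn_self])
  have : D.range.subtype.comp ψ = RingHom.id _ := by
    apply chartOver_ringHom_ext i hV
    rw [RingHom.comp_assoc, hψ]
    exact MvPolynomial.ringHom_ext (fun c => by simp [D]) (fun j => by simp [D])
  intro s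
  have := congr($this s)
  obtain ⟨F, hF⟩ := (ψ s).2
  exact ⟨F, hF.trans this⟩

/-- The affine open subset `xᵢ ≠ 0` of `ℙ²_S` over an affine open subset `V` of `S`. -/
def affineChart (i : Fin 3) (V : S.left.affineOpens) : (plane S).affineOpens :=
  ⟨chartOver S i V.1, isAffineOpen_chartOver i V.2⟩

/-- Dehomogenisation on the affine open subset `xᵢ ≠ 0` of `ℙ²_S` over `V`. -/
abbrev chartDehom (S : Over (Spec (CommRingCat.of k))) (i : Fin 3) (V : S.left.Opens) :
    MvPolynomial (Fin 3) Γ(S.left, V) →+* Γ(plane S, chartOver S i V) :=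
  dehom (chartOver_le_chart i V) (chartOver_le_base i V)

lemma chartDehom_X_self (i : Fin 3) (V : S.left.Opens) :
    chartDehom S i V (MvPolynomial.X i) = 1 := by
  rw [dehom_X, ratioOn_self]

/-- Homogenisation: the component of degree `d` is multiplied by `X i ^ (N - d)`, which `φ` does not
see. The coefficients that occur are still coefficients of `G`, so membership in extended ideals of
`R` persists. -/
lemma _root_.MvPolynomial.exists_isHomogeneous_map_eq {σ R B : Type*} [CommRing R]
    [CommRing B] (φ : MvPolynomial σ R →+* B) {i : σ} (hi : φ (MvPolynomial.X i) = 1)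
    (G : MvPolynomial σ R) : ∃ n, ∀ N, n ≤ N → ∃ F : MvPolynomial σ R, F.IsHomogeneous N ∧
      φ F = φ G ∧ ∀ J : Ideal R, G ∈ J.map MvPolynomial.C → F ∈ J.map MvPolynomial.C := by
  refine ⟨G.totalDegree, fun N hN => ⟨∑ d ∈ Finset.range (G.totalDegree + 1),
    MvPolynomial.X i ^ (N - d) * MvPolynomial.homogeneousComponent d G, ?_, ?_, fun J hJ => ?_⟩⟩
  · refine MvPolynomial.IsHomogeneous.sum _ _ _ fun d hd => ?_
    have := ((MvPolynomial.isHomogeneous_X R i).pow (N - d)).mul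
      (MvPolynomial.homogeneousComponent_isHomogeneous d G)
    rwa [one_mul, Nat.sub_add_cancel (by have := Finset.mem_range.mp hd; omega)] at this
  · conv_rhs => rw [← MvPolynomial.sum_homogeneousComponent G]
    simp [map_sum, hi]
  · refine sum_mem fun d _ => Ideal.mul_mem_left _ _ ?_
    rw [MvPolynomial.mem_map_C_iff] at hJ ⊢
    intro m
    rw [MvPolynomial.coeff_homogeneousComponent]
    split_ifs
    · exact hJ m
    · exact zero_mem _

lemma exists_isHomogeneous_chartDehom_eq (i : Fin 3) {V : S.left.Opens} (hV : IsAffineOpen V)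
    (s : Γ(plane S, chartOver S i V)) : ∃ n, ∀ N, n ≤ N →
      ∃ F : MvPolynomial (Fin 3) Γ(S.left, V), F.IsHomogeneous N ∧ chartDehom S i V F = s := by
  obtain ⟨G, rfl⟩ := dehom_surjective i hV s
  obtain ⟨n, hn⟩ := MvPolynomial.exists_isHomogeneous_map_eq _ (chartDehom_X_self i V) G
  exact ⟨n, fun N hN => (hn N hN).imp fun F hF => ⟨hF.1, hF.2.1⟩⟩

/-- In the polynomial ring with `xᵢ` inverted, `xᵢⁿ F(x / xᵢ) = F(x)`, and `xᵢ` is a nonzerodivisor,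
so a form can be recovered from its dehomogenisation. -/
lemma eq_zero_of_chartDehom_eq_zero (i : Fin 3) {V : S.left.Opens} (hV : IsAffineOpen V)
    {F : MvPolynomial (Fin 3) Γ(S.left, V)} {n : ℕ} (hF : F.IsHomogeneous n)
    (h : chartDehom S i V F = 0) : F = 0 := by
  let A := MvPolynomial (Fin 3) Γ(S.left, V)
  let L := Localization.Away (MvPolynomial.X i : A)
  let a : Fin 3 → L := fun j => IsLocalization.mk' L (MvPolynomial.X j)
    (⟨MvPolynomial.X i, Submonoid.mem_powers _⟩ : Submonoid.powers (MvPolynomial.X i : A))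
  obtain ⟨ψ, hψ⟩ := exists_chartOver_desc i hV ((algebraMap A L).comp MvPolynomial.C) a
    (IsLocalization.mk'_self _ _)
  have h1 := congr($hψ F)
  rw [RingHom.comp_apply] at h1
  replace h1 := ((congrArg ψ h).symm.trans h1).symm
  rw [map_zero, MvPolynomial.coe_eval₂Hom] at h1
  have h2 := hF.eval₂_mul_left ((algebraMap A L).comp MvPolynomial.C)
    (algebraMap A L (MvPolynomial.X i)) a
  rw [h1, mul_zero] at h2
  have h3 : MvPolynomial.eval₂Hom ((algebraMap A L).comp MvPolynomial.C)
      (fun j => algebraMap A L (MvPolynomial.X i) * a j) = algebraMap A L :=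
    MvPolynomial.ringHom_ext (fun c => by simp) (fun j => by
      simp only [a, MvPolynomial.eval₂Hom_X']
      rw [mul_comm]
      exact IsLocalization.mk'_spec _ _ _)
  have h4 := congr($h3 F)
  rw [MvPolynomial.coe_eval₂Hom, h2] at h4
  have : Submonoid.powers (MvPolynomial.X i : A) ≤ nonZeroDivisors A := by
    rw [Submonoid.powers_le]
    exact MvPolynomial.isRegular_X.mem_nonZeroDivisors
  exact (IsLocalization.injective L this) (h4.symm.trans (map_zero _).symm)

/-- By the mapping property of the chart ring the projection modulo `xᵢ - 1` factors through
dehomogenisation. -/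
lemma ker_chartDehom (i : Fin 3) {V : S.left.Opens} (hV : IsAffineOpen V) :
    RingHom.ker (chartDehom S i V) = Ideal.span {MvPolynomial.X i - 1} := by
  apply le_antisymm
  · intro F hF
    let A := MvPolynomial (Fin 3) Γ(S.left, V)
    let I : Ideal A := Ideal.span {MvPolynomial.X i - 1}
    obtain ⟨ψ, hψ⟩ := exists_chartOver_desc i hV ((Ideal.Quotient.mk I).comp MvPolynomial.C)
      (fun j => Ideal.Quotient.mk I (MvPolynomial.X j))
      (by
        rw [← map_one (Ideal.Quotient.mk I), Ideal.Quotient.eq]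
        exact Ideal.subset_span rfl)
    have h3 : MvPolynomial.eval₂Hom ((Ideal.Quotient.mk I).comp MvPolynomial.C)
        (fun j => Ideal.Quotient.mk I (MvPolynomial.X j)) = Ideal.Quotient.mk I :=
      MvPolynomial.ringHom_ext (fun c => by simp) (fun j => by simp)
    rw [h3] at hψ
    have h1 := congr($hψ F)
    rw [RingHom.comp_apply] at h1
    replace h1 := ((congrArg ψ hF).symm.trans h1).symm
    rw [map_zero] at h1
    exact Ideal.Quotient.eq_zero_iff_mem.mp h1
  · rw [Ideal.span_singleton_le_iff_mem, RingHom.mem_ker, map_sub, map_one, chartDehom_X_self,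
      sub_self]

lemma iSup_chartOver (V : S.left.Opens) : ⨆ i, chartOver S i V = toBase S ⁻¹ᵁ V := by
  have h : ⨆ i, planeChart S i = ⊤ :=
    (Scheme.Hom.preimage_iSup (toPlane S) (chart k)).symm.trans
      (congrArg (toPlane S ⁻¹ᵁ ·) (iSup_chart (k := k) (ι := Fin 3)))
  simp only [chartOver]
  rw [← iSup_inf_eq, h, top_inf_eq]

lemma exists_mem_chartOver {x : plane S} {V : S.left.Opens} (hx : toBase S x ∈ V) :
    ∃ i, x ∈ chartOver S i V := by
  have : x ∈ ⨆ i, chartOver S i V := by rw [iSup_chartOver]; exact hx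
  exact TopologicalSpace.Opens.mem_iSup.mp this

lemma iSup_affineChart {J : Type*} (V : J → S.left.affineOpens) (hV : ⨆ α, (V α).1 = ⊤) :
    ⨆ c : Fin 3 × J, (affineChart c.1 (V c.2)).1 = ⊤ := by
  refine top_le_iff.mp fun x _ => ?_
  have : toBase S x ∈ ⨆ α, (V α).1 := by rw [hV]; trivial
  obtain ⟨α, hα⟩ := TopologicalSpace.Opens.mem_iSup.mp this
  obtain ⟨i, hi⟩ := exists_mem_chartOver hα
  exact TopologicalSpace.Opens.mem_iSup.mpr ⟨(i, α), hi⟩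

lemma dehomogenize_eq (K : Type u) [Field K] (p : Spec (CommRingCat.of K) ⟶ Spec (CommRingCat.of k))
    (i : Fin 3) (F : MvPolynomial (Fin 3) K) :
    dehomogenize K p i F = dehom (S := Over.mk p) (le_refl (planeChart (Over.mk p) i))
      (le_preimage_top (toBase (Over.mk p)) _)
      (F.map (Scheme.ΓSpecIso (CommRingCat.of K)).inv.hom) := by
  have : dehomogenize K p i = (dehom (S := Over.mk p) (le_refl (planeChart (Over.mk p) i))
      (le_preimage_top (toBase (Over.mk p)) _)).comp
      (MvPolynomial.map (Scheme.ΓSpecIso (CommRingCat.of K)).inv.hom) := by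
    refine MvPolynomial.ringHom_ext (fun c => ?_) (fun j => ?_)
    · rw [RingHom.comp_apply, MvPolynomial.map_C, dehom_C, dehomogenize,
        MvPolynomial.eval₂Hom_C]
      rfl
    · rw [RingHom.comp_apply, MvPolynomial.map_X, dehom_X, dehomogenize,
        MvPolynomial.eval₂Hom_X', ratioOn]
      exact (congr($((plane (Over.mk p)).presheaf.map_id _) _)).symm
  exact congr($this F)

end PlaneCharts

end

end SingularCubics
namespace SingularCubics

noncomputable section

attribute [local instance] MvPolynomial.gradedAlgebra

/-! ### Glueing morphisms to projective space -/

lemma exists_glue_of_opens {X Y : Scheme.{u}} {J : Type*} (V : J → X.Opens) (hV : ⨆ α, V α = ⊤)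
    (f : ∀ α, (V α : Scheme.{u}) ⟶ Y)
    (h : ∀ α β, X.homOfLE (inf_le_left : V α ⊓ V β ≤ V α) ≫ f α =
      X.homOfLE (inf_le_right : V α ⊓ V β ≤ V β) ≫ f β) :
    ∃ g : X ⟶ Y, ∀ α, (V α).ι ≫ g = f α := by
  refine ⟨(X.openCoverOfIsOpenCover V hV).glueMorphisms f fun α β => ?_, fun α =>
    Scheme.Cover.ι_glueMorphisms (X.openCoverOfIsOpenCover V hV) f _ α⟩
  have hp := isPullback_opens_inf (V α) (V β)
  have h1 : pullback.fst (V α).ι (V β).ι ≫ f α = pullback.snd (V α).ι (V β).ι ≫ f β := by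
    rw [← cancel_epi hp.isoPullback.hom, hp.isoPullback_hom_fst_assoc,
      hp.isoPullback_hom_snd_assoc, h α β]
  exact h1

section

variable {k : Type u} [Field k] {ι : Type}

lemma appLE_ratio_mul {X : Over (Spec (CommRingCat.of k))} (g : X ⟶ projectiveSpace k ι)
    {U : X.left.Opens} {i j : ι} (hi : U ≤ g.left ⁻¹ᵁ chart k i) (hj : U ≤ g.left ⁻¹ᵁ chart k j)
    (l : ι) : g.left.appLE (chart k i) U hi (ratio k i j) *
      g.left.appLE (chart k j) U hj (ratio k j l) = g.left.appLE (chart k i) U hi (ratio k i l) := by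
  have hij : U ≤ g.left ⁻¹ᵁ (chart k i ⊓ chart k j) := le_inf hi hj
  have := congrArg (g.left.appLE (chart k i ⊓ chart k j) U hij)
    (ratio_mul_ratio (k := k) l (inf_le_right : chart k i ⊓ chart k j ≤ _) inf_le_left)
  rw [map_mul, ← CommRingCat.comp_apply, ← CommRingCat.comp_apply, ← CommRingCat.comp_apply,
    Scheme.Hom.map_appLE, Scheme.Hom.map_appLE] at this
  exact this

lemma le_preimage_chart {X : Over (Spec (CommRingCat.of k))} (g : X ⟶ projectiveSpace k ι)
    {U : X.left.Opens} {i j : ι} (hi : U ≤ g.left ⁻¹ᵁ chart k i)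
    (hj : IsUnit (g.left.appLE (chart k i) U hi (ratio k i j))) : U ≤ g.left ⁻¹ᵁ chart k j := by
  have h1 : U ≤ g.left ⁻¹ᵁ (projectiveSpace k ι).left.basicOpen (ratio k i j) := by
    rw [Scheme.preimage_basicOpen]
    have h2 : X.left.basicOpen (g.left.appLE (chart k i) U hi (ratio k i j)) = U :=
      X.left.basicOpen_of_isUnit hj
    rw [Scheme.Hom.appLE] at h2
    have := (X.left.basicOpen_res (g.left.app (chart k i) (ratio k i j)) (homOfLE hi).op)
    exact h2.ge.trans (this.le.trans inf_le_right)
  refine h1.trans ?_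
  rw [← chart_inf_chart]
  exact fun x hx => hx.2

lemma hom_ext_of_ratio {X : Over (Spec (CommRingCat.of k))} {g g' : X ⟶ projectiveSpace k ι}
    (h : ∀ x : X.left, ∃ (U : X.left.Opens) (_ : x ∈ U) (i : ι) (e : U ≤ g.left ⁻¹ᵁ chart k i)
      (e' : U ≤ g'.left ⁻¹ᵁ chart k i), ∀ j, g.left.appLE (chart k i) U e (ratio k i j) =
      g'.left.appLE (chart k i) U e' (ratio k i j)) : g = g' := by
  apply Over.OverMorphism.ext
  apply Scheme.hom_ext_of_forall
  intro x
  obtain ⟨U, hx, i, e, e', h⟩ := h x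
  exact ⟨U, hx, ι_comp_left_eq_of_ratio i e e' h⟩

lemma top_le_ι_preimage {X : Scheme.{u}} {U V : X.Opens} (h : U ≤ V) : ⊤ ≤ U.ι ⁻¹ᵁ V :=
  fun x _ => h x.2

lemma ι_appLE_injective {X : Scheme.{u}} (V : X.Opens) :
    Function.Injective (V.ι.appLE V ⊤ (top_le_ι_preimage le_rfl)) := by
  rw [Scheme.Opens.ι_appLE]
  have h : V.ι ''ᵁ ⊤ = V := by simp
  have : IsIso (homOfLE h.le) := ⟨homOfLE h.ge, rfl, rfl⟩
  exact (ConcreteCategory.bijective_of_isIso (X.presheaf.map (homOfLE h.le).op)).1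

/-- The local pieces for the glueing lemma `exists_hom_of_ratio_cover`: each of them has values in a
single chart. -/
lemma exists_hom_of_ratio_opens (X : Over (Spec (CommRingCat.of k))) (V : X.left.Opens) (i : ι)
    (a : ι → Γ(X.left, V)) (ha : a i = 1) :
    ∃ (g : Over.mk (V.ι ≫ X.hom) ⟶ projectiveSpace k ι) (e : ⊤ ≤ g.left ⁻¹ᵁ chart k i),
      ∀ j, g.left.appLE (chart k i) ⊤ e (ratio k i j) =
        V.ι.appLE V ⊤ (top_le_ι_preimage le_rfl) (a j) :=
  exists_hom_of_ratio (Over.mk (V.ι ≫ X.hom)) i _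
    ((congrArg (V.ι.appLE V ⊤ (top_le_ι_preimage le_rfl)).hom ha).trans (map_one _))

lemma exists_hom_of_ratio_cover (X : Over (Spec (CommRingCat.of k))) {J : Type*}
    (V : J → X.left.Opens) (hV : ⨆ α, V α = ⊤) (i : J → ι) (a : ∀ α, ι → Γ(X.left, V α))
    (ha : ∀ α, a α (i α) = 1)
    (h : ∀ α β l, X.left.presheaf.map (homOfLE (inf_le_left : V α ⊓ V β ≤ V α)).op (a α l) =
      X.left.presheaf.map (homOfLE (inf_le_left : V α ⊓ V β ≤ V α)).op (a α (i β)) *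
      X.left.presheaf.map (homOfLE (inf_le_right : V α ⊓ V β ≤ V β)).op (a β l)) :
    ∃ g : X ⟶ projectiveSpace k ι, ∀ α, ∃ e : V α ≤ g.left ⁻¹ᵁ chart k (i α),
      ∀ j, g.left.appLE (chart k (i α)) (V α) e (ratio k (i α) j) = a α j := by
  choose f e hf using fun α => exists_hom_of_ratio_opens X (V α) (i α) (a α) (ha α)
  have hw : ∀ α (W : X.left.Opens) (hW : W ≤ V α),
      ∃ (g : Over.mk (W.ι ≫ X.hom) ⟶ projectiveSpace k ι) (e : ⊤ ≤ g.left ⁻¹ᵁ chart k (i α)),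
      g.left = X.left.homOfLE hW ≫ (f α).left ∧
      ∀ j, g.left.appLE (chart k (i α)) ⊤ e (ratio k (i α) j) =
        W.ι.appLE W ⊤ (top_le_ι_preimage le_rfl)
          (X.left.presheaf.map (homOfLE hW).op (a α j)) := by
    intro α W hW
    let r : Over.mk (W.ι ≫ X.hom) ⟶ Over.mk ((V α).ι ≫ X.hom) :=
      Over.homMk (X.left.homOfLE hW) (by simp)
    have er : ⊤ ≤ (X.left.homOfLE hW) ⁻¹ᵁ ⊤ := le_preimage_top _ _
    refine ⟨r ≫ f α, fun x _ => e α trivial, rfl, fun j => ?_⟩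
    have h1 := congr($(Scheme.Hom.appLE_comp_appLE (X.left.homOfLE hW) (f α).left
      (chart k (i α)) ⊤ ⊤ (e α) er) (ratio k (i α) j))
    refine h1.symm.trans ?_
    have h2 := congrArg ((X.left.homOfLE hW).appLE ⊤ ⊤ er) (hf α j)
    refine h2.trans ?_
    have h3 := Scheme.Hom.appLE_comp_appLE (X.left.homOfLE hW) (V α).ι (V α) ⊤ ⊤
      (top_le_ι_preimage le_rfl) er
    have h4 := Scheme.Hom.map_appLE W.ι (top_le_ι_preimage le_rfl) (homOfLE hW).op
    simp only [Scheme.homOfLE_ι] at h3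
    exact congr($(h3.trans h4.symm) (a α j))
  obtain ⟨g, hg⟩ := exists_glue_of_opens V hV (fun α => (f α).left) (by
    intro α β
    obtain ⟨g₁, e₁, h₁, h₁'⟩ := hw α _ (inf_le_left : V α ⊓ V β ≤ V α)
    obtain ⟨g₂, e₂, h₂, h₂'⟩ := hw β _ (inf_le_right : V α ⊓ V β ≤ V β)
    -- The cocycle condition at `l = i α` with the normalisation `a α (i α) = 1`: the coordinate `i
    -- β` is invertible on the overlap, so both pieces map the overlap to the chart `i β` and can be
    -- compared there.
    have hu : X.left.presheaf.map (homOfLE (inf_le_left : V α ⊓ V β ≤ V α)).op (a α (i β)) *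
        X.left.presheaf.map (homOfLE (inf_le_right : V α ⊓ V β ≤ V β)).op (a β (i α)) = 1 := by
      rw [← h, ha, map_one]
    have e₁' : ⊤ ≤ g₁.left ⁻¹ᵁ chart k (i β) := by
      refine le_preimage_chart g₁ e₁ ?_
      rw [h₁' (i β)]
      exact (IsUnit.of_mul_eq_one _ hu).map ((V α ⊓ V β).ι.appLE _ ⊤ _).hom
    have : g₁ = g₂ := by
      refine hom_ext_of_ratio fun x => ⟨⊤, trivial, i β, e₁', e₂, fun l => ?_⟩
      have h3 := appLE_ratio_mul g₁ e₁ e₁' l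
      rw [h₁', h₁', h α β l, map_mul] at h3
      have hu' : IsUnit ((V α ⊓ V β).ι.appLE _ ⊤ (top_le_ι_preimage le_rfl)
        (X.left.presheaf.map (homOfLE (inf_le_left : V α ⊓ V β ≤ V α)).op (a α (i β)))) :=
        (IsUnit.of_mul_eq_one _ hu).map ((V α ⊓ V β).ι.appLE _ ⊤ _).hom
      rw [h₂']
      exact hu'.mul_left_cancel h3
    rw [← h₁, ← h₂, this])
  have hg' : g ≫ (projectiveSpace k ι).hom = X.hom := by
    apply Scheme.hom_ext_of_forall
    intro x
    have : x ∈ ⨆ α, V α := by rw [hV]; trivial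
    obtain ⟨α, hα⟩ := TopologicalSpace.Opens.mem_iSup.mp this
    refine ⟨V α, hα, ?_⟩
    rw [← Category.assoc, hg]
    exact Over.w (f α)
  refine ⟨Over.homMk g hg', fun α => ?_⟩
  have e' : V α ≤ g ⁻¹ᵁ chart k (i α) := by
    intro x hx
    have h1 : (f α).left ⟨x, hx⟩ ∈ chart k (i α) := e α trivial
    have h2 : g x = (f α).left ⟨x, hx⟩ := congr($(hg α) ⟨x, hx⟩)
    change g x ∈ chart k (i α)
    rw [h2]
    exact h1
  refine ⟨e', fun j => ι_appLE_injective (V α) ?_⟩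
  rw [← hf α j]
  have h3 := Scheme.Hom.appLE_comp_appLE (V α).ι g (chart k (i α)) (V α) ⊤ e'
      (top_le_ι_preimage le_rfl)
  simp only [hg] at h3
  exact congr($h3 (ratio k (i α) j))

end

end

end SingularCubics
-- Cubic forms, the universal cubic and its classifying morphisms.
namespace SingularCubics

noncomputable section

attribute [local instance] MvPolynomial.gradedAlgebra

/-! ### Cubic forms -/

section CubicForms

variable {R : Type*} [CommRing R]

/-- Induction on the number of variables: a polynomial in `x₀` over the ring of the other variables
is a nonzerodivisor as soon as one of its coefficients is. -/
lemma _root_.MvPolynomial.mem_nonZeroDivisors_of_isUnit_coeff {n : ℕ}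
    {F : MvPolynomial (Fin n) R} (d : Fin n →₀ ℕ) (h : IsUnit (F.coeff d)) :
    F ∈ nonZeroDivisors (MvPolynomial (Fin n) R) := by
  induction n with
  | zero =>
    have h0 : F = MvPolynomial.C (F.coeff 0) := MvPolynomial.eq_C_of_isEmpty F
    rw [Subsingleton.elim d 0] at h
    rw [h0]
    exact (h.map MvPolynomial.C).mem_nonZeroDivisors
  | succ n ih =>
    have h1 := Polynomial.mem_nonzeroDivisors_of_coeff_mem
      (p := MvPolynomial.finSuccEquiv R n F) (d 0) (ih d.tail (by
        rwa [MvPolynomial.finSuccEquiv_coeff_coeff, Finsupp.cons_tail]))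
    rw [mem_nonZeroDivisors_iff_right] at h1 ⊢
    intro G hG
    have := h1 (MvPolynomial.finSuccEquiv R n G) (by rw [← map_mul, hG, map_zero])
    simpa using this

/-- Divisibility on two charts gives divisibility of forms. Cancelling `F` yields `xⱼ^N' G = xᵢ^N
G'`, so `xᵢ^N` divides `G` and can be cancelled in turn. The last clause records the degree of the
quotient coefficientwise. -/
lemma exists_eq_mul_of_X_pow_mul {i j : Fin 3} (hij : i ≠ j) {F F' G G' : MvPolynomial (Fin 3) R}
    {N N' M : ℕ} (hF : F ∈ nonZeroDivisors (MvPolynomial (Fin 3) R)) (hG : G.IsHomogeneous M)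
    (h : MvPolynomial.X i ^ N * F' = G * F) (h' : MvPolynomial.X j ^ N' * F' = G' * F) :
    ∃ H, F' = H * F ∧ ∀ d, H.coeff d ≠ 0 → N + d.degree = M := by
  have h1 : MvPolynomial.X j ^ N' * G = MvPolynomial.X i ^ N * G' := by
    have := (mem_nonZeroDivisors_iff_right.mp hF) (MvPolynomial.X j ^ N' * G -
      MvPolynomial.X i ^ N * G') (by
        rw [sub_mul, mul_assoc, mul_assoc, ← h, ← h']; ring)
    exact sub_eq_zero.mp this
  have h2 : MvPolynomial.X i ^ N ∣ G := by
    rw [MvPolynomial.X_pow_eq_monomial, MvPolynomial.monomial_one_dvd_iff_modMonomial_eq_zero]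
    ext d
    rw [MvPolynomial.coeff_zero]
    by_cases hd : Finsupp.single i N ≤ d
    · rw [MvPolynomial.coeff_modMonomial_of_le _ hd]
    rw [MvPolynomial.coeff_modMonomial_of_not_le _ hd]
    -- Multiplication by a power of `xⱼ` does not change the exponent of `xᵢ`, which is below `N`
    -- here, so the right-hand side has no such term.
    have h3 := congrArg (MvPolynomial.coeff (Finsupp.single j N' + d)) h1
    rw [MvPolynomial.X_pow_eq_monomial, MvPolynomial.X_pow_eq_monomial,
      MvPolynomial.coeff_monomial_mul, MvPolynomial.coeff_monomial_mul', one_mul, if_neg] at h3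
    · exact h3
    · intro hle
      refine hd (Finsupp.single_le_iff.mpr ?_)
      simpa [hij.symm] using hle i
  obtain ⟨H, rfl⟩ := h2
  refine ⟨H, (MvPolynomial.isRegular_X_pow N).left (h.trans (mul_assoc _ _ _)), fun d hd => ?_⟩
  have h3 : (MvPolynomial.X i ^ N * H).coeff (Finsupp.single i N + d) = H.coeff d := by
    rw [MvPolynomial.X_pow_eq_monomial, MvPolynomial.coeff_monomial_mul, one_mul]
  by_contra hne
  refine hd (h3.symm.trans (hG.coeff_eq_zero ?_))
  rwa [map_add, Finsupp.degree_single]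

/-- The exponent vector of a cubic monomial. -/
def exponent (m : CubicMonomial) : Fin 3 →₀ ℕ := Multiset.toFinsupp (m : Multiset (Fin 3))

lemma exponent_injective : Function.Injective exponent := fun _ _ h =>
  Subtype.ext (Multiset.toFinsupp.injective h)

lemma degree_exponent (m : CubicMonomial) : (exponent m).degree = 3 := by
  rw [Finsupp.degree_eq_sum]
  have := Multiset.toFinsupp_sum_eq (m : Multiset (Fin 3))
  rw [Finsupp.sum_fintype _ _ (by simp)] at this
  exact this.trans m.2

lemma exists_exponent_eq {d : Fin 3 →₀ ℕ} (hd : d.degree = 3) : ∃ m, exponent m = d := by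
  refine ⟨⟨Finsupp.toMultiset d, ?_⟩, ?_⟩
  · rw [Finsupp.card_toMultiset, Finsupp.sum_fintype _ _ (by simp)]
    rw [Finsupp.degree_eq_sum] at hd
    exact hd
  · exact Finsupp.toMultiset_toFinsupp d

/-- The cubic form with given coefficients. -/
def cubicForm (a : CubicMonomial → R) : MvPolynomial (Fin 3) R :=
  ∑ m, MvPolynomial.monomial (exponent m) (a m)

lemma coeff_cubicForm (a : CubicMonomial → R) (m : CubicMonomial) :
    (cubicForm a).coeff (exponent m) = a m := by
  rw [cubicForm, MvPolynomial.coeff_sum, Finset.sum_eq_single m]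
  · simp
  · intro m' _ h
    rw [MvPolynomial.coeff_monomial, if_neg (fun e => h (exponent_injective e))]
  · simp

lemma cubicForm_isHomogeneous (a : CubicMonomial → R) : (cubicForm a).IsHomogeneous 3 :=
  MvPolynomial.IsHomogeneous.sum _ _ _ fun m _ =>
    MvPolynomial.isHomogeneous_monomial _ (degree_exponent m)

lemma cubicForm_coeff {F : MvPolynomial (Fin 3) R} (hF : F.IsHomogeneous 3) :
    cubicForm (fun m => F.coeff (exponent m)) = F := by
  ext d
  by_cases hd : d.degree = 3
  · obtain ⟨m, rfl⟩ := exists_exponent_eq hd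
    rw [coeff_cubicForm]
  · rw [hF.coeff_eq_zero hd, (cubicForm_isHomogeneous _).coeff_eq_zero hd]

lemma map_cubicForm {R' : Type*} [CommRing R'] (φ : R →+* R') (a : CubicMonomial → R) :
    (cubicForm a).map φ = cubicForm fun m => φ (a m) := by
  rw [cubicForm, map_sum, cubicForm]
  simp

lemma C_mul_cubicForm (c : R) (a : CubicMonomial → R) :
    MvPolynomial.C c * cubicForm a = cubicForm fun m => c * a m := by
  rw [cubicForm, Finset.mul_sum, cubicForm]
  simp [MvPolynomial.C_mul_monomial]

lemma eval₂_cubicForm {B : Type*} [CommRing B] (φ : R →+* B) (x : Fin 3 → B)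
    (a : CubicMonomial → R) : (cubicForm a).eval₂ φ x =
      ∑ m : CubicMonomial, φ (a m) * ((m : Multiset (Fin 3)).map x).prod := by
  rw [cubicForm, MvPolynomial.eval₂_sum]
  refine Finset.sum_congr rfl fun m _ => ?_
  rw [MvPolynomial.eval₂_monomial, exponent, Finsupp.prod_fintype _ _ (by simp),
    Finset.prod_multiset_map_count,
    ← Finset.prod_subset (Finset.subset_univ (m : Multiset (Fin 3)).toFinset)]
  · simp [Multiset.toFinsupp_apply]
  · intro j _ hj
    rw [Multiset.mem_toFinset] at hj
    simp [Multiset.count_eq_zero_of_notMem hj]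

lemma exists_coeff_ne_zero {F : MvPolynomial (Fin 3) R} (hF : F.IsHomogeneous 3) (h : F ≠ 0) :
    ∃ m, F.coeff (exponent m) ≠ 0 := by
  obtain ⟨d, hd⟩ := MvPolynomial.ne_zero_iff.mp h
  obtain ⟨m, rfl⟩ := exists_exponent_eq (d := d) (by
    by_contra h'
    exact hd (hF.coeff_eq_zero h'))
  exact ⟨m, hd⟩

end CubicForms

end

end SingularCubics
namespace SingularCubics

noncomputable section

attribute [local instance] MvPolynomial.gradedAlgebra

/-! ### The universal cubic and its pullbacks -/

section UniversalCubic

variable {k : Type u} [Field k]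

instance isSeparated_plane (S : Over (Spec (CommRingCat.of k))) [S.left.IsSeparated] :
    (plane S).IsSeparated := by
  have h1 : IsSeparated (projectiveSpace k (Fin 3)).hom :=
    inferInstanceAs (IsSeparated (Proj.toSpecZero _ ≫ Spec.map _))
  have h2 : IsSeparated (toBase S) := inferInstance
  exact ⟨by rw [← terminal.comp_from (toBase S)]; infer_instance⟩

instance isSeparated_spaceOfCubics : (spaceOfCubics k).left.IsSeparated :=
  inferInstanceAs (Proj (MvPolynomial.homogeneousSubmodule CubicMonomial k)).IsSeparated

variable (k) in
/-- The standard chart `a_m ≠ 0` of `ℙ⁹`. -/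
def spaceChart (m : CubicMonomial) : (spaceOfCubics k).left.Opens := chart k m

variable (k) in
/-- The function `a_m' / a_m` on the chart `a_m ≠ 0` of `ℙ⁹`. -/
def spaceRatio (m m' : CubicMonomial) : Γ((spaceOfCubics k).left, spaceChart k m) :=
  ratio k m m'

lemma isAffineOpen_spaceChart (m : CubicMonomial) : IsAffineOpen (spaceChart k m) :=
  isAffineOpen_chart m

lemma spaceRatio_self (m : CubicMonomial) : spaceRatio k m m = 1 := ratio_self m

lemma iSup_spaceChart : ⨆ m, spaceChart k m = ⊤ := iSup_chart

variable {S T : Over (Spec (CommRingCat.of k))}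

lemma appLE_spaceRatio_mul (g : S ⟶ spaceOfCubics k)
    {U : S.left.Opens} {i j : CubicMonomial} (hi : U ≤ g.left ⁻¹ᵁ spaceChart k i)
    (hj : U ≤ g.left ⁻¹ᵁ spaceChart k j) (l : CubicMonomial) :
    g.left.appLE (spaceChart k i) U hi (spaceRatio k i j) *
      g.left.appLE (spaceChart k j) U hj (spaceRatio k j l) =
    g.left.appLE (spaceChart k i) U hi (spaceRatio k i l) :=
  appLE_ratio_mul g hi hj l

lemma le_preimage_spaceChart (g : S ⟶ spaceOfCubics k)
    {U : S.left.Opens} {i j : CubicMonomial} (hi : U ≤ g.left ⁻¹ᵁ spaceChart k i)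
    (hj : IsUnit (g.left.appLE (spaceChart k i) U hi (spaceRatio k i j))) :
    U ≤ g.left ⁻¹ᵁ spaceChart k j :=
  le_preimage_chart g hi hj

lemma hom_ext_of_spaceRatio {g g' : S ⟶ spaceOfCubics k}
    (h : ∀ x : S.left, ∃ (U : S.left.Opens) (_ : x ∈ U) (i : CubicMonomial)
      (e : U ≤ g.left ⁻¹ᵁ spaceChart k i) (e' : U ≤ g'.left ⁻¹ᵁ spaceChart k i),
      ∀ j, g.left.appLE (spaceChart k i) U e (spaceRatio k i j) =
        g'.left.appLE (spaceChart k i) U e' (spaceRatio k i j)) : g = g' :=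
  hom_ext_of_ratio h

lemma exists_hom_of_spaceRatio_cover {J : Type*}
    (V : J → S.left.Opens) (hV : ⨆ α, V α = ⊤) (i : J → CubicMonomial)
    (a : ∀ α, CubicMonomial → Γ(S.left, V α)) (ha : ∀ α, a α (i α) = 1)
    (h : ∀ α β l, S.left.presheaf.map (homOfLE (inf_le_left : V α ⊓ V β ≤ V α)).op (a α l) =
      S.left.presheaf.map (homOfLE (inf_le_left : V α ⊓ V β ≤ V α)).op (a α (i β)) *
      S.left.presheaf.map (homOfLE (inf_le_right : V α ⊓ V β ≤ V β)).op (a β l)) :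
    ∃ g : S ⟶ spaceOfCubics k, ∀ α, ∃ e : V α ≤ g.left ⁻¹ᵁ spaceChart k (i α),
      ∀ j, g.left.appLE (spaceChart k (i α)) (V α) e (spaceRatio k (i α) j) = a α j :=
  exists_hom_of_ratio_cover S V hV i a ha h

/-- The closed subscheme `D` of `ℙ²_S` is, over the affine open subset `V`, the zero locus of the
form `F`. -/
def IsZeroLocusOn (D : (plane S).IdealSheafData) (V : S.left.affineOpens)
    (F : MvPolynomial (Fin 3) Γ(S.left, V)) : Prop :=
  ∀ i, D.ideal (affineChart i V) = Ideal.span {chartDehom S i V.1 F}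

/-- The cubic form over `Γ(S, V)` with coefficients the functions `a_m' / a_m`, for a morphism
`S ⟶ ℙ⁹` that sends `V` to the chart `a_m ≠ 0`. -/
def formOfHom (g : S ⟶ spaceOfCubics k) (m : CubicMonomial) {V : S.left.Opens}
    (e : V ≤ g.left ⁻¹ᵁ spaceChart k m) : MvPolynomial (Fin 3) Γ(S.left, V) :=
  cubicForm fun m' => g.left.appLE (spaceChart k m) V e (spaceRatio k m m')

lemma coeff_formOfHom (g : S ⟶ spaceOfCubics k) (m : CubicMonomial) {V : S.left.Opens}
    (e : V ≤ g.left ⁻¹ᵁ spaceChart k m) (m' : CubicMonomial) :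
    (formOfHom g m e).coeff (exponent m') =
      g.left.appLE (spaceChart k m) V e (spaceRatio k m m') :=
  coeff_cubicForm _ _

lemma coeff_formOfHom_self (g : S ⟶ spaceOfCubics k) (m : CubicMonomial) {V : S.left.Opens}
    (e : V ≤ g.left ⁻¹ᵁ spaceChart k m) : (formOfHom g m e).coeff (exponent m) = 1 := by
  rw [coeff_formOfHom, spaceRatio_self, map_one]

lemma formOfHom_isHomogeneous (g : S ⟶ spaceOfCubics k) (m : CubicMonomial) {V : S.left.Opens}
    (e : V ≤ g.left ⁻¹ᵁ spaceChart k m) : (formOfHom g m e).IsHomogeneous 3 :=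
  cubicForm_isHomogeneous _

variable (k) in
/-- The universal cubic form over the chart `a_m ≠ 0`. -/
def chartForm (m : CubicMonomial) : MvPolynomial (Fin 3) Γ((spaceOfCubics k).left, spaceChart k m) :=
  cubicForm (spaceRatio k m)

lemma formOfHom_mul (g : S ⟶ spaceOfCubics k) {m m' : CubicMonomial} {V : S.left.Opens}
    (e : V ≤ g.left ⁻¹ᵁ spaceChart k m) (e' : V ≤ g.left ⁻¹ᵁ spaceChart k m') :
    formOfHom g m e = MvPolynomial.C (g.left.appLE (spaceChart k m) V e (spaceRatio k m m')) *
      formOfHom g m' e' := by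
  rw [formOfHom, formOfHom, C_mul_cubicForm]
  congr 1
  ext l
  exact (appLE_spaceRatio_mul g e e' l).symm

lemma le_id_preimage {V W : S.left.Opens} (h : W ≤ V) : W ≤ (𝟙 S : S ⟶ S).left ⁻¹ᵁ V := h

lemma map_chartForm {m : CubicMonomial} {W : (spaceOfCubics k).left.Opens}
    (h : W ≤ spaceChart k m) :
    (chartForm k m).map ((spaceOfCubics k).left.presheaf.map (homOfLE h).op).hom =
      formOfHom (𝟙 _) m (le_id_preimage h) := by
  rw [formOfHom, chartForm, map_cubicForm]
  congr 1

lemma isAffineOpen_bichart (c : Fin 3 × CubicMonomial) : IsAffineOpen (bichart k c) :=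
  isAffineOpen_chartOver c.1 (isAffineOpen_spaceChart c.2)

lemma universalEquation_eq (c : Fin 3 × CubicMonomial) : universalEquation k c =
    chartDehom (spaceOfCubics k) c.1 (spaceChart k c.2) (chartForm k c.2) := by
  refine Eq.trans ?_ (eval₂_cubicForm _ _ _).symm
  rfl

lemma map_universalEquation_eq (c : Fin 3 × CubicMonomial) {W : (plane (spaceOfCubics k)).Opens}
    (h : W ≤ bichart k c) :
    (plane (spaceOfCubics k)).presheaf.map (homOfLE h).op (universalEquation k c) =
      dehom (h.trans (chartOver_le_chart c.1 (spaceChart k c.2)))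
        (h.trans (chartOver_le_base c.1 (spaceChart k c.2))) (chartForm k c.2) :=
  (congrArg ((plane (spaceOfCubics k)).presheaf.map (homOfLE h).op)
    (universalEquation_eq c)).trans (map_dehom _ _ h _)

/-- Changing the chart of `ℙ⁹` multiplies the form by a function on the base, and changing the chart
of `ℙ²` multiplies its dehomogenisation by the cube of a ratio. -/
lemma exists_map_universalEquation_eq (c c' : Fin 3 × CubicMonomial)
    {W : (plane (spaceOfCubics k)).Opens} (h : W ≤ bichart k c) (h' : W ≤ bichart k c') :
    ∃ u, (plane (spaceOfCubics k)).presheaf.map (homOfLE h).op (universalEquation k c) =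
      u * (plane (spaceOfCubics k)).presheaf.map (homOfLE h').op (universalEquation k c') := by
  have h₁ := h.trans (chartOver_le_chart c.1 (spaceChart k c.2))
  have h₂ := h.trans (chartOver_le_base c.1 (spaceChart k c.2))
  have h₁' := h'.trans (chartOver_le_chart c'.1 (spaceChart k c'.2))
  have h₂' := h'.trans (chartOver_le_base c'.1 (spaceChart k c'.2))
  have h₃ : W ≤ toBase (spaceOfCubics k) ⁻¹ᵁ (spaceChart k c.2 ⊓ spaceChart k c'.2) :=
    le_inf h₂ h₂'
  rw [map_universalEquation_eq, map_universalEquation_eq, ← dehom_map h₁ h₂ h₃ inf_le_left,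
    ← dehom_map h₁' h₂' h₃ inf_le_right, map_chartForm, map_chartForm,
    formOfHom_mul (𝟙 _) (le_id_preimage inf_le_left) (le_id_preimage inf_le_right), map_mul,
    dehom_change h₁' h₁ h₃ (formOfHom_isHomogeneous _ _ _), ← mul_assoc]
  exact ⟨_, rfl⟩

lemma ideal_universalCubic (c : Fin 3 × CubicMonomial) (W : (plane (spaceOfCubics k)).affineOpens)
    (h : W.1 ≤ bichart k c) : (universalCubic k).ideal W =
      Ideal.span {(plane (spaceOfCubics k)).presheaf.map (homOfLE h).op
        (universalEquation k c)} := by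
  refine ideal_ofLocalEquations (bichart k) isAffineOpen_bichart (universalEquation k)
    (fun c c' => ?_) c W h
  obtain ⟨u, hu⟩ := exists_map_universalEquation_eq c c'
    (inf_le_left : bichart k c ⊓ bichart k c' ≤ _) inf_le_right
  rw [hu, Ideal.mem_span_singleton']
  exact ⟨u, rfl⟩

variable (k) in
/-- The affine open subset `a_m ≠ 0` of `ℙ⁹`. -/
def affineSpaceChart (m : CubicMonomial) : (spaceOfCubics k).left.affineOpens :=
  ⟨spaceChart k m, isAffineOpen_spaceChart m⟩

lemma isZeroLocusOn_universalCubic (m : CubicMonomial) :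
    IsZeroLocusOn (universalCubic k) (affineSpaceChart k m) (chartForm k m) := fun i =>
  (ideal_universalCubic (i, m) (affineChart i (affineSpaceChart k m)) le_rfl).trans
    (congrArg (fun s => Ideal.span {s}) (map_universalEquation_eq (i, m) le_rfl))

lemma map_span_singleton {R R' : Type*} [CommRing R] [CommRing R'] (φ : R →+* R') (x : R) :
    (Ideal.span {x}).map φ = Ideal.span {φ x} := by
  rw [Ideal.map_span, Set.image_singleton]

lemma IsZeroLocusOn.comap {D : (plane S).IdealSheafData} {V : S.left.affineOpens}
    {F : MvPolynomial (Fin 3) Γ(S.left, V)} (h : IsZeroLocusOn D V F) (g : T ⟶ S)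
    {W : T.left.affineOpens} (e : W.1 ≤ g.left ⁻¹ᵁ V.1) :
    IsZeroLocusOn (D.comap (planeMap g)) W (F.map (g.left.appLE V W e).hom) := by
  intro i
  rw [ideal_comap _ _ (affineChart i W) (affineChart i V) (chartOver_le_preimage g i e), h i]
  refine (map_span_singleton _ _).trans (congrArg (fun s => Ideal.span {s}) ?_)
  exact appLE_dehom g _ e _ _ _ _ _

lemma IsZeroLocusOn.restrict {D : (plane S).IdealSheafData} {V W : S.left.affineOpens}
    {F : MvPolynomial (Fin 3) Γ(S.left, V)} (h : IsZeroLocusOn D V F) (hW : W.1 ≤ V.1) :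
    IsZeroLocusOn D W (F.map (S.left.presheaf.map (homOfLE hW).op).hom) := by
  have := h.comap (𝟙 S) (W := W) (le_id_preimage hW)
  rw [planeMap_id, Scheme.IdealSheafData.comap_id] at this
  exact this

lemma isZeroLocusOn_comap (g : S ⟶ spaceOfCubics k) (m : CubicMonomial) (V : S.left.affineOpens)
    (e : V.1 ≤ g.left ⁻¹ᵁ spaceChart k m) :
    IsZeroLocusOn ((universalCubic k).comap (planeMap g)) V (formOfHom g m e) := by
  have h := (isZeroLocusOn_universalCubic m).comap g (W := V) e
  have h' : (chartForm k m).map (g.left.appLE (spaceChart k m) V e).hom = formOfHom g m e :=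
    map_cubicForm _ _
  rw [← h']
  exact h

/-- On each chart `F'` is a multiple of `F`; homogenising the cofactor gives `xᵢ^N F' = G F`. As the
unit coefficient makes `F` a nonzerodivisor, two charts are enough. -/
lemma IsZeroLocusOn.exists_eq_mul {D : (plane S).IdealSheafData} {V : S.left.affineOpens}
    {F F' : MvPolynomial (Fin 3) Γ(S.left, V)} (h : IsZeroLocusOn D V F) {n : ℕ}
    (hF : F.IsHomogeneous 3) (hF' : F'.IsHomogeneous n) {m : CubicMonomial}
    (hm : IsUnit (F.coeff (exponent m)))
    (h' : ∀ i, chartDehom S i V.1 F' ∈ D.ideal (affineChart i V)) :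
    ∃ H, F' = H * F ∧ ∀ d, H.coeff d ≠ 0 → d.degree + 3 = n := by
  have key (i : Fin 3) : ∃ (N M : ℕ) (G : MvPolynomial (Fin 3) Γ(S.left, V)),
      G.IsHomogeneous M ∧ N + n = M + 3 ∧ MvPolynomial.X i ^ N * F' = G * F := by
    have h1 := h' i
    rw [h i] at h1
    obtain ⟨s, hs⟩ := Ideal.mem_span_singleton'.mp h1
    obtain ⟨M, hM⟩ := exists_isHomogeneous_chartDehom_eq i V.2 s
    -- With a cofactor of degree `M + n` and the exponent `M + 3` both sides are forms of degree `M
    -- + 3 + n`, hence determined by their dehomogenisations.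
    obtain ⟨G, hG, hGs⟩ := hM (M + n) (by omega)
    refine ⟨M + 3, M + n, G, hG, by omega, ?_⟩
    rw [← sub_eq_zero]
    refine eq_zero_of_chartDehom_eq_zero i V.2 (n := M + 3 + n)
      (MvPolynomial.IsHomogeneous.sub ?_ ?_) ?_
    · simpa using ((MvPolynomial.isHomogeneous_X Γ(S.left, V.1) i).pow (M + 3)).mul hF'
    · convert hG.mul hF using 1
      omega
    · rw [map_sub, map_mul, map_mul, map_pow, chartDehom_X_self, one_pow, one_mul, hGs, hs,
        sub_self]
  obtain ⟨N, M, G, hG, hN, h0⟩ := key 0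
  obtain ⟨N', M', G', -, -, h1⟩ := key 1
  obtain ⟨H, hH, hdeg⟩ := exists_eq_mul_of_X_pow_mul (by decide)
    (MvPolynomial.mem_nonZeroDivisors_of_isUnit_coeff _ hm) hG h0 h1
  exact ⟨H, hH, fun d hd => by have := hdeg d hd; omega⟩

/-- The quotient of two forms of the same degree is a form of degree zero, hence a constant. -/
lemma IsZeroLocusOn.exists_eq_C_mul {D : (plane S).IdealSheafData} {V : S.left.affineOpens}
    {F F' : MvPolynomial (Fin 3) Γ(S.left, V)} (h : IsZeroLocusOn D V F)
    (h' : IsZeroLocusOn D V F') (hF : F.IsHomogeneous 3) (hF' : F'.IsHomogeneous 3)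
    {m : CubicMonomial} (hm : F.coeff (exponent m) = 1) :
    ∃ c, F' = MvPolynomial.C c * F := by
  obtain ⟨H, hH, hdeg⟩ := h.exists_eq_mul hF hF' (m := m) (by rw [hm]; exact isUnit_one)
    (fun i => by rw [h' i]; exact Ideal.mem_span_singleton_self _)
  refine ⟨H.coeff 0, hH.trans (congrArg (· * F) ?_)⟩
  ext d
  rw [MvPolynomial.coeff_C]
  split_ifs with hd
  · rw [hd]
  · by_contra hne
    have := hdeg d hne
    exact hd ((Finsupp.degree_eq_zero_iff d).mp (by omega)).symm

end UniversalCubic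

end

end SingularCubics
namespace SingularCubics

noncomputable section

attribute [local instance] MvPolynomial.gradedAlgebra

/-! ### Morphisms to the space of cubics -/

section Classification

variable {k : Type u} [Field k] {S T : Over (Spec (CommRingCat.of k))}

/-- The closed subscheme `D` of `ℙ²_S` is, locally on `S`, the zero locus of a cubic form one of
whose coefficients is `1`. -/
def IsLocallyCubicForm (D : (plane S).IdealSheafData) : Prop :=
  ∀ x : S.left, ∃ (V : S.left.affineOpens) (_ : x ∈ V.1) (F : MvPolynomial (Fin 3) Γ(S.left, V))
    (m : CubicMonomial), F.IsHomogeneous 3 ∧ F.coeff (exponent m) = 1 ∧ IsZeroLocusOn D V F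

lemma exists_affineOpens_mem_le {X : Scheme.{u}} (x : X) {U : X.Opens} (hx : x ∈ U) :
    ∃ V : X.affineOpens, x ∈ V.1 ∧ V.1 ≤ U := by
  obtain ⟨V, hV, hxV, hVU⟩ := exists_isAffineOpen_mem_and_subset hx
  exact ⟨⟨V, hV⟩, hxV, hVU⟩

lemma exists_mem_preimage_spaceChart (g : S ⟶ spaceOfCubics k) (x : S.left) :
    ∃ m, x ∈ g.left ⁻¹ᵁ spaceChart k m := by
  have : g.left x ∈ ⨆ m, spaceChart k m := by rw [iSup_spaceChart]; trivial
  obtain ⟨m, hm⟩ := TopologicalSpace.Opens.mem_iSup.mp this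
  exact ⟨m, hm⟩

lemma isLocallyCubicForm_comap (g : S ⟶ spaceOfCubics k) :
    IsLocallyCubicForm ((universalCubic k).comap (planeMap g)) := by
  intro x
  obtain ⟨m, hm⟩ := exists_mem_preimage_spaceChart g x
  obtain ⟨V, hxV, hV⟩ := exists_affineOpens_mem_le x hm
  exact ⟨V, hxV, formOfHom g m hV, m, formOfHom_isHomogeneous _ _ _, coeff_formOfHom_self _ _ _,
    isZeroLocusOn_comap g m V hV⟩

lemma eq_of_isZeroLocusOn {D D' : (plane S).IdealSheafData} {J : Type*}
    (V : J → S.left.affineOpens) (hV : ⨆ α, (V α).1 = ⊤)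
    (F : ∀ α, MvPolynomial (Fin 3) Γ(S.left, V α)) (h : ∀ α, IsZeroLocusOn D (V α) (F α))
    (h' : ∀ α, IsZeroLocusOn D' (V α) (F α)) : D = D' :=
  Scheme.IdealSheafData.ext_of_iSup_eq_top (fun c : Fin 3 × J => affineChart c.1 (V c.2))
    (iSup_affineChart V hV) fun c => (h c.2 c.1).trans (h' c.2 c.1).symm

/-- Locally the forms of `g` and `g'` cut out the same subscheme, so they differ by a scalar, and
the ratios of their coefficients agree. -/
lemma hom_ext_of_comap_eq {g g' : S ⟶ spaceOfCubics k}
    (h : (universalCubic k).comap (planeMap g) = (universalCubic k).comap (planeMap g')) :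
    g = g' := by
  refine hom_ext_of_spaceRatio fun x => ?_
  obtain ⟨m, hm⟩ := exists_mem_preimage_spaceChart g x
  obtain ⟨m', hm'⟩ := exists_mem_preimage_spaceChart g' x
  obtain ⟨V, hxV, hV⟩ := exists_affineOpens_mem_le x (U := _ ⊓ _) ⟨hm, hm'⟩
  have e := hV.trans inf_le_left
  have e' := hV.trans inf_le_right
  obtain ⟨c, hc⟩ := (isZeroLocusOn_comap g m V e).exists_eq_C_mul
    (by rw [h]; exact isZeroLocusOn_comap g' m' V e') (formOfHom_isHomogeneous _ _ _)
    (formOfHom_isHomogeneous _ _ _) (coeff_formOfHom_self g m e)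
  have hcoeff (l) : g'.left.appLE (spaceChart k m') V e' (spaceRatio k m' l) =
      c * g.left.appLE (spaceChart k m) V e (spaceRatio k m l) := by
    rw [← coeff_formOfHom, ← coeff_formOfHom, hc, MvPolynomial.coeff_C_mul]
  -- The form of `g'` has coefficient `1` at `m'`, so `c` is inverse to the function `a_m' / a_m` of
  -- `g`. Thus `g` also maps `V` to the chart `a_m' ≠ 0`, and the two morphisms are compared there.
  have h1 := hcoeff m'
  rw [spaceRatio_self, map_one] at h1
  have e'' : V.1 ≤ g.left ⁻¹ᵁ spaceChart k m' :=
    le_preimage_spaceChart g e (IsUnit.of_mul_eq_one c (by rw [mul_comm, ← h1]))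
  refine ⟨V, hxV, m', e'', e', fun l => ?_⟩
  rw [hcoeff, ← appLE_spaceRatio_mul g e e'' l, ← mul_assoc, ← h1, one_mul]

lemma eq_of_affineOpens {X : Scheme.{u}} {U : X.Opens} {s t : Γ(X, U)}
    (h : ∀ (W : X.affineOpens) (hW : W.1 ≤ U), X.presheaf.map (homOfLE hW).op s =
      X.presheaf.map (homOfLE hW).op t) : s = t := by
  refine X.sheaf.eq_of_locally_eq' (fun W : {W : X.affineOpens // W.1 ≤ U} => W.1.1) U
    (fun W => homOfLE W.2) (fun x hx => ?_) s t (fun W => h W.1 W.2)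
  obtain ⟨W, hxW, hW⟩ := exists_affineOpens_mem_le x hx
  exact TopologicalSpace.Opens.mem_iSup.mpr ⟨⟨W, hW⟩, hxW⟩

theorem exists_comap_eq {D : (plane S).IdealSheafData} (hD : IsLocallyCubicForm D) :
    ∃ g : S ⟶ spaceOfCubics k, (universalCubic k).comap (planeMap g) = D := by
  choose V hV F m hF hm hD using hD
  have hVtop : ⨆ x, (V x).1 = ⊤ :=
    top_le_iff.mp fun x _ => TopologicalSpace.Opens.mem_iSup.mpr ⟨x, hV x⟩
  obtain ⟨g, hg⟩ := exists_hom_of_spaceRatio_cover (fun x => (V x).1) hVtop m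
    (fun x l => (F x).coeff (exponent l)) hm (by
      intro x y l
      refine eq_of_affineOpens fun W hW => ?_
      have hWx : W.1 ≤ (V x).1 := hW.trans inf_le_left
      have hWy : W.1 ≤ (V y).1 := hW.trans inf_le_right
      obtain ⟨c, hc⟩ := ((hD y).restrict hWy).exists_eq_C_mul ((hD x).restrict hWx)
        ((hF y).map _) ((hF x).map _) (m := m y) (by rw [MvPolynomial.coeff_map, hm, map_one])
      have hcoeff (l) := congrArg (MvPolynomial.coeff (exponent l)) hc
      simp only [MvPolynomial.coeff_map, MvPolynomial.coeff_C_mul] at hcoeff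
      rw [map_mul, ← CommRingCat.comp_apply, ← CommRingCat.comp_apply, ← CommRingCat.comp_apply,
        ← Functor.map_comp, ← Functor.map_comp]
      -- The form at `y` has coefficient `1` at `m y`, so the scalar between the two local forms is
      -- the coefficient of the form at `x` there. This is the cocycle condition.
      have h1 := hcoeff (m y)
      rw [hm, map_one, mul_one] at h1
      refine (hcoeff l).trans ?_
      rw [← h1]
      rfl)
  refine ⟨g, eq_of_isZeroLocusOn V hVtop F (fun x => ?_) hD⟩
  obtain ⟨e, he⟩ := hg x
  have h1 := isZeroLocusOn_comap g (m x) (V x) e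
  have h2 : formOfHom g (m x) e = F x := by
    rw [← cubicForm_coeff (hF x), formOfHom]
    exact congrArg cubicForm (funext he)
  rwa [h2] at h1

end Classification

end

end SingularCubics
-- Zero loci of normalised cubic forms are flat families of cubics.
namespace SingularCubics

noncomputable section

attribute [local instance] MvPolynomial.gradedAlgebra

/-! ### Flatness of families of zero loci -/

/-- The quotient of a flat algebra by an element that is regular modulo every ideal of the base is
flat. The proof uses the equational criterion: a relation in the quotient is corrected to a relation
in `B`, and there it is trivial. -/
lemma flat_comp_of_ker_eq_span_singleton {R B C : Type*} [CommRing R] [CommRing B] [CommRing C]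
    {φ : R →+* B} (hφ : φ.Flat) {π : B →+* C} (hπ : Function.Surjective π) {f : B}
    (hker : RingHom.ker π = Ideal.span {f})
    (hreg : ∀ (J : Ideal R) (g : B), f * g ∈ J.map φ → g ∈ J.map φ) : (π.comp φ).Flat := by
  algebraize [φ, π, π.comp φ]
  have hB : Module.Flat R B := hφ
  change Module.Flat R C
  rw [Module.Flat.iff_forall_isTrivialRelation]
  intro l a x hx
  choose b hb using fun i => hπ (x i)
  have h1 : ∑ i, a i • b i ∈ RingHom.ker π := by
    rw [RingHom.mem_ker, map_sum, ← hx]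
    refine Finset.sum_congr rfl fun i _ => ?_
    rw [Algebra.smul_def, map_mul, hb, Algebra.smul_def]
    rfl
  rw [hker, Ideal.mem_span_singleton'] at h1
  obtain ⟨g, hg⟩ := h1
  -- The lifted relation reads `∑ aᵢ bᵢ = f g`. Regularity modulo the ideal of the `aᵢ` gives `g = ∑
  -- aᵢ cᵢ`, so the lifts `bᵢ - f cᵢ` satisfy the relation exactly.
  have h2 : g ∈ (Ideal.span (Set.range a)).map φ := by
    refine hreg _ _ ?_
    rw [mul_comm, hg]
    refine sum_mem fun i _ => ?_
    rw [Algebra.smul_def]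
    exact Ideal.mul_mem_right _ _ (Ideal.mem_map_of_mem _ (Ideal.subset_span ⟨i, rfl⟩))
  rw [Ideal.map_span, ← Set.range_comp] at h2
  obtain ⟨c, hc⟩ := Ideal.mem_span_range_iff_exists_fun.mp h2
  obtain ⟨n, e, y, hy, he⟩ := Module.Flat.isTrivialRelation_of_sum_smul_eq_zero (R := R) (M := B) (f := a)
    (x := fun i => b i - f * c i) (by
      simp only [smul_sub, Finset.sum_sub_distrib, ← hg, ← hc, Finset.sum_mul]
      rw [sub_eq_zero]
      refine Finset.sum_congr rfl fun i _ => ?_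
      rw [Algebra.smul_def]
      simp only [Function.comp_apply]
      rw [show algebraMap R B = φ from rfl]
      ring)
  refine ⟨n, e, fun j => π (y j), fun i => ?_, he⟩
  have hf : π f = 0 := by
    rw [← RingHom.mem_ker, hker]
    exact Ideal.mem_span_singleton_self f
  have := congrArg π (hy i)
  rw [map_sub, map_mul, hf, zero_mul, sub_zero, hb, map_sum] at this
  rw [this]
  refine Finset.sum_congr rfl fun j _ => ?_
  rw [Algebra.smul_def, map_mul, Algebra.smul_def]
  rfl

/-- Modulo `J` the polynomial `F` still has a unit coefficient, so it is a nonzerodivisor there. -/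
lemma mem_map_C_of_mul_mem {R : Type*} [CommRing R] {n : ℕ} {F G : MvPolynomial (Fin n) R}
    (d : Fin n →₀ ℕ) (hd : IsUnit (F.coeff d)) (J : Ideal R) (h : F * G ∈ J.map MvPolynomial.C) :
    G ∈ J.map MvPolynomial.C := by
  have h1 : J.map MvPolynomial.C =
      RingHom.ker (MvPolynomial.map (σ := Fin n) (Ideal.Quotient.mk J)) := by
    rw [MvPolynomial.ker_map, Ideal.mk_ker]
  rw [h1, RingHom.mem_ker] at h ⊢
  rw [map_mul] at h
  have hd' : IsUnit (((F.map (Ideal.Quotient.mk J))).coeff d) := by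
    rw [MvPolynomial.coeff_map]
    exact hd.map _
  exact mem_nonZeroDivisors_iff_left.mp (MvPolynomial.mem_nonZeroDivisors_of_isUnit_coeff d hd') _ h

section

variable {k : Type u} [Field k] {S : Over (Spec (CommRingCat.of k))}

lemma chartDehom_comp_C (i : Fin 3) (V : S.left.Opens) : (chartDehom S i V).comp MvPolynomial.C =
    ((toBase S).appLE V (chartOver S i V) (chartOver_le_base i V)).hom :=
  RingHom.ext fun c => dehom_C _ _ c

lemma flat_appLE_chartOver (i : Fin 3) {V : S.left.Opens} (hV : IsAffineOpen V) :
    ((toBase S).appLE V (chartOver S i V) (chartOver_le_base i V)).hom.Flat := by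
  rw [← chartDehom_comp_C]
  refine flat_comp_of_ker_eq_span_singleton
    (RingHom.flat_algebraMap_iff (R := Γ(S.left, V)).mpr inferInstance)
    (dehom_surjective i hV) (ker_chartDehom i hV) fun J g hg => ?_
  -- The constant coefficient of `X i - 1` is the unit `-1`.
  refine mem_map_C_of_mul_mem 0 ?_ J hg
  simp

/-- Dehomogenisation keeps regularity modulo base ideals: both the cofactor and a witness of
membership are homogenised to matching degrees, so that the product formula becomes an identity of
forms. -/
lemma mem_map_of_chartDehom_mul_mem (i : Fin 3) {V : S.left.Opens} (hV : IsAffineOpen V) {n : ℕ}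
    {F : MvPolynomial (Fin 3) Γ(S.left, V)} (hF : F.IsHomogeneous n) (d : Fin 3 →₀ ℕ)
    (hd : IsUnit (F.coeff d)) (J : Ideal Γ(S.left, V)) (g : Γ(plane S, chartOver S i V))
    (h : chartDehom S i V F * g ∈
      J.map ((toBase S).appLE V (chartOver S i V) (chartOver_le_base i V)).hom) :
    g ∈ J.map ((toBase S).appLE V (chartOver S i V) (chartOver_le_base i V)).hom := by
  rw [← chartDehom_comp_C, ← Ideal.map_map] at h ⊢
  obtain ⟨M, hM⟩ := exists_isHomogeneous_chartDehom_eq i hV g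
  obtain ⟨H, hH, hHeq⟩ := (Ideal.mem_map_iff_of_surjective _ (dehom_surjective i hV)).mp h
  obtain ⟨N, hN⟩ := MvPolynomial.exists_isHomogeneous_map_eq _ (chartDehom_X_self i V) H
  obtain ⟨G, hG, rfl⟩ := hM (M + N) (by omega)
  obtain ⟨H', hH', hH'eq, hH'J⟩ := hN (n + (M + N)) (by omega)
  have h1 : F * G = H' := by
    rw [← sub_eq_zero]
    refine eq_zero_of_chartDehom_eq_zero i hV ((hF.mul hG).sub hH') ?_
    rw [map_sub, hH'eq, hHeq, map_mul, sub_self]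
  exact Ideal.mem_map_of_mem _ (mem_map_C_of_mul_mem d hd J (h1 ▸ hH'J J hH))

/-- The affine open subset of a closed subscheme of `ℙ²_S` cut out by `affineChart i V`. -/
def subschemeChart (D : (plane S).IdealSheafData) (i : Fin 3) (V : S.left.affineOpens) :
    D.subscheme.affineOpens :=
  ⟨D.subschemeι ⁻¹ᵁ chartOver S i V.1, (isAffineOpen_chartOver i V.2).preimage D.subschemeι⟩

lemma subschemeChart_le (D : (plane S).IdealSheafData) (i : Fin 3) (V : S.left.affineOpens) :
    (subschemeChart D i V).1 ≤ (D.subschemeι ≫ toBase S) ⁻¹ᵁ V.1 :=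
  fun _ hx => hx.2

lemma subschemeChart_le_preimage (D : (plane S).IdealSheafData) (i : Fin 3)
    (V : S.left.affineOpens) :
    (subschemeChart D i V).1 ≤ D.subschemeι ⁻¹ᵁ chartOver S i V.1 :=
  le_rfl

/-- The restriction of functions to a closed subscheme of `ℙ²_S`. -/
def chartRestrict (D : (plane S).IdealSheafData) (i : Fin 3) (V : S.left.affineOpens) :
    Γ(plane S, chartOver S i V.1) →+* Γ(D.subscheme, (subschemeChart D i V).1) :=
  (D.subschemeι.appLE (chartOver S i V.1) (subschemeChart D i V).1
    (subschemeChart_le_preimage D i V)).hom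

lemma chartRestrict_eq (D : (plane S).IdealSheafData) (i : Fin 3) (V : S.left.affineOpens) :
    chartRestrict D i V = (D.subschemeι.app (affineChart i V).1).hom := by
  rw [Scheme.Hom.app_eq_appLE]
  rfl

lemma chartRestrict_surjective (D : (plane S).IdealSheafData) (i : Fin 3)
    (V : S.left.affineOpens) : Function.Surjective (chartRestrict D i V) := by
  rw [chartRestrict_eq]
  exact D.subschemeι_app_surjective (affineChart i V)

lemma ker_chartRestrict (D : (plane S).IdealSheafData) (i : Fin 3)
    (V : S.left.affineOpens) : RingHom.ker (chartRestrict D i V) = D.ideal (affineChart i V) := by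
  rw [chartRestrict_eq]
  exact D.ker_subschemeι_app (affineChart i V)

lemma appLE_subschemeChart (D : (plane S).IdealSheafData) (i : Fin 3) (V : S.left.affineOpens) :
    ((D.subschemeι ≫ toBase S).appLE V.1 (subschemeChart D i V).1 (subschemeChart_le D i V)).hom =
      (chartRestrict D i V).comp
        ((toBase S).appLE V.1 (chartOver S i V.1) (chartOver_le_base i V.1)).hom := by
  rw [chartRestrict, ← CommRingCat.hom_comp, Scheme.Hom.appLE_comp_appLE]

lemma exists_mem_subschemeChart (D : (plane S).IdealSheafData) {x : D.subscheme}
    {V : S.left.affineOpens} (hx : (D.subschemeι ≫ toBase S) x ∈ V.1) :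
    ∃ i, x ∈ (subschemeChart D i V).1 := by
  rw [Scheme.Hom.comp_apply] at hx
  exact exists_mem_chartOver hx

/-- On a chart the ring of `D` is the quotient of a polynomial ring by `xᵢ - 1` and then by the
form. Each quotient is by a single element, which gives finite presentation, and each element is
regular modulo every ideal of the base, which gives flatness. -/
lemma IsLocallyCubicForm.isFlatFamily {D : (plane S).IdealSheafData} (hD : IsLocallyCubicForm D) :
    IsFlatFamily D := by
  constructor
  · rw [HasRingHomProperty.iff_exists_appLE (P := @Flat)]
    · intro x
      obtain ⟨V, hxV, F, m, hF, hm, hD⟩ := hD ((D.subschemeι ≫ toBase S) x)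
      obtain ⟨i, hi⟩ := exists_mem_subschemeChart D hxV
      refine ⟨V, subschemeChart D i V, hi, subschemeChart_le D i V, ?_⟩
      rw [appLE_subschemeChart]
      refine flat_comp_of_ker_eq_span_singleton (flat_appLE_chartOver i V.2)
        (chartRestrict_surjective D i V) ((ker_chartRestrict D i V).trans (hD i)) fun J g hg => ?_
      exact mem_map_of_chartDehom_mul_mem i V.2 hF (exponent m) (by rw [hm]; exact isUnit_one) J g hg
    · exact (RingHom.Flat.stableUnderComposition.stableUnderCompositionWithLocalizationAway
        RingHom.Flat.holdsForLocalizationAway).1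
  · rw [HasRingHomProperty.iff_exists_appLE (P := @LocallyOfFinitePresentation)]
    · intro x
      obtain ⟨V, hxV, F, m, hF, hm, hD⟩ := hD ((D.subschemeι ≫ toBase S) x)
      obtain ⟨i, hi⟩ := exists_mem_subschemeChart D hxV
      refine ⟨V, subschemeChart D i V, hi, subschemeChart_le D i V, ?_⟩
      rw [appLE_subschemeChart, ← chartDehom_comp_C]
      refine .comp_surjective (.comp_surjective ?_ (dehom_surjective i V.2) ?_)
        (chartRestrict_surjective D i V) ?_
      · exact (RingHom.finitePresentation_algebraMap (A := Γ(S.left, V.1))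
          (B := MvPolynomial (Fin 3) Γ(S.left, V.1))).mpr inferInstance
      · rw [ker_chartDehom i V.2]
        exact Submodule.fg_span_singleton _
      · rw [ker_chartRestrict, hD i]
        exact Submodule.fg_span_singleton _
    · exact (RingHom.finitePresentation_stableUnderComposition
        |>.stableUnderCompositionWithLocalizationAway
          RingHom.finitePresentation_holdsForLocalizationAway).1

/-! ### Fibres -/

lemma planeChart_eq_chartOver_top (i : Fin 3) : planeChart S i = chartOver S i ⊤ :=
  (inf_top_eq _).symm

section

variable (K : Type u) [Field K] (p : Spec (CommRingCat.of K) ⟶ Spec (CommRingCat.of k))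

/-- The spectrum of a field, as an affine open subset of itself. -/
def fieldTop : (Over.mk p).left.affineOpens :=
  ⟨⊤, isAffineOpen_top (Spec (CommRingCat.of K))⟩

/-- A polynomial over a field `K`, with coefficients viewed as functions on `Spec K`. -/
def fieldForm : MvPolynomial (Fin 3) K →+* MvPolynomial (Fin 3) Γ((Over.mk p).left, (fieldTop K p).1) :=
  MvPolynomial.map (Scheme.ΓSpecIso (CommRingCat.of K)).inv.hom

variable {K p}

lemma le_fieldTop (W : (plane (Over.mk p)).Opens) : W ≤ toBase (Over.mk p) ⁻¹ᵁ (fieldTop K p).1 :=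
  le_preimage_top _ _

lemma map_dehomogenize (i : Fin 3) (F : MvPolynomial (Fin 3) K) {W : (plane (Over.mk p)).Opens}
    (h : W ≤ planeChart (Over.mk p) i) :
    (plane (Over.mk p)).presheaf.map (homOfLE h).op (dehomogenize K p i F) =
      dehom (V := (fieldTop K p).1) h (le_fieldTop W) (fieldForm K p F) :=
  (congrArg ((plane (Over.mk p)).presheaf.map (homOfLE h).op) (dehomogenize_eq K p i F)).trans
    (map_dehom _ _ _ _)

lemma fieldForm_isHomogeneous {n : ℕ} {F : MvPolynomial (Fin 3) K} (hF : F.IsHomogeneous n) :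
    (fieldForm K p F).IsHomogeneous n :=
  hF.map _

lemma isZeroLocusOn_curveOfForm {n : ℕ} {F : MvPolynomial (Fin 3) K} (hF : F.IsHomogeneous n) :
    IsZeroLocusOn (curveOfForm K p F) (fieldTop K p) (fieldForm K p F) := by
  have hs : (Over.mk p).left.IsSeparated :=
    inferInstanceAs (Spec (CommRingCat.of K)).IsSeparated
  intro i
  refine (ideal_ofLocalEquations (planeChart (Over.mk p)) (fun i => ?_) _ (fun i j => ?_) i
    (affineChart i (fieldTop K p)) (chartOver_le_chart _ _)).trans
      (congrArg (fun s => Ideal.span {s}) (map_dehomogenize i F _))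
  · rw [planeChart_eq_chartOver_top]
    exact isAffineOpen_chartOver i (fieldTop K p).2
  · have h1 := map_dehomogenize i F
      (inf_le_left : planeChart (Over.mk p) i ⊓ planeChart (Over.mk p) j ≤ _)
    have h2 := map_dehomogenize j F
      (inf_le_right : planeChart (Over.mk p) i ⊓ planeChart (Over.mk p) j ≤ _)
    rw [h1, h2, dehom_change inf_le_right inf_le_left _ (fieldForm_isHomogeneous hF), Ideal.mem_span_singleton']
    exact ⟨_, rfl⟩

lemma exists_fieldForm_eq {n : ℕ} {F : MvPolynomial (Fin 3) Γ((Over.mk p).left, (fieldTop K p).1)}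
    (hF : F.IsHomogeneous n) :
    ∃ F₀ : MvPolynomial (Fin 3) K, F₀.IsHomogeneous n ∧ fieldForm K p F₀ = F := by
  have h : ((Scheme.ΓSpecIso (CommRingCat.of K)).inv.hom.comp
      (Scheme.ΓSpecIso (CommRingCat.of K)).hom.hom) = RingHom.id _ := by
    rw [← CommRingCat.hom_comp, Iso.hom_inv_id]
    rfl
  refine ⟨F.map (Scheme.ΓSpecIso (CommRingCat.of K)).hom.hom, hF.map _, ?_⟩
  exact (MvPolynomial.map_map _ _ F).trans ((congrArg (fun φ => MvPolynomial.map φ F) h).trans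
    (MvPolynomial.map_id F))

lemma fieldForm_injective : Function.Injective (fieldForm K p) :=
  MvPolynomial.map_injective _ (ConcreteCategory.bijective_of_isIso
    (Scheme.ΓSpecIso (CommRingCat.of K)).inv).1

lemma isZeroLocusOn_fieldTop_ext {D D' : (plane (Over.mk p)).IdealSheafData}
    {F : MvPolynomial (Fin 3) Γ((Over.mk p).left, (fieldTop K p).1)}
    (h : IsZeroLocusOn D (fieldTop K p) F) (h' : IsZeroLocusOn D' (fieldTop K p) F) : D = D' :=
  eq_of_isZeroLocusOn (J := Unit) (fun _ => fieldTop K p) (iSup_const) (fun _ => F)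
    (fun _ => h) fun _ => h'

lemma isCubic_iff {D : (plane (Over.mk p)).IdealSheafData} : IsCubic K p D ↔
    ∃ F : MvPolynomial (Fin 3) K, F.IsHomogeneous 3 ∧ F ≠ 0 ∧
      IsZeroLocusOn D (fieldTop K p) (fieldForm K p F) := by
  constructor
  · rintro ⟨F, hF, h0, rfl⟩
    exact ⟨F, hF, h0, isZeroLocusOn_curveOfForm hF⟩
  · rintro ⟨F, hF, h0, h⟩
    exact ⟨F, hF, h0, isZeroLocusOn_fieldTop_ext h (isZeroLocusOn_curveOfForm hF)⟩

end

lemma top_le_preimage_of_mem {K : Type u} [Field K] (t : Spec (CommRingCat.of K) ⟶ S.left)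
    {V : S.left.Opens} (h : t (IsLocalRing.closedPoint K) ∈ V) : (⊤ : (Spec (CommRingCat.of K)).Opens) ≤ t ⁻¹ᵁ V := by
  intro x _
  have : x = IsLocalRing.closedPoint K := Subsingleton.elim (α := PrimeSpectrum K) _ _
  rw [this]
  exact h

/-- The evaluation of functions on `S` at a field-valued point. -/
def evalPoint {K : Type u} [Field K] (t : Spec (CommRingCat.of K) ⟶ S.left) {V : S.left.Opens}
    (h : t (IsLocalRing.closedPoint K) ∈ V) : Γ(S.left, V) →+* K :=
  (t.appLE V ⊤ (top_le_preimage_of_mem t h) ≫ (Scheme.ΓSpecIso (CommRingCat.of K)).hom).hom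

lemma fieldForm_map_evalPoint {K : Type u} [Field K] (t : Spec (CommRingCat.of K) ⟶ S.left)
    {V : S.left.Opens} (h : t (IsLocalRing.closedPoint K) ∈ V)
    (F : MvPolynomial (Fin 3) Γ(S.left, V)) :
    fieldForm K (t ≫ S.hom) (F.map (evalPoint t h)) =
      F.map (t.appLE V ⊤ (top_le_preimage_of_mem t h)).hom := by
  refine (MvPolynomial.map_map _ _ F).trans (congrArg (fun φ => MvPolynomial.map φ F) ?_)
  have h1 : (t.appLE V ⊤ (top_le_preimage_of_mem t h) ≫
      (Scheme.ΓSpecIso (CommRingCat.of K)).hom) ≫ (Scheme.ΓSpecIso (CommRingCat.of K)).inv =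
      t.appLE V ⊤ (top_le_preimage_of_mem t h) := by
    rw [Category.assoc, Iso.hom_inv_id, Category.comp_id]
  exact congrArg CommRingCat.Hom.hom h1

lemma IsZeroLocusOn.fibre {D : (plane S).IdealSheafData} {V : S.left.affineOpens}
    {F : MvPolynomial (Fin 3) Γ(S.left, V)} (h : IsZeroLocusOn D V F) {K : Type u} [Field K]
    (t : Spec (CommRingCat.of K) ⟶ S.left) (ht : t (IsLocalRing.closedPoint K) ∈ V.1) :
    IsZeroLocusOn (fibre D K t) (fieldTop K (t ≫ S.hom))
      (fieldForm K (t ≫ S.hom) (F.map (evalPoint t ht))) := by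
  rw [fieldForm_map_evalPoint]
  exact h.comap (Over.homMk t : fieldPoint K t ⟶ S) (W := fieldTop K (t ≫ S.hom))
    (top_le_preimage_of_mem t ht)

lemma IsLocallyCubicForm.isCubic_fibre {D : (plane S).IdealSheafData} (hD : IsLocallyCubicForm D)
    (K : Type u) [Field K] (t : Spec (CommRingCat.of K) ⟶ S.left) :
    IsCubic K (t ≫ S.hom) (fibre D K t) := by
  obtain ⟨V, hxV, F, m, hF, hm, hD⟩ := hD (t (IsLocalRing.closedPoint K))
  refine isCubic_iff.mpr ⟨F.map (evalPoint t hxV), hF.map _, fun h0 => ?_, hD.fibre t hxV⟩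
  have h1 := congrArg (MvPolynomial.coeff (exponent m)) h0
  rw [MvPolynomial.coeff_zero, MvPolynomial.coeff_map, hm, map_one] at h1
  exact one_ne_zero h1

lemma IsLocallyCubicForm.isCubicFamily {D : (plane S).IdealSheafData} (hD : IsLocallyCubicForm D) :
    IsCubicFamily D :=
  ⟨hD.isFlatFamily, fun K _ t => hD.isCubic_fibre K t⟩

end

end

end SingularCubics
-- Over a field: Hilbert polynomial `3t` characterises cubics.
namespace SingularCubics

noncomputable section

attribute [local instance] MvPolynomial.gradedAlgebra

/-! ### Dimensions of spaces of ternary forms -/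

section Forms

/-- Over a domain the highest and the lowest degree of a product are the sums of those of the
factors; if they agree for the product, they agree for each factor. -/
lemma _root_.MvPolynomial.IsHomogeneous.of_mul_left {σ R : Type*} [CommRing R] [IsDomain R]
    {F G : MvPolynomial σ R} {n : ℕ} (h : (F * G).IsHomogeneous n) (h0 : F * G ≠ 0) :
    ∃ m, F.IsHomogeneous m := by
  classical
  let A := MvPolynomial σ R
  -- The substitution `xⱼ ↦ T xⱼ`: the coefficient of `T^N` is the homogeneous component of degree
  -- `N`, so highest and lowest degrees become `natDegree` and `natTrailingDegree`.
  let τ : A →+* Polynomial A :=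
    MvPolynomial.eval₂Hom (Polynomial.C.comp MvPolynomial.C)
      (fun j => Polynomial.X * Polynomial.C (MvPolynomial.X j))
  have hmon (d : σ →₀ ℕ) (c : R) : τ (MvPolynomial.monomial d c) =
      Polynomial.monomial d.degree (MvPolynomial.monomial d c) := by
    have h1 := MvPolynomial.eval₂_monomial (Polynomial.C.comp MvPolynomial.C)
      (fun j => (Polynomial.X * Polynomial.C (MvPolynomial.X j) : Polynomial A)) (s := d) (a := c)
    refine h1.trans ?_
    rw [← Polynomial.C_mul_X_pow_eq_monomial, MvPolynomial.monomial_eq, Polynomial.C_mul,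
      Finsupp.prod, Finsupp.prod, map_prod, Finsupp.degree_apply, ← Finset.prod_pow_eq_pow_sum]
    simp only [map_pow, RingHom.comp_apply, mul_pow, Finset.prod_mul_distrib]
    ring
  have hcoeff (F : A) (N : ℕ) (d : σ →₀ ℕ) :
      ((τ F).coeff N).coeff d = if d.degree = N then F.coeff d else 0 := by
    induction F using MvPolynomial.induction_on' with
    | monomial e c =>
      rw [hmon, Polynomial.coeff_monomial]
      split_ifs with h1 h2 h2
      · rfl
      · rw [MvPolynomial.coeff_monomial, if_neg (by rintro rfl; exact h2 h1)]
      · rw [MvPolynomial.coeff_zero, MvPolynomial.coeff_monomial,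
          if_neg (by rintro rfl; exact h1 h2)]
      · rw [MvPolynomial.coeff_zero]
    | add p q hp hq =>
      rw [map_add, Polynomial.coeff_add, MvPolynomial.coeff_add, hp, hq, MvPolynomial.coeff_add]
      split_ifs <;> simp
  have hinj : Function.Injective τ := by
    rw [injective_iff_map_eq_zero]
    intro F hF
    ext d
    have := hcoeff F d.degree d
    rw [hF] at this
    simpa using this.symm
  have hne : τ F * τ G ≠ 0 := by
    rw [← map_mul]
    exact (map_ne_zero_iff τ hinj).mpr h0
  have hsupp (N : ℕ) (hN : (τ F * τ G).coeff N ≠ 0) : N = n := by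
    obtain ⟨d, hd⟩ := MvPolynomial.ne_zero_iff.mp hN
    rw [← map_mul, hcoeff] at hd
    split_ifs at hd with h1
    · rw [← h1]
      by_contra h2
      exact hd (h.coeff_eq_zero h2)
    · exact absurd rfl hd
  have h1 := hsupp _ (Polynomial.leadingCoeff_ne_zero.mpr hne)
  have h2 := hsupp _ (Polynomial.trailingCoeff_nonzero_iff_nonzero.mpr hne)
  rw [Polynomial.natDegree_mul (left_ne_zero_of_mul hne) (right_ne_zero_of_mul hne)] at h1
  rw [Polynomial.natTrailingDegree_mul (left_ne_zero_of_mul hne) (right_ne_zero_of_mul hne)] at h2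
  have h3 := Polynomial.natTrailingDegree_le_natDegree (τ F)
  have h4 := Polynomial.natTrailingDegree_le_natDegree (τ G)
  refine ⟨(τ F).natDegree, fun {d} hd => ?_⟩
  have h5 : ((τ F).coeff d.degree) ≠ 0 := by
    intro h0
    have := hcoeff F d.degree d
    rw [h0, if_pos rfl, MvPolynomial.coeff_zero] at this
    exact hd this.symm
  have h6 := Polynomial.natTrailingDegree_le_of_ne_zero h5
  have h7 := Polynomial.le_natDegree_of_ne_zero h5
  have h8 : d.degree = (τ F).natDegree := by omega
  rw [← h8, Finsupp.degree_eq_weight_one]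
  rfl

variable {K : Type*} [Field K]

variable (K) in
/-- The space of ternary forms of degree `n`. -/
abbrev forms (n : ℕ) : Submodule K (MvPolynomial (Fin 3) K) :=
  MvPolynomial.homogeneousSubmodule (Fin 3) K n

instance finiteDimensional_forms (n : ℕ) : FiniteDimensional K (forms K n) :=
  Module.Finite.iff_fg.mpr (MvPolynomial.homogeneousSubmodule_fg (Fin 3) K n)

/-- Taking coefficients identifies forms with functions on multisets. The factor `2` keeps later
counts free of division. -/
lemma two_mul_finrank_forms (n : ℕ) : 2 * Module.finrank K (forms K n) = (n + 2) * (n + 1) := by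
  let c : forms K n →ₗ[K] (Sym (Fin 3) n → K) :=
    { toFun := fun F s => F.1.coeff (Multiset.toFinsupp (s : Multiset (Fin 3)))
      map_add' := fun F G => by ext; simp
      map_smul' := fun c F => by ext; simp }
  have hc : Function.Bijective c := by
    constructor
    · rw [injective_iff_map_eq_zero]
      rintro ⟨F, hF⟩ h
      apply Subtype.ext
      ext d
      by_cases hd : d.degree = n
      · have hcard : Multiset.card (Finsupp.toMultiset d) = n := by
          rw [Finsupp.card_toMultiset, Finsupp.sum_fintype _ _ (by simp)]
          rw [Finsupp.degree_eq_sum] at hd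
          exact hd
        have := congrFun h ⟨Finsupp.toMultiset d, hcard⟩
        have h2 : F.coeff (Multiset.toFinsupp (Finsupp.toMultiset d)) = 0 := this
        rwa [Finsupp.toMultiset_toFinsupp] at h2
      · exact hF.coeff_eq_zero hd
    · intro a
      refine ⟨⟨∑ s : Sym (Fin 3) n, MvPolynomial.monomial (Multiset.toFinsupp (s : Multiset (Fin 3))) (a s), ?_⟩, ?_⟩
      · refine sum_mem fun s _ => MvPolynomial.isHomogeneous_monomial _ ?_
        rw [Finsupp.degree_eq_sum]
        have := Multiset.toFinsupp_sum_eq (s : Multiset (Fin 3))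
        rw [Finsupp.sum_fintype _ _ (by simp)] at this
        exact this.trans s.2
      · ext s
        simp only [c, LinearMap.coe_mk, AddHom.coe_mk]
        rw [MvPolynomial.coeff_sum, Finset.sum_eq_single s]
        · simp
        · intro s' _ hs
          rw [MvPolynomial.coeff_monomial, if_neg]
          exact fun e => hs (Subtype.ext (Multiset.toFinsupp.injective e))
        · simp
  rw [(LinearEquiv.ofBijective c hc).finrank_eq, Module.finrank_fintype_fun_eq_card,
    Sym.card_sym_eq_choose, Fintype.card_fin]
  have : 3 + n - 1 = n + 2 := by omega
  rw [this, Nat.choose_symm_add, Nat.choose_two_right, Nat.mul_div_cancel' (Nat.even_mul_pred_self _).two_dvd]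
  rfl

/-- The space of multiples of `d` by forms of degree `n`. -/
def multiples (d : MvPolynomial (Fin 3) K) (n : ℕ) : Submodule K (MvPolynomial (Fin 3) K) :=
  (forms K n).map (LinearMap.mulLeft K d)

instance finiteDimensional_multiples (d : MvPolynomial (Fin 3) K) (n : ℕ) :
    FiniteDimensional K (multiples d n) :=
  inferInstanceAs (FiniteDimensional K ((forms K n).map (LinearMap.mulLeft K d)))

lemma mem_multiples {d F : MvPolynomial (Fin 3) K} {n : ℕ} :
    F ∈ multiples d n ↔ ∃ G : MvPolynomial (Fin 3) K, G.IsHomogeneous n ∧ d * G = F :=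
  Iff.rfl

lemma finrank_multiples {d : MvPolynomial (Fin 3) K} (hd : d ≠ 0) (n : ℕ) :
    Module.finrank K (multiples d n) = Module.finrank K (forms K n) :=
  (Submodule.equivMapOfInjective (LinearMap.mulLeft K d)
    (fun _ _ h => mul_left_cancel₀ hd h) (forms K n)).finrank_eq.symm

lemma multiples_mul_le {d e : MvPolynomial (Fin 3) K} {a : ℕ} (he : e.IsHomogeneous a) (n : ℕ) :
    multiples (d * e) n ≤ multiples d (a + n) := by
  rintro _ ⟨G, hG, rfl⟩
  exact ⟨e * G, he.mul hG, (mul_assoc _ _ _).symm⟩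

/-- If `h d x = h g y` with `d` and `g` coprime, then `g` divides `x`, so the common value is a
multiple of `h d g`. -/
lemma multiples_inf_multiples_le {h d g : MvPolynomial (Fin 3) K} (h0 : h ≠ 0)
    (hg0 : g ≠ 0) {a b : ℕ} (hg : g.IsHomogeneous b)
    (hdg : IsRelPrime d g) (n : ℕ) :
    multiples (h * d) (b + n) ⊓ multiples (h * g) (a + n) ≤ multiples (h * d * g) n := by
  rintro u ⟨⟨x, hx, hxu⟩, ⟨y, hy, hyu⟩⟩
  simp only [LinearMap.mulLeft_apply] at hxu hyu
  have h1 : d * x = g * y := by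
    apply mul_left_cancel₀ h0
    rw [← mul_assoc, ← mul_assoc, hxu, hyu]
  obtain ⟨z, rfl⟩ : g ∣ x := hdg.symm.dvd_of_dvd_mul_left ⟨y, h1⟩
  by_cases hz : z = 0
  · rw [← hxu, hz, mul_zero, mul_zero]
    exact zero_mem _
  obtain ⟨c, hc⟩ := MvPolynomial.IsHomogeneous.of_mul_left (F := z) (G := g)
    (by rw [mul_comm]; exact hx) (mul_ne_zero hz hg0)
  have := (hg.mul hc).inj_right hx (mul_ne_zero hg0 hz)
  refine ⟨z, ?_, ?_⟩
  · have : c = n := by omega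
    rw [← this]
    exact hc
  · rw [← hxu, LinearMap.mulLeft_apply]
    ring

/-- A form of Bézout's theorem. For coprime `d` and `g` of degrees `a` and `b`, the multiples of `h
d` and of `h g` together have codimension at most `a b` among the multiples of `h`: this is the
second difference of `(n + 2)(n + 1) / 2`. -/
lemma finrank_sup_multiples_le {I : Submodule K (MvPolynomial (Fin 3) K)} [FiniteDimensional K I]
    {h d g : MvPolynomial (Fin 3) K} (h0 : h ≠ 0) (hd0 : d ≠ 0)
    (hg0 : g ≠ 0) {a b : ℕ} (hd : d.IsHomogeneous a) (hg : g.IsHomogeneous b)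
    (hdg : IsRelPrime d g) (n : ℕ) (hI : multiples (h * g) (a + n) ≤ I) :
    Module.finrank K (I ⊔ multiples h (a + b + n) : Submodule K _) ≤
      Module.finrank K (I ⊔ multiples (h * d) (b + n) : Submodule K _) + a * b := by
  have h1 := Submodule.finrank_sup_add_finrank_inf_eq (I ⊔ multiples (h * d) (b + n))
    (multiples h (a + b + n))
  have hle : multiples (h * d) (b + n) ≤ multiples h (a + b + n) := by
    rw [add_assoc]
    exact multiples_mul_le hd _
  have hle' : multiples (h * g) (a + n) ≤ multiples h (a + b + n) := by
    rw [add_comm a b, add_assoc]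
    exact multiples_mul_le hg _
  rw [sup_assoc, sup_eq_right.mpr hle, finrank_multiples h0] at h1
  have h2 : multiples (h * d) (b + n) ⊔ multiples (h * g) (a + n) ≤
      (I ⊔ multiples (h * d) (b + n)) ⊓ multiples h (a + b + n) :=
    le_inf (sup_le le_sup_right (hI.trans le_sup_left)) (sup_le hle hle')
  have h3 := Submodule.finrank_mono h2
  have h4 := Submodule.finrank_sup_add_finrank_inf_eq (multiples (h * d) (b + n))
    (multiples (h * g) (a + n))
  have h5 := Submodule.finrank_mono (multiples_inf_multiples_le (a := a) h0 hg0 hg hdg n)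
  rw [finrank_multiples (mul_ne_zero h0 hd0), finrank_multiples (mul_ne_zero h0 hg0)] at h4
  rw [finrank_multiples (mul_ne_zero (mul_ne_zero h0 hd0) hg0)] at h5
  have e1 := two_mul_finrank_forms (K := K) (a + b + n)
  have e2 := two_mul_finrank_forms (K := K) (b + n)
  have e3 := two_mul_finrank_forms (K := K) (a + n)
  have e4 := two_mul_finrank_forms (K := K) n
  nlinarith

end Forms

end

end SingularCubics
namespace SingularCubics

noncomputable section

attribute [local instance] MvPolynomial.gradedAlgebra

/-! ### Homogeneous ideals with Hilbert polynomial `3t` -/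

section Hilbert

variable {K : Type*} [Field K]

/-- The form `d` is chosen of least degree such that its multiples exceed the ideal by a bounded
dimension; any nonzero element of the ideal qualifies, with bound `0`. For `g` in the ideal the
greatest common divisor of `d` and `g` also qualifies, so by minimality it is `d` up to a unit. -/
lemma dvd_of_forall_finrank_sup_le {I : ℕ → Submodule K (MvPolynomial (Fin 3) K)}
    (hI : ∀ n, I n ≤ forms K n)
    (hmul : ∀ a n (F G : MvPolynomial (Fin 3) K), F.IsHomogeneous a → G ∈ I n → G * F ∈ I (n + a))
    (h0 : ∃ n, I n ≠ ⊥) :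
    ∃ (e : ℕ) (d : MvPolynomial (Fin 3) K), d.IsHomogeneous e ∧ d ≠ 0 ∧
      (∃ C n₀, ∀ n, n₀ ≤ n → Module.finrank K (I (e + n) ⊔ multiples d n : Submodule K _) ≤
        Module.finrank K (I (e + n)) + C) ∧ ∀ n, ∀ g ∈ I n, d ∣ g := by
  classical
  have hfin (n : ℕ) : FiniteDimensional K (I n) := Submodule.finiteDimensional_of_le (hI n)
  let P : ℕ → Prop := fun e => ∃ d : MvPolynomial (Fin 3) K, d.IsHomogeneous e ∧ d ≠ 0 ∧
      ∃ C n₀, ∀ n, n₀ ≤ n → Module.finrank K (I (e + n) ⊔ multiples d n : Submodule K _) ≤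
        Module.finrank K (I (e + n)) + C
  have hex : ∃ e, P e := by
    obtain ⟨e, he⟩ := h0
    obtain ⟨d, hd, hd0⟩ := (Submodule.ne_bot_iff _).mp he
    refine ⟨e, d, hI _ hd, hd0, 0, 0, fun n _ => ?_⟩
    have : multiples d n ≤ I (e + n) := by
      rintro _ ⟨F, hF, rfl⟩
      exact hmul _ _ _ _ hF hd
    rw [sup_eq_left.mpr this, add_zero]
  obtain ⟨d, hd, hd0, C, n₀, hC⟩ := Nat.find_spec hex
  refine ⟨Nat.find hex, d, hd, hd0, ⟨C, n₀, hC⟩, fun b g hg => ?_⟩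
  by_cases hg0 : g = 0
  · rw [hg0]; exact dvd_zero d
  obtain ⟨d', g', h, hrel, rfl, rfl⟩ := UniqueFactorizationMonoid.exists_reduced_factors d hd0 g
  obtain ⟨e', he'⟩ := MvPolynomial.IsHomogeneous.of_mul_left hd hd0
  obtain ⟨a, ha⟩ := MvPolynomial.IsHomogeneous.of_mul_left (F := d') (G := h)
    (by rw [mul_comm]; exact hd) (by rwa [mul_comm])
  obtain ⟨b', hb'⟩ := MvPolynomial.IsHomogeneous.of_mul_left (F := g') (G := h)
    (by rw [mul_comm]; exact hI _ hg) (by rwa [mul_comm])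
  have hh0 := left_ne_zero_of_mul hd0
  have hd'0 := right_ne_zero_of_mul hd0
  have hg'0 := right_ne_zero_of_mul hg0
  have e1 : e' + a = Nat.find hex := (he'.mul ha).inj_right hd hd0
  have e2 : e' + b' = b := (he'.mul hb').inj_right (hI _ hg) hg0
  -- The bound for the common factor `h` grows by the Bézout number `a * b'` of the coprime parts.
  have hP : P e' := by
    refine ⟨h, he', hh0, C + a * b', a + b' + n₀, fun N hN => ?_⟩
    obtain ⟨n, rfl⟩ := Nat.exists_eq_add_of_le hN
    have h1 := finrank_sup_multiples_le (I := I (e' + (a + b' + n₀ + n))) hh0 hd'0 hg'0 ha hb' hrel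
      (n₀ + n) (by
        rintro _ ⟨F, hF, rfl⟩
        have := hmul _ _ _ _ hF hg
        rw [← e2, show e' + b' + (a + (n₀ + n)) = e' + (a + b' + n₀ + n) by omega] at this
        exact this)
    have h2 := hC (b' + (n₀ + n)) (by omega)
    rw [← e1, show e' + a + (b' + (n₀ + n)) = e' + (a + b' + n₀ + n) by omega] at h2
    rw [show a + b' + (n₀ + n) = a + b' + n₀ + n by omega] at h1
    omega
  have e3 := Nat.find_min' hex hP
  have ha0 : a = 0 := by omega
  subst ha0
  have hu : IsUnit d' := by
    have h1 : d' = MvPolynomial.C (d'.coeff 0) := by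
      ext m
      rw [MvPolynomial.coeff_C]
      split_ifs with hm
      · rw [hm]
      · exact ha.coeff_eq_zero fun h => hm ((Finsupp.degree_eq_zero_iff m).mp h).symm
    rw [h1]
    refine (IsUnit.mk0 _ fun h2 => hd'0 ?_).map MvPolynomial.C
    rw [h1, h2, map_zero]
  obtain ⟨u, rfl⟩ := hu
  exact (Units.mul_right_dvd).mpr (dvd_mul_right h g')

/-- The ideal lies in the multiples of some form `d` of degree `e` with bounded codimension. The
codimension of these multiples grows like `e n`, that of the ideal is `3 n`, so `e = 3`. Then the
dimensions agree exactly in large degrees, and saturation puts `d` itself in the ideal. -/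
lemma exists_cubic_of_finrank {I : ℕ → Submodule K (MvPolynomial (Fin 3) K)}
    (hI : ∀ n, I n ≤ forms K n)
    (hmul : ∀ a n (F G : MvPolynomial (Fin 3) K), F.IsHomogeneous a → G ∈ I n → G * F ∈ I (n + a))
    (hsat : ∀ n (G : MvPolynomial (Fin 3) K), G.IsHomogeneous n →
      (∀ i, ∃ N, G * MvPolynomial.X i ^ N ∈ I (n + N)) → G ∈ I n)
    (hdim : ∃ n₀, ∀ n, n₀ ≤ n →
      Module.finrank K (forms K n) = Module.finrank K (I n) + 3 * n) :
    ∃ d ∈ I 3, d ≠ 0 ∧ ∀ n, ∀ g ∈ I n, d ∣ g := by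
  have hfin (n : ℕ) : FiniteDimensional K (I n) := Submodule.finiteDimensional_of_le (hI n)
  obtain ⟨n₁, hn₁⟩ := hdim
  have h0 : ∃ n, I n ≠ ⊥ := by
    refine ⟨n₁ + 3, fun h => ?_⟩
    have h1 := hn₁ (n₁ + 3) (by omega)
    have h2 := two_mul_finrank_forms (K := K) (n₁ + 3)
    rw [h, finrank_bot] at h1
    nlinarith
  obtain ⟨e, d, hd, hd0, ⟨C, n₀, hC⟩, hdvd⟩ := dvd_of_forall_finrank_sup_le hI hmul h0
  have hle (n : ℕ) : I (e + n) ≤ multiples d n := by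
    intro g hg
    obtain ⟨f, rfl⟩ := hdvd _ g hg
    by_cases hf0 : f = 0
    · rw [hf0, mul_zero]; exact zero_mem _
    obtain ⟨c, hc⟩ := MvPolynomial.IsHomogeneous.of_mul_left (F := f) (G := d)
      (by rw [mul_comm]; exact hI _ hg) (mul_ne_zero hf0 hd0)
    have := (hd.mul hc).inj_right (hI _ hg) (mul_ne_zero hd0 hf0)
    refine ⟨f, ?_, rfl⟩
    have : c = n := by omega
    rw [← this]
    exact hc
  have hlow (n : ℕ) : Module.finrank K (I (e + n)) ≤ Module.finrank K (forms K n) := by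
    rw [← finrank_multiples hd0 n]
    exact Submodule.finrank_mono (hle n)
  have hup (n : ℕ) (hn : n₀ ≤ n) :
      Module.finrank K (forms K n) ≤ Module.finrank K (I (e + n)) + C := by
    have := hC n hn
    rwa [sup_eq_right.mpr (hle n), finrank_multiples hd0] at this
  -- Twice the difference of the dimensions of forms in degrees `e + n` and `n` is `e (2 n + e +
  -- 3)`. It differs from `6 (e + n)` by at most `2 C`, and `n` is taken so large that this excludes
  -- `e ≥ 4` and `e ≤ 2`.
  have he : e = 3 := by
    let n := n₀ + n₁ + 2 * C + e * e + 3 * e + 10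
    have h1 := hlow n
    have h2 := hup n (by omega)
    have h3 := hn₁ (e + n) (by omega)
    have h4 := two_mul_finrank_forms (K := K) (e + n)
    have h5 := two_mul_finrank_forms (K := K) n
    have h6 : e * (2 * n + e + 3) ≤ 6 * (e + n) := by nlinarith
    have h7 : 6 * (e + n) ≤ e * (2 * n + e + 3) + 2 * C := by nlinarith
    have hn : 2 * C + e * e + 3 * e + 10 ≤ n := by omega
    apply le_antisymm
    · by_contra hlt
      have : 4 * (2 * n + e + 3) ≤ e * (2 * n + e + 3) := Nat.mul_le_mul_right _ (by omega)
      omega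
    · by_contra hlt
      have : e * (2 * n + e + 3) ≤ 2 * (2 * n + e + 3) := Nat.mul_le_mul_right _ (by omega)
      omega
  subst he
  refine ⟨d, hsat _ _ hd fun i => ⟨n₁, ?_⟩, hd0, hdvd⟩
  have heq : I (3 + n₁) = multiples d n₁ := by
    refine Submodule.eq_of_le_of_finrank_eq (hle n₁) ?_
    rw [finrank_multiples hd0]
    have h3 := hn₁ (3 + n₁) (by omega)
    have h4 := two_mul_finrank_forms (K := K) (3 + n₁)
    have h5 := two_mul_finrank_forms (K := K) n₁
    nlinarith
  rw [heq]
  exact ⟨MvPolynomial.X i ^ n₁, by simpa using (MvPolynomial.isHomogeneous_X K i).pow n₁, rfl⟩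

end Hilbert

section Saturation

lemma exists_pow_mul_mem_ideal {X : Scheme.{u}} (D : X.IdealSheafData) (U : X.affineOpens)
    (r s : Γ(X, U.1)) (h : X.presheaf.map (homOfLE (X.basicOpen_le r)).op s ∈
      D.ideal (X.affineBasicOpen r)) : ∃ N, r ^ N * s ∈ D.ideal U := by
  have := U.2.isLocalization_basicOpen r
  rw [← D.map_ideal_basicOpen U r] at h
  obtain ⟨_, ⟨N, rfl⟩, hm⟩ := (IsLocalization.algebraMap_mem_map_algebraMap_iff
    (Submonoid.powers r) Γ(X, X.basicOpen r) _ _).mp h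
  exact ⟨N, hm⟩

variable {k : Type u} [Field k] {S : Over (Spec (CommRingCat.of k))}

lemma basicOpen_ratioOn_le {U : (plane S).Opens} {j : Fin 3} (hj : U ≤ planeChart S j) (i : Fin 3) :
    (plane S).basicOpen (ratioOn hj i) ≤ planeChart S i := by
  have h1 : (plane S).basicOpen (planeRatio S j i) ≤ planeChart S i := by
    have h2 : toPlane S ⁻¹ᵁ (chart k j ⊓ chart k i) = (plane S).basicOpen (planeRatio S j i) := by
      rw [chart_inf_chart]
      exact Scheme.preimage_basicOpen _ _
    rw [← h2]
    exact fun x hx => hx.2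
  refine le_trans ?_ h1
  rw [ratioOn]
  exact ((plane S).basicOpen_res (planeRatio S j i) (homOfLE hj).op).le.trans inf_le_right

/-- The ideal of a closed subscheme of `ℙ²_S` on the affine open subset `xᵢ ≠ 0` over `V`. -/
def chartIdeal (D : (plane S).IdealSheafData) (i : Fin 3) (V : S.left.affineOpens) :
    Ideal Γ(plane S, chartOver S i V.1) :=
  D.ideal (affineChart i V)

lemma IsZeroLocusOn.chartIdeal_eq {D : (plane S).IdealSheafData} {V : S.left.affineOpens}
    {F : MvPolynomial (Fin 3) Γ(S.left, V)} (h : IsZeroLocusOn D V F) (i : Fin 3) :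
    chartIdeal D i V = Ideal.span {chartDehom S i V.1 F} :=
  h i

/-- A form that vanishes on the part `xᵢ ≠ 0` of `D` vanishes on all of `D` after multiplication by
a power of `xᵢ`: on the chart `xⱼ ≠ 0` it vanishes where `xᵢ / xⱼ` is invertible, and the
denominator can be cleared. -/
lemma exists_X_pow_mul_chartDehom_mem (D : (plane S).IdealSheafData) (V : S.left.affineOpens)
    {i : Fin 3} {n : ℕ} {G : MvPolynomial (Fin 3) Γ(S.left, V)} (hG : G.IsHomogeneous n)
    (h : chartDehom S i V.1 G ∈ chartIdeal D i V) :
    ∃ N, ∀ M, N ≤ M → ∀ j, chartDehom S j V.1 (MvPolynomial.X i ^ M * G) ∈ chartIdeal D j V := by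
  have key (j : Fin 3) : ∃ N, chartDehom S j V.1 (MvPolynomial.X i ^ N * G) ∈
      chartIdeal D j V := by
    let r : Γ(plane S, (affineChart j V).1) := ratioOn (chartOver_le_chart j V.1) i
    let W := (plane S).affineBasicOpen r
    have hW : W.1 ≤ chartOver S j V.1 := (plane S).basicOpen_le r
    have hWi : W.1 ≤ chartOver S i V.1 :=
      le_inf (basicOpen_ratioOn_le _ i) (hW.trans (chartOver_le_base j V.1))
    have h1 : (plane S).presheaf.map (homOfLE hWi).op (chartDehom S i V.1 G) ∈ D.ideal W :=
      D.ideal_le_comap_ideal (U := W) (V := affineChart i V) hWi h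
    have h2 : (plane S).presheaf.map (homOfLE hW).op (chartDehom S j V.1 G) ∈ D.ideal W := by
      have e1 := map_dehom (chartOver_le_chart i V.1) (chartOver_le_base i V.1) hWi G
      have e2 := map_dehom (chartOver_le_chart j V.1) (chartOver_le_base j V.1) hW G
      rw [e1] at h1
      rw [e2, dehom_change (hWi.trans (chartOver_le_chart i V.1)) _ _ hG]
      exact Ideal.mul_mem_left _ _ h1
    obtain ⟨N, hN⟩ := exists_pow_mul_mem_ideal D (affineChart j V) r _ h2
    refine ⟨N, ?_⟩
    rw [map_mul, map_pow, dehom_X]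
    exact hN
  choose N hN using key
  refine ⟨∑ j, N j, fun M hM j => ?_⟩
  obtain ⟨c, hc⟩ := Nat.exists_eq_add_of_le
    ((Finset.single_le_sum (f := N) (fun _ _ => Nat.zero_le _) (Finset.mem_univ j)).trans hM)
  rw [hc, pow_add, mul_comm (_ ^ N j), mul_assoc, map_mul]
  exact Ideal.mul_mem_left _ _ (hN j)

end Saturation

section HilbertPolynomial

variable {k : Type u} [Field k] {K : Type u} [Field K]
  {p : Spec (CommRingCat.of K) ⟶ Spec (CommRingCat.of k)}

lemma mem_vanishingForms_iff {D : (plane (Over.mk p)).IdealSheafData} {n : ℕ}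
    {G : MvPolynomial.homogeneousSubmodule (Fin 3) K n} : G ∈ vanishingForms K p D n ↔
      ∀ i, chartDehom (Over.mk p) i (fieldTop K p).1 (fieldForm K p G.1) ∈
        chartIdeal D i (fieldTop K p) := by
  constructor
  · intro h i
    have h1 := h i (affineChart i (fieldTop K p)) (chartOver_le_chart _ _)
    have h2 := map_dehomogenize i G.1 (chartOver_le_chart (S := Over.mk p) i (fieldTop K p).1)
    exact h2 ▸ h1
  · intro h i V hV
    have hV' : V.1 ≤ chartOver (Over.mk p) i (fieldTop K p).1 := le_inf hV (le_fieldTop V.1)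
    have h1 := D.ideal_le_comap_ideal (U := V) (V := affineChart i (fieldTop K p)) hV' (h i)
    have h2 := map_dehom (chartOver_le_chart (S := Over.mk p) i (fieldTop K p).1)
      (chartOver_le_base i (fieldTop K p).1) hV' (fieldForm K p G.1)
    have h3 := map_dehomogenize i G.1 hV
    exact h3.symm ▸ (h2 ▸ h1)

/-- The forms of degree `n` that vanish on `D`, as a space of polynomials. -/
def vanishing (D : (plane (Over.mk p)).IdealSheafData) (n : ℕ) :
    Submodule K (MvPolynomial (Fin 3) K) :=
  (vanishingForms K p D n).map (forms K n).subtype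

lemma mem_vanishing {D : (plane (Over.mk p)).IdealSheafData} {n : ℕ}
    {G : MvPolynomial (Fin 3) K} : G ∈ vanishing D n ↔ G.IsHomogeneous n ∧
      ∀ i, chartDehom (Over.mk p) i (fieldTop K p).1 (fieldForm K p G) ∈
        chartIdeal D i (fieldTop K p) := by
  constructor
  · rintro ⟨G, hG, rfl⟩
    exact ⟨G.2, mem_vanishingForms_iff.mp hG⟩
  · rintro ⟨hG, h⟩
    exact ⟨⟨G, hG⟩, mem_vanishingForms_iff.mpr h, rfl⟩

lemma finrank_quotient_vanishingForms (D : (plane (Over.mk p)).IdealSheafData) (n : ℕ) :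
    Module.finrank K (MvPolynomial.homogeneousSubmodule (Fin 3) K n ⧸ vanishingForms K p D n) +
      Module.finrank K (vanishing D n) = Module.finrank K (forms K n) := by
  rw [vanishing, ← (Submodule.equivMapOfInjective (forms K n).subtype Subtype.val_injective
    (vanishingForms K p D n)).finrank_eq]
  exact Submodule.finrank_quotient_add_finrank _

lemma eval_three_mul_X (n : ℕ) : (3 * Polynomial.X : Polynomial ℚ).eval (n : ℚ) =
    ((3 * n : ℕ) : ℚ) := by
  simp

/-- In degree `3 + n` the forms vanishing on `V₊(F)` are the multiples of `F` by forms of degree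
`n`, and the dimensions differ by `3 (3 + n)`. -/
lemma IsCubic.hasHilbertPolynomial {D : (plane (Over.mk p)).IdealSheafData} (hD : IsCubic K p D) :
    HasHilbertPolynomial K p (3 * Polynomial.X) D := by
  obtain ⟨F, hF, h0, h⟩ := isCubic_iff.mp hD
  obtain ⟨m, hm⟩ := exists_coeff_ne_zero hF h0
  have hm' : IsUnit ((fieldForm K p F).coeff (exponent m)) := by
    have : (fieldForm K p F).coeff (exponent m) =
        (Scheme.ΓSpecIso (CommRingCat.of K)).inv.hom (F.coeff (exponent m)) :=
      MvPolynomial.coeff_map _ _ _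
    rw [this]
    exact (IsUnit.mk0 _ hm).map (Scheme.ΓSpecIso (CommRingCat.of K)).inv.hom
  have heq (n : ℕ) : vanishing D (3 + n) = multiples F n := by
    ext G
    rw [mem_vanishing, mem_multiples]
    constructor
    · rintro ⟨hG, hGD⟩
      obtain ⟨H, hH, hdeg⟩ := h.exists_eq_mul (fieldForm_isHomogeneous hF)
        (fieldForm_isHomogeneous hG) hm' hGD
      have hHhom : H.IsHomogeneous n := by
        intro d hd
        have := hdeg d hd
        have h2 : d.degree = n := by omega
        rw [← h2, Finsupp.degree_eq_weight_one]
        rfl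
      obtain ⟨H₀, hH₀, rfl⟩ := exists_fieldForm_eq (p := p) hHhom
      refine ⟨H₀, hH₀, fieldForm_injective (p := p) ?_⟩
      rw [map_mul, mul_comm, ← hH]
    · rintro ⟨H, hH, rfl⟩
      refine ⟨hF.mul hH, fun i => ?_⟩
      rw [h.chartIdeal_eq i, map_mul, map_mul]
      exact Ideal.mul_mem_right _ _ (Ideal.mem_span_singleton_self _)
  filter_upwards [Filter.eventually_ge_atTop 3] with n hn
  obtain ⟨n, rfl⟩ := Nat.exists_eq_add_of_le hn
  rw [eval_three_mul_X]
  norm_cast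
  have h1 := finrank_quotient_vanishingForms D (3 + n)
  rw [heq, finrank_multiples h0] at h1
  have h2 := two_mul_finrank_forms (K := K) (3 + n)
  have h3 := two_mul_finrank_forms (K := K) n
  nlinarith

/-- The forms vanishing on `D` make up a saturated homogeneous ideal, to which
`exists_cubic_of_finrank` applies. A function in the ideal of `D` on a chart becomes, after
homogenising and multiplying by a power of `xᵢ`, a form in this ideal, hence a multiple of the
cubic. -/
lemma HasHilbertPolynomial.isCubic {D : (plane (Over.mk p)).IdealSheafData}
    (hD : HasHilbertPolynomial K p (3 * Polynomial.X) D) : IsCubic K p D := by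
  have hmul : ∀ a n (F G : MvPolynomial (Fin 3) K), F.IsHomogeneous a → G ∈ vanishing D n →
      G * F ∈ vanishing D (n + a) := by
    intro a n F G hF hG
    rw [mem_vanishing] at hG ⊢
    refine ⟨hG.1.mul hF, fun i => ?_⟩
    rw [map_mul, map_mul]
    exact Ideal.mul_mem_right _ _ (hG.2 i)
  have hX (i : Fin 3) : fieldForm K p (MvPolynomial.X i) = MvPolynomial.X i :=
    MvPolynomial.map_X _ _
  have hsat : ∀ n (G : MvPolynomial (Fin 3) K), G.IsHomogeneous n →
      (∀ i, ∃ N, G * MvPolynomial.X i ^ N ∈ vanishing D (n + N)) → G ∈ vanishing D n := by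
    intro n G hG h
    refine mem_vanishing.mpr ⟨hG, fun i => ?_⟩
    obtain ⟨N, hN⟩ := h i
    have := (mem_vanishing.mp hN).2 i
    rwa [map_mul, map_pow, hX, map_mul, map_pow, chartDehom_X_self, one_pow, mul_one] at this
  have hdim : ∃ n₀, ∀ n, n₀ ≤ n →
      Module.finrank K (forms K n) = Module.finrank K (vanishing D n) + 3 * n := by
    obtain ⟨n₀, hn₀⟩ := Filter.eventually_atTop.mp hD
    refine ⟨n₀, fun n hn => ?_⟩
    have h1 := hn₀ n hn
    rw [eval_three_mul_X] at h1
    norm_cast at h1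
    have h2 := finrank_quotient_vanishingForms D n
    omega
  obtain ⟨F, hF, h0, hdvd⟩ := exists_cubic_of_finrank (I := vanishing D)
    (fun n G hG => (mem_vanishing.mp hG).1) hmul hsat hdim
  refine isCubic_iff.mpr ⟨F, (mem_vanishing.mp hF).1, h0, fun i => le_antisymm ?_ ?_⟩
  · intro s hs
    obtain ⟨n, hn⟩ := exists_isHomogeneous_chartDehom_eq i (fieldTop K p).2 s
    obtain ⟨G, hG, rfl⟩ := hn n le_rfl
    obtain ⟨N, hN⟩ := exists_X_pow_mul_chartDehom_mem D (fieldTop K p) hG hs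
    obtain ⟨G₀, hG₀, rfl⟩ := exists_fieldForm_eq hG
    have h1 : MvPolynomial.X i ^ N * G₀ ∈ vanishing D (N + n) := by
      rw [mem_vanishing]
      refine ⟨by simpa using ((MvPolynomial.isHomogeneous_X K i).pow N).mul hG₀, fun j => ?_⟩
      have := hN N le_rfl j
      rw [map_mul, map_pow, hX]
      exact this
    obtain ⟨H, hH⟩ := hdvd _ _ h1
    have h2 := congrArg (fun P => chartDehom (Over.mk p) i (fieldTop K p).1 (fieldForm K p P)) hH
    simp only [map_mul, map_pow, hX] at h2
    rw [chartDehom_X_self, one_pow, one_mul] at h2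
    exact Ideal.mem_span_singleton.mpr ⟨_, h2⟩
  · exact (Ideal.span_singleton_le_iff_mem _).mpr ((mem_vanishing.mp hF).2 i)

lemma hasHilbertPolynomial_iff_isCubic {D : (plane (Over.mk p)).IdealSheafData} :
    HasHilbertPolynomial K p (3 * Polynomial.X) D ↔ IsCubic K p D :=
  ⟨fun h => h.isCubic, fun h => h.hasHilbertPolynomial⟩

end HilbertPolynomial

end

end SingularCubics
-- Flat families with cubic fibres are locally given by cubic forms; representability of the Hilbert
-- functor.
namespace SingularCubics

noncomputable section

attribute [local instance] MvPolynomial.gradedAlgebra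

/-! ### Division by a cubic form over a local ring -/

section Division

variable {R : Type*} [CommRing R]

variable (R) in
/-- The ternary forms of degree `n` in which `x₀` occurs with exponent at most `D`. -/
def boundedForms (n D : ℕ) : Submodule R (MvPolynomial (Fin 3) R) :=
  MvPolynomial.restrictSupport R {d | d.degree = n ∧ d 0 ≤ D}

lemma mem_boundedForms {n D : ℕ} {F : MvPolynomial (Fin 3) R} :
    F ∈ boundedForms R n D ↔ ∀ d, F.coeff d ≠ 0 → d.degree = n ∧ d 0 ≤ D := by
  rw [boundedForms, MvPolynomial.mem_restrictSupport_iff, Set.subset_def]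
  simp only [Finset.mem_coe, MvPolynomial.mem_support_iff, Set.mem_ofPred_eq]

lemma isHomogeneous_of_mem_boundedForms {n D : ℕ} {F : MvPolynomial (Fin 3) R}
    (h : F ∈ boundedForms R n D) : F.IsHomogeneous n := fun d hd => by
  rw [← (mem_boundedForms.mp h d hd).1, Finsupp.degree_eq_weight_one]; rfl

lemma _root_.MvPolynomial.IsHomogeneous.mem_boundedForms {n : ℕ} {F : MvPolynomial (Fin 3) R}
    (h : F.IsHomogeneous n) {D : ℕ} (hD : n ≤ D) : F ∈ boundedForms R n D := by
  refine SingularCubics.mem_boundedForms.mpr fun d hd => ?_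
  have h1 : d.degree = n := by
    by_contra hne
    exact hd (h.coeff_eq_zero hne)
  exact ⟨h1, (Finsupp.le_degree 0 d).trans (h1.le.trans hD)⟩

lemma monomial_mem_boundedForms {n D : ℕ} {d : Fin 3 →₀ ℕ} (h : d.degree = n) (h0 : d 0 ≤ D)
    (a : R) : MvPolynomial.monomial d a ∈ boundedForms R n D := by
  classical
  refine mem_boundedForms.mpr fun d' hd' => ?_
  rw [MvPolynomial.coeff_monomial] at hd'
  obtain rfl : d = d' := by
    by_contra hne
    exact hd' (if_neg hne)
  exact ⟨h, h0⟩

lemma mul_mem_boundedForms {n n' D D' : ℕ} {F G : MvPolynomial (Fin 3) R}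
    (hF : F ∈ boundedForms R n D) (hG : G ∈ boundedForms R n' D') :
    F * G ∈ boundedForms R (n + n') (D + D') := by
  have h := Submodule.mul_mem_mul hF hG
  rw [boundedForms, boundedForms, ← MvPolynomial.restrictSupport_add] at h
  refine MvPolynomial.restrictSupport_mono (R := R) ?_ h
  rintro _ ⟨d, hd, e, he, rfl⟩
  have h1 := hd.1
  have h2 := he.1
  exact ⟨by simp only [map_add, h1, h2], add_le_add hd.2 he.2⟩

lemma boundedForms_le {n D : ℕ} {N : Submodule R (MvPolynomial (Fin 3) R)}
    (h : ∀ d : Fin 3 →₀ ℕ, d.degree = n → d 0 ≤ D → MvPolynomial.monomial d 1 ∈ N) :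
    boundedForms R n D ≤ N := by
  rw [boundedForms, MvPolynomial.restrictSupport_eq_span, Submodule.span_le]
  rintro _ ⟨d, hd, rfl⟩
  exact h d hd.1 hd.2

lemma X_pow_mem_boundedForms {i : Fin 3} (hi : i ≠ 0) (e : ℕ) :
    (MvPolynomial.X i ^ e : MvPolynomial (Fin 3) R) ∈ boundedForms R e 0 := by
  rw [MvPolynomial.X_pow_eq_monomial]
  exact monomial_mem_boundedForms (Finsupp.degree_single _ _) (by simp [hi.symm]) _

/-- Division with remainder by a cubic form that is monic in `x₀`, within homogeneous forms. -/
lemma mem_sup_boundedForms {F P : MvPolynomial (Fin 3) R} (hF : F = MvPolynomial.X 0 ^ 3 - P)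
    (hP : P ∈ boundedForms R 3 2) (n : ℕ) {G : MvPolynomial (Fin 3) R}
    (hG : G.IsHomogeneous (n + 3)) :
    ∃ Q T : MvPolynomial (Fin 3) R, Q.IsHomogeneous n ∧ T ∈ boundedForms R (n + 3) 2 ∧
      G = F * Q + T := by
  -- Induction on the bound for the exponent of `x₀`: since `x₀³ = F + P`, a monomial divisible by
  -- `x₀³` is a multiple of `F` plus a form of smaller degree in `x₀`.
  suffices h : ∀ D, boundedForms R (n + 3) (D + 2) ≤
      (MvPolynomial.homogeneousSubmodule (Fin 3) R n).map (LinearMap.mulLeft R F) ⊔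
        boundedForms R (n + 3) 2 by
    obtain ⟨_, ⟨Q, hQ, rfl⟩, T, hT, hQT⟩ :=
      Submodule.mem_sup.mp (h (n + 3) (hG.mem_boundedForms (by omega)))
    exact ⟨Q, T, hQ, hT, hQT.symm⟩
  intro D
  induction D with
  | zero => exact le_sup_right
  | succ D ih =>
    refine boundedForms_le fun d hd h0 => ?_
    by_cases hle : d 0 ≤ D + 2
    · exact ih (monomial_mem_boundedForms hd hle _)
    obtain ⟨d', rfl⟩ : ∃ d', d = Finsupp.single 0 3 + d' :=
      ⟨d - Finsupp.single 0 3, (add_tsub_cancel_of_le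
        (Finsupp.single_le_iff.mpr (by omega))).symm⟩
    have hd' : d'.degree = n := by
      rw [map_add, Finsupp.degree_single] at hd; omega
    have h0' : d' 0 ≤ D := by
      simp only [Finsupp.add_apply, Finsupp.single_eq_same] at h0; omega
    have h1 : MvPolynomial.monomial (Finsupp.single 0 3 + d') (1 : R) =
        F * MvPolynomial.monomial d' 1 + P * MvPolynomial.monomial d' 1 := by
      rw [hF, ← add_mul, sub_add_cancel, MvPolynomial.X_pow_eq_monomial,
        MvPolynomial.monomial_mul, mul_one]
    rw [h1]
    refine add_mem (Submodule.mem_sup_left ⟨_, ?_, rfl⟩) (ih ?_)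
    · exact isHomogeneous_of_mem_boundedForms (monomial_mem_boundedForms hd' le_rfl _)
    · have := mul_mem_boundedForms hP (monomial_mem_boundedForms hd' h0' (1 : R))
      rwa [add_comm 3, add_comm 2] at this

lemma exists_map_eq_of_mem_boundedForms {B : Type*} [CommRing B] {φ : R →+* B}
    (hφ : Function.Surjective φ) {n D : ℕ} {T : MvPolynomial (Fin 3) B}
    (hT : T ∈ boundedForms B n D) : ∃ T' ∈ boundedForms R n D, MvPolynomial.map φ T' = T := by
  refine ⟨∑ d ∈ T.support, MvPolynomial.monomial d (Function.surjInv hφ (T.coeff d)),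
    sum_mem fun d hd => ?_, ?_⟩
  · have := mem_boundedForms.mp hT d (MvPolynomial.mem_support_iff.mp hd)
    exact monomial_mem_boundedForms this.1 this.2 _
  · conv_rhs => rw [T.as_sum]
    simp only [map_sum, MvPolynomial.map_monomial, Function.surjInv_eq]

lemma mem_ker_smul_of_map_eq_zero {B : Type*} [CommRing B] {φ : R →+* B} {n D : ℕ}
    {T : MvPolynomial (Fin 3) R} (hT : T ∈ boundedForms R n D) (h : MvPolynomial.map φ T = 0) :
    T ∈ RingHom.ker φ • boundedForms R n D := by
  rw [T.as_sum]
  refine sum_mem fun d hd => ?_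
  have := mem_boundedForms.mp hT d (MvPolynomial.mem_support_iff.mp hd)
  rw [← mul_one (T.coeff d), ← smul_eq_mul, ← MvPolynomial.smul_monomial]
  refine Submodule.smul_mem_smul ?_ (monomial_mem_boundedForms this.1 this.2 _)
  rw [RingHom.mem_ker, ← MvPolynomial.coeff_map, h, MvPolynomial.coeff_zero]

lemma fg_boundedForms (n D : ℕ) : (boundedForms R n D).FG := by
  rw [boundedForms, MvPolynomial.restrictSupport_eq_span]
  refine Submodule.fg_span (Set.Finite.image _ (Set.Finite.subset
    (s := (Finset.univ.finsuppAntidiag n : Finset (Fin 3 →₀ ℕ))) (Finset.finite_toSet _) ?_))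
  rintro d ⟨hd, -⟩
  rw [Finset.mem_coe, Finset.mem_finsuppAntidiag]
  rw [Finsupp.degree_eq_sum] at hd
  exact ⟨hd, Finset.subset_univ _⟩

/-- A monomial of degree `3 e` in three variables is divisible by some `xᵢ^e`. -/
lemma mul_mem_of_X_pow_mul_mem {I : ℕ → Submodule R (MvPolynomial (Fin 3) R)}
    (hmul : ∀ a n (F G : MvPolynomial (Fin 3) R), F.IsHomogeneous a → G ∈ I n → F * G ∈ I (a + n))
    {e n : ℕ} {G : MvPolynomial (Fin 3) R} (h : ∀ i, MvPolynomial.X i ^ e * G ∈ I (e + n))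
    {H : MvPolynomial (Fin 3) R} (hH : H.IsHomogeneous (3 * e)) : H * G ∈ I (3 * e + n) := by
  suffices hle : boundedForms R (3 * e) (3 * e) ≤
      (I (3 * e + n)).comap (LinearMap.mulRight R G) from hle (hH.mem_boundedForms le_rfl)
  refine boundedForms_le fun d hd _ => ?_
  obtain ⟨i, hi⟩ : ∃ i, e ≤ d i := by
    by_contra! hlt
    rw [Finsupp.degree_eq_sum, Fin.sum_univ_three] at hd
    have := hlt 0
    have := hlt 1
    have := hlt 2
    omega
  obtain ⟨d', rfl⟩ : ∃ d', d = d' + Finsupp.single i e :=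
    ⟨d - Finsupp.single i e, (tsub_add_cancel_of_le (Finsupp.single_le_iff.mpr hi)).symm⟩
  rw [map_add, Finsupp.degree_single] at hd
  change MvPolynomial.monomial (d' + Finsupp.single i e) 1 * G ∈ I (3 * e + n)
  rw [← mul_one (1 : R), ← MvPolynomial.monomial_mul, ← MvPolynomial.X_pow_eq_monomial, mul_assoc,
    ← hd, add_assoc]
  refine hmul _ _ _ _ ?_ (h i)
  exact isHomogeneous_of_mem_boundedForms (monomial_mem_boundedForms rfl le_rfl _)

end Division

section LocalRing

variable {A κ : Type*} [CommRing A] [IsLocalRing A] [Field κ] {φ : A →+* κ}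

/-- Lifting the generator from the residue field. Here `I` will be the ideal of forms vanishing on
`D`. The lifting hypothesis makes the forms of `x₀`-degree at most `2` span modulo `I` in large
degrees, and `hindep`, which will come from flatness, says that they are independent modulo `I` in
all degrees. -/
lemma exists_cubicForm_of_coeff_eq_one (hφ : Function.Surjective φ)
    {I : ℕ → Submodule A (MvPolynomial (Fin 3) A)} (hI : ∀ n, ∀ G ∈ I n, G.IsHomogeneous n)
    (hmul : ∀ a n (F G : MvPolynomial (Fin 3) A), F.IsHomogeneous a → G ∈ I n → F * G ∈ I (a + n))
    (hsat : ∀ n N (G : MvPolynomial (Fin 3) A), G.IsHomogeneous n →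
      (∀ H : MvPolynomial (Fin 3) A, H.IsHomogeneous N → H * G ∈ I (N + n)) → G ∈ I n)
    {f : MvPolynomial (Fin 3) κ} (hf : f.IsHomogeneous 3) (hf1 : f.coeff (Finsupp.single 0 3) = 1)
    (hindep : ∀ n, ∀ T ∈ boundedForms A n 2, T ∈ I n → T = 0)
    {n₀ : ℕ} (hlift : ∀ n, n₀ ≤ n → ∀ h : MvPolynomial (Fin 3) κ, h.IsHomogeneous n →
      ∃ G ∈ I (n + 3), MvPolynomial.map φ G = f * h) :
    ∃ F ∈ I 3, F.coeff (Finsupp.single 0 3) = 1 ∧ ∀ n, ∀ G ∈ I n, F ∣ G := by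
  have hfP : MvPolynomial.X 0 ^ 3 - f ∈ boundedForms κ 3 2 := by
    refine mem_boundedForms.mpr fun d hd => ?_
    have h1 := mem_boundedForms.mp ((((MvPolynomial.isHomogeneous_X κ (0 : Fin 3)).pow 3).sub
      hf).mem_boundedForms le_rfl) d hd
    rw [one_mul] at h1
    refine ⟨h1.1, ?_⟩
    by_contra hlt
    refine hd ?_
    have h2 : d = Finsupp.single 0 3 := by
      have h3 := h1.1
      rw [Finsupp.degree_eq_sum, Fin.sum_univ_three] at h3
      ext i
      fin_cases i <;> simp <;> omega
    rw [h2, MvPolynomial.coeff_sub, hf1, MvPolynomial.X_pow_eq_monomial,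
      MvPolynomial.coeff_monomial, if_pos rfl, sub_self]
  -- Nakayama's lemma in the finitely generated module of all forms of degree `n + 3`: over the
  -- residue field the claim is division by `f`, and multiples of `f` lift to `I`.
  have hspan (n : ℕ) (hn : n₀ ≤ n) {G : MvPolynomial (Fin 3) A} (hG : G.IsHomogeneous (n + 3)) :
      ∃ T ∈ boundedForms A (n + 3) 2, G - T ∈ I (n + 3) := by
    have h1 : boundedForms A (n + 3) (n + 3) ≤ I (n + 3) ⊔ boundedForms A (n + 3) 2 := by
      refine Submodule.le_of_le_smul_of_le_jacobson_bot (I := RingHom.ker φ)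
        (fg_boundedForms _ _) ?_ fun G hG => ?_
      · rw [IsLocalRing.jacobson_eq_maximalIdeal _ bot_ne_top]
        exact IsLocalRing.le_maximalIdeal (RingHom.ker_ne_top φ)
      · obtain ⟨Q, T, hQ, hT, hQT⟩ := mem_sup_boundedForms (sub_sub_cancel _ _).symm hfP n
          ((isHomogeneous_of_mem_boundedForms hG).map φ)
        obtain ⟨G', hG', h2⟩ := hlift n hn Q hQ
        obtain ⟨T', hT', h3⟩ := exists_map_eq_of_mem_boundedForms hφ hT
        have h4 : G - (G' + T') ∈ RingHom.ker φ • boundedForms A (n + 3) (n + 3) := by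
          refine mem_ker_smul_of_map_eq_zero (Submodule.sub_mem _ hG (Submodule.add_mem _
            ((hI _ _ hG').mem_boundedForms le_rfl)
            ((isHomogeneous_of_mem_boundedForms hT').mem_boundedForms le_rfl))) ?_
          rw [map_sub, map_add, h2, h3, hQT, sub_self]
        have h5 := Submodule.add_mem_sup (Submodule.add_mem_sup hG' hT') h4
        rwa [add_sub_cancel] at h5
    obtain ⟨G', hG', T, hT, rfl⟩ := Submodule.mem_sup.mp (h1 (hG.mem_boundedForms le_rfl))
    exact ⟨T, hT, by rwa [add_sub_cancel_right]⟩
  have hX (i : Fin 3) (n : ℕ) : ((MvPolynomial.X i ^ n : MvPolynomial (Fin 3) A)).IsHomogeneous n := by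
    simpa using (MvPolynomial.isHomogeneous_X A i).pow n
  -- The remainder of `x₀³` itself is wanted, but remainders exist only in large degrees; so `x₀³`
  -- is multiplied by powers of `x₁` and of `x₂`, which do not raise the degree in `x₀`.
  obtain ⟨P₁, hP₁, h₁⟩ := hspan n₀ le_rfl ((hX 1 n₀).mul (hX 0 3))
  obtain ⟨P₂, hP₂, h₂⟩ := hspan n₀ le_rfl ((hX 2 n₀).mul (hX 0 3))
  -- Both sides are remainders of `x₁ⁿ x₂ⁿ x₀³` with `n = n₀`, so they agree by independence. It
  -- follows that `x₁ⁿ` divides `P₁`, and the quotient `P` is the remainder of `x₀³`.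
  have h12 : MvPolynomial.X 2 ^ n₀ * P₁ = P₂ * MvPolynomial.X 1 ^ n₀ := by
    rw [mul_comm P₂]
    refine sub_eq_zero.mp (hindep (n₀ + (n₀ + 3)) _ (sub_mem ?_ ?_) ?_)
    · simpa using mul_mem_boundedForms (X_pow_mem_boundedForms (by decide) _) hP₁
    · simpa using mul_mem_boundedForms (X_pow_mem_boundedForms (by decide) _) hP₂
    · have := sub_mem (hmul _ _ _ _ (hX 1 n₀) h₂) (hmul _ _ _ _ (hX 2 n₀) h₁)
      convert this using 1
      ring
  obtain ⟨P, hP, hPd⟩ := exists_eq_mul_of_X_pow_mul (i := 2) (j := 1) (by decide)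
    (F := MvPolynomial.X 1 ^ n₀) (F' := P₁) (G := P₂) (G' := P₁) (N := n₀) (N' := n₀)
    (M := n₀ + 3) ((MvPolynomial.isRegular_X_pow n₀).mem_nonZeroDivisors)
    (isHomogeneous_of_mem_boundedForms hP₂) h12 (mul_comm _ _)
  have hPb : P ∈ boundedForms A 3 2 := by
    refine mem_boundedForms.mpr fun d hd => ⟨by have := hPd d hd; omega, ?_⟩
    have h1 : P₁.coeff (d + Finsupp.single 1 n₀) ≠ 0 := by
      rwa [hP, MvPolynomial.X_pow_eq_monomial, MvPolynomial.coeff_mul_monomial, mul_one]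
    simpa using (mem_boundedForms.mp hP₁ _ h1).2
  have hP2 : P₂ = P * MvPolynomial.X 2 ^ n₀ := by
    refine (MvPolynomial.isRegular_X_pow (n := (1 : Fin 3)) n₀).right ?_
    change P₂ * _ = _ * _
    rw [← h12, hP]; ring
  set F : MvPolynomial (Fin 3) A := MvPolynomial.X 0 ^ 3 - P with hF
  have hFh : F.IsHomogeneous 3 := (hX 0 3).sub (isHomogeneous_of_mem_boundedForms hPb)
  have hF1 : MvPolynomial.X 1 ^ n₀ * F ∈ I (n₀ + 3) := by
    rw [hF, mul_sub, mul_comm _ P, ← hP]; exact h₁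
  have hF2 : MvPolynomial.X 2 ^ n₀ * F ∈ I (n₀ + 3) := by
    rw [hF, mul_sub, mul_comm _ P, ← hP2]; exact h₂
  -- The remainder `T` of `x₀ⁿ F` vanishes, because `x₁ⁿ T` lies in `I` and is still a bounded form.
  have hF0 : MvPolynomial.X 0 ^ n₀ * F ∈ I (n₀ + 3) := by
    obtain ⟨T, hT, h⟩ := hspan n₀ le_rfl ((hX 0 n₀).mul hFh)
    have h0 : MvPolynomial.X 1 ^ n₀ * T = 0 := by
      refine hindep (n₀ + (n₀ + 3)) _ ?_ ?_
      · simpa using mul_mem_boundedForms (X_pow_mem_boundedForms (by decide) _) hT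
      · have := sub_mem (hmul _ _ _ _ (hX 0 n₀) hF1) (hmul _ _ _ _ (hX 1 n₀) h)
        convert this using 1
        ring
    have hT0 : T = 0 := (MvPolynomial.isRegular_X_pow (n := (1 : Fin 3)) n₀).left
      (h0.trans (mul_zero _).symm)
    rwa [hT0, sub_zero] at h
  have hFI : F ∈ I 3 := hsat 3 (3 * n₀) F hFh fun H hH => by
    refine mul_mem_of_X_pow_mul_mem hmul (fun i => ?_) hH
    fin_cases i
    exacts [hF0, hF1, hF2]
  refine ⟨F, hFI, ?_, fun n G hG => ?_⟩
  · rw [hF, MvPolynomial.coeff_sub, MvPolynomial.X_pow_eq_monomial, MvPolynomial.coeff_monomial,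
      if_pos rfl, sub_eq_self]
    by_contra hne
    simpa using (mem_boundedForms.mp hPb _ hne).2
  -- In degrees at most `2` every form is its own remainder, so independence leaves only zero.
  by_cases hn : n ≤ 2
  · rw [hindep n G ((hI _ _ hG).mem_boundedForms hn) hG]
    exact dvd_zero F
  obtain ⟨n, rfl⟩ : ∃ m, n = m + 3 := ⟨n - 3, by omega⟩
  obtain ⟨Q, T, hQ, hT, rfl⟩ := mem_sup_boundedForms hF hPb n (hI _ _ hG)
  rw [hindep _ T hT, add_zero]
  · exact dvd_mul_right F Q
  · have h1 := hmul _ _ _ _ hQ hFI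
    rw [mul_comm] at h1
    simpa using sub_mem hG h1

end LocalRing

end

end SingularCubics
namespace SingularCubics

noncomputable section

attribute [local instance] MvPolynomial.gradedAlgebra

/-! ### Linear changes of coordinates -/

section Shear

variable {R : Type*} [CommRing R]

/-- The substitution `x₀ ↦ x₀`, `xⱼ ↦ xⱼ + cⱼ x₀` for `j ≠ 0`. -/
def shearHom (c : Fin 3 → R) : MvPolynomial (Fin 3) R →ₐ[R] MvPolynomial (Fin 3) R :=
  MvPolynomial.aeval fun j => if j = 0 then MvPolynomial.X 0 else
    MvPolynomial.X j + MvPolynomial.C (c j) * MvPolynomial.X 0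

lemma shearHom_comp_neg (c : Fin 3 → R) : (shearHom c).comp (shearHom (-c)) = AlgHom.id R _ := by
  refine MvPolynomial.algHom_ext fun j => ?_
  by_cases hj : j = 0
  · subst hj; simp [shearHom]
  · simp [shearHom, hj]

/-- The substitution `x₀ ↦ x₀`, `xⱼ ↦ xⱼ + cⱼ x₀` for `j ≠ 0`, as an automorphism. -/
def shear (c : Fin 3 → R) : MvPolynomial (Fin 3) R ≃ₐ[R] MvPolynomial (Fin 3) R :=
  AlgEquiv.ofAlgHom (shearHom c) (shearHom (-c)) (shearHom_comp_neg c)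
    (by simpa using shearHom_comp_neg (-c))

lemma shear_symm (c : Fin 3 → R) : (shear c).symm = shear (-c) := by
  ext F; rfl

lemma isHomogeneous_shear (c : Fin 3 → R) {n : ℕ} {F : MvPolynomial (Fin 3) R}
    (hF : F.IsHomogeneous n) : (shear c F).IsHomogeneous n := by
  have := hF.aeval (fun j : Fin 3 => if j = 0 then MvPolynomial.X 0 else
    MvPolynomial.X j + MvPolynomial.C (c j) * MvPolynomial.X (0 : Fin 3)) (n := 1) fun j => by
      split_ifs
      · exact MvPolynomial.isHomogeneous_X R 0
      · exact (MvPolynomial.isHomogeneous_X R j).add (MvPolynomial.isHomogeneous_C_mul_X (c j) 0)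
  rwa [one_mul] at this

lemma map_shear {B : Type*} [CommRing B] (φ : R →+* B) (c : Fin 3 → R)
    (F : MvPolynomial (Fin 3) R) : MvPolynomial.map φ (shear c F) =
      shear (φ ∘ c) (MvPolynomial.map φ F) := by
  suffices h : (MvPolynomial.map φ).comp (shearHom c).toRingHom =
      ((shearHom (φ ∘ c)).toRingHom).comp (MvPolynomial.map φ) from congr($h F)
  refine MvPolynomial.ringHom_ext (fun r => ?_) fun j => ?_
  · simp [shearHom]
  · by_cases hj : j = 0
    · subst hj; simp [shearHom]
    · simp [shearHom, hj]

lemma _root_.MvPolynomial.IsHomogeneous.coeff_single_eq_eval {F : MvPolynomial (Fin 3) R} {n : ℕ}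
    (hF : F.IsHomogeneous n) (i : Fin 3) :
    F.coeff (Finsupp.single i n) = MvPolynomial.eval (Pi.single i 1) F := by
  rw [MvPolynomial.eval_eq, eq_comm]
  refine (Finset.sum_eq_single (Finsupp.single i n) (fun d hd hne => ?_) fun h => ?_).trans ?_
  · obtain ⟨j, hj, hdj⟩ : ∃ j, j ≠ i ∧ d j ≠ 0 := by
      by_contra! h
      refine hne (Finsupp.ext fun j => ?_)
      have hd' : d.degree = n := by
        by_contra hn
        exact MvPolynomial.mem_support_iff.mp hd (hF.coeff_eq_zero hn)
      rw [Finsupp.degree_eq_sum, Finset.sum_eq_single i (fun j _ hj => h j hj) (by simp)] at hd'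
      by_cases hj : j = i
      · rw [hj, hd', Finsupp.single_eq_same]
      · rw [h j hj, Finsupp.single_eq_of_ne hj]
    rw [Finset.prod_eq_zero (Finsupp.mem_support_iff.mpr hdj), mul_zero]
    rw [Pi.single_eq_of_ne hj, zero_pow hdj]
  · rw [MvPolynomial.notMem_support_iff.mp h, zero_mul]
  · rw [Finset.prod_eq_one, mul_one]
    intro j _
    by_cases hj : j = i
    · rw [hj, Pi.single_eq_same, one_pow]
    · rw [Finsupp.single_eq_of_ne hj, pow_zero]

lemma eval_shear (c : Fin 3 → R) (F : MvPolynomial (Fin 3) R) :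
    MvPolynomial.eval (Pi.single 0 1) (shear c F) =
      MvPolynomial.eval (fun j => if j = 0 then 1 else c j) F := by
  suffices h : (MvPolynomial.eval (Pi.single 0 1)).comp (shearHom c).toRingHom =
      MvPolynomial.eval (fun j => if j = 0 then 1 else c j) from congr($h F)
  refine MvPolynomial.ringHom_ext (fun r => ?_) fun j => ?_
  · simp [shearHom]
  · by_cases hj : j = 0
    · subst hj; simp [shearHom]
    · simp [shearHom, hj]

/-- If `F` vanished at all points with `x₀ = 1`, then by homogeneity `x₀ F` would vanish at every
point, and over an infinite field it would be zero. -/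
lemma exists_eval_ne_zero {κ : Type*} [Field κ] [Infinite κ] {F : MvPolynomial (Fin 3) κ} {n : ℕ}
    (hF : F.IsHomogeneous n) (h0 : F ≠ 0) :
    ∃ c : Fin 3 → κ, MvPolynomial.eval (fun j => if j = 0 then 1 else c j) F ≠ 0 := by
  by_contra! h
  refine mul_ne_zero h0 (MvPolynomial.X_ne_zero (0 : Fin 3)) (MvPolynomial.funext fun v => ?_)
  rw [map_mul, MvPolynomial.eval_X, map_zero]
  by_cases hv : v 0 = 0
  · rw [hv, mul_zero]
  have h1 : v = fun j => v 0 * (if j = 0 then 1 else v j / v 0) := by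
    ext j
    split_ifs with hj
    · rw [hj, mul_one]
    · rw [mul_div_cancel₀ _ hv]
  have h2 : MvPolynomial.eval v F = 0 := by
    rw [h1]
    have := MvPolynomial.IsHomogeneous.eval₂_mul_left hF (RingHom.id κ) (v 0)
      (fun j => if j = 0 then 1 else v j / v 0)
    refine this.trans ?_
    change v 0 ^ n * MvPolynomial.eval (fun j => if j = 0 then 1 else v j / v 0) F = 0
    rw [h fun j => v j / v 0, mul_zero]
  rw [h2, zero_mul]

end Shear

section LocalRing

variable {A κ : Type*} [CommRing A] [IsLocalRing A] [Field κ] [Infinite κ] {φ : A →+* κ}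

/-- A shear moves a point where `f` does not vanish to `(1 : 0 : 0)`, which makes the coefficient of
`x₀³` a unit; after scaling, `exists_cubicForm_of_coeff_eq_one` applies to the transformed ideal.
The independence hypothesis is phrased for arbitrary families of forms so that it can be carried
along the shear. -/
lemma exists_form_of_saturated (hφ : Function.Surjective φ)
    {I : ℕ → Submodule A (MvPolynomial (Fin 3) A)} (hI : ∀ n, ∀ G ∈ I n, G.IsHomogeneous n)
    (hmul : ∀ a n (F G : MvPolynomial (Fin 3) A), F.IsHomogeneous a → G ∈ I n → F * G ∈ I (a + n))
    (hsat : ∀ n N (G : MvPolynomial (Fin 3) A), G.IsHomogeneous n →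
      (∀ H : MvPolynomial (Fin 3) A, H.IsHomogeneous N → H * G ∈ I (N + n)) → G ∈ I n)
    {f : MvPolynomial (Fin 3) κ} (hf : f.IsHomogeneous 3) (hf0 : f ≠ 0)
    (hindep : ∀ (n : ℕ) (ι : Type) [Fintype ι] (G : ι → MvPolynomial (Fin 3) A),
      (∀ j, (G j).IsHomogeneous n) →
      (∀ c : ι → κ, f ∣ ∑ j, c j • MvPolynomial.map φ (G j) → c = 0) →
      ∀ a : ι → A, ∑ j, a j • G j ∈ I n → a = 0)
    {n₀ : ℕ} (hlift : ∀ n, n₀ ≤ n → ∀ h : MvPolynomial (Fin 3) κ, h.IsHomogeneous n →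
      ∃ G ∈ I (n + 3), MvPolynomial.map φ G = f * h) :
    ∃ F ∈ I 3, (∃ m, IsUnit (F.coeff m)) ∧ ∀ n, ∀ G ∈ I n, F ∣ G := by
  obtain ⟨c', hc⟩ := exists_eval_ne_zero hf hf0
  obtain ⟨c, rfl⟩ : ∃ c : Fin 3 → A, φ ∘ c = c' :=
    ⟨fun j => Function.surjInv hφ (c' j), funext fun j => Function.surjInv_eq hφ _⟩
  have hfc := isHomogeneous_shear (φ ∘ c) hf
  set u := (shear (φ ∘ c) f).coeff (Finsupp.single 0 3) with hu
  have hu0 : u ≠ 0 := by rwa [hu, hfc.coeff_single_eq_eval, eval_shear]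
  have hs (G : MvPolynomial (Fin 3) A) : shear c ((shear c).symm G) = G :=
    (shear c).apply_symm_apply G
  have hmap (G : MvPolynomial (Fin 3) A) : shear (φ ∘ c) (MvPolynomial.map φ ((shear c).symm G)) =
      MvPolynomial.map φ G := by rw [← map_shear, hs]
  have hsymm {n : ℕ} {G : MvPolynomial (Fin 3) A} (hG : G.IsHomogeneous n) :
      ((shear c).symm G).IsHomogeneous n := by
    rw [shear_symm]; exact isHomogeneous_shear _ hG
  have hindep' : ∀ n, ∀ T ∈ boundedForms A n 2,
      T ∈ (I n).comap (shear c).symm.toLinearMap → T = 0 := by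
    intro n T hT hTI
    have h1 := hindep n T.support (fun d => (shear c).symm (MvPolynomial.monomial d.1 1))
      (fun d => hsymm (isHomogeneous_of_mem_boundedForms (monomial_mem_boundedForms
        (mem_boundedForms.mp hT d.1 (MvPolynomial.mem_support_iff.mp d.2)).1 le_rfl 1)))
      (fun b hb => ?_) (fun d => T.coeff d.1) ?_
    · by_contra hT0
      obtain ⟨d, hd⟩ := MvPolynomial.ne_zero_iff.mp hT0
      exact hd congr($h1 ⟨d, MvPolynomial.mem_support_iff.mpr hd⟩)
    · have h2 := map_dvd (shear (φ ∘ c)) hb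
      simp only [map_sum, map_smul, hmap, MvPolynomial.map_monomial, map_one] at h2
      have h3 : ∑ d : T.support, b d • MvPolynomial.monomial d.1 (1 : κ) ∈ boundedForms κ n 2 :=
        sum_mem fun d _ => Submodule.smul_mem _ _ (by
          have := mem_boundedForms.mp hT d.1 (MvPolynomial.mem_support_iff.mp d.2)
          exact monomial_mem_boundedForms this.1 this.2 1)
      -- A nonzero multiple of the sheared `f` has degree at least `3` in `x₀`, while this sum has
      -- degree at most `2`.
      have h4 : ∑ d : T.support, b d • MvPolynomial.monomial d.1 (1 : κ) = 0 := by
        by_contra hne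
        obtain ⟨q, hq⟩ := h2
        rw [hq] at h3 hne
        have h5 : 3 ≤ MvPolynomial.degreeOf 0 (shear (φ ∘ c) f) := by
          simpa using MvPolynomial.monomial_le_degreeOf 0 (MvPolynomial.mem_support_iff.mpr hu0)
        have h6 : MvPolynomial.degreeOf 0 (shear (φ ∘ c) f * q) ≤ 2 :=
          MvPolynomial.degreeOf_le_iff.mpr fun m hm =>
            (mem_boundedForms.mp h3 m (MvPolynomial.mem_support_iff.mp hm)).2
        rw [MvPolynomial.degreeOf_mul_eq (left_ne_zero_of_mul hne) (right_ne_zero_of_mul hne)] at h6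
        omega
      ext d
      have h5 := congrArg (MvPolynomial.coeff d.1) h4
      rw [MvPolynomial.coeff_sum, Finset.sum_eq_single d] at h5
      · simpa using h5
      · intro d' _ hne
        rw [MvPolynomial.coeff_smul, MvPolynomial.coeff_monomial, if_neg, smul_zero]
        exact fun h => hne (Subtype.ext h)
      · simp
    · have h2 : T = ∑ d : T.support, T.coeff d.1 • MvPolynomial.monomial d.1 (1 : A) := by
        conv_lhs => rw [T.as_sum]
        rw [← Finset.sum_coe_sort]
        simp [MvPolynomial.smul_monomial]
      rw [Submodule.mem_comap, AlgEquiv.toLinearMap_apply, h2, map_sum] at hTI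
      simpa only [map_smul] using hTI
  have hlift' : ∀ n, n₀ ≤ n → ∀ h : MvPolynomial (Fin 3) κ, h.IsHomogeneous n →
      ∃ G ∈ (I (n + 3)).comap (shear c).symm.toLinearMap,
        MvPolynomial.map φ G = u⁻¹ • shear (φ ∘ c) f * h := by
    intro n hn h hh
    obtain ⟨G, hG, h1⟩ := hlift n hn (u⁻¹ • (shear (φ ∘ c)).symm h) (by
      rw [MvPolynomial.smul_eq_C_mul, shear_symm]
      exact (isHomogeneous_shear _ hh).C_mul _)
    refine ⟨shear c G, by simpa using hG, ?_⟩
    rw [map_shear, h1, map_mul, map_smul, AlgEquiv.apply_symm_apply]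
    simp
  obtain ⟨F, hF, hF1, hdvd⟩ := exists_cubicForm_of_coeff_eq_one (n₀ := n₀) hφ
    (I := fun n => (I n).comap (shear c).symm.toLinearMap) (f := u⁻¹ • shear (φ ∘ c) f)
    (fun n G hG => by simpa using isHomogeneous_shear c (hI n _ hG))
    (fun a n F G hF hG => by
      have := hmul a n _ _ (hsymm hF) hG
      rwa [Submodule.mem_comap, AlgEquiv.toLinearMap_apply, map_mul])
    (fun n N G hG h => hsat n N _ (hsymm hG) fun H hH => by
      simpa using h (shear c H) (isHomogeneous_shear c hH))
    (by rw [MvPolynomial.smul_eq_C_mul]; exact hfc.C_mul _)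
    (by rw [MvPolynomial.coeff_smul, smul_eq_mul, ← hu, inv_mul_cancel₀ hu0])
    hindep'
    hlift'
  refine ⟨(shear c).symm F, hF, ?_, fun n G hG => ?_⟩
  -- If no coefficient were a unit, the form would reduce to zero over the residue field; but its
  -- shear has a coefficient equal to `1`.
  · by_contra! hne
    have h1 : ∀ m, φ (((shear c).symm F).coeff m) = 0 := fun m => by
      by_contra h
      exact hne m ((IsLocalHom.of_surjective φ hφ).map_nonunit _
        (isUnit_iff_ne_zero.mpr h))
    have h2 : MvPolynomial.map φ ((shear c).symm F) = 0 := by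
      ext m; rw [MvPolynomial.coeff_map, h1, MvPolynomial.coeff_zero]
    have h3 := hmap F
    rw [h2, map_zero] at h3
    have h4 := congrArg (MvPolynomial.coeff (Finsupp.single 0 3)) h3
    rw [MvPolynomial.coeff_map, hF1, map_one, MvPolynomial.coeff_zero] at h4
    exact zero_ne_one h4
  · have := map_dvd (shear c).symm (hdvd n (shear c G) (by simpa using hG))
    simpa using this

end LocalRing

end

end SingularCubics
namespace SingularCubics

noncomputable section

attribute [local instance] MvPolynomial.gradedAlgebra

/-! ### Flat families over a local ring with a cubic as special fibre -/

section LocalRing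

/-- Vectors of a flat module over a local ring that are independent modulo the maximal ideal are
independent. By the equational criterion `v = P y` with `a P = 0`; modulo the maximal ideal the rows
of `P` are independent, so `P` has a right inverse there, and for a lift `Q` of it `P Q` is
invertible. -/
lemma eq_zero_of_flat_of_residue {A κ : Type*} [CommRing A] [IsLocalRing A] [Field κ] {φ : A →+* κ}
    (hφ : Function.Surjective φ) {M : Type*} [AddCommGroup M] [Module A M] [Module.Flat A M]
    {ι : Type*} [Fintype ι] {v : ι → M}
    (hv : ∀ c : ι → A, ∑ j, c j • v j ∈ RingHom.ker φ • (⊤ : Submodule A M) → ∀ j, φ (c j) = 0)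
    {a : ι → A} (ha : ∑ j, a j • v j = 0) : a = 0 := by
  classical
  let E := Fintype.equivFin ι
  obtain ⟨κ', _, e, y, hy, he⟩ :
      ∃ (κ' : Type) (_ : Fintype κ') (e : ι → κ' → A) (y : κ' → M),
        (∀ j, v j = ∑ l, e j l • y l) ∧ ∀ l, ∑ j, a j * e j l = 0 := by
    obtain ⟨n, e, y, hy, he⟩ := Module.Flat.isTrivialRelation_of_sum_smul_eq_zero
      (f := a ∘ E.symm) (x := v ∘ E.symm) (by
        rw [← ha]; exact Fintype.sum_equiv E.symm _ _ fun _ => rfl)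
    refine ⟨Fin n, inferInstance, fun j => e (E j), y, fun j => ?_, fun l => ?_⟩
    · simpa using hy (E j)
    · rw [← he l]
      exact Fintype.sum_equiv E _ _ fun j => by simp
  let P : Matrix ι κ' A := Matrix.of e
  have hinj : Function.Injective (Matrix.vecMulLinear (P.map φ)) := by
    rw [← LinearMap.ker_eq_bot, LinearMap.ker_eq_bot']
    intro c hc
    ext j
    have h1 := hv (fun j => Function.surjInv hφ (c j)) (by
      simp_rw [hy, Finset.smul_sum, smul_smul]
      rw [Finset.sum_comm]
      refine sum_mem fun l _ => ?_
      rw [← Finset.sum_smul]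
      refine Submodule.smul_mem_smul ?_ trivial
      rw [RingHom.mem_ker, map_sum]
      simp_rw [map_mul, Function.surjInv_eq hφ]
      exact congrFun hc l) j
    rwa [Function.surjInv_eq hφ] at h1
  obtain ⟨L, hL⟩ := LinearMap.exists_leftInverse_of_injective _ (LinearMap.ker_eq_bot.mpr hinj)
  let Q : Matrix κ' ι A := Matrix.of fun l j => Function.surjInv hφ (L (Pi.single l 1) j)
  have hPQ : (P * Q).map φ = 1 := by
    ext i j
    have h1 := congrFun (LinearMap.congr_fun hL (Pi.single i 1)) j
    rw [LinearMap.comp_apply, Matrix.vecMulLinear_apply, Matrix.single_one_vecMul] at h1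
    have h2 : L ((P.map φ).row i) j = ∑ l, φ (P i l) * L (Pi.single l 1) j := by
      conv_lhs => rw [LinearMap.pi_apply_eq_sum_univ L]
      rw [Finset.sum_apply]
      refine Finset.sum_congr rfl fun l _ => ?_
      rw [Pi.smul_apply, smul_eq_mul]
      refine congrArg (fun w => φ (P i l) * L w j) (funext fun m => ?_)
      rw [Pi.single_apply]
      exact if_congr eq_comm rfl rfl
    rw [Matrix.map_apply, Matrix.mul_apply, map_sum]
    simp_rw [map_mul]
    simp only [Q, Matrix.of_apply, Function.surjInv_eq hφ]
    refine h2.symm.trans (h1.trans ?_)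
    rw [LinearMap.id_apply, Matrix.one_apply, Pi.single_apply]
    exact if_congr eq_comm rfl rfl
  have hdet : IsUnit (P * Q).det := by
    refine (IsLocalHom.of_surjective φ hφ).map_nonunit _ ?_
    rw [RingHom.map_det, RingHom.mapMatrix_apply, hPQ, Matrix.det_one]
    exact isUnit_one
  have h0 : Matrix.vecMul a (P * Q) = 0 := by
    rw [← Matrix.vecMul_vecMul]
    have : Matrix.vecMul a P = 0 := funext he
    rw [this, Matrix.zero_vecMul]
  exact Matrix.vecMul_injective_of_isUnit ((Matrix.isUnit_iff_isUnit_det _).mpr hdet)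
    (h0.trans (Matrix.zero_vecMul _).symm)

/-- As in `IsZeroLocusOn.exists_eq_mul`, divisibility on the charts `0` and `1` is homogenised to
`xᵢ^N G = H f`, and the two identities are compared. -/
lemma dvd_of_forall_mem_span {κ : Type*} [Field κ] {B : Fin 3 → Type*} [∀ i, CommRing (B i)]
    {δ : ∀ i, MvPolynomial (Fin 3) κ →+* B i} (hδ : ∀ i, Function.Surjective (δ i))
    (hX : ∀ i, δ i (MvPolynomial.X i) = 1)
    (hinj : ∀ i n (F : MvPolynomial (Fin 3) κ), F.IsHomogeneous n → δ i F = 0 → F = 0)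
    {f : MvPolynomial (Fin 3) κ} {a : ℕ} (hf : f.IsHomogeneous a) (hf0 : f ≠ 0)
    {G : MvPolynomial (Fin 3) κ} {n : ℕ} (hG : G.IsHomogeneous n)
    (h : ∀ i, δ i G ∈ Ideal.span {δ i f}) : f ∣ G := by
  have key (i : Fin 3) : ∃ (N M : ℕ) (H : MvPolynomial (Fin 3) κ), H.IsHomogeneous M ∧
      MvPolynomial.X i ^ N * G = H * f := by
    obtain ⟨s, hs⟩ := Ideal.mem_span_singleton'.mp (h i)
    obtain ⟨H', rfl⟩ := hδ i s
    obtain ⟨M, hM⟩ := MvPolynomial.exists_isHomogeneous_map_eq (δ i) (hX i) H'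
    obtain ⟨H, hH, hHeq, -⟩ := hM (M + n) (by omega)
    refine ⟨M + a, M + n, H, hH, sub_eq_zero.mp (hinj i (M + a + n) _ (.sub ?_ ?_) ?_)⟩
    · simpa using ((MvPolynomial.isHomogeneous_X κ i).pow (M + a)).mul hG
    · rw [show M + a + n = M + n + a by omega]
      exact hH.mul hf
    · rw [map_sub, map_mul, map_mul, map_pow, hX, one_pow, one_mul, hHeq, ← hs, sub_self]
  obtain ⟨N, M, H, hH, h0⟩ := key 0
  obtain ⟨N', M', H', hH', h1⟩ := key 1
  obtain ⟨Q, hQ, -⟩ := exists_eq_mul_of_X_pow_mul (by decide : (0 : Fin 3) ≠ 1)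
    (mem_nonZeroDivisors_of_ne_zero hf0) hH h0 h1
  exact ⟨Q, hQ.trans (mul_comm _ _)⟩

variable {A κ : Type*} [CommRing A] [Field κ] {φ : A →+* κ}
  {B B' C : Fin 3 → Type*} [∀ i, CommRing (B i)] [∀ i, CommRing (B' i)] [∀ i, CommRing (C i)]
  {δ : ∀ i, MvPolynomial (Fin 3) A →+* B i} {δ' : ∀ i, MvPolynomial (Fin 3) κ →+* B' i}
  {π : ∀ i, B i →+* C i} {ψ : ∀ i, B i →+* B' i}

/-- The product of the three chart rings of `D` is flat over `A`. A combination of forms that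
vanishes on `D` modulo the maximal ideal is divisible by `f` on the closed fibre, so
`eq_zero_of_flat_of_residue` converts independence modulo `f` into independence modulo the ideal of
`D`. -/
lemma eq_zero_of_sum_smul_mem_ker [IsLocalRing A] (hφ : Function.Surjective φ)
    (hδ' : ∀ i, Function.Surjective (δ' i)) (hX' : ∀ i, δ' i (MvPolynomial.X i) = 1)
    (hinj : ∀ i n (F : MvPolynomial (Fin 3) κ), F.IsHomogeneous n → δ' i F = 0 → F = 0)
    (hπ : ∀ i, Function.Surjective (π i))
    (hψ : ∀ i G, ψ i (δ i G) = δ' i (MvPolynomial.map φ G))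
    (hflat : ∀ i, ((π i).comp ((δ i).comp MvPolynomial.C)).Flat)
    {f : MvPolynomial (Fin 3) κ} {d : ℕ} (hf : f.IsHomogeneous d) (hf0 : f ≠ 0)
    (hJ : ∀ i, (RingHom.ker (π i)).map (ψ i) = Ideal.span {δ' i f})
    {n : ℕ} {ι : Type*} [Fintype ι] {G : ι → MvPolynomial (Fin 3) A}
    (hG : ∀ j, (G j).IsHomogeneous n)
    (hc : ∀ c : ι → κ, f ∣ ∑ j, c j • MvPolynomial.map φ (G j) → c = 0)
    {a : ι → A} (ha : ∀ i, π i (δ i (∑ j, a j • G j)) = 0) : a = 0 := by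
  let _ (i : Fin 3) : Module A (C i) := Module.compHom (C i) ((π i).comp ((δ i).comp MvPolynomial.C))
  have hfl (i : Fin 3) : Module.Flat A (C i) := hflat i
  have hflp : Module.Flat A (∀ i, C i) :=
    .of_linearEquiv (DirectSum.linearEquivFunOnFintype A (Fin 3) C).symm
  have hsmul (i : Fin 3) (x : A) (y : C i) : x • y = π i (δ i (MvPolynomial.C x)) * y := rfl
  have hsum (c : ι → A) (i : Fin 3) :
      (∑ j, c j • fun i => π i (δ i (G j))) i = π i (δ i (∑ j, c j • G j)) := by
    rw [Finset.sum_apply, map_sum, map_sum]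
    refine Finset.sum_congr rfl fun j _ => ?_
    rw [Pi.smul_apply, hsmul, MvPolynomial.smul_eq_C_mul, map_mul, map_mul]
  refine eq_zero_of_flat_of_residue hφ (M := ∀ i, C i) (v := fun j i => π i (δ i (G j)))
    (fun c h => ?_) (funext fun i => (hsum a i).trans (ha i))
  have hmem (i : Fin 3) : δ i (∑ j, c j • G j) ∈
      RingHom.ker (π i) ⊔ (RingHom.ker φ).map ((δ i).comp MvPolynomial.C) := by
    have h1 : π i (δ i (∑ j, c j • G j)) ∈
        (RingHom.ker φ).map ((π i).comp ((δ i).comp MvPolynomial.C)) := by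
      rw [← hsum]
      refine Submodule.smul_induction_on (p := fun w : ∀ i, C i => w i ∈ _) h
        (fun r hr x _ => ?_) fun x y hx hy => add_mem hx hy
      rw [Pi.smul_apply, hsmul]
      exact Ideal.mul_mem_right _ _ (Ideal.mem_map_of_mem _ hr)
    rw [← Ideal.map_map] at h1
    obtain ⟨y, hy, hy'⟩ := (Ideal.mem_map_iff_of_surjective _ (hπ i)).mp h1
    rw [← sub_add_cancel (δ i _) y]
    refine Submodule.add_mem_sup ?_ hy
    rw [RingHom.mem_ker, map_sub, hy', sub_self]
  have hdvd : f ∣ ∑ j, φ (c j) • MvPolynomial.map φ (G j) := by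
    refine dvd_of_forall_mem_span hδ' hX' hinj hf hf0 (n := n)
      (.sum _ _ _ fun j _ => ?_) fun i => ?_
    · rw [MvPolynomial.smul_eq_C_mul]
      exact ((hG j).map φ).C_mul _
    · have h1 := Ideal.mem_map_of_mem (ψ i) (hmem i)
      rw [Ideal.map_sup, hJ, Ideal.map_map, hψ] at h1
      have h2 : (RingHom.ker φ).map ((ψ i).comp ((δ i).comp MvPolynomial.C)) = ⊥ := by
        rw [eq_bot_iff, Ideal.map_le_iff_le_comap]
        intro r hr
        rw [RingHom.mem_ker] at hr
        simp [hψ, hr]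
      rw [h2, sup_bot_eq] at h1
      simpa [MvPolynomial.smul_eq_C_mul] using h1
  exact fun j => congrFun (hc _ hdvd) j

/-- On the chart `xᵢ ≠ 0` the equation of the closed fibre lifts to the ideal of `D`. Homogenising
and multiplying by a power of `xᵢ` gives a form vanishing on `D` that lifts `xᵢ^M f`. -/
lemma exists_lift_mul (hφ : Function.Surjective φ)
    (hδ : ∀ i, Function.Surjective (δ i)) (hX : ∀ i, δ i (MvPolynomial.X i) = 1)
    (hδ' : ∀ i, Function.Surjective (δ' i)) (hX' : ∀ i, δ' i (MvPolynomial.X i) = 1)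
    (hinj : ∀ i n (F : MvPolynomial (Fin 3) κ), F.IsHomogeneous n → δ' i F = 0 → F = 0)
    (hψ : ∀ i G, ψ i (δ i G) = δ' i (MvPolynomial.map φ G))
    {J : ∀ i, Ideal (B i)}
    (hsat : ∀ i n (G : MvPolynomial (Fin 3) A), G.IsHomogeneous n → δ i G ∈ J i →
      ∃ N, ∀ M, N ≤ M → ∀ j, δ j (MvPolynomial.X i ^ M * G) ∈ J j)
    {f : MvPolynomial (Fin 3) κ} (hf : f.IsHomogeneous 3)
    (hJ : ∀ i, (J i).map (ψ i) = Ideal.span {δ' i f}) :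
    ∃ n₀, ∀ n, n₀ ≤ n → ∀ h : MvPolynomial (Fin 3) κ, h.IsHomogeneous n →
      ∃ G : MvPolynomial (Fin 3) A, G.IsHomogeneous (n + 3) ∧ (∀ i, δ i G ∈ J i) ∧
        MvPolynomial.map φ G = f * h := by
  have hXh (i : Fin 3) (n : ℕ) : (MvPolynomial.X i ^ n : MvPolynomial (Fin 3) A).IsHomogeneous n := by
    simpa using (MvPolynomial.isHomogeneous_X A i).pow n
  have hXh' (i : Fin 3) (n : ℕ) :
      (MvPolynomial.X i ^ n : MvPolynomial (Fin 3) κ).IsHomogeneous n := by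
    simpa using (MvPolynomial.isHomogeneous_X κ i).pow n
  have key (i : Fin 3) : ∃ N, ∀ M, N ≤ M → ∃ G : MvPolynomial (Fin 3) A,
      G.IsHomogeneous (M + 3) ∧ (∀ j, δ j G ∈ J j) ∧
        MvPolynomial.map φ G = MvPolynomial.X i ^ M * f := by
    have hsurj : Function.Surjective (ψ i) := fun y => by
      obtain ⟨Y, rfl⟩ := hδ' i y
      obtain ⟨Z, rfl⟩ := MvPolynomial.map_surjective φ hφ Y
      exact ⟨_, hψ i Z⟩
    have h1 : δ' i f ∈ (J i).map (ψ i) := by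
      rw [hJ]; exact Ideal.mem_span_singleton_self _
    obtain ⟨s, hs, hs'⟩ := (Ideal.mem_map_iff_of_surjective _ hsurj).mp h1
    obtain ⟨G', rfl⟩ := hδ i s
    obtain ⟨m, hm⟩ := MvPolynomial.exists_isHomogeneous_map_eq (δ i) (hX i) G'
    obtain ⟨G, hG, hGeq, -⟩ := hm (m + 3) (by omega)
    rw [← hGeq] at hs hs'
    have h2 : MvPolynomial.map φ G = MvPolynomial.X i ^ m * f := by
      refine sub_eq_zero.mp (hinj i (m + 3) _ ((hG.map φ).sub ((hXh' i m).mul hf)) ?_)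
      rw [map_sub, ← hψ, hs', map_mul, map_pow, hX', one_pow, one_mul, sub_self]
    obtain ⟨N, hN⟩ := hsat i _ G hG hs
    refine ⟨N + m, fun M hM => ⟨MvPolynomial.X i ^ (M - m) * G, ?_, hN _ (by omega), ?_⟩⟩
    · rw [show M + 3 = M - m + (m + 3) by omega]
      exact (hXh i _).mul hG
    · rw [map_mul, map_pow, MvPolynomial.map_X, h2, ← mul_assoc, ← pow_add,
        Nat.sub_add_cancel (by omega)]
  choose N hN using key
  -- With `e` at least every `N i`, each `xᵢ^e f` lifts, and a monomial of degree at least `3 e` is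
  -- divisible by some `xᵢ^e`.
  let e := ∑ i, N i
  have hNe (i : Fin 3) : N i ≤ e :=
    Finset.single_le_sum (f := N) (fun _ _ => Nat.zero_le _) (Finset.mem_univ i)
  refine ⟨3 * e, fun n hn h hh => ?_⟩
  let T : Submodule κ (MvPolynomial (Fin 3) κ) :=
    { carrier := {h | ∃ G : MvPolynomial (Fin 3) A, G.IsHomogeneous (n + 3) ∧ (∀ i, δ i G ∈ J i) ∧
        MvPolynomial.map φ G = f * h}
      add_mem' := by
        rintro _ _ ⟨G, hG, hGJ, h1⟩ ⟨G', hG', hGJ', h2⟩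
        refine ⟨G + G', hG.add hG', fun i => ?_, by rw [map_add, h1, h2, mul_add]⟩
        rw [map_add]; exact add_mem (hGJ i) (hGJ' i)
      zero_mem' := ⟨0, MvPolynomial.isHomogeneous_zero _ _ _, fun i => by
        rw [map_zero]; exact zero_mem _, by simp⟩
      smul_mem' := by
        rintro c _ ⟨G, hG, hGJ, h1⟩
        obtain ⟨c, rfl⟩ := hφ c
        refine ⟨MvPolynomial.C c * G, hG.C_mul c, fun i => ?_, ?_⟩
        · rw [map_mul]; exact Ideal.mul_mem_left _ _ (hGJ i)
        · rw [map_mul, h1, MvPolynomial.map_C, MvPolynomial.smul_eq_C_mul]; ring }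
  suffices hle : boundedForms κ n n ≤ T from hle (hh.mem_boundedForms le_rfl)
  refine boundedForms_le fun d hd _ => ?_
  obtain ⟨i, hi⟩ : ∃ i, e ≤ d i := by
    by_contra! hlt
    rw [Finsupp.degree_eq_sum, Fin.sum_univ_three] at hd
    have := hlt 0
    have := hlt 1
    have := hlt 2
    omega
  obtain ⟨d', rfl⟩ : ∃ d', d = d' + Finsupp.single i e :=
    ⟨d - Finsupp.single i e, (tsub_add_cancel_of_le (Finsupp.single_le_iff.mpr hi)).symm⟩
  rw [map_add, Finsupp.degree_single] at hd
  obtain ⟨G, hG, hGJ, h1⟩ := hN i e (hNe i)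
  refine ⟨MvPolynomial.monomial d' 1 * G, ?_, fun j => ?_, ?_⟩
  · rw [show n + 3 = d'.degree + (e + 3) by omega]
    exact (isHomogeneous_of_mem_boundedForms (monomial_mem_boundedForms rfl le_rfl _)).mul hG
  · rw [map_mul]; exact Ideal.mul_mem_left _ _ (hGJ j)
  · have h2 : MvPolynomial.monomial (d' + Finsupp.single i e) (1 : κ) =
        MvPolynomial.monomial d' 1 * MvPolynomial.X i ^ e := by
      rw [MvPolynomial.X_pow_eq_monomial, MvPolynomial.monomial_mul, mul_one]
    rw [map_mul, h1, MvPolynomial.map_monomial, map_one, h2]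
    ring

/-- The saturated ideal `I` of forms vanishing on `D` meets the hypotheses of
`exists_form_of_saturated`: flatness gives independence and the closed fibre gives lifts. In the
application `δ i` and `δ' i` are dehomogenisations over the base and on the fibre, `π i` restricts
to `D` and `ψ i` restricts to the fibre. -/
lemma exists_form_of_flat [IsLocalRing A] [Infinite κ] (hφ : Function.Surjective φ)
    (hδ : ∀ i, Function.Surjective (δ i)) (hX : ∀ i, δ i (MvPolynomial.X i) = 1)
    (hδ' : ∀ i, Function.Surjective (δ' i)) (hX' : ∀ i, δ' i (MvPolynomial.X i) = 1)
    (hinj : ∀ i n (F : MvPolynomial (Fin 3) κ), F.IsHomogeneous n → δ' i F = 0 → F = 0)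
    (hπ : ∀ i, Function.Surjective (π i))
    (hψ : ∀ i G, ψ i (δ i G) = δ' i (MvPolynomial.map φ G))
    (hflat : ∀ i, ((π i).comp ((δ i).comp MvPolynomial.C)).Flat)
    (hsat : ∀ i n (G : MvPolynomial (Fin 3) A), G.IsHomogeneous n → δ i G ∈ RingHom.ker (π i) →
      ∃ N, ∀ M, N ≤ M → ∀ j, δ j (MvPolynomial.X i ^ M * G) ∈ RingHom.ker (π j))
    {f : MvPolynomial (Fin 3) κ} (hf : f.IsHomogeneous 3) (hf0 : f ≠ 0)
    (hJ : ∀ i, (RingHom.ker (π i)).map (ψ i) = Ideal.span {δ' i f}) :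
    ∃ F : MvPolynomial (Fin 3) A, F.IsHomogeneous 3 ∧ (∃ m, IsUnit (F.coeff m)) ∧
      ∀ i, RingHom.ker (π i) = Ideal.span {δ i F} := by
  obtain ⟨n₀, hlift⟩ := exists_lift_mul hφ hδ hX hδ' hX' hinj hψ hsat hf hJ
  let I (n : ℕ) : Submodule A (MvPolynomial (Fin 3) A) :=
    { carrier := {G | G.IsHomogeneous n ∧ ∀ i, δ i G ∈ RingHom.ker (π i)}
      add_mem' := fun {F G} hF hG => ⟨hF.1.add hG.1, fun i => by
        rw [map_add]; exact add_mem (hF.2 i) (hG.2 i)⟩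
      zero_mem' := ⟨MvPolynomial.isHomogeneous_zero _ _ _, fun i => by
        rw [map_zero]; exact zero_mem _⟩
      smul_mem' := fun c F hF => by
        rw [MvPolynomial.smul_eq_C_mul]
        exact ⟨hF.1.C_mul c, fun i => by rw [map_mul]; exact Ideal.mul_mem_left _ _ (hF.2 i)⟩ }
  have hXh (i : Fin 3) (n : ℕ) : (MvPolynomial.X i ^ n : MvPolynomial (Fin 3) A).IsHomogeneous n := by
    simpa using (MvPolynomial.isHomogeneous_X A i).pow n
  obtain ⟨F, hF, hm, hdvd⟩ := exists_form_of_saturated hφ (I := I) (n₀ := n₀)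
    (fun n G hG => hG.1)
    (fun a n F G hF hG => ⟨hF.mul hG.1, fun i => by
      rw [map_mul]; exact Ideal.mul_mem_left _ _ (hG.2 i)⟩)
    (fun n N G hG h => ⟨hG, fun i => by
      simpa [hX] using (h _ (hXh i N)).2 i⟩) hf hf0
    (fun n ι _ G hG hc a ha => eq_zero_of_sum_smul_mem_ker hφ hδ' hX' hinj hπ hψ hflat hf hf0 hJ
      hG hc ha.2)
    (fun n hn h hh => by
      obtain ⟨G, hG, hGJ, h1⟩ := hlift n hn h hh
      exact ⟨G, ⟨hG, hGJ⟩, h1⟩)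
  refine ⟨F, hF.1, hm, fun i => le_antisymm (fun s hs => ?_) ?_⟩
  · obtain ⟨G', rfl⟩ := hδ i s
    obtain ⟨n, hn⟩ := MvPolynomial.exists_isHomogeneous_map_eq (δ i) (hX i) G'
    obtain ⟨G, hG, hGeq, -⟩ := hn n le_rfl
    rw [← hGeq] at hs ⊢
    obtain ⟨N, hN⟩ := hsat i n G hG hs
    have h1 := hdvd _ _ ⟨(hXh i N).mul hG, hN N le_rfl⟩
    have h2 := map_dvd (δ i) h1
    rw [map_mul, map_pow, hX, one_pow, one_mul] at h2
    exact Ideal.mem_span_singleton.mpr h2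
  · rw [Ideal.span_singleton_le_iff_mem]
    exact hF.2 i

end LocalRing

end

end SingularCubics
namespace SingularCubics

noncomputable section

attribute [local instance] MvPolynomial.gradedAlgebra

/-! ### Flat families over the spectrum of a local ring -/

section LocalScheme

variable {k : Type u} [Field k] {S T : Over (Spec (CommRingCat.of k))}

lemma isPullback_planeMap (g : T ⟶ S) : IsPullback (planeMap g) (toBase T) (toBase S) g.left := by
  refine IsPullback.of_right (h₁₂ := toPlane S) (v₁₃ := (projectiveSpace k (Fin 3)).hom)
    (h₂₂ := S.hom) ?_ (planeMap_toBase g) (.of_hasPullback _ _)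
  rw [planeMap_toPlane, Over.w]
  exact .of_hasPullback _ _

lemma flat_comap {D : (plane S).IdealSheafData} (h : Flat (D.subschemeι ≫ toBase S)) (g : T ⟶ S) :
    Flat ((D.comap (planeMap g)).subschemeι ≫ toBase T) := by
  have h1 : IsPullback ((D.comapIso (planeMap g)).hom ≫ pullback.snd _ _)
      (D.comap (planeMap g)).subschemeι D.subschemeι (planeMap g) := by
    refine IsPullback.of_iso (IsPullback.of_hasPullback (planeMap g) D.subschemeι).flip
      (D.comapIso (planeMap g)).symm (Iso.refl _) (Iso.refl _) (Iso.refl _) ?_ ?_ ?_ ?_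
    · simp [-Scheme.IdealSheafData.comapIso_hom_snd]
    · simp
    · simp
    · simp
  exact MorphismProperty.of_isPullback (h1.paste_vert (isPullback_planeMap g)) h

lemma IsCubicFamily.isCubic_comap {D : (plane S).IdealSheafData}
    (h : ∀ (K : Type u) [Field K] (t : Spec (CommRingCat.of K) ⟶ S.left),
      IsCubic K (t ≫ S.hom) (fibre D K t)) {K : Type u} [Field K]
    {p : Spec (CommRingCat.of K) ⟶ Spec (CommRingCat.of k)} (g : Over.mk p ⟶ S) :
    IsCubic K p (D.comap (planeMap g)) := by
  obtain ⟨t, ht, rfl⟩ : ∃ (t : Spec (CommRingCat.of K) ⟶ S.left) (ht : t ≫ S.hom = p),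
      g = Over.homMk t ht := ⟨g.left, Over.w g, rfl⟩
  subst ht
  exact h K t

variable {K : Type u} [Field K]

/-- Dehomogenisation of polynomials over a field `K`, as functions on a chart of `ℙ²_K`. -/
def fieldDehom (p : Spec (CommRingCat.of K) ⟶ Spec (CommRingCat.of k)) (i : Fin 3) :
    MvPolynomial (Fin 3) K →+*
      Γ(plane (Over.mk p), chartOver (Over.mk p) i (fieldTop K p).1) :=
  (chartDehom (Over.mk p) i (fieldTop K p).1).comp (fieldForm K p)

lemma fieldForm_surjective (p : Spec (CommRingCat.of K) ⟶ Spec (CommRingCat.of k)) :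
    Function.Surjective (fieldForm K p) :=
  MvPolynomial.map_surjective _ (ConcreteCategory.bijective_of_isIso
    (Scheme.ΓSpecIso (CommRingCat.of K)).inv).2

lemma exists_isZeroLocusOn_of_isLocalRing [Infinite K] {D : (plane S).IdealSheafData}
    (hD : Flat (D.subschemeι ≫ toBase S)) (V : S.left.affineOpens) [IsLocalRing Γ(S.left, V.1)]
    (t : Spec (CommRingCat.of K) ⟶ S.left) (ht : t (IsLocalRing.closedPoint K) ∈ V.1)
    (hsurj : Function.Surjective (evalPoint t ht)) (hc : IsCubic K (t ≫ S.hom) (fibre D K t)) :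
    ∃ F : MvPolynomial (Fin 3) Γ(S.left, V), F.IsHomogeneous 3 ∧ (∃ m, IsUnit (F.coeff m)) ∧
      IsZeroLocusOn D V F := by
  obtain ⟨f, hf, hf0, hfD⟩ := isCubic_iff.mp hc
  let g : fieldPoint K t ⟶ S := Over.homMk t
  let ψ (i : Fin 3) : Γ(plane S, chartOver S i V.1) →+*
      Γ(plane (fieldPoint K t), chartOver (fieldPoint K t) i (fieldTop K (t ≫ S.hom)).1) :=
    ((planeMap g).appLE _ _ (chartOver_le_preimage g i (top_le_preimage_of_mem t ht))).hom
  obtain ⟨F, hF, hm, h⟩ := exists_form_of_flat (φ := evalPoint t ht)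
    (δ := fun i => chartDehom S i V.1) (δ' := fun i => fieldDehom (t ≫ S.hom) i)
    (π := fun i => chartRestrict D i V) (ψ := ψ) hsurj (fun i => dehom_surjective i V.2)
    (fun i => chartDehom_X_self i V.1)
    (fun i => (dehom_surjective i (fieldTop K (t ≫ S.hom)).2).comp (fieldForm_surjective _))
    (fun i => by
      rw [fieldDehom, RingHom.comp_apply]
      have : fieldForm K (t ≫ S.hom) (MvPolynomial.X i) = MvPolynomial.X i :=
        MvPolynomial.map_X _ i
      rw [this]
      exact chartDehom_X_self i _)
    (fun i n F hF h => fieldForm_injective (p := t ≫ S.hom)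
      ((eq_zero_of_chartDehom_eq_zero i (fieldTop K (t ≫ S.hom)).2 (fieldForm_isHomogeneous hF)
        h).trans (map_zero _).symm))
    (fun i => chartRestrict_surjective D i V)
    (fun i G => by
      refine (appLE_dehom g _ (top_le_preimage_of_mem t ht) _ (chartOver_le_chart i _) _
        (chartOver_le_base i _) G).trans ?_
      exact congrArg (chartDehom (Over.mk (t ≫ S.hom)) i (fieldTop K (t ≫ S.hom)).1)
        (fieldForm_map_evalPoint t ht G).symm)
    (fun i => by
      rw [chartDehom_comp_C, ← appLE_subschemeChart]
      exact HasRingHomProperty.appLE (P := @Flat) _ hD V (subschemeChart D i V) _)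
    (fun i n G hG h => by
      simp only [ker_chartRestrict] at h ⊢
      exact exists_X_pow_mul_chartDehom_mem D V hG h) hf hf0
    (fun i => by
      rw [ker_chartRestrict]
      exact (ideal_comap D (planeMap g) (affineChart i (fieldTop K (t ≫ S.hom)))
        (affineChart i V) _).symm.trans (hfD i))
  exact ⟨F, hF, hm, fun i => (ker_chartRestrict D i V).symm.trans (h i)⟩

lemma infinite_of_hom [Infinite k] (p : Spec (CommRingCat.of K) ⟶ Spec (CommRingCat.of k)) :
    Infinite K :=
  Infinite.of_injective _ (Spec.preimage p).hom.injective

lemma appLE_fromSpecStalk {X : Scheme.{u}} {x : X} {V : X.Opens} (hx : x ∈ V)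
    (e : ⊤ ≤ X.fromSpecStalk x ⁻¹ᵁ V) :
    (X.fromSpecStalk x).appLE V ⊤ e = X.presheaf.germ V x hx ≫
      (Scheme.ΓSpecIso (X.presheaf.stalk x)).inv := by
  rw [Scheme.Hom.appLE, Scheme.fromSpecStalk_app hx, Category.assoc, Category.assoc,
    ← Functor.map_comp]
  refine congrArg _ ?_
  have : ((homOfLE (le_top : X.fromSpecStalk x ⁻¹ᵁ V ≤ ⊤)).op ≫ (homOfLE e).op) = 𝟙 _ :=
    Subsingleton.elim _ _
  rw [this, CategoryTheory.Functor.map_id, Category.comp_id]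

lemma top_le_fromSpecStalk_preimage {X : Scheme.{u}} {x : X} {V : X.Opens} (hx : x ∈ V) :
    ⊤ ≤ X.fromSpecStalk x ⁻¹ᵁ V := by
  refine (Scheme.preimage_eq_top_of_closedPoint_mem (X.fromSpecStalk x) ?_).ge
  rwa [Scheme.fromSpecStalk_closedPoint]

lemma isLocalization_appLE_fromSpecStalk {X : Scheme.{u}} {x : X} {V : X.Opens}
    (hV : IsAffineOpen V) (hx : x ∈ V) (e : ⊤ ≤ X.fromSpecStalk x ⁻¹ᵁ V) :
    letI := ((X.fromSpecStalk x).appLE V ⊤ e).hom.toAlgebra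
    IsLocalization.AtPrime Γ(Spec (X.presheaf.stalk x), ⊤) (hV.primeIdealOf ⟨x, hx⟩).asIdeal := by
  have h1 := hV.isLocalization_stalk ⟨x, hx⟩
  let := X.presheaf.algebra_section_stalk (⟨x, hx⟩ : V)
  let := ((X.fromSpecStalk x).appLE V ⊤ e).hom.toAlgebra
  refine IsLocalization.isLocalization_of_algEquiv
    (hV.primeIdealOf ⟨x, hx⟩).asIdeal.primeCompl (S := X.presheaf.stalk x)
    (AlgEquiv.ofRingEquiv (f := (Scheme.ΓSpecIso (X.presheaf.stalk x)).symm.commRingCatIsoToRingEquiv) fun r => ?_)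
  exact congr($(appLE_fromSpecStalk hx e) r).symm

lemma evalPoint_surjective_of_surjective {A : CommRingCat.{u}} {p : Spec A ⟶ Spec (CommRingCat.of k)}
    (φ : A ⟶ CommRingCat.of K) (hφ : Function.Surjective φ)
    (h : (Spec.map φ : Spec (CommRingCat.of K) ⟶ (Over.mk p).left) (IsLocalRing.closedPoint K) ∈
      (⊤ : (Spec A).Opens)) :
    Function.Surjective (evalPoint (S := Over.mk p) (Spec.map φ) h) := by
  have h1 : (Spec.map φ).appLE ⊤ ⊤ (top_le_preimage_of_mem (S := Over.mk p) (Spec.map φ) h) ≫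
      (Scheme.ΓSpecIso (CommRingCat.of K)).hom = (Scheme.ΓSpecIso A).hom ≫ φ := by
    rw [← Scheme.ΓSpecIso_naturality, Scheme.Hom.appTop, Scheme.Hom.app_eq_appLE]
    rfl
  intro y
  obtain ⟨z, rfl⟩ := hφ y
  refine ⟨(Scheme.ΓSpecIso A).inv z, ?_⟩
  refine (congr($h1 ((Scheme.ΓSpecIso A).inv z))).trans ?_
  rw [CommRingCat.comp_apply, Iso.inv_hom_id_apply]

/-- The spectrum of the local ring of `S` at a point, over `S`. -/
def stalkScheme (S : Over (Spec (CommRingCat.of k))) (x : S.left) : Over (Spec (CommRingCat.of k)) :=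
  Over.mk (S.left.fromSpecStalk x ≫ S.hom)

/-- The morphism from the spectrum of a local ring of `S` to `S`. -/
def fromStalk (S : Over (Spec (CommRingCat.of k))) (x : S.left) : stalkScheme S x ⟶ S :=
  Over.homMk (S.left.fromSpecStalk x)

/-- The spectrum of a local ring, as an affine open subset of itself. -/
def stalkTop (S : Over (Spec (CommRingCat.of k))) (x : S.left) : (stalkScheme S x).left.affineOpens :=
  ⟨⊤, isAffineOpen_top (Spec (S.left.presheaf.stalk x))⟩

/-- The family is pulled back to the spectrum of the local ring, where it stays flat. The residue
field is infinite because it contains `k`. -/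
lemma exists_isZeroLocusOn_stalk [Infinite k] {D : (plane S).IdealSheafData}
    (hD : IsCubicFamily D) (x : S.left) :
    ∃ F : MvPolynomial (Fin 3) Γ((stalkScheme S x).left, (stalkTop S x).1), F.IsHomogeneous 3 ∧
      (∃ m, IsUnit (F.coeff m)) ∧
        IsZeroLocusOn (D.comap (planeMap (fromStalk S x))) (stalkTop S x) F := by
  let A := S.left.presheaf.stalk x
  let K := IsLocalRing.ResidueField A
  let φ : A ⟶ CommRingCat.of K := CommRingCat.ofHom (IsLocalRing.residue A)
  let t : Spec (CommRingCat.of K) ⟶ (stalkScheme S x).left := Spec.map φ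
  have : Infinite K := infinite_of_hom (t ≫ (stalkScheme S x).hom)
  have : IsLocalRing Γ((stalkScheme S x).left, (stalkTop S x).1) :=
    (Scheme.ΓSpecIso A).symm.commRingCatIsoToRingEquiv.isLocalRing
  refine exists_isZeroLocusOn_of_isLocalRing (flat_comap hD.1.1 _) (stalkTop S x) t trivial ?_ ?_
  · exact evalPoint_surjective_of_surjective (p := (stalkScheme S x).hom) φ
      IsLocalRing.residue_surjective trivial
  · have := IsCubicFamily.isCubic_comap hD.2
      ((Over.homMk t : fieldPoint K t ⟶ stalkScheme S x) ≫ fromStalk S x)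
    rw [planeMap_comp, Scheme.IdealSheafData.comap_comp] at this
    exact this

end LocalScheme

end

end SingularCubics
namespace SingularCubics

noncomputable section

attribute [local instance] MvPolynomial.gradedAlgebra

/-! ### Local structure of flat families of cubics -/

section Spreading

/-- A polynomial ring over a localisation is the localisation of the polynomial ring at the
constants from `M`, so each of the finitely many generators needs one denominator. -/
lemma exists_C_mul_mem_of_fg {R A : Type*} [CommRing R] [CommRing A] [Algebra R A] (M : Submonoid R)
    [IsLocalization M A] {σ : Type*} {J K : Ideal (MvPolynomial σ R)} (hJ : J.FG)
    (h : J.map (MvPolynomial.map (algebraMap R A)) ≤ K.map (MvPolynomial.map (algebraMap R A))) :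
    ∃ u ∈ M, ∀ G ∈ J, MvPolynomial.C u * G ∈ K := by
  classical
  let := MvPolynomial.algebraMvPolynomial (R := R) (S := A) (σ := σ)
  have key (G : MvPolynomial σ R) (hG : G ∈ J) : ∃ u ∈ M, MvPolynomial.C u * G ∈ K := by
    obtain ⟨_, ⟨u, hu, rfl⟩, h1⟩ := (IsLocalization.algebraMap_mem_map_algebraMap_iff
      (M.map (MvPolynomial.C (σ := σ))) (MvPolynomial σ A) K G).mp (h (Ideal.mem_map_of_mem _ hG))
    exact ⟨u, hu, h1⟩
  obtain ⟨s, rfl⟩ := hJ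
  choose! u hu hG using key
  refine ⟨∏ G ∈ s, u G, prod_mem fun G hGs => hu G (Submodule.subset_span hGs), fun G hGJ => ?_⟩
  suffices hle : Ideal.span (s : Set (MvPolynomial σ R)) ≤
      Submodule.comap (LinearMap.mulLeft (MvPolynomial σ R) (MvPolynomial.C (∏ G ∈ s, u G))) K from
    hle hGJ
  rw [Ideal.span, Submodule.span_le]
  intro G hGs
  change MvPolynomial.C (∏ G ∈ s, u G) * G ∈ K
  rw [← Finset.prod_erase_mul s u hGs, map_mul, mul_assoc]
  exact Ideal.mul_mem_left _ _ (hG G (Submodule.subset_span hGs))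

/-- Spreading out: denominators of the form and of both inclusions of ideals are cleared. Once the
single element `w` is inverted, the form generates the ideals and its coefficient at `m`, a divisor
of `w`, becomes a unit. -/
lemma exists_cubicForm_of_localization {R A : Type*} [CommRing R] [CommRing A] [Algebra R A]
    (M : Submonoid R) [IsLocalization M A] {F' : MvPolynomial (Fin 3) A} (hF' : F'.IsHomogeneous 3)
    (hd : ∃ d, IsUnit (F'.coeff d)) {J : Fin 3 → Ideal (MvPolynomial (Fin 3) R)}
    (hJ : ∀ i, (J i).FG) (hJF : ∀ i, (J i).map (MvPolynomial.map (algebraMap R A)) =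
      Ideal.span {F', MvPolynomial.X i - 1}) :
    ∃ (F : MvPolynomial (Fin 3) R) (m : CubicMonomial) (w : R), F.IsHomogeneous 3 ∧
      IsUnit (algebraMap R A w) ∧ F.coeff (exponent m) ∣ w ∧
      (∀ i, ∀ G ∈ J i, MvPolynomial.C w * G ∈ Ideal.span {F, MvPolynomial.X i - 1}) ∧
      ∀ i, MvPolynomial.C w * F ∈ J i := by
  obtain ⟨m, hd⟩ : ∃ m, IsUnit (F'.coeff (exponent m)) := by
    obtain ⟨d, hd⟩ := hd
    by_cases h3 : d.degree = 3
    · obtain ⟨m, rfl⟩ := exists_exponent_eq h3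
      exact ⟨m, hd⟩
    -- A unit coefficient outside degree `3` is zero, so `A` is the zero ring and any monomial will
    -- do.
    · rw [hF'.coeff_eq_zero h3, isUnit_zero_iff] at hd
      have := subsingleton_of_zero_eq_one hd
      exact ⟨Sym.replicate 3 0, isUnit_of_subsingleton _⟩
  obtain ⟨b, hb⟩ := IsLocalization.exist_integer_multiples_of_finite M
    (fun m => F'.coeff (exponent m) : CubicMonomial → A)
  choose a ha using hb
  have hFF' : MvPolynomial.map (algebraMap R A) (cubicForm a) =
      MvPolynomial.C (algebraMap R A b.1) * F' := by
    rw [map_cubicForm, ← cubicForm_coeff hF', C_mul_cubicForm]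
    congr 1
    funext m
    rw [ha, Algebra.smul_def]
  have hbu : IsUnit (algebraMap R A b.1) := IsLocalization.map_units A b
  have ham : IsUnit (algebraMap R A (a m)) := by
    rw [ha, Algebra.smul_def]
    exact hbu.mul hd
  have hpoly (i : Fin 3) : (J i).map (MvPolynomial.map (algebraMap R A)) =
      (Ideal.span {cubicForm a, MvPolynomial.X i - 1}).map
        (MvPolynomial.map (algebraMap R A)) := by
    rw [hJF, Ideal.map_span, Set.image_pair, hFF', map_sub, map_one,
      MvPolynomial.map_X, Ideal.span_insert, Ideal.span_insert,
      Ideal.span_singleton_mul_left_unit (hbu.map MvPolynomial.C)]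
  have hu (i : Fin 3) := exists_C_mul_mem_of_fg M (hJ i) (hpoly i).le
  have hv (i : Fin 3) := exists_C_mul_mem_of_fg M
    (Submodule.fg_span (Set.toFinite {cubicForm a, MvPolynomial.X i - 1})) (hpoly i).ge
  choose u hu hu' using hu
  choose v hv hv' using hv
  have hdu (i : Fin 3) : ∃ r, a m * (∏ i, u i) * ∏ i, v i = r * u i := by
    obtain ⟨r, hr⟩ := Finset.dvd_prod_of_mem u (Finset.mem_univ i)
    exact ⟨a m * r * ∏ i, v i, by rw [hr]; ring⟩
  have hdv (i : Fin 3) : ∃ r, a m * (∏ i, u i) * ∏ i, v i = r * v i := by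
    obtain ⟨r, hr⟩ := Finset.dvd_prod_of_mem v (Finset.mem_univ i)
    exact ⟨a m * (∏ i, u i) * r, by rw [hr]; ring⟩
  refine ⟨cubicForm a, m, a m * (∏ i, u i) * ∏ i, v i, cubicForm_isHomogeneous a, ?_, ?_,
    fun i G hG => ?_, fun i => ?_⟩
  · rw [map_mul, map_mul]
    refine (ham.mul ?_).mul ?_
    · exact IsLocalization.map_units A (⟨∏ i, u i, prod_mem fun i _ => hu i⟩ : M)
    · exact IsLocalization.map_units A (⟨∏ i, v i, prod_mem fun i _ => hv i⟩ : M)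
  · rw [coeff_cubicForm, mul_assoc]
    exact dvd_mul_right _ _
  · obtain ⟨r, hr⟩ := hdu i
    rw [hr, map_mul, mul_assoc]
    exact Ideal.mul_mem_left _ _ (hu' i G hG)
  · obtain ⟨r, hr⟩ := hdv i
    rw [hr, map_mul, mul_assoc]
    exact Ideal.mul_mem_left _ _ (hv' i _ (Ideal.subset_span (Set.mem_insert _ _)))

variable {k : Type u} [Field k] {S T : Over (Spec (CommRingCat.of k))}

/-- The polynomials over `Γ(S, V)` whose dehomogenisation on the chart `xᵢ ≠ 0` vanishes on `D`. -/
def polyIdeal (D : (plane S).IdealSheafData) (i : Fin 3) (V : S.left.affineOpens) :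
    Ideal (MvPolynomial (Fin 3) Γ(S.left, V.1)) :=
  (chartIdeal D i V).comap (chartDehom S i V.1)

lemma map_polyIdeal (D : (plane S).IdealSheafData) (i : Fin 3) (V : S.left.affineOpens) :
    (polyIdeal D i V).map (chartDehom S i V.1) = chartIdeal D i V :=
  Ideal.map_comap_of_surjective _ (dehom_surjective i V.2) _

lemma X_sub_one_mem_polyIdeal (D : (plane S).IdealSheafData) (i : Fin 3) (V : S.left.affineOpens) :
    MvPolynomial.X i - 1 ∈ polyIdeal D i V := by
  rw [polyIdeal, Ideal.mem_comap, map_sub, map_one, chartDehom_X_self, sub_self]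
  exact zero_mem _

/-- The restriction of a base change morphism `ℙ²_T ⟶ ℙ²_S` to charts, on functions. -/
def chartMap (g : T ⟶ S) (i : Fin 3) {V : S.left.Opens} {W : T.left.Opens}
    (e : W ≤ g.left ⁻¹ᵁ V) : Γ(plane S, chartOver S i V) →+* Γ(plane T, chartOver T i W) :=
  ((planeMap g).appLE _ _ (chartOver_le_preimage g i e)).hom

lemma chartMap_chartDehom (g : T ⟶ S) (i : Fin 3) {V : S.left.Opens} {W : T.left.Opens}
    (e : W ≤ g.left ⁻¹ᵁ V) (G : MvPolynomial (Fin 3) Γ(S.left, V)) :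
    chartMap g i e (chartDehom S i V G) =
      chartDehom T i W (G.map (g.left.appLE V W e).hom) :=
  appLE_dehom g _ e (chartOver_le_chart i _) (chartOver_le_chart i _)
    (chartOver_le_base i _) (chartOver_le_base i _) G

lemma chartIdeal_comap (D : (plane S).IdealSheafData) (g : T ⟶ S) (i : Fin 3)
    {V : S.left.affineOpens} {W : T.left.affineOpens} (e : W.1 ≤ g.left ⁻¹ᵁ V.1) :
    chartIdeal (D.comap (planeMap g)) i W = (chartIdeal D i V).map (chartMap g i e) :=
  ideal_comap D (planeMap g) (affineChart i W) (affineChart i V) (chartOver_le_preimage g i e)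

/-- Ideals of polynomials are used in place of ideals of chart rings because base change acts on
them through the coefficients. The kernel of dehomogenisation adds nothing, as `xᵢ - 1` is already
in the extended ideal. -/
lemma polyIdeal_comap (D : (plane S).IdealSheafData) (g : T ⟶ S) (i : Fin 3)
    (V : S.left.affineOpens) (W : T.left.affineOpens) (e : W.1 ≤ g.left ⁻¹ᵁ V.1) :
    polyIdeal (D.comap (planeMap g)) i W =
      (polyIdeal D i V).map (MvPolynomial.map (g.left.appLE V W e).hom) := by
  have h1 : chartIdeal (D.comap (planeMap g)) i W =
      ((polyIdeal D i V).map (MvPolynomial.map (g.left.appLE V W e).hom)).map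
        (chartDehom T i W.1) := by
    rw [chartIdeal_comap D g i e, ← map_polyIdeal, Ideal.map_map, Ideal.map_map]
    exact congrArg (fun φ => Ideal.map φ (polyIdeal D i V))
      (RingHom.ext fun G => chartMap_chartDehom g i e G)
  rw [polyIdeal, h1, Ideal.comap_map_of_surjective' _ (dehom_surjective i W.2),
    ker_chartDehom i W.2, sup_eq_left, Ideal.span_singleton_le_iff_mem]
  have := Ideal.mem_map_of_mem (MvPolynomial.map (g.left.appLE V W e).hom)
    (X_sub_one_mem_polyIdeal D i V)
  rwa [map_sub, map_one, MvPolynomial.map_X] at this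

lemma IsZeroLocusOn.polyIdeal_eq {D : (plane S).IdealSheafData} {V : S.left.affineOpens}
    {F : MvPolynomial (Fin 3) Γ(S.left, V)} (h : IsZeroLocusOn D V F) (i : Fin 3) :
    polyIdeal D i V = Ideal.span {F, MvPolynomial.X i - 1} := by
  rw [polyIdeal, h.chartIdeal_eq, ← Set.image_singleton, ← Ideal.map_span,
    Ideal.comap_map_of_surjective' _ (dehom_surjective i V.2), ker_chartDehom i V.2,
    ← Ideal.span_union, Set.singleton_union]

/-- The kernel of a surjection from a polynomial ring onto a finitely presented algebra is finitely
generated; this is where local finite presentation of `D` over `S` enters. -/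
lemma fg_polyIdeal {D : (plane S).IdealSheafData}
    (hD : LocallyOfFinitePresentation (D.subschemeι ≫ toBase S)) (i : Fin 3)
    (V : S.left.affineOpens) : (polyIdeal D i V).FG := by
  have h := Scheme.Hom.finitePresentation_appLE (D.subschemeι ≫ toBase S) V.2
    (subschemeChart D i V).2 (subschemeChart_le D i V)
  rw [appLE_subschemeChart, ← chartDehom_comp_C] at h
  let B := Γ(D.subscheme, (subschemeChart D i V).1)
  let φ : MvPolynomial (Fin 3) Γ(S.left, V.1) →+* B := (chartRestrict D i V).comp (chartDehom S i V.1)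
  let := (φ.comp MvPolynomial.C).toAlgebra
  have hfp : Algebra.FinitePresentation Γ(S.left, V.1) B := h
  have h1 := Algebra.FinitePresentation.ker_fG_of_surjective
    ({ φ with commutes' := fun r => rfl } : MvPolynomial (Fin 3) Γ(S.left, V.1) →ₐ[Γ(S.left, V.1)] B)
    ((chartRestrict_surjective D i V).comp (dehom_surjective i V.2))
  have h2 : polyIdeal D i V = RingHom.ker φ := by
    rw [← RingHom.comap_ker, ker_chartRestrict]
    rfl
  rw [h2]
  exact h1

lemma polyIdeal_restrict (D : (plane S).IdealSheafData) (i : Fin 3) {V W : S.left.affineOpens}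
    (h : W.1 ≤ V.1) : polyIdeal D i W =
      (polyIdeal D i V).map (MvPolynomial.map (S.left.presheaf.map (homOfLE h).op).hom) := by
  have h1 : W.1 ≤ (𝟙 S : S ⟶ S).left ⁻¹ᵁ V.1 := h
  have h2 := polyIdeal_comap D (𝟙 S) i V W h1
  rw [planeMap_id, Scheme.IdealSheafData.comap_id] at h2
  rw [h2]
  congr 3

lemma isZeroLocusOn_of_polyIdeal_eq {D : (plane S).IdealSheafData} {V : S.left.affineOpens}
    {F : MvPolynomial (Fin 3) Γ(S.left, V)}
    (h : ∀ i, polyIdeal D i V = Ideal.span {F, MvPolynomial.X i - 1}) : IsZeroLocusOn D V F := by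
  intro i
  refine (map_polyIdeal D i V).symm.trans ?_
  rw [h, Ideal.map_span, Set.image_pair, map_sub, map_one, chartDehom_X_self, sub_self,
    Set.pair_comm, Ideal.span_insert_zero]

/-- The equation found over the local ring at `x` spreads out to the basic open neighbourhood of `x`
where `w` is invertible; dividing by the unit coefficient normalises it. -/
lemma IsCubicFamily.isLocallyCubicForm [Infinite k] {D : (plane S).IdealSheafData}
    (hD : IsCubicFamily D) : IsLocallyCubicForm D := by
  intro x
  obtain ⟨V₀, hx, -⟩ := exists_affineOpens_mem_le x (U := ⊤) trivial
  obtain ⟨F', hF', hd, h'⟩ := exists_isZeroLocusOn_stalk hD x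
  have e : (stalkTop S x).1 ≤ (fromStalk S x).left ⁻¹ᵁ V₀.1 := top_le_fromSpecStalk_preimage hx
  obtain ⟨F, m, w, hF, hw, hm, hJ, hFJ⟩ : ∃ (F : MvPolynomial (Fin 3) Γ(S.left, V₀.1))
      (m : CubicMonomial) (w : Γ(S.left, V₀.1)), F.IsHomogeneous 3 ∧
      IsUnit ((fromStalk S x).left.appLE V₀ (stalkTop S x) e w) ∧ F.coeff (exponent m) ∣ w ∧
      (∀ i, ∀ G ∈ polyIdeal D i V₀, MvPolynomial.C w * G ∈
        Ideal.span {F, MvPolynomial.X i - 1}) ∧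
      ∀ i, MvPolynomial.C w * F ∈ polyIdeal D i V₀ := by
    let := ((fromStalk S x).left.appLE V₀ (stalkTop S x) e).hom.toAlgebra
    have hloc : IsLocalization.AtPrime Γ((stalkScheme S x).left, (stalkTop S x).1)
        (V₀.2.primeIdealOf ⟨x, hx⟩).asIdeal := isLocalization_appLE_fromSpecStalk V₀.2 hx e
    exact exists_cubicForm_of_localization (V₀.2.primeIdealOf ⟨x, hx⟩).asIdeal.primeCompl hF' hd
      (fun i => fg_polyIdeal hD.1.2 i V₀) fun i => (polyIdeal_comap D (fromStalk S x) i V₀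
        (stalkTop S x) e).symm.trans (h'.polyIdeal_eq i)
  let V : S.left.affineOpens := S.left.affineBasicOpen w
  have hV : V.1 ≤ V₀.1 := S.left.basicOpen_le w
  have hxV : x ∈ V.1 := by
    refine (S.left.mem_basicOpen w x hx).mpr ?_
    have h1 := congr($(appLE_fromSpecStalk hx e) w)
    have h2 : IsUnit ((Scheme.ΓSpecIso (S.left.presheaf.stalk x)).inv
      (S.left.presheaf.germ V₀.1 x hx w)) := by
        rw [CommRingCat.comp_apply] at h1
        rw [← h1]
        exact hw
    exact (isUnit_map_iff (Scheme.ΓSpecIso (S.left.presheaf.stalk x)).inv.hom _).mp h2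
  let ρ : Γ(S.left, V₀.1) →+* Γ(S.left, V.1) := (S.left.presheaf.map (homOfLE hV).op).hom
  have hρw : IsUnit (ρ w) := RingedSpace.isUnit_res_basicOpen _ w
  obtain ⟨c, hc⟩ : IsUnit (ρ (F.coeff (exponent m))) := isUnit_of_dvd_unit (map_dvd ρ hm) hρw
  have hmap {J K : Ideal (MvPolynomial (Fin 3) Γ(S.left, V₀.1))}
      (h : ∀ G ∈ J, MvPolynomial.C w * G ∈ K) :
      J.map (MvPolynomial.map ρ) ≤ K.map (MvPolynomial.map ρ) := by
    rw [Ideal.map_le_iff_le_comap]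
    intro G hG
    have h1 := Ideal.mem_map_of_mem (MvPolynomial.map ρ) (h G hG)
    rw [map_mul, MvPolynomial.map_C] at h1
    exact (Ideal.unit_mul_mem_iff_mem _ (hρw.map MvPolynomial.C)).mp h1
  have hspan (i : Fin 3) : ∀ G ∈ Ideal.span {F, MvPolynomial.X i - 1},
      MvPolynomial.C w * G ∈ polyIdeal D i V₀ := by
    intro G hG
    obtain ⟨a, b, rfl⟩ := Ideal.mem_span_pair.mp hG
    rw [mul_add, mul_left_comm _ a, mul_left_comm _ b]
    exact add_mem (Ideal.mul_mem_left _ _ (hFJ i)) (Ideal.mul_mem_left _ _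
      (Ideal.mul_mem_left _ _ (X_sub_one_mem_polyIdeal D i V₀)))
  refine ⟨V, hxV, MvPolynomial.C ((c⁻¹ : Units _) : Γ(S.left, V.1)) * MvPolynomial.map ρ F, m,
    (hF.map ρ).C_mul _, ?_, isZeroLocusOn_of_polyIdeal_eq fun i => ?_⟩
  · rw [MvPolynomial.coeff_C_mul, MvPolynomial.coeff_map, ← hc, Units.inv_mul]
  · rw [polyIdeal_restrict D i hV]
    refine (le_antisymm (hmap (hJ i)) (hmap (hspan i))).trans ?_
    rw [Ideal.map_span, Set.image_pair, map_sub, map_one, MvPolynomial.map_X, Ideal.span_insert,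
      Ideal.span_insert, Ideal.span_singleton_mul_left_unit (c⁻¹.isUnit.map MvPolynomial.C)]

lemma isCubicFamily_iff [Infinite k] {D : (plane S).IdealSheafData} :
    IsCubicFamily D ↔ IsLocallyCubicForm D :=
  ⟨fun h => h.isLocallyCubicForm, fun h => h.isCubicFamily⟩

lemma mem_hilbertPoints_iff [Infinite k] {D : (plane S).IdealSheafData} :
    D ∈ hilbertPoints S ↔ IsLocallyCubicForm D := by
  rw [← isCubicFamily_iff]
  exact and_congr_right fun _ => forall_congr' fun K => forall_congr' fun _ =>
    forall_congr' fun t => hasHilbertPolynomial_iff_isCubic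

end Spreading

end

end SingularCubics
namespace SingularCubics

noncomputable section

attribute [local instance] MvPolynomial.gradedAlgebra

/-! ### Representability of the Hilbert functor -/

/-- Stability under pullback need not be assumed: every element of `P` is a pullback of `x`, hence
so are its own pullbacks. -/
lemma isRepresentedBy_of_bijective {C : Type*} [Category.{u} C] {F : Cᵒᵖ ⥤ Type u}
    {P : ∀ S : C, Set (F.obj (op S))} {X : C} {x : F.obj (op X)}
    (hx : ∀ {S : C} (g : S ⟶ X), F.map g.op x ∈ P S)
    (hinj : ∀ {S : C} {g g' : S ⟶ X}, F.map g.op x = F.map g'.op x → g = g')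
    (hsurj : ∀ {S : C} {y : F.obj (op S)}, y ∈ P S → ∃ g : S ⟶ X, F.map g.op x = y) :
    IsRepresentedBy P X x := by
  let G : Subfunctor F :=
    { obj := fun U => P U.unop
      map := by
        intro U V i y hy
        obtain ⟨g, rfl⟩ := hsurj hy
        have := hx (i.unop ≫ g)
        rw [op_comp, F.map_comp] at this
        exact this }
  let r : G.toFunctor.RepresentableBy X :=
    { homEquiv := fun {S} => Equiv.ofBijective (fun g => ⟨F.map g.op x, hx g⟩)
        ⟨fun g g' h => hinj (congrArg Subtype.val h), fun y => by
          obtain ⟨g, hg⟩ := hsurj y.2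
          exact ⟨g, Subtype.ext hg⟩⟩
      homEquiv_comp := by
        intro S T f g
        refine Subtype.ext ?_
        change F.map (f ≫ g).op x = F.map f.op (F.map g.op x)
        rw [op_comp, F.map_comp]
        rfl }
  refine ⟨G, fun S => rfl, r, ?_⟩
  change F.map (𝟙 X).op x = x
  rw [op_id, F.map_id]
  rfl

lemma isRepresentedBy_hilbertPoints (k : Type u) [Field k] [Infinite k] :
    IsRepresentedBy (F := closedSubschemes k) hilbertPoints (spaceOfCubics k) (universalCubic k) :=
  isRepresentedBy_of_bijective (F := closedSubschemes k)
    (fun g => mem_hilbertPoints_iff.mpr (isLocallyCubicForm_comap g))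
    (fun h => hom_ext_of_comap_eq h)
    (fun hy => exists_comap_eq (mem_hilbertPoints_iff.mp hy))

end

end SingularCubics
-- The critical locus is where the partial derivatives vanish; representability of `SC`.
namespace SingularCubics

noncomputable section

attribute [local instance] MvPolynomial.gradedAlgebra

/-! ### Bounding Fitting ideals -/

section Minors

variable {B : Type*} [CommRing B]

/-- The adjugate gives `det N • h = 0`, and pairing with `g` recovers `det N`. -/
lemma det_eq_zero_of_mulVec_eq_zero {n : Type*} [Fintype n] [DecidableEq n] {N : Matrix n n B}
    {h g : n → B} (hN : N.mulVec h = 0) (hg : g ⬝ᵥ h = 1) : N.det = 0 := by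
  have h1 : N.det • h = 0 := by
    have := Matrix.mulVec_mulVec h N.adjugate N
    rw [hN, Matrix.mulVec_zero, Matrix.adjugate_mul, Matrix.smul_mulVec, Matrix.one_mulVec] at this
    exact this.symm
  rw [← mul_one N.det, ← hg, ← smul_eq_mul, ← dotProduct_smul, h1, dotProduct_zero]

/-- A matrix with one more column than rows that kills two independent vectors has vanishing maximal
minors. A row `w` is added below, and linearity of the determinant in `w` is used. -/
lemma det_submatrix_eq_zero {n : Type*} [Fintype n] [DecidableEq n]
    {r : Matrix n (n ⊕ Unit) B} {h₁ h₂ g₁ g₂ : n ⊕ Unit → B} (hr₁ : r.mulVec h₁ = 0)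
    (hr₂ : r.mulVec h₂ = 0) (h11 : g₁ ⬝ᵥ h₁ = 1) (h22 : g₂ ⬝ᵥ h₂ = 1) (h12 : g₁ ⬝ᵥ h₂ = 0) :
    (r.submatrix id Sum.inl).det = 0 := by
  let N (w : n ⊕ Unit → B) : Matrix (n ⊕ Unit) (n ⊕ Unit) B :=
    (Matrix.of (Sum.elim r fun _ => 0)).updateRow (Sum.inr ()) w
  have hNl (w : n ⊕ Unit → B) (a : n) : N w (Sum.inl a) = r a := Matrix.updateRow_ne Sum.inl_ne_inr
  have hNr (w : n ⊕ Unit → B) : N w (Sum.inr ()) = w := Matrix.updateRow_self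
  have hzero {w h g : n ⊕ Unit → B} (hr : r.mulVec h = 0) (hg : g ⬝ᵥ h = 1) (hw : w ⬝ᵥ h = 0) :
      (N w).det = 0 := by
    refine det_eq_zero_of_mulVec_eq_zero (h := h) (g := g) (funext fun a => ?_) hg
    rcases a with a | a
    · exact (congrArg (· ⬝ᵥ h) (hNl w a)).trans (congrFun hr a)
    · exact (congrArg (· ⬝ᵥ h) (hNr w)).trans hw
  -- For this last row the determinant is the minor in question. It splits as `w = (w - (w · h₁) g₁)
  -- + (w · h₁) g₁`: with the first summand as last row the matrix kills `h₁`, and with `g₁` it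
  -- kills `h₂`.
  let w : n ⊕ Unit → B := Pi.single (Sum.inr ()) 1
  have h1 : (N (w - (w ⬝ᵥ h₁) • g₁)).det = 0 := by
    refine hzero hr₁ h11 ?_
    rw [sub_dotProduct, smul_dotProduct, h11, smul_eq_mul, mul_one, sub_self]
  have h2 : (N g₁).det = 0 := hzero hr₂ h22 h12
  have h3 : (N w).det = 0 := by
    have h4 := Matrix.det_updateRow_add (Matrix.of (Sum.elim r fun _ => 0)) (Sum.inr ())
      (w - (w ⬝ᵥ h₁) • g₁) ((w ⬝ᵥ h₁) • g₁)
    rw [sub_add_cancel, Matrix.det_updateRow_smul] at h4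
    refine h4.trans ?_
    change (N _).det + _ * (N _).det = 0
    rw [h1, h2, mul_zero, add_zero]
  have h5 : N w = Matrix.fromBlocks (r.submatrix id Sum.inl) (r.submatrix id Sum.inr) 0 1 := by
    ext a b
    rcases a with a | a
    · refine (congrFun (hNl w a) b).trans ?_
      rcases b with b | b <;> rfl
    · refine (congrFun (hNr w) b).trans ?_
      rcases b with b | b
      · simp [w]
      · simp [w]
  rwa [h5, Matrix.det_fromBlocks_zero₂₁, Matrix.det_one, mul_one] at h3

lemma det_of_comp_eq_zero {m : ℕ} {r : Fin m → Fin (m + 1) → B} {h₁ h₂ g₁ g₂ : Fin (m + 1) → B}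
    (hr₁ : ∀ i, ∑ j, r i j * h₁ j = 0) (hr₂ : ∀ i, ∑ j, r i j * h₂ j = 0)
    (h11 : ∑ j, g₁ j * h₁ j = 1) (h22 : ∑ j, g₂ j * h₂ j = 1) (h12 : ∑ j, g₁ j * h₂ j = 0)
    (c : Fin m → Fin (m + 1)) : (Matrix.of fun i j => r i (c j)).det = 0 := by
  by_cases hc : Function.Injective c
  · obtain ⟨a, ha⟩ : ∃ a, ∀ j, c j ≠ a := by
      by_contra! h
      have := Fintype.card_le_of_surjective c h
      simp at this
    have hbij : Function.Bijective (Sum.elim c fun _ : Unit => a) := by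
      rw [Fintype.bijective_iff_injective_and_card]
      refine ⟨hc.sumElim (Function.injective_of_subsingleton _) fun j _ => ha j, by simp⟩
    let e := Equiv.ofBijective _ hbij
    have hsum (f : Fin (m + 1) → B) : ∑ j, f (e j) = ∑ j, f j := e.sum_comp f
    exact det_submatrix_eq_zero (r := Matrix.of fun i j => r i (e j)) (h₁ := h₁ ∘ e) (h₂ := h₂ ∘ e)
      (g₁ := g₁ ∘ e) (g₂ := g₂ ∘ e)
      (funext fun i => (hsum fun j => r i j * h₁ j).trans (hr₁ i))
      (funext fun i => (hsum fun j => r i j * h₂ j).trans (hr₂ i))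
      ((hsum fun j => g₁ j * h₁ j).trans h11) ((hsum fun j => g₂ j * h₂ j).trans h22)
      ((hsum fun j => g₁ j * h₂ j).trans h12)
  · rw [Function.not_injective_iff] at hc
    obtain ⟨i, j, hij, hne⟩ := hc
    exact Matrix.det_zero_of_column_eq hne fun l => by simp [hij]

/-- After base change to `B` the module has a free quotient of rank two, whose first Fitting ideal
is zero. Concretely, the values of the two functionals on the generators are independent vectors
killed by every matrix of relations. -/
lemma fittingIdeal_le_ker {R : Type u} [CommRing R] {M : Type u} [AddCommGroup M] [Module R M]
    (π : R →+* B) (ℓ₁ ℓ₂ : M →ₛₗ[π] B) {x₁ x₂ : M} (h11 : ℓ₁ x₁ = 1) (h22 : ℓ₂ x₂ = 1)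
    (h12 : ℓ₂ x₁ = 0) : fittingIdeal R M 1 ≤ RingHom.ker π := by
  rw [fittingIdeal, Ideal.span_le]
  rintro _ ⟨m, g, hg, r, hr, c, rfl⟩
  have hx (x : M) : ∃ b : Fin (m + 1) → R, ∑ j, b j • g j = x :=
    (Submodule.mem_span_range_iff_exists_fun R).mp (hg ▸ Submodule.mem_top)
  obtain ⟨b₁, hb₁⟩ := hx x₁
  obtain ⟨b₂, hb₂⟩ := hx x₂
  have hℓ (ℓ : M →ₛₗ[π] B) (b : Fin (m + 1) → R) :
      ∑ j, π (b j) * ℓ (g j) = ℓ (∑ j, b j • g j) := by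
    rw [map_sum]
    exact Finset.sum_congr rfl fun j _ => (ℓ.map_smulₛₗ _ _).symm
  rw [SetLike.mem_coe, RingHom.mem_ker, RingHom.map_det]
  refine det_of_comp_eq_zero (r := fun i j => π (r i j)) (h₁ := fun j => ℓ₁ (g j))
    (h₂ := fun j => ℓ₂ (g j)) (g₁ := fun j => π (b₁ j)) (g₂ := fun j => π (b₂ j))
    (fun i => ?_) (fun i => ?_) ?_ ?_ ?_ c
  · rw [hℓ, hr, map_zero]
  · rw [hℓ, hr, map_zero]
  · rw [hℓ, hb₁, h11]
  · rw [hℓ, hb₂, h22]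
  · rw [hℓ, hb₁, h12]

end Minors

end

end SingularCubics
namespace SingularCubics

noncomputable section

attribute [local instance] MvPolynomial.gradedAlgebra

/-! ### The Fitting ideal of the differentials of a plane curve -/

section Differentials

open scoped KaehlerDifferential

/-- The ideal generated by the partial derivatives of a ternary form. -/
def jacobianIdeal {R B : Type*} [CommRing R] [CommRing B] (β : MvPolynomial (Fin 3) R →+* B)
    (F : MvPolynomial (Fin 3) R) : Ideal B :=
  Ideal.span (Set.range fun j => β (MvPolynomial.pderiv j F))

lemma pderiv_mem_jacobianIdeal {R B : Type*} [CommRing R] [CommRing B]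
    (β : MvPolynomial (Fin 3) R →+* B) (F : MvPolynomial (Fin 3) R) (j : Fin 3) :
    β (MvPolynomial.pderiv j F) ∈ jacobianIdeal β F :=
  Ideal.subset_span ⟨j, rfl⟩

/-- For `l ≠ i` the partial derivative with respect to `xₗ` kills `xᵢ - 1`, and it maps `F` into the
jacobian ideal, so it descends to a derivation of `B` modulo that ideal. -/
lemma exists_derivation {R B : Type*} [CommRing R] [CommRing B] [Algebra R B]
    {β : MvPolynomial (Fin 3) R →+* B} (hβ : Function.Surjective β)
    (hC : ∀ r, β (MvPolynomial.C r) = algebraMap R B r) {i : Fin 3} {F : MvPolynomial (Fin 3) R}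
    (hker : RingHom.ker β = Ideal.span {F, MvPolynomial.X i - 1}) {l : Fin 3} (hl : l ≠ i) :
    ∃ δ : Derivation R B (B ⧸ jacobianIdeal β F), ∀ P,
      δ (β P) = Ideal.Quotient.mk _ (β (MvPolynomial.pderiv l P)) := by
  let d (P : MvPolynomial (Fin 3) R) : B ⧸ jacobianIdeal β F :=
    Ideal.Quotient.mk _ (β (MvPolynomial.pderiv l P))
  have hF : β F = 0 := by
    rw [← RingHom.mem_ker, hker]
    exact Ideal.subset_span (Set.mem_insert _ _)
  have hX : β (MvPolynomial.X i - 1) = 0 := by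
    rw [← RingHom.mem_ker, hker]
    exact Ideal.subset_span (Set.mem_insert_of_mem _ rfl)
  have hdF : Ideal.Quotient.mk (jacobianIdeal β F) (β (MvPolynomial.pderiv l F)) = 0 :=
    Ideal.Quotient.eq_zero_iff_mem.mpr (pderiv_mem_jacobianIdeal β F l)
  have hdX : MvPolynomial.pderiv l (MvPolynomial.X i - 1 : MvPolynomial (Fin 3) R) = 0 := by
    rw [map_sub, MvPolynomial.pderiv_X_of_ne hl.symm, MvPolynomial.pderiv_one, sub_zero]
  have hd0 (P : MvPolynomial (Fin 3) R) (hP : β P = 0) : d P = 0 := by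
    rw [← RingHom.mem_ker, hker] at hP
    obtain ⟨a, b, rfl⟩ := Ideal.mem_span_pair.mp hP
    simp only [d, map_add, MvPolynomial.pderiv_mul, map_mul, hF, hX, hdF, hdX, mul_zero,
      map_zero, add_zero]
  have hd (P Q : MvPolynomial (Fin 3) R) (h : β P = β Q) : d P = d Q := by
    have h1 := hd0 (P - Q) (by rw [map_sub, h, sub_self])
    simp only [d, map_sub] at h1
    exact sub_eq_zero.mp h1
  let e (b : B) : B ⧸ jacobianIdeal β F := d (Function.surjInv hβ b)
  have he (P : MvPolynomial (Fin 3) R) : e (β P) = d P := hd _ _ (Function.surjInv_eq hβ _)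
  let ℓ : B →ₗ[R] B ⧸ jacobianIdeal β F :=
    { toFun := e
      map_add' := fun a b => by
        obtain ⟨P, rfl⟩ := hβ a
        obtain ⟨Q, rfl⟩ := hβ b
        rw [← map_add, he, he, he]
        simp only [d, map_add]
      map_smul' := fun r b => by
        obtain ⟨P, rfl⟩ := hβ b
        rw [Algebra.smul_def, ← hC, ← map_mul, he, he, RingHom.id_apply, Algebra.smul_def,
          IsScalarTower.algebraMap_apply R B (B ⧸ jacobianIdeal β F), ← hC]
        simp only [d, MvPolynomial.pderiv_C_mul, map_mul]
        rfl }
  refine ⟨Derivation.mk' ℓ fun a b => ?_, he⟩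
  obtain ⟨P, rfl⟩ := hβ a
  obtain ⟨Q, rfl⟩ := hβ b
  change e (β P * β Q) = β P • e (β Q) + β Q • e (β P)
  rw [← map_mul, he, he, he, Algebra.smul_def, Algebra.smul_def]
  simp only [d, MvPolynomial.pderiv_mul, map_add, map_mul, Ideal.Quotient.algebraMap_eq]
  ring

/-- The derivations with respect to the two variables other than `xᵢ` give functionals on the
differentials that are dual to the differentials of these variables. -/
lemma fittingIdeal_differentials_le {R B : Type u} [CommRing R] [CommRing B] [Algebra R B]
    {β : MvPolynomial (Fin 3) R →+* B} (hβ : Function.Surjective β)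
    (hC : ∀ r, β (MvPolynomial.C r) = algebraMap R B r) {i : Fin 3} {F : MvPolynomial (Fin 3) R}
    (hker : RingHom.ker β = Ideal.span {F, MvPolynomial.X i - 1}) :
    fittingIdeal B (Ω[B⁄R]) 1 ≤ jacobianIdeal β F := by
  obtain ⟨δ₁, h₁⟩ := exists_derivation hβ hC hker (Fin.succAbove_ne i 0)
  obtain ⟨δ₂, h₂⟩ := exists_derivation hβ hC hker (Fin.succAbove_ne i 1)
  let ℓ (δ : Derivation R B (B ⧸ jacobianIdeal β F)) :
      Ω[B⁄R] →ₛₗ[Ideal.Quotient.mk (jacobianIdeal β F)] B ⧸ jacobianIdeal β F :=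
    { toFun := δ.liftKaehlerDifferential
      map_add' := map_add _
      map_smul' := fun b x => by
        rw [map_smul, Algebra.smul_def]
        rfl }
  have hℓ (δ : Derivation R B (B ⧸ jacobianIdeal β F)) (b : B) :
      ℓ δ (KaehlerDifferential.D R B b) = δ b :=
    δ.liftKaehlerDifferential_comp_D b
  rw [← Ideal.mk_ker (I := jacobianIdeal β F)]
  refine fittingIdeal_le_ker _ (ℓ δ₁) (ℓ δ₂)
    (x₁ := KaehlerDifferential.D R B (β (MvPolynomial.X (i.succAbove 0))))
    (x₂ := KaehlerDifferential.D R B (β (MvPolynomial.X (i.succAbove 1)))) ?_ ?_ ?_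
  · rw [hℓ, h₁, MvPolynomial.pderiv_X_self, map_one, map_one]
  · rw [hℓ, h₂, MvPolynomial.pderiv_X_self, map_one, map_one]
  · rw [hℓ, h₂, MvPolynomial.pderiv_X_of_ne, map_zero, map_zero]
    exact fun h => by simpa using Fin.succAbove_right_injective h

/-- For the generators `g, y₁, y₂` the given relations form a matrix; without the column of `y₂` it
is upper triangular with diagonal entries `t l` and `e₁`. -/
lemma prod_mul_mem_fittingIdeal {R M : Type u} [CommRing R] [AddCommGroup M] [Module R M] {n : ℕ}
    {g : Fin n → M} (hg : Submodule.span R (Set.range g) = ⊤) {t a₁ a₂ : Fin n → R} {y₁ y₂ : M}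
    (h : ∀ l, t l • g l = a₁ l • y₁ + a₂ l • y₂) {e₁ e₂ : R} (he : e₁ • y₁ + e₂ • y₂ = 0) :
    (∏ l, t l) * e₁ ∈ fittingIdeal R M 1 := by
  let g' : Fin (n + 1 + 1) → M := Fin.snoc (Fin.snoc g y₁ : Fin (n + 1) → M) y₂
  let r : Fin (n + 1) → Fin (n + 1 + 1) → R :=
    Fin.snoc (fun l => Fin.snoc (Fin.snoc (Pi.single l (t l)) (-a₁ l) : Fin (n + 1) → R) (-a₂ l))
      (Fin.snoc (Fin.snoc (0 : Fin n → R) e₁ : Fin (n + 1) → R) e₂)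
  refine Ideal.subset_span ⟨n + 1, g', ?_, r, fun i => ?_, Fin.castSucc, ?_⟩
  · rw [eq_top_iff, ← hg, Submodule.span_le]
    rintro _ ⟨l, rfl⟩
    refine Submodule.subset_span ⟨l.castSucc.castSucc, ?_⟩
    simp [g']
  · refine Fin.lastCases ?_ (fun l => ?_) i
    · simp [Fin.sum_univ_castSucc, r, g', he]
    · simp only [Fin.sum_univ_castSucc, r, g', Fin.snoc_castSucc, Fin.snoc_last]
      rw [Finset.sum_eq_single l (fun b _ hb => by rw [Pi.single_eq_of_ne hb, zero_smul])
        (by simp), Pi.single_eq_same, h]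
      module
  · rw [Matrix.det_of_isUpperTriangular]
    · rw [Fin.prod_univ_castSucc]
      simp [r]
    · intro a b hab
      have hab' : b < a := hab
      revert hab'
      refine Fin.lastCases ?_ (fun l => ?_) a
      · refine Fin.lastCases (fun h => (lt_irrefl _ h).elim) (fun l _ => ?_) b
        simp [r]
      · refine Fin.lastCases (fun h => ?_) (fun l' h => ?_) b
        · exact absurd h (not_lt.mpr (Fin.le_last _))
        · have hne : l' ≠ l := (Fin.castSucc_lt_castSucc_iff.mp h).ne
          simp [r, hne]

end Differentials

end

end SingularCubics
namespace SingularCubics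

noncomputable section

attribute [local instance] MvPolynomial.gradedAlgebra

/-! ### Local computation of Fitting ideals -/

section FittingLocal

open scoped KaehlerDifferential

/-- If inverting `h` leaves two generators with a relation `b₁ y₁ + b₂ y₂ = 0`, then `b₁` and `b₂`
lie in the localised Fitting ideal. Working with minors over `B` and clearing powers of `h` avoids
comparing Fitting ideals over different rings or generating families. -/
lemma exists_pow_mul_mem_fittingIdeal {B : Type u} {Bh : Type*} [CommRing B] [CommRing Bh]
    [Algebra B Bh] (h : B) [IsLocalization.Away h Bh] {M : Type u} {N : Type*} [AddCommGroup M]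
    [Module B M] [Module.Finite B M] [AddCommGroup N] [Module B N] [Module Bh N]
    [IsScalarTower B Bh N] (ℓ : M →ₗ[B] N) [IsLocalizedModule (Submonoid.powers h) ℓ] {y₁ y₂ : N}
    (hy : Submodule.span Bh {y₁, y₂} = ⊤) {b₁ b₂ : Bh} (hb : b₁ • y₁ + b₂ • y₂ = 0) {s : B}
    (hs : algebraMap B Bh s ∈ Ideal.span {b₁, b₂}) : ∃ n, h ^ n * s ∈ fittingIdeal B M 1 := by
  have hden (b : Bh) : ∃ (n : ℕ) (c : B), algebraMap B Bh c = algebraMap B Bh (h ^ n) * b := by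
    obtain ⟨⟨c, ⟨_, n, rfl⟩⟩, hc⟩ := IsLocalization.surj (Submonoid.powers h) b
    exact ⟨n, c, by rw [mul_comm, ← hc]⟩
  have hnum (y : N) : ∃ (n : ℕ) (x : M), ℓ x = h ^ n • y := by
    obtain ⟨⟨x, ⟨_, n, rfl⟩⟩, hx⟩ := IsLocalizedModule.surj (Submonoid.powers h) ℓ y
    exact ⟨n, x, hx.symm⟩
  have hzero {x : M} (hx : ℓ x = 0) : ∃ n : ℕ, h ^ n • x = 0 := by
    obtain ⟨⟨_, n, rfl⟩, hn⟩ := (IsLocalizedModule.eq_zero_iff (Submonoid.powers h) ℓ).mp hx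
    exact ⟨n, hn⟩
  have hunit (n : ℕ) : IsUnit (algebraMap B Bh (h ^ n)) :=
    IsLocalization.map_units Bh (⟨h ^ n, n, rfl⟩ : Submonoid.powers h)
  have hsm (b : B) (y : N) : b • y = algebraMap B Bh b • y := (algebraMap_smul Bh b y).symm
  obtain ⟨n₁, x₁, hx₁⟩ := hnum y₁
  obtain ⟨n₂, x₂, hx₂⟩ := hnum y₂
  have hcomb (u₁ u₂ : Bh) (x : M) (hx : ℓ x = u₁ • y₁ + u₂ • y₂) : ∃ (n p₁ p₂ : ℕ) (c₁ c₂ : B),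
      algebraMap B Bh c₁ = algebraMap B Bh (h ^ p₁) * u₁ ∧
      algebraMap B Bh c₂ = algebraMap B Bh (h ^ p₂) * u₂ ∧ h ^ n • x = c₁ • x₁ + c₂ • x₂ := by
    obtain ⟨m₁, v₁, hv₁⟩ := hden u₁
    obtain ⟨m₂, v₂, hv₂⟩ := hden u₂
    obtain ⟨q, hq⟩ := hzero (x := h ^ (m₁ + m₂ + n₁ + n₂) • x - ((h ^ (m₂ + n₂) * v₁) • x₁ +
        (h ^ (m₁ + n₁) * v₂) • x₂)) (by
      simp only [map_sub, map_add, map_smul, hx, hx₁, hx₂]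
      simp only [hsm, map_mul, hv₁, hv₂, map_pow, smul_add, smul_smul]
      module)
    refine ⟨q + (m₁ + m₂ + n₁ + n₂), q + (m₂ + n₂) + m₁, q + (m₁ + n₁) + m₂,
      h ^ q * (h ^ (m₂ + n₂) * v₁), h ^ q * (h ^ (m₁ + n₁) * v₂), ?_, ?_, ?_⟩
    · simp only [map_mul, hv₁, map_pow]; ring
    · simp only [map_mul, hv₂, map_pow]; ring
    · rw [smul_sub, sub_eq_zero, smul_smul, ← pow_add, smul_add, smul_smul, smul_smul] at hq
      exact hq
  obtain ⟨n₀, p₁, p₂, e₁, e₂, he₁, he₂, he⟩ := hcomb b₁ b₂ 0 (by rw [map_zero, hb])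
  rw [smul_zero] at he
  obtain ⟨r, g, hg⟩ := Module.Finite.exists_fin (R := B) (M := M)
  have hgl (l : Fin r) : ∃ (n : ℕ) (c₁ c₂ : B), h ^ n • g l = c₁ • x₁ + c₂ • x₂ := by
    have : ℓ (g l) ∈ Submodule.span Bh {y₁, y₂} := hy ▸ Submodule.mem_top
    obtain ⟨u₁, u₂, hu⟩ := Submodule.mem_span_pair.mp this
    obtain ⟨n, -, -, c₁, c₂, -, -, hc⟩ := hcomb u₁ u₂ (g l) hu.symm
    exact ⟨n, c₁, c₂, hc⟩
  choose n c₁ c₂ hc using hgl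
  have h1 := prod_mul_mem_fittingIdeal hg hc he.symm
  have h2 := prod_mul_mem_fittingIdeal hg (t := fun l => h ^ n l) (a₁ := c₂) (a₂ := c₁)
    (y₁ := x₂) (y₂ := x₁) (fun l => (hc l).trans (add_comm _ _)) (e₁ := e₂) (e₂ := e₁)
    ((add_comm _ _).trans he.symm)
  rw [Finset.prod_pow_eq_pow_sum] at h1 h2
  have h3 : algebraMap B Bh s ∈ (Ideal.span {e₁, e₂}).map (algebraMap B Bh) := by
    rwa [Ideal.map_span, Set.image_pair, he₁, he₂, Ideal.span_insert,
      Ideal.span_singleton_mul_left_unit (hunit _), Ideal.span_singleton_mul_left_unit (hunit _),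
      ← Ideal.span_insert]
  obtain ⟨_, ⟨q, rfl⟩, hq⟩ := (IsLocalization.algebraMap_mem_map_algebraMap_iff
    (Submonoid.powers h) Bh _ s).mp h3
  obtain ⟨v₁, v₂, hv⟩ := Ideal.mem_span_pair.mp hq
  refine ⟨∑ l, n l + q, ?_⟩
  rw [pow_add, mul_assoc, ← hv, mul_add, mul_left_comm, mul_left_comm _ v₂]
  exact add_mem (Ideal.mul_mem_left _ _ h1) (Ideal.mul_mem_left _ _ h2)

variable {R' R Bh : Type*} [CommRing R'] [CommRing R] [CommRing Bh] [Algebra R' Bh]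
  {β : MvPolynomial (Fin 3) R →+* Bh}

/-- The chain rule. The coefficients lie in `R` while the derivation is linear over `R'` only; `hR`
says that elements of `R` are fractions of elements of `R'`, as for functions on a basic open
subset, so they are killed all the same. -/
lemma derivation_apply_eq_sum (hR : ∀ r, ∃ c, IsUnit (β (MvPolynomial.C c)) ∧
      β (MvPolynomial.C c) ∈ (algebraMap R' Bh).range ∧
      β (MvPolynomial.C (c * r)) ∈ (algebraMap R' Bh).range)
    {M : Type*} [AddCommGroup M] [Module R' M] [Module Bh M] (δ : Derivation R' Bh M)
    (P : MvPolynomial (Fin 3) R) :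
    δ (β P) = ∑ j, β (MvPolynomial.pderiv j P) • δ (β (MvPolynomial.X j)) := by
  have hC (r : R) : δ (β (MvPolynomial.C r)) = 0 := by
    obtain ⟨c, hc, ⟨x, hx⟩, ⟨y, hy⟩⟩ := hR r
    have h1 := δ.map_algebraMap y
    rw [hy, map_mul, map_mul, δ.leibniz, ← hx, δ.map_algebraMap, smul_zero, add_zero, hx] at h1
    exact hc.smul_eq_zero.mp h1
  induction P using MvPolynomial.induction_on with
  | C r => simp [hC]
  | add P Q hP hQ => simp only [map_add, hP, hQ, add_smul, Finset.sum_add_distrib]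
  | mul_X P l hP =>
    rw [map_mul, δ.leibniz, hP, Finset.smul_sum]
    simp only [MvPolynomial.pderiv_mul, map_add, map_mul, add_smul, Finset.sum_add_distrib,
      smul_smul]
    rw [add_comm]
    congr 1
    · exact Finset.sum_congr rfl fun j _ => by rw [mul_comm]
    · rw [Finset.sum_eq_single l]
      · rw [MvPolynomial.pderiv_X_self, map_one, mul_one]
      · intro j _ hj
        rw [MvPolynomial.pderiv_X_of_ne hj.symm, map_zero, mul_zero, zero_smul]
      · simp

lemma span_D_eq_top (hR : ∀ r, ∃ c, IsUnit (β (MvPolynomial.C c)) ∧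
      β (MvPolynomial.C c) ∈ (algebraMap R' Bh).range ∧
      β (MvPolynomial.C (c * r)) ∈ (algebraMap R' Bh).range)
    (hB : ∀ b, ∃ P Q, IsUnit (β Q) ∧ β Q * b = β P) {i : Fin 3}
    (hX : β (MvPolynomial.X i) = 1) :
    Submodule.span Bh {KaehlerDifferential.D R' Bh (β (MvPolynomial.X (i.succAbove 0))),
      KaehlerDifferential.D R' Bh (β (MvPolynomial.X (i.succAbove 1)))} = ⊤ := by
  set N := Submodule.span Bh {KaehlerDifferential.D R' Bh (β (MvPolynomial.X (i.succAbove 0))),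
      KaehlerDifferential.D R' Bh (β (MvPolynomial.X (i.succAbove 1)))} with hN
  rw [eq_top_iff, ← KaehlerDifferential.span_range_derivation R' Bh, Submodule.span_le]
  rintro _ ⟨b, rfl⟩
  have hP (P : MvPolynomial (Fin 3) R) : KaehlerDifferential.D R' Bh (β P) ∈ N := by
    rw [derivation_apply_eq_sum hR]
    refine sum_mem fun j _ => Submodule.smul_mem _ _ ?_
    refine Fin.succAboveCases i ?_ (fun j => ?_) j
    · rw [hX, Derivation.map_one_eq_zero]
      exact zero_mem _
    · fin_cases j
      · exact Submodule.subset_span (Set.mem_insert _ _)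
      · exact Submodule.subset_span (Set.mem_insert_of_mem _ rfl)
  obtain ⟨P, Q, hQ, hb⟩ := hB b
  have h1 := hP P
  rw [← hb, Derivation.leibniz] at h1
  exact (Submodule.smul_mem_iff_of_isUnit _ hQ).mp
    ((Submodule.add_mem_iff_left _ (Submodule.smul_mem _ _ (hP Q))).mp h1)

/-- Euler's formula with `F = 0` and `xᵢ = 1` expresses the derivative with respect to `xᵢ` by the
other two, in every characteristic. -/
lemma jacobianIdeal_eq_span {F : MvPolynomial (Fin 3) R} {n : ℕ} (hF : F.IsHomogeneous n)
    (h0 : β F = 0) {i : Fin 3} (hX : β (MvPolynomial.X i) = 1) :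
    jacobianIdeal β F = Ideal.span {β (MvPolynomial.pderiv (i.succAbove 0) F),
      β (MvPolynomial.pderiv (i.succAbove 1) F)} := by
  have h1 := congrArg β hF.sum_X_mul_pderiv
  rw [map_sum, Fin.sum_univ_succAbove _ i, Fin.sum_univ_two, map_nsmul, h0, smul_zero, map_mul,
    map_mul, map_mul, hX, one_mul] at h1
  refine le_antisymm (Ideal.span_le.mpr ?_) (Ideal.span_le.mpr ?_)
  · rintro _ ⟨j, rfl⟩
    refine Fin.succAboveCases i ?_ (fun j => ?_) j
    · rw [SetLike.mem_coe, Ideal.mem_span_pair]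
      exact ⟨-β (MvPolynomial.X (i.succAbove 0)), -β (MvPolynomial.X (i.succAbove 1)), by
        rw [← sub_eq_zero]
        refine Eq.trans ?_ (neg_eq_zero.mpr h1)
        ring⟩
    · fin_cases j
      · exact Ideal.subset_span (Set.mem_insert _ _)
      · exact Ideal.subset_span (Set.mem_insert_of_mem _ rfl)
  · rintro _ (rfl | rfl)
    · exact pderiv_mem_jacobianIdeal β F _
    · exact pderiv_mem_jacobianIdeal β F _

lemma exists_pow_mul_mem_fittingIdeal_differentials {R' B : Type u} [CommRing R'] [CommRing B]
    [Algebra R' B] [Algebra.FiniteType R' B] [Algebra B Bh] [Algebra R' Bh] [IsScalarTower R' B Bh]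
    (h : B) [IsLocalization.Away h Bh]
    (hR : ∀ r, ∃ c, IsUnit (β (MvPolynomial.C c)) ∧
      β (MvPolynomial.C c) ∈ (algebraMap R' Bh).range ∧
      β (MvPolynomial.C (c * r)) ∈ (algebraMap R' Bh).range)
    (hB : ∀ b, ∃ P Q, IsUnit (β Q) ∧ β Q * b = β P) {i : Fin 3}
    (hX : β (MvPolynomial.X i) = 1) {F : MvPolynomial (Fin 3) R} {n : ℕ} (hF : F.IsHomogeneous n)
    (h0 : β F = 0) {s : B} (hs : algebraMap B Bh s ∈ jacobianIdeal β F) :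
    ∃ n, h ^ n * s ∈ fittingIdeal B (Ω[B⁄R']) 1 := by
  rw [jacobianIdeal_eq_span hF h0 hX] at hs
  refine exists_pow_mul_mem_fittingIdeal h (KaehlerDifferential.map R' R' B Bh)
    (span_D_eq_top hR hB hX) ?_ hs
  have h1 := derivation_apply_eq_sum hR (KaehlerDifferential.D R' Bh) F
  rw [h0, map_zero, Fin.sum_univ_succAbove _ i, Fin.sum_univ_two, hX,
    Derivation.map_one_eq_zero, smul_zero, zero_add] at h1
  exact h1.symm

end FittingLocal

end

end SingularCubics
namespace SingularCubics

noncomputable section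

attribute [local instance] MvPolynomial.gradedAlgebra

/-! ### The locus where the partial derivatives of the universal cubic vanish -/

section Polars

variable {k : Type u} [Field k] {S T : Over (Spec (CommRingCat.of k))}

variable (k) in
/-- The function `∂(∑ₘ' a_m' xᵐ')/∂xⱼ / (a_m xᵢ²)` on the open subset `xᵢ ≠ 0`, `a_m ≠ 0`. -/
def polarEquation (j : Fin 3) (c : Fin 3 × CubicMonomial) :
    Γ(plane (spaceOfCubics k), bichart k c) :=
  chartDehom (spaceOfCubics k) c.1 (spaceChart k c.2)
    (MvPolynomial.pderiv j (chartForm k c.2))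

variable (k) in
/-- The zero locus of the `j`-th partial derivative of the universal cubic form. -/
def universalPolar (j : Fin 3) : (plane (spaceOfCubics k)).IdealSheafData :=
  ofLocalEquations (bichart k) (polarEquation k j)

lemma map_polarEquation_eq (j : Fin 3) (c : Fin 3 × CubicMonomial)
    {W : (plane (spaceOfCubics k)).Opens} (h : W ≤ bichart k c) :
    (plane (spaceOfCubics k)).presheaf.map (homOfLE h).op (polarEquation k j c) =
      dehom (h.trans (chartOver_le_chart c.1 (spaceChart k c.2)))
        (h.trans (chartOver_le_base c.1 (spaceChart k c.2)))
        (MvPolynomial.pderiv j (chartForm k c.2)) :=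
  map_dehom _ _ h _

lemma exists_map_polarEquation_eq (j : Fin 3) (c c' : Fin 3 × CubicMonomial)
    {W : (plane (spaceOfCubics k)).Opens} (h : W ≤ bichart k c) (h' : W ≤ bichart k c') :
    ∃ u, (plane (spaceOfCubics k)).presheaf.map (homOfLE h).op (polarEquation k j c) =
      u * (plane (spaceOfCubics k)).presheaf.map (homOfLE h').op (polarEquation k j c') := by
  have h₁ := h.trans (chartOver_le_chart c.1 (spaceChart k c.2))
  have h₂ := h.trans (chartOver_le_base c.1 (spaceChart k c.2))
  have h₁' := h'.trans (chartOver_le_chart c'.1 (spaceChart k c'.2))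
  have h₂' := h'.trans (chartOver_le_base c'.1 (spaceChart k c'.2))
  have h₃ : W ≤ toBase (spaceOfCubics k) ⁻¹ᵁ (spaceChart k c.2 ⊓ spaceChart k c'.2) :=
    le_inf h₂ h₂'
  rw [map_polarEquation_eq, map_polarEquation_eq, ← dehom_map h₁ h₂ h₃ inf_le_left,
    ← dehom_map h₁' h₂' h₃ inf_le_right, ← MvPolynomial.pderiv_map, ← MvPolynomial.pderiv_map,
    map_chartForm, map_chartForm,
    formOfHom_mul (𝟙 _) (le_id_preimage inf_le_left) (le_id_preimage inf_le_right),
    MvPolynomial.pderiv_C_mul, map_mul,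
    dehom_change h₁' h₁ h₃ (formOfHom_isHomogeneous _ _ _).pderiv, ← mul_assoc]
  exact ⟨_, rfl⟩

lemma ideal_universalPolar (j : Fin 3) (c : Fin 3 × CubicMonomial)
    (W : (plane (spaceOfCubics k)).affineOpens) (h : W.1 ≤ bichart k c) :
    (universalPolar k j).ideal W =
      Ideal.span {(plane (spaceOfCubics k)).presheaf.map (homOfLE h).op
        (polarEquation k j c)} := by
  refine ideal_ofLocalEquations (bichart k) isAffineOpen_bichart (polarEquation k j)
    (fun c c' => ?_) c W h
  obtain ⟨u, hu⟩ := exists_map_polarEquation_eq j c c'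
    (inf_le_left : bichart k c ⊓ bichart k c' ≤ _) inf_le_right
  rw [hu, Ideal.mem_span_singleton']
  exact ⟨u, rfl⟩

lemma isZeroLocusOn_universalPolar (j : Fin 3) (m : CubicMonomial) :
    IsZeroLocusOn (universalPolar k j) (affineSpaceChart k m)
      (MvPolynomial.pderiv j (chartForm k m)) := fun i =>
  (ideal_universalPolar j (i, m) (affineChart i (affineSpaceChart k m)) le_rfl).trans
    (congrArg (fun s => Ideal.span {s}) (map_polarEquation_eq j (i, m) le_rfl))

lemma isZeroLocusOn_universalPolar_comap (j : Fin 3) (g : S ⟶ spaceOfCubics k) (m : CubicMonomial)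
    (V : S.left.affineOpens) (e : V.1 ≤ g.left ⁻¹ᵁ spaceChart k m) :
    IsZeroLocusOn ((universalPolar k j).comap (planeMap g)) V
      (MvPolynomial.pderiv j (formOfHom g m e)) := by
  have h := (isZeroLocusOn_universalPolar j m).comap g (W := V) e
  have h' : (chartForm k m).map (g.left.appLE (spaceChart k m) V e).hom = formOfHom g m e :=
    map_cubicForm _ _
  rw [← h', MvPolynomial.pderiv_map]
  exact h

variable (k) in
/-- The closed subscheme of `ℙ² × ℙ⁹` where the partial derivatives of the universal cubic form
vanish. -/
def singularLocus : (plane (spaceOfCubics k)).IdealSheafData := ⨆ j, universalPolar k j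

lemma comap_iSup {X Y : Scheme.{u}} {ι : Type*} (I : ι → Y.IdealSheafData) (f : X ⟶ Y) :
    (⨆ i, I i).comap f = ⨆ i, (I i).comap f :=
  (Scheme.IdealSheafData.map_gc f).l_iSup

lemma ideal_iSup_comap {X Y : Scheme.{u}} {ι : Type*} (I : ι → Y.IdealSheafData) (f : X ⟶ Y)
    (U : X.affineOpens) : ((⨆ i, I i).comap f).ideal U = ⨆ i, ((I i).comap f).ideal U := by
  rw [comap_iSup, Scheme.IdealSheafData.ideal_iSup, iSup_apply]

lemma ideal_singularLocus_comap (g : S ⟶ spaceOfCubics k) (m : CubicMonomial) (i : Fin 3)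
    (V : S.left.affineOpens) (e : V.1 ≤ g.left ⁻¹ᵁ spaceChart k m) :
    ((singularLocus k).comap (planeMap g)).ideal (affineChart i V) =
      jacobianIdeal (chartDehom S i V.1) (formOfHom g m e) := by
  rw [singularLocus, ideal_iSup_comap, jacobianIdeal, Ideal.span_range_eq_iSup]
  exact iSup_congr fun j => isZeroLocusOn_universalPolar_comap j g m V e i

lemma map_jacobianIdeal {R B C : Type*} [CommRing R] [CommRing B] [CommRing C]
    (β : MvPolynomial (Fin 3) R →+* B) (φ : B →+* C) (F : MvPolynomial (Fin 3) R) :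
    (jacobianIdeal β F).map φ = jacobianIdeal (φ.comp β) F := by
  rw [jacobianIdeal, jacobianIdeal, Ideal.map_span, ← Set.range_comp]
  rfl

end Polars

end

end SingularCubics
namespace SingularCubics

noncomputable section

attribute [local instance] MvPolynomial.gradedAlgebra

/-! ### The critical locus of a family of cubics -/

section CriticalLocus

variable {k : Type u} [Field k] {S T : Over (Spec (CommRingCat.of k))}

/-- Dehomogenization with respect to `xᵢ`, followed by restriction to `D`. -/
def subschemeDehom (D : (plane S).IdealSheafData) (i : Fin 3) (V : S.left.affineOpens) :
    MvPolynomial (Fin 3) Γ(S.left, V.1) →+* Γ(D.subscheme, (subschemeChart D i V).1) :=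
  (chartRestrict D i V).comp (chartDehom S i V.1)

lemma subschemeDehom_surjective (D : (plane S).IdealSheafData) (i : Fin 3)
    (V : S.left.affineOpens) : Function.Surjective (subschemeDehom D i V) :=
  (chartRestrict_surjective D i V).comp (dehom_surjective i V.2)

lemma ker_subschemeDehom (D : (plane S).IdealSheafData) (i : Fin 3)
    (V : S.left.affineOpens) : RingHom.ker (subschemeDehom D i V) = polyIdeal D i V := by
  rw [subschemeDehom, ← RingHom.comap_ker, ker_chartRestrict]
  rfl

lemma subschemeDehom_C (D : (plane S).IdealSheafData) (i : Fin 3) (V : S.left.affineOpens)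
    (r : Γ(S.left, V.1)) : subschemeDehom D i V (MvPolynomial.C r) =
      (D.subschemeι ≫ toBase S).appLE V.1 (subschemeChart D i V).1 (subschemeChart_le D i V) r := by
  refine Eq.trans ?_ congr($(appLE_subschemeChart D i V) r).symm
  rw [← chartDehom_comp_C]
  rfl

lemma subschemeDehom_X_self (D : (plane S).IdealSheafData) (i : Fin 3) (V : S.left.affineOpens) :
    subschemeDehom D i V (MvPolynomial.X i) = 1 := by
  rw [subschemeDehom, RingHom.comp_apply, chartDehom_X_self, map_one]

lemma ideal_singularLocus_comap_subschemeChart (D : (plane S).IdealSheafData)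
    (g : S ⟶ spaceOfCubics k) (m : CubicMonomial) (i : Fin 3) (V : S.left.affineOpens)
    (e : V.1 ≤ g.left ⁻¹ᵁ spaceChart k m) :
    ((singularLocus k).comap (D.subschemeι ≫ planeMap g)).ideal (subschemeChart D i V) =
      jacobianIdeal (subschemeDehom D i V) (formOfHom g m e) := by
  rw [Scheme.IdealSheafData.comap_comp, ideal_comap _ _ (subschemeChart D i V) (affineChart i V)
    (subschemeChart_le_preimage D i V), ideal_singularLocus_comap g m i V e]
  exact map_jacobianIdeal _ _ _

lemma criticalIdeal_le {X Y : Scheme.{u}} (φ : X ⟶ Y) (d : ℕ) (U : X.affineOpens)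
    (V : Y.affineOpens) (e : U.1 ≤ φ ⁻¹ᵁ V.1) :
    (criticalIdeal φ d).ideal U ≤ differentialsFitting φ d U.1 V.1 e := by
  refine (Scheme.IdealSheafData.ideal_ofIdeals_le _ U).trans ?_
  refine (iInf_le _ U).trans ((iInf_le _ V).trans ((iInf_le _ le_rfl).trans ((iInf_le _ e).trans ?_)))
  have : X.presheaf.map (homOfLE (le_refl U.1)).op = 𝟙 _ := X.presheaf.map_id _
  rw [this]
  exact le_rfl

lemma le_criticalIdeal {X Y : Scheme.{u}} (φ : X ⟶ Y) (d : ℕ) (I : X.IdealSheafData)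
    (h : ∀ (U : X.affineOpens) (V : Y.affineOpens) (e : U.1 ≤ φ ⁻¹ᵁ V.1),
      I.ideal U ≤ differentialsFitting φ d U.1 V.1 e) : I ≤ criticalIdeal φ d := by
  refine Scheme.IdealSheafData.le_ofIdeals_iff.mpr fun W => ?_
  refine le_iInf fun U => le_iInf fun V => le_iInf fun hU => le_iInf fun e => ?_
  exact (I.ideal_le_comap_ideal hU).trans (Ideal.comap_mono (h U V e))

/-- It suffices to compare on the standard charts of `D`, where `fittingIdeal_differentials_le`
applies. -/
lemma criticalIdeal_le_singularLocus_comap {D : (plane S).IdealSheafData}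
    {g : S ⟶ spaceOfCubics k} (hD : (universalCubic k).comap (planeMap g) = D) :
    criticalIdeal (D.subschemeι ≫ toBase S) 1 ≤
      (singularLocus k).comap (D.subschemeι ≫ planeMap g) := by
  let J := {c : Fin 3 × S.left.affineOpens × CubicMonomial //
    c.2.1.1 ≤ g.left ⁻¹ᵁ spaceChart k c.2.2}
  refine Scheme.IdealSheafData.le_of_iSup_eq_top
    (fun c : J => subschemeChart D c.1.1 c.1.2.1) ?_ ?_
  · refine top_le_iff.mp fun x _ => ?_
    obtain ⟨m, hm⟩ := exists_mem_preimage_spaceChart g ((D.subschemeι ≫ toBase S) x)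
    obtain ⟨V, hxV, hV⟩ := exists_affineOpens_mem_le _ hm
    obtain ⟨i, hi⟩ := exists_mem_subschemeChart D hxV
    exact TopologicalSpace.Opens.mem_iSup.mpr ⟨⟨(i, V, m), hV⟩, hi⟩
  · rintro ⟨⟨i, V, m⟩, e⟩
    refine (criticalIdeal_le _ 1 (subschemeChart D i V) V (subschemeChart_le D i V)).trans ?_
    refine le_of_le_of_eq ?_ (ideal_singularLocus_comap_subschemeChart D g m i V e).symm
    let _ : Algebra Γ(S.left, V.1) Γ(D.subscheme, (subschemeChart D i V).1) :=
      ((D.subschemeι ≫ toBase S).appLE V.1 (subschemeChart D i V).1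
        (subschemeChart_le D i V)).hom.toAlgebra
    refine fittingIdeal_differentials_le (subschemeDehom_surjective D i V)
      (subschemeDehom_C D i V) (i := i) ?_
    rw [ker_subschemeDehom]
    exact (hD ▸ isZeroLocusOn_comap g m V e).polyIdeal_eq i

lemma exists_map_eq_pow_mul {X : Scheme.{u}} {U : X.Opens} (hU : IsAffineOpen U) (h : Γ(X, U))
    {W : X.Opens} (hW : W = X.basicOpen h) (hWU : W ≤ U) (b : Γ(X, W)) :
    ∃ (n : ℕ) (t : Γ(X, U)), X.presheaf.map (homOfLE hWU).op t =
      X.presheaf.map (homOfLE hWU).op (h ^ n) * b := by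
  let _ : Algebra Γ(X, U) Γ(X, W) := (X.presheaf.map (homOfLE hWU).op).hom.toAlgebra
  have := hU.isLocalization_of_eq_basicOpen h (homOfLE hWU) hW
  obtain ⟨⟨t, ⟨_, n, rfl⟩⟩, ht⟩ := IsLocalization.surj (Submonoid.powers h) b
  exact ⟨n, t, by rw [mul_comm]; exact ht.symm⟩

lemma isUnit_map_pow {X : Scheme.{u}} {U : X.Opens} (h : Γ(X, U))
    {W : X.Opens} (hW : W ≤ X.basicOpen h) (hWU : W ≤ U) (n : ℕ) :
    IsUnit (X.presheaf.map (homOfLE hWU).op (h ^ n)) := by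
  rw [map_pow]
  refine IsUnit.pow n ?_
  have h1 := (RingedSpace.isUnit_res_basicOpen X.toRingedSpace h).map
    (X.presheaf.map (homOfLE hW).op).hom
  have h2 : X.presheaf.map (homOfLE hWU).op = X.presheaf.map (homOfLE (X.basicOpen_le h)).op ≫
      X.presheaf.map (homOfLE hW).op := by
    rw [← Functor.map_comp]
    rfl
  rw [h2]
  exact h1

/-- The critical ideal involves all affine opens `U` of `D` and `V'` of `S`, not just the standard
charts. Membership in the Fitting ideal is checked in the stalks, after restriction to an open
subset that is basic both in `U` and in a standard chart. -/
lemma ideal_singularLocus_comap_le_differentialsFitting {D : (plane S).IdealSheafData}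
    {g : S ⟶ spaceOfCubics k} (hD : (universalCubic k).comap (planeMap g) = D)
    (U : D.subscheme.affineOpens) (V' : S.left.affineOpens)
    (e : U.1 ≤ (D.subschemeι ≫ toBase S) ⁻¹ᵁ V'.1) :
    ((singularLocus k).comap (D.subschemeι ≫ planeMap g)).ideal U ≤
      differentialsFitting (D.subschemeι ≫ toBase S) 1 U.1 V'.1 e := by
  have hfp : LocallyOfFinitePresentation (D.subschemeι ≫ toBase S) :=
    (hD ▸ isLocallyCubicForm_comap g : IsLocallyCubicForm D).isFlatFamily.2
  intro s hs
  refine U.2.mem_ideal_iff.mpr fun x hx => ?_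
  obtain ⟨m, hm⟩ := exists_mem_preimage_spaceChart g ((D.subschemeι ≫ toBase S) x)
  -- On the base a basic open subset of `V'` is chosen, so that its functions are fractions of
  -- functions on `V'`.
  obtain ⟨a, ha, hxa⟩ := V'.2.exists_basicOpen_le ⟨_, hm⟩ (e hx)
  let V : S.left.affineOpens := S.left.affineBasicOpen a
  have hVV' : V.1 ≤ V'.1 := S.left.basicOpen_le a
  obtain ⟨i, hi⟩ := exists_mem_subschemeChart D (V := V) hxa
  obtain ⟨h, h', hh, hxh⟩ := exists_basicOpen_le_affine_inter U.2 (subschemeChart D i V).2 x ⟨hx, hi⟩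
  let W : D.subscheme.affineOpens := D.subscheme.affineBasicOpen h
  have hWU : W.1 ≤ U.1 := D.subscheme.basicOpen_le h
  have hWh' : W.1 = D.subscheme.basicOpen h' := hh
  have hWC : W.1 ≤ (subschemeChart D i V).1 := hWh'.le.trans (D.subscheme.basicOpen_le h')
  let ρ := (D.subscheme.presheaf.map (homOfLE hWC).op).hom
  let β := ρ.comp (subschemeDehom D i V)
  have hWV' : W.1 ≤ (D.subschemeι ≫ toBase S) ⁻¹ᵁ V'.1 := hWU.trans e
  let _ : Algebra Γ(S.left, V'.1) Γ(D.subscheme, U.1) :=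
    ((D.subschemeι ≫ toBase S).appLE V'.1 U.1 e).hom.toAlgebra
  let _ : Algebra Γ(D.subscheme, U.1) Γ(D.subscheme, W.1) :=
    (D.subscheme.presheaf.map (homOfLE hWU).op).hom.toAlgebra
  let _ : Algebra Γ(S.left, V'.1) Γ(D.subscheme, W.1) :=
    ((D.subschemeι ≫ toBase S).appLE V'.1 W.1 hWV').hom.toAlgebra
  have : IsScalarTower Γ(S.left, V'.1) Γ(D.subscheme, U.1) Γ(D.subscheme, W.1) :=
    .of_algebraMap_eq fun r =>
      congr($(Scheme.Hom.appLE_map (D.subschemeι ≫ toBase S) e (homOfLE hWU).op) r).symm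
  have : IsLocalization.Away h Γ(D.subscheme, W.1) :=
    U.2.isLocalization_of_eq_basicOpen h (homOfLE hWU) rfl
  have : Algebra.FiniteType Γ(S.left, V'.1) Γ(D.subscheme, U.1) :=
    RingHom.FiniteType.of_finitePresentation
      ((D.subschemeι ≫ toBase S).finitePresentation_appLE V'.2 U.2 e)
  have hβC (r : Γ(S.left, V'.1)) : β (MvPolynomial.C (S.left.presheaf.map (homOfLE hVV').op r)) =
      algebraMap Γ(S.left, V'.1) Γ(D.subscheme, W.1) r := by
    refine (congrArg ρ (subschemeDehom_C D i V _)).trans ?_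
    have h1 := Scheme.Hom.map_appLE (D.subschemeι ≫ toBase S) (subschemeChart_le D i V)
      (homOfLE hVV').op
    refine (congrArg ρ congr($h1 r)).trans ?_
    exact congr($(Scheme.Hom.appLE_map (D.subschemeι ≫ toBase S)
      ((subschemeChart_le D i V).trans (Scheme.Hom.preimage_mono _ hVV')) (homOfLE hWC).op) r)
  have key : ∃ n : ℕ, h ^ n * s ∈
      differentialsFitting (D.subschemeι ≫ toBase S) 1 U.1 V'.1 e := by
    refine exists_pow_mul_mem_fittingIdeal_differentials (R' := Γ(S.left, V'.1)) (β := β)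
      (s := s) (F := formOfHom g m ha) (n := 3) (i := i) h (fun r => ?_) (fun b => ?_) ?_
      (formOfHom_isHomogeneous g m ha) ?_ ?_
    · obtain ⟨n, t, ht⟩ := exists_map_eq_pow_mul V'.2 a rfl hVV' r
      refine ⟨S.left.presheaf.map (homOfLE hVV').op (a ^ n), ?_, ⟨_, (hβC _).symm⟩, ?_⟩
      · exact (isUnit_map_pow a le_rfl hVV' n).map (β.comp MvPolynomial.C)
      · exact ⟨t, (hβC t).symm.trans (congrArg (fun r => β (MvPolynomial.C r)) ht)⟩
    · obtain ⟨n, t, ht⟩ := exists_map_eq_pow_mul (subschemeChart D i V).2 h' hWh' hWC b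
      obtain ⟨P, rfl⟩ := subschemeDehom_surjective D i V t
      obtain ⟨Q, hQ⟩ := subschemeDehom_surjective D i V (h' ^ n)
      refine ⟨P, Q, ?_, ?_⟩
      · refine (congrArg (fun t => IsUnit (ρ t)) hQ).mpr ?_
        exact isUnit_map_pow h' hWh'.le hWC n
      · exact (congrArg (fun t => ρ t * b) hQ).trans ht.symm
    · exact (congrArg ρ (subschemeDehom_X_self D i V)).trans (map_one ρ)
    · have h1 : subschemeDehom D i V (formOfHom g m ha) = 0 := by
        rw [← RingHom.mem_ker, ker_subschemeDehom]
        have h2 := (hD ▸ isZeroLocusOn_comap g m V ha : IsZeroLocusOn D V _).polyIdeal_eq i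
        rw [h2]
        exact Ideal.subset_span (Set.mem_insert _ _)
      exact (congrArg ρ h1).trans (map_zero ρ)
    · have h1 := Ideal.mem_map_of_mem (D.subscheme.presheaf.map (homOfLE hWU).op).hom hs
      have h2 := ((singularLocus k).comap (D.subschemeι ≫ planeMap g)).map_ideal (U := W) (V := U) hWU
      have h3 := ((singularLocus k).comap (D.subschemeι ≫ planeMap g)).map_ideal
        (U := W) (V := subschemeChart D i V) hWC
      rw [ideal_singularLocus_comap_subschemeChart D g m i V ha, map_jacobianIdeal] at h3
      exact (h2.trans h3.symm).le h1
  obtain ⟨n, hn⟩ := key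
  -- The function `h` is a unit in the stalk at `x`, so its power can be removed there.
  have h1 : D.subscheme.presheaf.germ U.1 x hx (h ^ n * s) ∈
      (differentialsFitting (D.subschemeι ≫ toBase S) 1 U.1 V'.1 e).map
        (D.subscheme.presheaf.germ U.1 x hx).hom := Ideal.mem_map_of_mem _ hn
  rw [map_mul, map_pow] at h1
  exact (Ideal.unit_mul_mem_iff_mem _
    (((D.subscheme.mem_basicOpen h x hx).mp hxh).pow n)).mp h1

theorem criticalIdeal_eq {D : (plane S).IdealSheafData} {g : S ⟶ spaceOfCubics k}
    (hD : (universalCubic k).comap (planeMap g) = D) :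
    criticalIdeal (D.subschemeι ≫ toBase S) 1 =
      (singularLocus k).comap (D.subschemeι ≫ planeMap g) :=
  le_antisymm (criticalIdeal_le_singularLocus_comap hD) (le_criticalIdeal _ _ _
    (ideal_singularLocus_comap_le_differentialsFitting hD))

end CriticalLocus

end

end SingularCubics
namespace SingularCubics

noncomputable section

attribute [local instance] MvPolynomial.gradedAlgebra

/-! ### Representability of the functor of cubics with a singular section -/

section SingularSections

variable {k : Type u} [Field k] {S T : Over (Spec (CommRingCat.of k))}

/-- The right-hand side depends only on the composite to `ℙ² × ℙ⁹`. Hence critical loci of families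
commute with base change, and singular sections can be read off on the universal family. -/
lemma exists_lift_criticalLocus_iff {D : (plane S).IdealSheafData} {g : S ⟶ spaceOfCubics k}
    (hD : (universalCubic k).comap (planeMap g) = D) {W : Scheme.{u}} (y : W ⟶ plane S) :
    (∃ h : W ⟶ criticalLocus (D.subschemeι ≫ toBase S) 1,
      h ≫ (criticalIdeal (D.subschemeι ≫ toBase S) 1).subschemeι ≫ D.subschemeι = y) ↔
    (universalCubic k).comap (y ≫ planeMap g) = ⊥ ∧
      (singularLocus k).comap (y ≫ planeMap g) = ⊥ := by
  have hlift (τ : W ⟶ D.subscheme) :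
      (∃ h : W ⟶ criticalLocus (D.subschemeι ≫ toBase S) 1,
        h ≫ (criticalIdeal (D.subschemeι ≫ toBase S) 1).subschemeι = τ) ↔
      (singularLocus k).comap ((τ ≫ D.subschemeι) ≫ planeMap g) = ⊥ := by
    rw [exists_lift_iff, criticalIdeal_eq hD, ← Scheme.IdealSheafData.comap_comp, Category.assoc]
  constructor
  · rintro ⟨h, rfl⟩
    refine ⟨?_, ?_⟩
    · rw [Scheme.IdealSheafData.comap_comp, hD]
      exact (exists_lift_iff _ _).mp ⟨h ≫ (criticalIdeal (D.subschemeι ≫ toBase S) 1).subschemeι,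
        Category.assoc _ _ _⟩
    · have := (hlift _).mp ⟨h, rfl⟩
      rwa [Category.assoc] at this
  · rintro ⟨h1, h2⟩
    rw [Scheme.IdealSheafData.comap_comp, hD] at h1
    obtain ⟨τ, rfl⟩ := (exists_lift_iff _ _).mpr h1
    obtain ⟨h, rfl⟩ := (hlift τ).mpr h2
    exact ⟨h, (Category.assoc _ _ _).symm⟩

variable (k) in
/-- The inclusion of the critical locus in `ℙ² × ℙ⁹`. -/
def criticalMap : (universalCriticalLocus k).left ⟶ plane (spaceOfCubics k) :=
  criticalInclusion k

instance isClosedImmersion_criticalMap : IsClosedImmersion (criticalMap k) :=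
  inferInstanceAs (IsClosedImmersion (criticalInclusion k))

lemma universalCriticalLocus_hom : (universalCriticalLocus k).hom =
    criticalMap k ≫ toBase (spaceOfCubics k) ≫ (spaceOfCubics k).hom := rfl

lemma criticalToSpace_left :
    (criticalToSpace k).left = criticalMap k ≫ toBase (spaceOfCubics k) := rfl

lemma exists_lift_criticalMap_iff {W : Scheme.{u}} (y : W ⟶ plane (spaceOfCubics k)) :
    (∃ h : W ⟶ (universalCriticalLocus k).left, h ≫ criticalMap k = y) ↔
    (universalCubic k).comap y = ⊥ ∧ (singularLocus k).comap y = ⊥ := by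
  have h := exists_lift_criticalLocus_iff (g := 𝟙 (spaceOfCubics k)) (D := universalCubic k)
    (by rw [planeMap_id, Scheme.IdealSheafData.comap_id]) y
  rw [planeMap_id, Category.comp_id] at h
  exact h

/-- Both the singular sections of `D` and the morphisms to the universal critical locus are
described by the same two vanishing conditions along `σ ≫ planeMap g`. -/
lemma mem_SC_iff [Infinite k] (D : (plane S).IdealSheafData) (σ : PlaneSection S) :
    (D, σ) ∈ SC S ↔ ∃ g : S ⟶ spaceOfCubics k, (universalCubic k).comap (planeMap g) = D ∧
      ∃ h : S.left ⟶ (universalCriticalLocus k).left,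
        h ≫ criticalMap k = σ.1 ≫ planeMap g := by
  have key (g : S ⟶ spaceOfCubics k) (hD : (universalCubic k).comap (planeMap g) = D) :
      (∃ τ : S.left ⟶ D.subscheme, τ ≫ D.subschemeι = σ.1 ∧
        IsSingularSection (D.subschemeι ≫ toBase S) 1 τ) ↔
      ∃ h : S.left ⟶ (universalCriticalLocus k).left,
        h ≫ criticalMap k = σ.1 ≫ planeMap g := by
    rw [exists_lift_criticalMap_iff, ← exists_lift_criticalLocus_iff hD]
    constructor
    · rintro ⟨τ, hτ, -, h, hh⟩
      exact ⟨h, by rw [← Category.assoc, hh, hτ]⟩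
    · rintro ⟨h, hh⟩
      refine ⟨h ≫ (criticalIdeal (D.subschemeι ≫ toBase S) 1).subschemeι,
        (Category.assoc _ _ _).trans hh, ?_, h, rfl⟩
      have h1 := congrArg (· ≫ toBase S) hh
      simp only [Category.assoc, σ.2] at h1
      simpa only [Category.assoc] using h1
  constructor
  · rintro ⟨h1, h2⟩
    obtain ⟨g, hg⟩ := exists_comap_eq (isCubicFamily_iff.mp h1)
    exact ⟨g, hg, (key g hg).mp h2⟩
  · rintro ⟨g, hg, h⟩
    exact ⟨isCubicFamily_iff.mpr (hg ▸ isLocallyCubicForm_comap g), (key g hg).mpr h⟩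

lemma tautologicalSection_toPlane : (tautologicalSection k).1 ≫ toPlane (universalCriticalLocus k) =
    criticalMap k ≫ toPlane (spaceOfCubics k) :=
  pullback.lift_fst _ _ _

lemma pull_tautologicalSection_comp_planeMap (f : S ⟶ universalCriticalLocus k) :
    ((tautologicalSection k).pull f).1 ≫ planeMap (f ≫ criticalToSpace k) =
      f.left ≫ criticalMap k := by
  refine pullback.hom_ext ?_ ?_
  · change (_ ≫ planeMap (f ≫ criticalToSpace k)) ≫ toPlane _ = (_ ≫ _) ≫ toPlane _
    rw [Category.assoc, planeMap_toPlane, PlaneSection.pull_toPlane, tautologicalSection_toPlane,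
      Category.assoc]
  · change (_ ≫ planeMap (f ≫ criticalToSpace k)) ≫ toBase _ = (_ ≫ _) ≫ toBase _
    rw [Category.assoc, planeMap_toBase, ← Category.assoc, ((tautologicalSection k).pull f).2, Category.id_comp,
      Over.comp_left, Category.assoc, criticalToSpace_left]

lemma map_tautologicalPair (f : S ⟶ universalCriticalLocus k) :
    (pairs k).map f.op (tautologicalPair k) =
      ((universalCubic k).comap (planeMap (f ≫ criticalToSpace k)),
        (tautologicalSection k).pull f) := by
  refine Prod.ext ?_ rfl
  rw [planeMap_comp, Scheme.IdealSheafData.comap_comp]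
  rfl

lemma isRepresentedBy_SC (k : Type u) [Field k] [Infinite k] :
    IsRepresentedBy (F := pairs k) SC (universalCriticalLocus k) (tautologicalPair k) := by
  refine isRepresentedBy_of_bijective (F := pairs k) (fun f => ?_) (fun {S f f'} h => ?_)
    (fun {S y} hy => ?_)
  · rw [map_tautologicalPair]
    exact (mem_SC_iff _ _).mpr ⟨_, rfl, f.left, (pull_tautologicalSection_comp_planeMap f).symm⟩
  · rw [map_tautologicalPair, map_tautologicalPair] at h
    have h1 := hom_ext_of_comap_eq (congrArg Prod.fst h)
    have h2 : (tautologicalSection k).pull f = (tautologicalSection k).pull f' :=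
      congrArg Prod.snd h
    have h3 := pull_tautologicalSection_comp_planeMap f
    rw [h1, h2, pull_tautologicalSection_comp_planeMap] at h3
    exact Over.OverMorphism.ext ((cancel_mono (criticalMap k)).mp h3.symm)
  · obtain ⟨D, σ⟩ := y
    obtain ⟨g, rfl, h, hh⟩ := (mem_SC_iff D σ).mp hy
    have hbase : h ≫ criticalMap k ≫ toBase (spaceOfCubics k) = g.left := by
      rw [← Category.assoc, hh, Category.assoc, planeMap_toBase, ← Category.assoc, σ.2,
        Category.id_comp]
    let f : S ⟶ universalCriticalLocus k := Over.homMk h (by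
      rw [universalCriticalLocus_hom, ← Over.w g, ← hbase, Category.assoc, Category.assoc])
    have hf : f ≫ criticalToSpace k = g := Over.OverMorphism.ext hbase
    refine ⟨f, ?_⟩
    rw [map_tautologicalPair, hf]
    refine Prod.ext rfl (PlaneSection.ext ?_)
    rw [PlaneSection.pull_toPlane, tautologicalSection_toPlane, ← Category.assoc]
    refine (congrArg (· ≫ toPlane (spaceOfCubics k)) hh).trans ?_
    rw [Category.assoc, planeMap_toPlane]

end SingularSections

end

end SingularCubics
-- Charts, smoothness, dimension and projectivity of the critical locus.
namespace SingularCubics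

noncomputable section

attribute [local instance] MvPolynomial.gradedAlgebra

/-! ### Cubic forms singular at a point -/

section SingularForms

variable {R : Type*} [CommRing R]

/-- The cubic form with coefficients `a` is singular at the point with coordinates `x`. -/
def IsSingularAt (a : CubicMonomial → R) (x : Fin 3 → R) : Prop :=
  MvPolynomial.eval x (cubicForm a) = 0 ∧
    ∀ j, MvPolynomial.eval x (MvPolynomial.pderiv j (cubicForm a)) = 0

/-- The monomial `xᵢ² xₗ`. -/
def doubled (i l : Fin 3) : CubicMonomial := i ::ₛ i ::ₛ l ::ₛ Sym.nil

lemma doubled_injective (i : Fin 3) : Function.Injective (doubled i) := fun l l' h => by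
  rw [doubled, doubled, Sym.cons_inj_right, Sym.cons_inj_right, Sym.cons_inj_left] at h
  exact h

lemma exponent_doubled (i l : Fin 3) :
    exponent (doubled i l) = Finsupp.single i 2 + Finsupp.single l 1 := by
  have : ((doubled i l : CubicMonomial) : Multiset (Fin 3)) = {i} + {i} + {l} := rfl
  rw [exponent, this, map_add, map_add, Multiset.toFinsupp_singleton,
    Multiset.toFinsupp_singleton, ← Finsupp.single_add]

lemma monomial_exponent_doubled (i l : Fin 3) (c : R) :
    MvPolynomial.monomial (exponent (doubled i l)) c =
      MvPolynomial.C c * MvPolynomial.X i ^ 2 * MvPolynomial.X l := by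
  rw [exponent_doubled, mul_assoc, MvPolynomial.X_pow_eq_monomial, MvPolynomial.X,
    MvPolynomial.monomial_mul, MvPolynomial.C_mul_monomial, mul_one, mul_one]

lemma cubicForm_extend {i : Fin 3} {b : CubicMonomial → R} (hb : ∀ l, b (doubled i l) = 0)
    (d : Fin 3 → R) : cubicForm (Function.extend (doubled i) d b) = cubicForm b +
      ∑ l, MvPolynomial.C (d l) * MvPolynomial.X i ^ 2 * MvPolynomial.X l := by
  have h1 : ∑ l, MvPolynomial.C (d l) * MvPolynomial.X i ^ 2 * MvPolynomial.X l =
      ∑ m, MvPolynomial.monomial (exponent m) (Function.extend (doubled i) d b m - b m) := by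
    refine Fintype.sum_of_injective (doubled i) (doubled_injective i) _ _ (fun m hm => ?_)
      fun l => ?_
    · rw [Function.extend_apply' _ _ _ hm, sub_self, map_zero]
    · rw [(doubled_injective i).extend_apply, hb, sub_zero, monomial_exponent_doubled]
  rw [h1, cubicForm, cubicForm, ← Finset.sum_add_distrib]
  exact Finset.sum_congr rfl fun m _ => by rw [← map_add, add_sub_cancel]

/-- The coefficients of the monomials divisible by `xᵢ²` of a cubic form singular at a point `x`
with `xᵢ = 1`, in terms of the other coefficients. -/
def solve (i : Fin 3) (x : Fin 3 → R) (b : CubicMonomial → R) (j : Fin 3) : R :=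
  if j = i then ∑ l ∈ Finset.univ.erase i, x l *
      MvPolynomial.eval x (MvPolynomial.pderiv l (cubicForm b)) - MvPolynomial.eval x (cubicForm b)
    else -MvPolynomial.eval x (MvPolynomial.pderiv j (cubicForm b))

lemma map_eval_cubicForm {R' : Type*} [CommRing R'] (φ : R →+* R') (x : Fin 3 → R)
    (b : CubicMonomial → R) : φ (MvPolynomial.eval x (cubicForm b)) =
      MvPolynomial.eval (fun l => φ (x l)) (cubicForm fun m => φ (b m)) := by
  rw [← map_cubicForm, MvPolynomial.eval_map]
  exact MvPolynomial.eval₂_comp_left φ (RingHom.id R) x _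

lemma map_eval_pderiv_cubicForm {R' : Type*} [CommRing R'] (φ : R →+* R') (x : Fin 3 → R)
    (b : CubicMonomial → R) (j : Fin 3) :
    φ (MvPolynomial.eval x (MvPolynomial.pderiv j (cubicForm b))) =
      MvPolynomial.eval (fun l => φ (x l)) (MvPolynomial.pderiv j (cubicForm fun m => φ (b m))) := by
  rw [← map_cubicForm, MvPolynomial.pderiv_map, MvPolynomial.eval_map]
  exact MvPolynomial.eval₂_comp_left φ (RingHom.id R) x _

lemma map_solve {R' : Type*} [CommRing R'] (φ : R →+* R') (i : Fin 3) (x : Fin 3 → R)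
    (b : CubicMonomial → R) (j : Fin 3) :
    φ (solve i x b j) = solve i (fun l => φ (x l)) (fun m => φ (b m)) j := by
  simp only [solve, apply_ite φ, map_sub, map_neg, map_sum, map_mul, map_eval_cubicForm,
    map_eval_pderiv_cubicForm]

/-- By Euler's formula the derivative with respect to `xᵢ` vanishes once the form and the other two
derivatives do. -/
lemma isSingularAt_iff {a : CubicMonomial → R} {x : Fin 3 → R} {i : Fin 3} (hx : x i = 1) :
    IsSingularAt a x ↔ MvPolynomial.eval x (cubicForm a) = 0 ∧
      ∀ j ≠ i, MvPolynomial.eval x (MvPolynomial.pderiv j (cubicForm a)) = 0 := by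
  refine ⟨fun h => ⟨h.1, fun j _ => h.2 j⟩, fun h => ⟨h.1, fun j => ?_⟩⟩
  by_cases hj : j = i
  · have h1 := congrArg (MvPolynomial.eval x) (cubicForm_isHomogeneous a).sum_X_mul_pderiv
    rw [map_sum, Finset.sum_eq_single i, map_nsmul, h.1, smul_zero, map_mul, MvPolynomial.eval_X,
      hx, one_mul] at h1
    · rw [hj, h1]
    · intro l _ hl
      rw [map_mul, h.2 l hl, mul_zero]
    · simp
  · exact h.2 j hj

/-- At a point with `xᵢ = 1` the derivative of `d_j xᵢ² xⱼ` with respect to `xⱼ`, `j ≠ i`, is `d_j`,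
so the two derivative equations determine these `d_j`. The vanishing of the form then determines
`d_i`, which enters with coefficient `1`. -/
lemma isSingularAt_extend_iff {i : Fin 3} {b : CubicMonomial → R} (hb : ∀ l, b (doubled i l) = 0)
    {x : Fin 3 → R} (hx : x i = 1) (d : Fin 3 → R) :
    IsSingularAt (Function.extend (doubled i) d b) x ↔ d = solve i x b := by
  have h1 : MvPolynomial.eval x (cubicForm (Function.extend (doubled i) d b)) =
      MvPolynomial.eval x (cubicForm b) + (d i + ∑ l ∈ Finset.univ.erase i, x l * d l) := by
    rw [cubicForm_extend hb, map_add, map_sum,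
      ← Finset.add_sum_erase _ _ (Finset.mem_univ i)]
    simp [hx, mul_comm]
  have h2 (j : Fin 3) (hj : j ≠ i) :
      MvPolynomial.eval x (MvPolynomial.pderiv j (cubicForm (Function.extend (doubled i) d b))) =
        MvPolynomial.eval x (MvPolynomial.pderiv j (cubicForm b)) + d j := by
    rw [cubicForm_extend hb, map_add, map_add, map_sum, map_sum, Finset.sum_eq_single j]
    · simp [MvPolynomial.pderiv_X_of_ne hj.symm,
        hx]
    · intro l _ hl
      simp [MvPolynomial.pderiv_X_of_ne hj.symm,
        MvPolynomial.pderiv_X_of_ne hl]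
    · simp
  have h3 : (∀ j ≠ i, MvPolynomial.eval x (MvPolynomial.pderiv j
      (cubicForm (Function.extend (doubled i) d b))) = 0) ↔ ∀ j ≠ i, d j = solve i x b j := by
    refine forall₂_congr fun j hj => ?_
    rw [h2 j hj, solve, if_neg hj, eq_neg_iff_add_eq_zero, add_comm]
  rw [isSingularAt_iff hx, h1, h3]
  have h4 (h : ∀ j ≠ i, d j = solve i x b j) : MvPolynomial.eval x (cubicForm b) +
      (d i + ∑ l ∈ Finset.univ.erase i, x l * d l) = d i - solve i x b i := by
    have : ∑ l ∈ Finset.univ.erase i, x l * d l = -∑ l ∈ Finset.univ.erase i,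
        x l * MvPolynomial.eval x (MvPolynomial.pderiv l (cubicForm b)) := by
      rw [← Finset.sum_neg_distrib]
      refine Finset.sum_congr rfl fun l hl => ?_
      rw [h l (Finset.ne_of_mem_erase hl), solve, if_neg (Finset.ne_of_mem_erase hl), mul_neg]
    rw [this, solve, if_pos rfl]
    ring
  constructor
  · rintro ⟨h, h'⟩
    rw [h4 h', sub_eq_zero] at h
    funext j
    by_cases hj : j = i
    · rw [hj, h]
    · exact h' j hj
  · rintro rfl
    exact ⟨by rw [h4 fun _ _ => rfl, sub_self], fun _ _ => rfl⟩

/-- Two affine coordinates of the point, and ten coefficients less the three that are solved for and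
the one equal to `1`. -/
lemma card_coordinates {i : Fin 3} {m : CubicMonomial} (hm : m ∉ Set.range (doubled i)) :
    Nat.card ({l : Fin 3 // l ≠ i} ⊕ {m' : CubicMonomial // m' ∉ Set.range (doubled i) ∧ m' ≠ m}) =
      8 := by
  classical
  have h1 : Nat.card {l : Fin 3 // l ≠ i} = 2 := by
    rw [Nat.card_eq_fintype_card, Fintype.card_subtype_compl, Fintype.card_fin,
      Fintype.card_subtype_eq]
  have h2 : Nat.card {m' : CubicMonomial // m' ∉ Set.range (doubled i) ∧ m' ≠ m} = 6 := by
    have h3 : {m' : CubicMonomial | m' ∉ Set.range (doubled i) ∧ m' ≠ m} =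
        ↑((Finset.univ \ Finset.univ.image (doubled i)).erase m) := by
      ext m'
      simp [and_comm]
    have h4 : ((Finset.univ \ Finset.univ.image (doubled i)).erase m).card = 6 := by
      rw [Finset.card_erase_of_mem (by simpa using hm), Finset.card_sdiff_of_subset (by simp),
        Finset.card_image_of_injective _ (doubled_injective i), Finset.card_univ,
        card_cubicMonomial, Finset.card_univ, Fintype.card_fin]
    have h5 := Set.ncard_coe_finset ((Finset.univ \ Finset.univ.image (doubled i)).erase m)
    rw [← h3, h4] at h5
    exact h5
  rw [Nat.card_sum, h1, h2]

/-- If a `k`-algebra `C` carries the universal cubic form singular at a point, for forms and points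
with a coordinate `x i` and a coefficient `a m` equal to `1`, where `m` is not divisible by `xᵢ²`,
then it is a polynomial ring in eight variables. -/
theorem exists_polynomial_equiv {k C : Type u} [CommRing k] [CommRing C] (s : k →+* C)
    {x : Fin 3 → C} {a : CubicMonomial → C} {i : Fin 3} {m : CubicMonomial}
    (hm : m ∉ Set.range (doubled i)) (hx : x i = 1) (ha : a m = 1) (h : IsSingularAt a x)
    (hlift : ∀ {A : Type u} [CommRing A] (s' : k →+* A) (x' : Fin 3 → A) (a' : CubicMonomial → A),
      x' i = 1 → a' m = 1 → IsSingularAt a' x' → ∃ φ : C →+* A, φ.comp s = s' ∧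
        (∀ l, φ (x l) = x' l) ∧ ∀ m', φ (a m') = a' m')
    (hext : ∀ φ : C →+* C, φ.comp s = s → (∀ l, φ (x l) = x l) → (∀ m', φ (a m') = a m') →
      φ = RingHom.id C) :
    ∃ e : MvPolynomial (Fin 8) k ≃+* C, ∀ c, e (MvPolynomial.C c) = s c := by
  classical
  let σ := {l : Fin 3 // l ≠ i} ⊕ {m' : CubicMonomial // m' ∉ Set.range (doubled i) ∧ m' ≠ m}
  let x' (l : Fin 3) : MvPolynomial σ k :=
    if h : l ≠ i then MvPolynomial.X (Sum.inl ⟨l, h⟩) else 1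
  let b (m' : CubicMonomial) : MvPolynomial σ k :=
    if h : m' ∉ Set.range (doubled i) ∧ m' ≠ m then MvPolynomial.X (Sum.inr ⟨m', h⟩)
      else if m' = m then 1 else 0
  have hb (l : Fin 3) : b (doubled i l) = 0 := by
    have h1 : doubled i l ≠ m := fun h => hm ⟨l, h⟩
    have h2 : ¬(doubled i l ∉ Set.range (doubled i) ∧ doubled i l ≠ m) := fun h => h.1 ⟨l, rfl⟩
    simp only [b, dif_neg h2, if_neg h1]
  have hx' : x' i = 1 := by simp [x']
  -- The generic singular form: free coefficients away from the multiples of `xᵢ²`, the remaining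
  -- three given by `solve`.
  let a' := Function.extend (doubled i) (solve i x' b) b
  have hsing : IsSingularAt a' x' := (isSingularAt_extend_iff hb hx' _).mpr rfl
  have ha'b (m' : CubicMonomial) (hm' : m' ∉ Set.range (doubled i)) : a' m' = b m' :=
    Function.extend_apply' _ _ _ hm'
  have ha' : a' m = 1 := by
    rw [ha'b m hm]
    simp [b]
  obtain ⟨θ, hθs, hθx, hθa⟩ := hlift MvPolynomial.C x' a' hx' ha' hsing
  let ι : MvPolynomial σ k →+* C :=
    MvPolynomial.eval₂Hom s (Sum.elim (fun l => x l.1) (fun m' => a m'.1))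
  have hιx (l : Fin 3) : ι (x' l) = x l := by
    by_cases hl : l = i
    · rw [hl, hx', hx, map_one]
    · simp [x', hl, ι]
  -- The coefficients of the universal form over `C` with those of the multiples of `xᵢ²` deleted;
  -- singularity recovers the deleted ones as `solve i x c`, so `ι` carries `a'` to `a`.
  let c := Function.extend (doubled i) 0 a
  have hc (l : Fin 3) : c (doubled i l) = 0 := (doubled_injective i).extend_apply _ _ _
  have hιb (m' : CubicMonomial) : ι (b m') = c m' := by
    by_cases hm' : m' ∈ Set.range (doubled i)
    · obtain ⟨l, rfl⟩ := hm'
      rw [hb, hc, map_zero]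
    · have h1 : c m' = a m' := Function.extend_apply' _ _ _ hm'
      rw [h1]
      by_cases hmm : m' = m
      · subst hmm
        simp [b, ha]
      · have h2 : m' ∉ Set.range (doubled i) ∧ m' ≠ m := ⟨hm', hmm⟩
        simp only [b, dif_pos h2, ι, MvPolynomial.coe_eval₂Hom, MvPolynomial.eval₂_X, Sum.elim_inr]
  have hac : a = Function.extend (doubled i) (fun l => a (doubled i l)) c := by
    funext m'
    by_cases hm' : m' ∈ Set.range (doubled i)
    · obtain ⟨l, rfl⟩ := hm'
      rw [(doubled_injective i).extend_apply]
    · rw [Function.extend_apply' _ _ _ hm']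
      exact (Function.extend_apply' _ _ _ hm').symm
  have hsolve : (fun l => a (doubled i l)) = solve i x c := by
    rw [hac, isSingularAt_extend_iff hc hx] at h
    exact h
  have hιa (m' : CubicMonomial) : ι (a' m') = a m' := by
    by_cases hm' : m' ∈ Set.range (doubled i)
    · obtain ⟨l, rfl⟩ := hm'
      have h1 : a' (doubled i l) = solve i x' b l := (doubled_injective i).extend_apply _ _ _
      rw [h1, map_solve, funext hιx, funext hιb]
      exact congrFun hsolve.symm l
    · rw [ha'b m' hm', hιb]
      exact Function.extend_apply' _ _ _ hm'
  have h1 : θ.comp ι = RingHom.id _ := by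
    refine MvPolynomial.ringHom_ext (fun r => ?_) fun v => ?_
    · rw [RingHom.comp_apply, MvPolynomial.eval₂Hom_C]
      exact congr($hθs r)
    · rw [RingHom.comp_apply, MvPolynomial.eval₂Hom_X']
      rcases v with ⟨l, hl⟩ | ⟨m', hm'⟩
      · rw [Sum.elim_inl, hθx]
        simp [x', hl]
      · rw [Sum.elim_inr, hθa, ha'b m' hm'.1]
        simp only [b, dif_pos hm', RingHom.id_apply]
  have h2 : ι.comp θ = RingHom.id _ := by
    refine hext _ ?_ (fun l => ?_) fun m' => ?_
    · rw [RingHom.comp_assoc, hθs]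
      exact MvPolynomial.eval₂Hom_comp_C _ _
    · rw [RingHom.comp_apply, hθx, hιx]
    · rw [RingHom.comp_apply, hθa, hιa]
  have hcard : Nat.card σ = 8 := card_coordinates hm
  let e := (Finite.equivFinOfCardEq hcard).symm
  refine ⟨(MvPolynomial.renameEquiv k e).toRingEquiv.trans (RingEquiv.ofRingHom ι θ h2 h1),
    fun r => ?_⟩
  change ι (MvPolynomial.rename e (MvPolynomial.C r)) = s r
  rw [MvPolynomial.rename_C]
  exact MvPolynomial.eval₂Hom_C _ _ _

end SingularForms

end

end SingularCubics
namespace SingularCubics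

noncomputable section

attribute [local instance] MvPolynomial.gradedAlgebra

/-! ### Charts of the critical locus -/

section CriticalCharts

variable {k : Type u} [Field k]

/-- Both closed subschemes have the same mapping property, so each inclusion factors through the
other. -/
lemma ker_criticalMap : (criticalMap k).ker = universalCubic k ⊔ singularLocus k := by
  apply le_antisymm
  · obtain ⟨h, hh⟩ := (exists_lift_criticalMap_iff
      (universalCubic k ⊔ singularLocus k).subschemeι).mpr (by
        have := (exists_lift_iff (universalCubic k ⊔ singularLocus k) _).mp ⟨𝟙 _, Category.id_comp _⟩
        rwa [Scheme.IdealSheafData.comap_sup, sup_eq_bot_iff] at this)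
    have h1 := Scheme.Hom.le_ker_comp h (criticalMap k)
    rwa [hh, Scheme.IdealSheafData.ker_subschemeι] at h1
  · obtain ⟨h, hh⟩ := (exists_lift_iff (universalCubic k ⊔ singularLocus k) (criticalMap k)).mpr (by
      rw [Scheme.IdealSheafData.comap_sup, sup_eq_bot_iff]
      exact (exists_lift_criticalMap_iff _).mp ⟨𝟙 _, Category.id_comp _⟩)
    have h1 := Scheme.Hom.le_ker_comp h (universalCubic k ⊔ singularLocus k).subschemeι
    rwa [hh, Scheme.IdealSheafData.ker_subschemeι] at h1

lemma ideal_singularLocus (i : Fin 3) (m : CubicMonomial) :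
    (singularLocus k).ideal (affineChart i (affineSpaceChart k m)) =
      jacobianIdeal (chartDehom (spaceOfCubics k) i (spaceChart k m)) (chartForm k m) := by
  rw [singularLocus, Scheme.IdealSheafData.ideal_iSup, iSup_apply, jacobianIdeal,
    Ideal.span_range_eq_iSup]
  exact iSup_congr fun j => isZeroLocusOn_universalPolar j m i

variable (k) in
/-- The affine open subset `xᵢ ≠ 0`, `a_m ≠ 0` of the critical locus. -/
def criticalChart (i : Fin 3) (m : CubicMonomial) : (universalCriticalLocus k).left.affineOpens :=
  ⟨criticalMap k ⁻¹ᵁ chartOver (spaceOfCubics k) i (spaceChart k m),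
    (isAffineOpen_chartOver i (isAffineOpen_spaceChart m)).preimage (criticalMap k)⟩

lemma criticalChart_le (i : Fin 3) (m : CubicMonomial) : (criticalChart k i m).1 ≤
    criticalMap k ⁻¹ᵁ chartOver (spaceOfCubics k) i (spaceChart k m) := le_rfl

lemma criticalChart_le_base (i : Fin 3) (m : CubicMonomial) :
    (criticalChart k i m).1 ≤ (criticalToSpace k).left ⁻¹ᵁ spaceChart k m :=
  fun _ hx => hx.2

/-- The restriction of functions to the critical locus. -/
def criticalRestrict (i : Fin 3) (m : CubicMonomial) :
    Γ(plane (spaceOfCubics k), chartOver (spaceOfCubics k) i (spaceChart k m)) →+*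
      Γ((universalCriticalLocus k).left, (criticalChart k i m).1) :=
  ((criticalMap k).appLE _ _ (criticalChart_le i m)).hom

lemma criticalRestrict_eq (i : Fin 3) (m : CubicMonomial) : criticalRestrict (k := k) i m =
    ((criticalMap k).app (affineChart i (affineSpaceChart k m)).1).hom := by
  rw [Scheme.Hom.app_eq_appLE]
  rfl

lemma criticalRestrict_surjective (i : Fin 3) (m : CubicMonomial) :
    Function.Surjective (criticalRestrict (k := k) i m) := by
  rw [criticalRestrict_eq]
  exact (criticalMap k).app_surjective _ (affineChart i (affineSpaceChart k m)).2

lemma ker_criticalRestrict (i : Fin 3) (m : CubicMonomial) :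
    RingHom.ker (criticalRestrict (k := k) i m) =
      Ideal.span {chartDehom (spaceOfCubics k) i (spaceChart k m) (chartForm k m)} ⊔
        jacobianIdeal (chartDehom (spaceOfCubics k) i (spaceChart k m)) (chartForm k m) := by
  rw [criticalRestrict_eq]
  refine (Scheme.Hom.ker_apply (criticalMap k) (affineChart i (affineSpaceChart k m))).symm.trans ?_
  rw [ker_criticalMap, Scheme.IdealSheafData.ideal_sup, Pi.sup_apply, ideal_singularLocus]
  exact congrArg (· ⊔ _) (isZeroLocusOn_universalCubic m i)

/-- Dehomogenization, followed by restriction to the critical locus. -/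
def criticalDehom (i : Fin 3) (m : CubicMonomial) :
    MvPolynomial (Fin 3) Γ((spaceOfCubics k).left, spaceChart k m) →+*
      Γ((universalCriticalLocus k).left, (criticalChart k i m).1) :=
  (criticalRestrict i m).comp (chartDehom (spaceOfCubics k) i (spaceChart k m))

lemma criticalDehom_comp_C (i : Fin 3) (m : CubicMonomial) :
    (criticalDehom (k := k) i m).comp MvPolynomial.C = ((criticalToSpace k).left.appLE (spaceChart k m)
      (criticalChart k i m).1 (criticalChart_le_base i m)).hom := by
  rw [criticalDehom, RingHom.comp_assoc, chartDehom_comp_C, criticalRestrict, ← CommRingCat.hom_comp,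
    Scheme.Hom.appLE_comp_appLE]
  rfl

/-- The coordinates `xₗ / xᵢ` on the chart `xᵢ ≠ 0`, `a_m ≠ 0` of the critical locus. -/
def criticalPoint (i : Fin 3) (m : CubicMonomial) (l : Fin 3) :
    Γ((universalCriticalLocus k).left, (criticalChart k i m).1) :=
  criticalDehom i m (MvPolynomial.X l)

/-- The coordinates `a_m' / a_m` on the chart `xᵢ ≠ 0`, `a_m ≠ 0` of the critical locus. -/
def criticalCoeff (i : Fin 3) (m m' : CubicMonomial) :
    Γ((universalCriticalLocus k).left, (criticalChart k i m).1) :=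
  criticalDehom i m (MvPolynomial.C (spaceRatio k m m'))

lemma criticalCoeff_eq (i : Fin 3) (m m' : CubicMonomial) : criticalCoeff (k := k) i m m' =
    (criticalToSpace k).left.appLE (spaceChart k m) (criticalChart k i m).1
      (criticalChart_le_base i m) (spaceRatio k m m') :=
  congr($(criticalDehom_comp_C i m) (spaceRatio k m m'))

lemma criticalPoint_self (i : Fin 3) (m : CubicMonomial) : criticalPoint (k := k) i m i = 1 := by
  rw [criticalPoint, criticalDehom, RingHom.comp_apply, chartDehom_X_self, map_one]

lemma criticalCoeff_self (i : Fin 3) (m : CubicMonomial) : criticalCoeff (k := k) i m m = 1 := by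
  rw [criticalCoeff, spaceRatio_self, map_one, map_one]

lemma map_eq_eval_map {R B : Type*} [CommRing R] [CommRing B] (γ : MvPolynomial (Fin 3) R →+* B)
    (F : MvPolynomial (Fin 3) R) :
    γ F = MvPolynomial.eval (fun l => γ (MvPolynomial.X l)) (F.map (γ.comp MvPolynomial.C)) := by
  have : γ = (MvPolynomial.eval fun l => γ (MvPolynomial.X l)).comp
      (MvPolynomial.map (γ.comp MvPolynomial.C)) :=
    MvPolynomial.ringHom_ext (fun r => by simp) (fun j => by simp)
  exact congr($this F)

lemma isSingularAt_of_map_eq_zero {B : Type*} [CommRing B] {m : CubicMonomial}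
    (γ : MvPolynomial (Fin 3) Γ((spaceOfCubics k).left, spaceChart k m) →+* B) :
    IsSingularAt (fun m' => γ (MvPolynomial.C (spaceRatio k m m')))
      (fun l => γ (MvPolynomial.X l)) ↔
    γ (chartForm k m) = 0 ∧ ∀ j, γ (MvPolynomial.pderiv j (chartForm k m)) = 0 := by
  have h : (chartForm k m).map (γ.comp MvPolynomial.C) =
      cubicForm fun m' => γ (MvPolynomial.C (spaceRatio k m m')) := map_cubicForm _ _
  rw [map_eq_eval_map γ (chartForm k m), IsSingularAt, h]
  refine and_congr_right' (forall_congr' fun j => ?_)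
  rw [map_eq_eval_map γ (MvPolynomial.pderiv j (chartForm k m)), ← MvPolynomial.pderiv_map, h]

lemma isSingularAt_criticalCoeff (i : Fin 3) (m : CubicMonomial) :
    IsSingularAt (criticalCoeff (k := k) i m) (criticalPoint i m) := by
  refine (isSingularAt_of_map_eq_zero (criticalDehom (k := k) i m)).mpr ⟨?_, fun j => ?_⟩
  · rw [criticalDehom, RingHom.comp_apply, ← RingHom.mem_ker, ker_criticalRestrict]
    exact Ideal.mem_sup_left (Ideal.mem_span_singleton_self _)
  · rw [criticalDehom, RingHom.comp_apply, ← RingHom.mem_ker, ker_criticalRestrict]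
    exact Ideal.mem_sup_right (pderiv_mem_jacobianIdeal _ _ j)

lemma criticalDehom_scalars (i : Fin 3) (m : CubicMonomial) :
    ((criticalDehom (k := k) i m).comp MvPolynomial.C).comp
      (scalars (spaceOfCubics k) (spaceChart k m)) =
      scalars (universalCriticalLocus k) (criticalChart k i m).1 := by
  rw [criticalDehom_comp_C]
  exact appLE_scalars _ _ _ _

/-- A homomorphism from the ring of the ambient chart is given by normalised coordinates and
coefficients; it factors through the critical locus because the equations of singularity generate
the kernel of restriction. -/
lemma exists_criticalChart_lift {i : Fin 3} {m : CubicMonomial} {A : Type u} [CommRing A]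
    (s : k →+* A) (x : Fin 3 → A) (a : CubicMonomial → A) (hx : x i = 1) (ha : a m = 1)
    (h : IsSingularAt a x) :
    ∃ φ : Γ((universalCriticalLocus k).left, (criticalChart k i m).1) →+* A,
      φ.comp (scalars (universalCriticalLocus k) (criticalChart k i m).1) = s ∧
      (∀ l, φ (criticalPoint i m l) = x l) ∧ ∀ m', φ (criticalCoeff i m m') = a m' := by
  let χ : Γ((spaceOfCubics k).left, spaceChart k m) →+* A := chartLift s m a ha
  have hχs : χ.comp (scalars (spaceOfCubics k) (spaceChart k m)) = s := chartLift_scalars s m a ha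
  have hχa (m' : CubicMonomial) : χ (spaceRatio k m m') = a m' := chartLift_ratio s m a ha m'
  obtain ⟨ψ, hψ⟩ := exists_chartOver_desc i (isAffineOpen_spaceChart (k := k) m) χ x hx
  have hψC (r) : ψ (chartDehom (spaceOfCubics k) i (spaceChart k m) (MvPolynomial.C r)) = χ r :=
    congr($hψ (MvPolynomial.C r)).trans (MvPolynomial.eval₂Hom_C _ _ _)
  have hψX (l) : ψ (chartDehom (spaceOfCubics k) i (spaceChart k m) (MvPolynomial.X l)) = x l :=
    congr($hψ (MvPolynomial.X l)).trans (MvPolynomial.eval₂Hom_X' _ _ _)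
  have hker : RingHom.ker (criticalRestrict (k := k) i m) ≤ RingHom.ker ψ := by
    have h1 := (isSingularAt_of_map_eq_zero
      (ψ.comp (chartDehom (spaceOfCubics k) i (spaceChart k m)))).mp (by
        simp only [RingHom.comp_apply, hψC, hψX, hχa]
        exact h)
    rw [ker_criticalRestrict]
    refine sup_le ((Ideal.span_singleton_le_iff_mem _).mpr h1.1) (Ideal.span_le.mpr ?_)
    rintro _ ⟨j, rfl⟩
    exact h1.2 j
  let φ := (criticalRestrict (k := k) i m).liftOfSurjective (criticalRestrict_surjective i m)
    ⟨ψ, hker⟩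
  have hφ (b) : φ (criticalRestrict i m b) = ψ b :=
    RingHom.liftOfRightInverse_comp_apply _ _ _ ⟨ψ, hker⟩ b
  refine ⟨φ, ?_, fun l => (hφ _).trans (hψX l), fun m' => ((hφ _).trans (hψC _)).trans (hχa m')⟩
  rw [← criticalDehom_scalars, ← hχs]
  exact RingHom.ext fun c => (hφ _).trans (hψC _)

lemma criticalChart_ringHom_ext {i : Fin 3} {m : CubicMonomial} {A : Type u} [CommRing A]
    {φ φ' : Γ((universalCriticalLocus k).left, (criticalChart k i m).1) →+* A}
    (hs : φ.comp (scalars (universalCriticalLocus k) (criticalChart k i m).1) =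
      φ'.comp (scalars (universalCriticalLocus k) (criticalChart k i m).1))
    (hx : ∀ l, φ (criticalPoint i m l) = φ' (criticalPoint i m l))
    (ha : ∀ m', φ (criticalCoeff i m m') = φ' (criticalCoeff i m m')) : φ = φ' := by
  have hsurj : Function.Surjective (criticalDehom (k := k) i m) :=
    (criticalRestrict_surjective i m).comp (dehom_surjective i (isAffineOpen_spaceChart m))
  refine (RingHom.cancel_right hsurj).mp (MvPolynomial.ringHom_ext (fun r => ?_) hx)
  have h1 : (φ.comp (criticalDehom i m)).comp MvPolynomial.C =
      (φ'.comp (criticalDehom i m)).comp MvPolynomial.C := by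
    refine chart_ringHom_ext m ?_ ha
    have h2 := criticalDehom_scalars (k := k) i m
    rw [← h2] at hs
    exact hs
  exact congr($h1 r)

theorem exists_criticalChart_equiv {i : Fin 3} {m : CubicMonomial}
    (hm : m ∉ Set.range (doubled i)) : ∃ e : MvPolynomial (Fin 8) k ≃+*
      Γ((universalCriticalLocus k).left, (criticalChart k i m).1),
      ∀ c, e (MvPolynomial.C c) = scalars (universalCriticalLocus k) (criticalChart k i m).1 c :=
  exists_polynomial_equiv _ hm (criticalPoint_self i m) (criticalCoeff_self i m)
    (isSingularAt_criticalCoeff i m) (fun s x a hx ha h => exists_criticalChart_lift s x a hx ha h)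
    fun _ hs hx ha => criticalChart_ringHom_ext hs hx ha

end CriticalCharts

end

end SingularCubics
namespace SingularCubics

noncomputable section

attribute [local instance] MvPolynomial.gradedAlgebra

/-! ### Smoothness and dimension of the critical locus -/

section SmoothDimension

/-- An irreducible closed subset meets some `U i`, and its coheight is unchanged on intersecting
with that open subset. -/
lemma topologicalKrullDim_eq_of_openCover {X ι : Type*} [TopologicalSpace X] [Nonempty ι]
    (U : ι → TopologicalSpace.Opens X) (hU : ⨆ i, U i = ⊤) {n : WithBot ℕ∞}
    (h : ∀ i, topologicalKrullDim (U i) = n) : topologicalKrullDim X = n := by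
  apply le_antisymm
  · rw [topologicalKrullDim, Order.krullDim_eq_iSup_coheight]
    refine iSup_le fun Z => ?_
    obtain ⟨x, hx⟩ := Z.isIrreducible.nonempty
    have hxU : x ∈ ⨆ i, U i := hU ▸ trivial
    obtain ⟨i, hi⟩ := TopologicalSpace.Opens.mem_iSup.mp hxU
    have hf : Topology.IsOpenEmbedding (Subtype.val : U i → X) := (U i).isOpenEmbedding'
    let W := (TopologicalSpace.IrreducibleCloseds.orderIsoOfIsOpenEmbedding _ hf).symm
      ⟨Z, ⟨⟨x, hi⟩, hx⟩⟩
    have hW : TopologicalSpace.IrreducibleCloseds.map _ hf.continuous W = Z :=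
      congrArg Subtype.val ((TopologicalSpace.IrreducibleCloseds.orderIsoOfIsOpenEmbedding _
        hf).apply_symm_apply ⟨Z, ⟨⟨x, hi⟩, hx⟩⟩)
    rw [← hW, hf.coheight_map, ← h i]
    exact Order.coheight_le_krullDim W
  · obtain ⟨i⟩ := ‹Nonempty ι›
    rw [← h i]
    exact Topology.IsInducing.subtypeVal.topologicalKrullDim_le

lemma topologicalKrullDim_eq_ringKrullDim {X : Scheme.{u}} {U : X.Opens} (hU : IsAffineOpen U) :
    topologicalKrullDim U = ringKrullDim Γ(X, U) := by
  rw [← PrimeSpectrum.topologicalKrullDim_eq_ringKrullDim]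
  exact IsHomeomorph.topologicalKrullDim_eq _ hU.isoSpec.hom.homeomorph.isHomeomorph

/-- The presentation of a polynomial ring without relations. -/
def polynomialPresentation (k : Type u) [CommRing k] (n : ℕ) :
    Algebra.PreSubmersivePresentation k (MvPolynomial (Fin n) k) (Fin n) PEmpty.{1} where
  toGenerators := .ofSurjective MvPolynomial.X fun p =>
    ⟨p, congr($(MvPolynomial.aeval_X_left (R := k) (σ := Fin n)) p)⟩
  relation := PEmpty.elim
  span_range_relation_eq_ker := by
    rw [Set.range_eq_empty, Ideal.span_empty]
    refine ((RingHom.injective_iff_ker_eq_bot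
      (MvPolynomial.aeval (R := k) (MvPolynomial.X (σ := Fin n) (R := k))).toRingHom).mp ?_).symm
    rw [MvPolynomial.aeval_X_left]
    exact Function.injective_id
  map := PEmpty.elim
  map_inj := fun x => x.elim

lemma isStandardSmoothOfRelativeDimension_mvPolynomial (k : Type u) [CommRing k] (n : ℕ) :
    Algebra.IsStandardSmoothOfRelativeDimension n k (MvPolynomial (Fin n) k) := by
  let P : Algebra.SubmersivePresentation k (MvPolynomial (Fin n) k) (Fin n) PEmpty.{1} :=
    { polynomialPresentation k n with
      jacobian_isUnit := by
        rw [Algebra.PreSubmersivePresentation.jacobian_eq_jacobiMatrix_det, Matrix.det_isEmpty,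
          map_one]
        exact isUnit_one }
  exact P.isStandardSmoothOfRelativeDimension (by simp [Algebra.Presentation.dimension])

variable {k : Type u} [Field k]

/-- Charts with `m` a multiple of `xᵢ²` are superfluous: if all other coefficients vanish at the
point, so do those of the multiples of `xᵢ²`, since `solve` expresses the latter linearly by the
former. -/
lemma exists_mem_criticalChart (x : (universalCriticalLocus k).left) :
    ∃ (i : Fin 3) (m : CubicMonomial), m ∉ Set.range (doubled i) ∧ x ∈ (criticalChart k i m).1 := by
  obtain ⟨m₀, hm₀⟩ := exists_mem_preimage_spaceChart (criticalToSpace k) x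
  obtain ⟨i, hi⟩ := exists_mem_chartOver (S := spaceOfCubics k) (V := spaceChart k m₀)
    (x := criticalMap k x) hm₀
  have hx : x ∈ (criticalChart k i m₀).1 := hi
  by_cases hm : m₀ ∈ Set.range (doubled i)
  · let ε := ((universalCriticalLocus k).left.evaluation (criticalChart k i m₀).1 x hx).hom
    -- Otherwise `solve` with zero input would return the coefficient at `m₀`, which is `1`.
    have hε : ∃ m, m ∉ Set.range (doubled i) ∧ ε (criticalCoeff i m₀ m) ≠ 0 := by
      by_contra! hcon
      have h1 : IsSingularAt (fun m => ε (criticalCoeff i m₀ m))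
          (fun l => ε (criticalPoint i m₀ l)) := by
        refine ⟨?_, fun j => ?_⟩
        · rw [← map_eval_cubicForm, (isSingularAt_criticalCoeff i m₀).1, map_zero]
        · rw [← map_eval_pderiv_cubicForm, (isSingularAt_criticalCoeff i m₀).2, map_zero]
      have h2 : (fun m => ε (criticalCoeff i m₀ m)) = Function.extend (doubled i)
          (fun l => ε (criticalCoeff i m₀ (doubled i l))) 0 := by
        funext m
        by_cases hm : m ∈ Set.range (doubled i)
        · obtain ⟨l, rfl⟩ := hm
          rw [(doubled_injective i).extend_apply]
        · rw [Function.extend_apply' _ _ _ hm, hcon m hm, Pi.zero_apply]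
      rw [h2, isSingularAt_extend_iff (fun _ => rfl)
        (by rw [criticalPoint_self, map_one])] at h1
      obtain ⟨l, rfl⟩ := hm
      have h3 := congrFun h1 l
      rw [criticalCoeff_self, map_one] at h3
      have h4 : cubicForm (0 : CubicMonomial →
          (universalCriticalLocus k).left.residueField x) = 0 := by
        simp [cubicForm]
      simp [solve, h4] at h3
    obtain ⟨m, hm, hne⟩ := hε
    refine ⟨i, m, hm, ?_⟩
    have hxb : x ∈ (universalCriticalLocus k).left.basicOpen (criticalCoeff i m₀ m) :=
      ((universalCriticalLocus k).left.evaluation_ne_zero_iff_mem_basicOpen x hx _).mp hne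
    have hle := (universalCriticalLocus k).left.basicOpen_le (criticalCoeff i m₀ m)
    have h1 := le_preimage_spaceChart (criticalToSpace k) (j := m)
      (hle.trans (criticalChart_le_base i m₀)) (by
        have h2 := congr($(Scheme.Hom.appLE_map (criticalToSpace k).left
          (criticalChart_le_base i m₀) (homOfLE hle).op) (spaceRatio k m₀ m))
        have h3 := RingedSpace.isUnit_res_basicOpen
          (universalCriticalLocus k).left.toRingedSpace (criticalCoeff i m₀ m)
        exact (congrArg IsUnit ((congrArg ((universalCriticalLocus k).left.presheaf.map
          (homOfLE hle).op) (criticalCoeff_eq i m₀ m)).trans h2)).mp h3)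
    exact ⟨hi.1, h1 hxb⟩
  · exact ⟨i, m₀, hm, hx⟩

variable (k) in
lemma smoothOfRelativeDimension_universalCriticalLocus :
    SmoothOfRelativeDimension 8 (universalCriticalLocus k).hom := by
  constructor
  intro x
  obtain ⟨i, m, hm, hx⟩ := exists_mem_criticalChart x
  refine ⟨⊤, isAffineOpen_top _, (criticalChart k i m).1, (criticalChart k i m).2, hx,
    le_preimage_top _ _, ?_⟩
  obtain ⟨e, he⟩ := exists_criticalChart_equiv (k := k) hm
  have h1 : (MvPolynomial.C : k →+* MvPolynomial (Fin 8) k).IsStandardSmoothOfRelativeDimension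
      8 := by
    have h2 := isStandardSmoothOfRelativeDimension_mvPolynomial k 8
    rw [← RingHom.isStandardSmoothOfRelativeDimension_algebraMap] at h2
    exact h2
  have h2 : ((universalCriticalLocus k).hom.appLE ⊤ (criticalChart k i m).1
      (le_preimage_top _ _)).hom = (e.toRingHom.comp MvPolynomial.C).comp
        (Scheme.ΓSpecIso (CommRingCat.of k)).commRingCatIsoToRingEquiv.toRingHom := by
    have h3 : e.toRingHom.comp MvPolynomial.C =
      scalars (universalCriticalLocus k) (criticalChart k i m).1 := RingHom.ext he
    rw [h3]
    ext c
    exact congrArg _ (congr($((Scheme.ΓSpecIso (CommRingCat.of k)).hom_inv_id) c)).symm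
  rw [h2]
  exact RingHom.isStandardSmoothOfRelativeDimension_respectsIso.2 _ _
    (RingHom.isStandardSmoothOfRelativeDimension_respectsIso.1 _ _ h1)

variable (k) in
lemma topologicalKrullDim_universalCriticalLocus :
    topologicalKrullDim (universalCriticalLocus k).left = 8 := by
  let J := {c : Fin 3 × CubicMonomial // c.2 ∉ Set.range (doubled c.1)}
  -- The monomial `x₁³` is not divisible by `x₀²`.
  have : Nonempty J := ⟨(0, Sym.replicate 3 1), by decide⟩
  refine topologicalKrullDim_eq_of_openCover (fun c : J => (criticalChart k c.1.1 c.1.2).1)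
    (top_le_iff.mp fun x _ => ?_) fun c => ?_
  · obtain ⟨i, m, hm, hx⟩ := exists_mem_criticalChart x
    exact TopologicalSpace.Opens.mem_iSup.mpr ⟨⟨(i, m), hm⟩, hx⟩
  · obtain ⟨e, -⟩ := exists_criticalChart_equiv (k := k) c.2
    refine (topologicalKrullDim_eq_ringKrullDim (criticalChart k c.1.1 c.1.2).2).trans ?_
    rw [← ringKrullDim_eq_of_ringEquiv e, MvPolynomial.ringKrullDim_of_isNoetherianRing,
      ringKrullDim_eq_zero_of_field, Nat.card_eq_fintype_card, Fintype.card_fin]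
    rfl

end SmoothDimension

end

end SingularCubics
namespace SingularCubics

noncomputable section

attribute [local instance] MvPolynomial.gradedAlgebra

/-! ### Projectivity of the critical locus -/

section Projectivity

variable {k : Type u} [Field k]

variable (k) in
/-- The morphism `C(φ) ⟶ ℙ²`. -/
def criticalToPlane : universalCriticalLocus k ⟶ projectiveSpace k (Fin 3) :=
  Over.homMk (criticalMap k ≫ toPlane (spaceOfCubics k)) (by
    rw [universalCriticalLocus_hom, Category.assoc, pullback.condition])

lemma criticalChart_le_plane (i : Fin 3) (m : CubicMonomial) :
    (criticalChart k i m).1 ≤ (criticalToPlane k).left ⁻¹ᵁ chart k i :=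
  fun _ hx => hx.1

lemma mem_criticalChart {i : Fin 3} {m : CubicMonomial} {x : (universalCriticalLocus k).left}
    (h : x ∈ (criticalToPlane k).left ⁻¹ᵁ chart k i)
    (h' : x ∈ (criticalToSpace k).left ⁻¹ᵁ spaceChart k m) : x ∈ (criticalChart k i m).1 :=
  ⟨h, h'⟩

lemma criticalPoint_eq (i : Fin 3) (m : CubicMonomial) (l : Fin 3) : criticalPoint (k := k) i m l =
    (criticalToPlane k).left.appLE (chart k i) (criticalChart k i m).1
      (criticalChart_le_plane i m) (ratio k i l) := by
  rw [criticalPoint, criticalDehom, RingHom.comp_apply, dehom_X, ratioOn_eq, criticalRestrict]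
  exact congr($(Scheme.Hom.appLE_comp_appLE (criticalMap k) (toPlane (spaceOfCubics k)) (chart k i)
    _ _ (le_toPlane (chartOver_le_chart i (spaceChart k m))) (criticalChart_le i m)) (ratio k i l))

lemma map_criticalPoint {i : Fin 3} {m : CubicMonomial} {W : (universalCriticalLocus k).left.Opens}
    (h : W ≤ (criticalChart k i m).1) (l : Fin 3) :
    (universalCriticalLocus k).left.presheaf.map (homOfLE h).op (criticalPoint i m l) =
      (criticalToPlane k).left.appLE (chart k i) W (h.trans (criticalChart_le_plane i m))
        (ratio k i l) :=
  (congrArg ((universalCriticalLocus k).left.presheaf.map (homOfLE h).op)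
    (criticalPoint_eq i m l)).trans
    congr($(Scheme.Hom.appLE_map (criticalToPlane k).left (criticalChart_le_plane i m)
      (homOfLE h).op) (ratio k i l))

lemma map_criticalCoeff {i : Fin 3} {m : CubicMonomial} {W : (universalCriticalLocus k).left.Opens}
    (h : W ≤ (criticalChart k i m).1) (m' : CubicMonomial) :
    (universalCriticalLocus k).left.presheaf.map (homOfLE h).op (criticalCoeff i m m') =
      (criticalToSpace k).left.appLE (spaceChart k m) W (h.trans (criticalChart_le_base i m))
        (spaceRatio k m m') :=
  (congrArg ((universalCriticalLocus k).left.presheaf.map (homOfLE h).op)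
    (criticalCoeff_eq i m m')).trans
    congr($(Scheme.Hom.appLE_map (criticalToSpace k).left (criticalChart_le_base i m)
      (homOfLE h).op) (spaceRatio k m m'))

/-- The Segre coordinates on the chart `xᵢ ≠ 0`, `a_m ≠ 0` of the critical locus. -/
def segre (c c' : Fin 3 × CubicMonomial) :
    Γ((universalCriticalLocus k).left, (criticalChart k c.1 c.2).1) :=
  criticalPoint c.1 c.2 c'.1 * criticalCoeff c.1 c.2 c'.2

lemma map_segre {c : Fin 3 × CubicMonomial} {W : (universalCriticalLocus k).left.Opens}
    (h : W ≤ (criticalChart k c.1 c.2).1) (c' : Fin 3 × CubicMonomial) :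
    (universalCriticalLocus k).left.presheaf.map (homOfLE h).op (segre c c') =
      (criticalToPlane k).left.appLE (chart k c.1) W (h.trans (criticalChart_le_plane c.1 c.2))
        (ratio k c.1 c'.1) *
      (criticalToSpace k).left.appLE (spaceChart k c.2) W (h.trans (criticalChart_le_base c.1 c.2))
        (spaceRatio k c.2 c'.2) := by
  rw [segre, map_mul, map_criticalPoint, map_criticalCoeff]

lemma map_segre_mul_map_segre {c c' : Fin 3 × CubicMonomial}
    {W : (universalCriticalLocus k).left.Opens} (h : W ≤ (criticalChart k c.1 c.2).1)
    (h' : W ≤ (criticalChart k c'.1 c'.2).1) (l : Fin 3 × CubicMonomial) :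
    (universalCriticalLocus k).left.presheaf.map (homOfLE h).op (segre c l) =
      (universalCriticalLocus k).left.presheaf.map (homOfLE h).op (segre c c') *
      (universalCriticalLocus k).left.presheaf.map (homOfLE h').op (segre c' l) := by
  rw [map_segre, map_segre, map_segre, mul_mul_mul_comm, appLE_ratio_mul, appLE_spaceRatio_mul]

lemma segre_self (c : Fin 3 × CubicMonomial) : segre (k := k) c c = 1 := by
  rw [segre, criticalPoint_self, criticalCoeff_self, one_mul]

lemma iSup_criticalChart :
    ⨆ c : Fin 3 × CubicMonomial, (criticalChart k c.1 c.2).1 = ⊤ := by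
  refine top_le_iff.mp fun x _ => ?_
  obtain ⟨i, m, -, hx⟩ := exists_mem_criticalChart x
  exact TopologicalSpace.Opens.mem_iSup.mpr ⟨(i, m), hx⟩

/-- The scalars and the affine coordinates generate the ring of the chart. -/
lemma criticalDehom_mem {i : Fin 3} {m : CubicMonomial}
    {A : Subring Γ((universalCriticalLocus k).left, (criticalChart k i m).1)}
    (hs : ∀ c, scalars (universalCriticalLocus k) (criticalChart k i m).1 c ∈ A)
    (hx : ∀ l, criticalPoint i m l ∈ A) (ha : ∀ m', criticalCoeff i m m' ∈ A)
    (P : MvPolynomial (Fin 3) Γ((spaceOfCubics k).left, spaceChart k m)) :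
    criticalDehom i m P ∈ A := by
  have key (Q : MvPolynomial CubicMonomial k) :
      ((criticalDehom (k := k) i m).comp MvPolynomial.C).comp (chartPoly (k := k) m) Q ∈ A := by
    generalize hγ : ((criticalDehom (k := k) i m).comp MvPolynomial.C).comp (chartPoly (k := k) m) = γ
    induction Q using MvPolynomial.induction_on with
    | C c =>
      have h1 : chartPoly m (MvPolynomial.C c) = scalars (spaceOfCubics k) (spaceChart k m) c :=
        MvPolynomial.eval₂Hom_C _ _ _
      have h2 := congr($(criticalDehom_scalars (k := k) i m) c)
      have h3 : γ (MvPolynomial.C c) = scalars (universalCriticalLocus k) _ c :=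
        congr($hγ (MvPolynomial.C c)).symm.trans
          ((congrArg (fun r => criticalDehom i m (MvPolynomial.C r)) h1).trans h2)
      exact h3 ▸ hs c
    | add P Q hP hQ =>
      rw [map_add]
      exact add_mem hP hQ
    | mul_X P m' hP =>
      have h1 : chartPoly m (MvPolynomial.X m') = spaceRatio k m m' :=
        MvPolynomial.eval₂Hom_X' _ _ _
      have h3 : γ (MvPolynomial.X m') = criticalCoeff i m m' :=
        congr($hγ (MvPolynomial.X m')).symm.trans
          (congrArg (fun r => criticalDehom i m (MvPolynomial.C r)) h1)
      rw [map_mul, h3]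
      exact mul_mem hP (ha m')
  induction P using MvPolynomial.induction_on with
  | C r =>
    obtain ⟨Q, rfl⟩ := chartPoly_surjective m r
    exact key Q
  | add P Q hP hQ =>
    rw [map_add]
    exact add_mem hP hQ
  | mul_X P l hP =>
    rw [map_mul]
    exact mul_mem hP (hx l)

lemma isClosedImmersion_of_iSup_eq_top {X Y : Scheme.{u}} (f : X ⟶ Y) {ι : Type*}
    (U : ι → Y.affineOpens) (hU : ⨆ i, (U i).1 = ⊤) (h : ∀ i, IsAffineOpen (f ⁻¹ᵁ (U i).1))
    (h' : ∀ i, Function.Surjective (f.app (U i).1)) : IsClosedImmersion f := by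
  refine IsZariskiLocalAtTarget.of_iSup_eq_top (fun i => (U i).1) hU fun i => ?_
  have : IsAffine (f ⁻¹ᵁ (U i).1 : X.Opens) := h i
  have : IsAffine (U i).1 := (U i).2
  refine IsClosedImmersion.of_surjective_of_isAffine _ ?_
  have key : ∀ U' : Y.Opens, (U i).1 = U' → Function.Surjective (f.app U') := by
    rintro _ rfl
    exact h' i
  rw [morphismRestrict_appTop]
  intro s
  obtain ⟨t, rfl⟩ := (ConcreteCategory.bijective_of_isIso (X.presheaf.map (eqToHom
    (image_morphismRestrict_preimage f (U i).1 ⊤)).op)).2 s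
  obtain ⟨r, rfl⟩ := key _ (U i).1.ι_image_top.symm t
  exact ⟨r, rfl⟩

lemma surjective_app_of_eq {X Y : Scheme.{u}} (f : X ⟶ Y) {U : Y.Opens} {V : X.Opens}
    (h : f ⁻¹ᵁ U = V) (h' : Function.Surjective (f.appLE U V h.ge)) :
    Function.Surjective (f.app U) := by
  subst h
  rwa [Scheme.Hom.app_eq_appLE]

variable (k) in
-- The Segre map with homogeneous coordinates `xₗ a_m'` embeds `C(φ)` in `ℙ²⁹`, where `29 = 3 · 10 -
-- 1`. It is a closed immersion because the preimage of each standard chart is a bichart and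
-- restriction of functions is surjective.
theorem isProjective_universalCriticalLocus : IsProjective (universalCriticalLocus k) := by
  have hcard : Fintype.card (Fin 3 × CubicMonomial) = 29 + 1 := by
    rw [Fintype.card_prod, card_cubicMonomial, Fintype.card_fin]
  let e := Fintype.equivFinOfCardEq hcard
  let V (α : Fin (29 + 1)) := (criticalChart k (e.symm α).1 (e.symm α).2).1
  have hV : ⨆ α, V α = ⊤ := by
    rw [← iSup_criticalChart]
    exact e.symm.iSup_congr fun _ => rfl
  obtain ⟨g, hg⟩ := exists_hom_of_ratio_cover (universalCriticalLocus k) V hV id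
    (fun α j => segre (e.symm α) (e.symm j)) (fun α => segre_self _)
    (fun α β l => map_segre_mul_map_segre _ _ _)
  refine ⟨29, g, ?_⟩
  choose hVg' hg' using hg
  have hVg (α : Fin (29 + 1)) : V α ≤ g.left ⁻¹ᵁ chart k α := hVg' α
  have hg (α j : Fin (29 + 1)) : g.left.appLE (chart k α) (V α) (hVg α) (ratio k α j) =
      segre (e.symm α) (e.symm j) := hg' α j
  -- Where a product `xₗ a_m'` is invertible, both factors are.
  have hpre (α : Fin (29 + 1)) : g.left ⁻¹ᵁ chart k α = V α := by
    refine le_antisymm (fun x hx => ?_) (hVg α)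
    have hxV : x ∈ ⨆ α, V α := hV ▸ trivial
    obtain ⟨β, hβ⟩ := TopologicalSpace.Opens.mem_iSup.mp hxV
    let W : (universalCriticalLocus k).left.Opens := V β ⊓ g.left ⁻¹ᵁ chart k α
    have hWβ : W ≤ V β := inf_le_left
    have hWα : W ≤ g.left ⁻¹ᵁ chart k α := inf_le_right
    have h1 := appLE_ratio_mul g (hWβ.trans (hVg β)) hWα β
    have h2 : g.left.appLE (chart k β) W (hWβ.trans (hVg β)) (ratio k β α) =
        (universalCriticalLocus k).left.presheaf.map (homOfLE hWβ).op
          (segre (e.symm β) (e.symm α)) :=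
      congr($(Scheme.Hom.appLE_map g.left (hVg β) (homOfLE hWβ).op) (ratio k β α)).symm.trans
        (congrArg ((universalCriticalLocus k).left.presheaf.map (homOfLE hWβ).op) (hg β α))
    rw [ratio_self, map_one, h2, map_segre] at h1
    have h3 := isUnit_of_mul_isUnit_left (IsUnit.of_mul_eq_one _ h1)
    have h4 := isUnit_of_mul_isUnit_right (IsUnit.of_mul_eq_one _ h1)
    exact mem_criticalChart (le_preimage_chart (criticalToPlane k) _ h3 ⟨hβ, hx⟩)
      (le_preimage_spaceChart (criticalToSpace k) _ h4 ⟨hβ, hx⟩)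
  -- Relative to `α = (i, m)`, the Segre coordinates with index `(l, m)` are the `xₗ / xᵢ`, and
  -- those with index `(i, m')` are the `a_m' / a_m`.
  have hsurj (α : Fin (29 + 1)) : Function.Surjective (g.left.appLE (chart k α) (V α) (hVg α)) := by
    intro s
    obtain ⟨b, rfl⟩ := criticalRestrict_surjective (e.symm α).1 (e.symm α).2 s
    obtain ⟨P, rfl⟩ := dehom_surjective (e.symm α).1 (isAffineOpen_spaceChart (e.symm α).2) b
    refine criticalDehom_mem (A := (g.left.appLE (chart k α) (V α) (hVg α)).hom.range)
      (fun c => ?_) (fun l => ?_) (fun m' => ?_) P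
    · exact ⟨scalars _ _ c, congr($(appLE_scalars g _ _ (hVg α)) c)⟩
    · refine ⟨ratio k α (e (l, (e.symm α).2)), (hg α _).trans ?_⟩
      rw [e.symm_apply_apply, segre, criticalCoeff_self, mul_one]
    · refine ⟨ratio k α (e ((e.symm α).1, m')), (hg α _).trans ?_⟩
      rw [e.symm_apply_apply, segre, criticalPoint_self, one_mul]
  refine isClosedImmersion_of_iSup_eq_top g.left (fun α => ⟨chart k α, isAffineOpen_chart α⟩)
    iSup_chart (fun α => ?_) fun α => ?_
  · rw [hpre]
    exact (criticalChart k (e.symm α).1 (e.symm α).2).2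
  · exact surjective_app_of_eq g.left (hpre α) (hsurj α)

end Projectivity

end

end SingularCubics
theorem mainTheorem11 (k : Type u) [Field k] [IsAlgClosed k] :
    SingularCubics.IsRepresentedBy (F := SingularCubics.closedSubschemes k)
        SingularCubics.hilbertPoints
        (SingularCubics.spaceOfCubics k) (SingularCubics.universalCubic k) ∧
      SingularCubics.IsRepresentedBy (F := SingularCubics.pairs k)
        SingularCubics.SC
        (SingularCubics.universalCriticalLocus k) (SingularCubics.tautologicalPair k) ∧
      SmoothOfRelativeDimension 8 (SingularCubics.universalCriticalLocus k).hom ∧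
      SingularCubics.IsProjective (SingularCubics.universalCriticalLocus k) ∧
      topologicalKrullDim (SingularCubics.universalCriticalLocus k).left = 8 := by
  -- An algebraically closed field is infinite, which is all that the proof uses of it.
  have : Infinite k := inferInstance
  refine ⟨SingularCubics.isRepresentedBy_hilbertPoints k, SingularCubics.isRepresentedBy_SC k, ?_⟩
  refine ⟨SingularCubics.smoothOfRelativeDimension_universalCriticalLocus k, ?_,
    SingularCubics.topologicalKrullDim_universalCriticalLocus k⟩
  exact SingularCubics.isProjective_universalCriticalLocus k
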